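/- **Setup.** Let $M$ be a smooth oriented $3$-manifold (Hausdorff, second countable) with (possibly empty) boundary $\iota:\partial M\hookrightarrow M$. Give $\partial M$ the induced orientation (outward normal first), and let it be endowed with a Lorentzian metric $g$ of signature $(-,+)$ and a time-orientation. Choose a chirality $\pm$. Let $\Theta_\pm:\mathbb R\times\partial M\to\partial M$ be a $\pm$-chiral flow, i.e. the global flow of a complete future-directed null vector field $v$ such that, for $t$ a vector field representing the time-orientation, $(t,v)$ is an oriented frame for the sign $+$ and an oppositely oriented frame for the sign $-$. Let $\widehat\Theta_\pm:\mathbb R\times M\to M$ be a smooth proper $\mathbb R$-action with $\widehat\Theta_\pm(s,\iota(p))=\iota(\Theta_\pm(s,p))$. Let $\widehat\pi_\pm:M\to B_\pm=M/\!\sim_\pm$ be the quotient by the orbits. For subsets $S\subseteq M$ put $J^{\uparrow}(S)=\{\widehat\Theta_\pm(s,x):s\ge 0,\ x\in S\}$ and $J^{\downarrow}(S)=\{\widehat\Theta_\pm(s,x):s\le 0,\ x\in S\}$. Let $\widehat\Theta_\pm\text{-}\mathbf{Open}(M)$ be the poset of non-empty open $U\subseteq M$ with $J^\uparrow(U)\cap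 J^\downarrow(U)\subseteq U$, where $U_1\perp U_2$ iff $(J^\uparrow(U_1)\cup J^\downarrow(U_1))\cap U_2=\emptyset$. Let $\mathbf{Open}(B_\pm)$ be the poset of non-empty open subsets of $B_\pm$, where $V_1\perp V_2$ iff $V_1\cap V_2=\emptyset$. Taking preimages is a functor $\widehat\pi_\pm^{-1}:\mathbf{Open}(B_\pm)\to\widehat\Theta_\pm\text{-}\mathbf{Open}(M)$. *Bulk.* For $U\subseteq M$ open let $\mathfrak F_{\mathfrak L^\pm,\mathrm c}(U)[1]$ be the cochain complex whose elements of degree $i$ are the compactly supported $(i+2)$-forms on $U$ satisfying the boundary condition ($\iota^*$ of a $0$-form is $0$; $\iota^*$ of a $1$-form $\alpha$ satisfies $\ast\iota^*\alpha=\pm\iota^*\alpha$, where $\ast e^0=-e^1$ and $\ast e^1=-e^0$ in oriented orthonormal frames with $e_0$ time-like; no condition on $2$- and $3$-forms), with differential $\mathrm d$. Let $$\tau_{(0)}(\varphi\otimes\psi)=(-1)^{|\varphi|+1}\int_M\varphi\wedge\big(G^\uparrow_{[1]}-G^\downarrow_{[1]}\big)\psi,\qquad G^{\uparrow}_{[1]}=-\int_{\mathbb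 R^{\le0}}\widehat\Theta_\pm^*,\quad G^{\downarrow}_{[1]}=+\int_{\mathbb R^{\ge0}}\widehat\Theta_\pm^*,$$ where $\int_{\mathbb R^{\le 0}},\int_{\mathbb R^{\ge 0}}$ are fiber integrations along the projection $\mathbb R\times M\to M$ (the fiber coordinate being integrated out of the first slot). *Base.* For $V\subseteq B_\pm$ open let $\Omega^\bullet_{\partial,\mathrm c}(V)[1]$ be the cochain complex whose elements of degree $i$ are the compactly supported $(i+1)$-forms on $V$, with $0$-forms required to vanish on $\partial V$, and with differential $-\mathrm d$. Let $\sigma_{(0)}(\alpha\otimes\beta)=(-1)^{|\alpha|}\int_V\alpha\wedge\beta$. *CCR.* For a real Poisson cochain complex $(W,\tau)$, i.e. a cochain complex with a graded antisymmetric cochain map $\tau:W\otimes W\to\mathbb R$, let $\mathfrak{CCR}(W,\tau)$ be the differential graded unital $*$-algebra over $\mathbb C$ that is generated by $W$ (as $*$-invariant elements, with the differential extended as a graded derivation) subject to $\varphi\psi-(-1)^{|\varphi||\psi|}\psi\varphi=\mathrm i\,\tau(\varphi\otimes\psi)\,1$. A weak equivalence of dg-$*$-algebras is a morphism whose underlying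 cochain map is a quasi-isomorphism. An AQFT on a poset with orthogonality relation $\perp$ is a functor $\mathfrak A$ to dg-$*$-algebras satisfying Einstein causality: for $U_1\perp U_2$ with $U_1,U_2\subseteq U$, the images of $\mathfrak A(U_1)$ and $\mathfrak A(U_2)$ in $\mathfrak A(U)$ commute in the graded sense. **Theorem.** 1. $B_\pm$ with the quotient topology is Hausdorff and second countable, and it admits the structure of a smooth $2$-manifold with boundary for which $\widehat\pi_\pm$ is a smooth principal $\mathbb R$-bundle, together with an orientation induced by that of $M$ (a frame of $B_\pm$ is oriented iff the frame of $M$ consisting of the generator of $\widehat\Theta_\pm$ followed by lifts is oriented). 2. For every such smooth structure and orientation on $B_\pm$, the maps $\tau_{(0)}$ and $\sigma_{(0)}$ are Poisson structures, so that (with extensions by zero as the functorial structure) $\mathfrak A_\pm=\mathfrak{CCR}(\mathfrak F_{\mathfrak L^\pm,\mathrm c}[1],\tau_{(0)})$ and $\mathfrak B_\pm=\mathfrak{CCR}(\Omega^\bullet_{\partial,\mathrm c}[1],\sigma_{(0)})$ are functors on $\widehat\Theta_\pm\text{-}\mathbf{Open}(M)$ and on $\mathbf{Open}(B_\pm)$;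 the functors $\mathfrak A_\pm$, $(\widehat\pi_\pm^{-1})^*(\mathfrak A_\pm)=\mathfrak A_\pm\circ\widehat\pi_\pm^{-1}$ and $\mathfrak B_\pm$ are AQFTs; and fiber integration restricts to morphisms of Poisson complexes $$(\widehat\pi_\pm)_*:\big(\mathfrak F_{\mathfrak L^\pm,\mathrm c}(\widehat\pi_\pm^{-1}(V))[1],\tau_{(0)}\big)\longrightarrow\big(\Omega^\bullet_{\partial,\mathrm c}(V)[1],\sigma_{(0)}\big)$$ that are natural in $V\in\mathbf{Open}(B_\pm)$. The resulting natural transformation $$\mathfrak{CCR}\big((\widehat\pi_\pm)_*\big):(\widehat\pi_\pm^{-1})^*(\mathfrak A_\pm)\Longrightarrow\mathfrak B_\pm$$ of AQFTs on $\mathbf{Open}(B_\pm)$ is a natural weak equivalence: each of its components is a quasi-isomorphism. -/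

import Mathlib

open scoped Manifold ContDiff Topology DirectSum TensorProduct ComplexConjugate
open CategoryTheory Set Filter MeasureTheory

universe u v

namespace CSWZW

/-! ## Cochain complexes

A `ℤ`-graded vector space is encoded by its total space together with its homogeneous
components, so that no casts between degrees are needed. -/

/-- A cochain complex over the field `𝕜` (total space, homogeneous components, differential). -/
structure GradedComplex (𝕜 : Type) [Field 𝕜] where
  carrier : Type u
  [addCommGroup : AddCommGroup carrier]
  [module : Module 𝕜 carrier]
  deg : ℤ → Submodule 𝕜 carrier
  internal : DirectSum.IsInternal deg
  d : carrier →ₗ[𝕜] carrier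
  d_mem : ∀ {i : ℤ} {x : carrier}, x ∈ deg i → d x ∈ deg (i + 1)
  d_d : ∀ x : carrier, d (d x) = 0

namespace GradedComplex

variable {𝕜 : Type} [Field 𝕜]

instance : CoeSort (GradedComplex.{u} 𝕜) (Type u) := ⟨carrier⟩
instance (V : GradedComplex.{u} 𝕜) : AddCommGroup V := V.addCommGroup
instance (V : GradedComplex.{u} 𝕜) : Module 𝕜 V := V.module

/-- The cocycles of degree `i`. -/
def cocycles (V : GradedComplex.{u} 𝕜) (i : ℤ) : Submodule 𝕜 V := V.deg i ⊓ LinearMap.ker V.d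

/-- The coboundaries of degree `i`. -/
def coboundaries (V : GradedComplex.{u} 𝕜) (i : ℤ) : Submodule 𝕜 V := (V.deg (i - 1)).map V.d

/-- The `i`-th cohomology `Ker (d : Vⁱ → Vⁱ⁺¹) / Im (d : Vⁱ⁻¹ → Vⁱ)`. -/
abbrev cohomology (V : GradedComplex.{u} 𝕜) (i : ℤ) : Type u :=
  V.cocycles i ⧸ (V.coboundaries i).comap (V.cocycles i).subtype

/-- `f` is a cochain map: linear, of degree zero, and compatible with the differentials. -/
structure IsCochainMap (V : GradedComplex.{u} 𝕜) (W : GradedComplex.{v} 𝕜) (f : V → W) :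
    Prop where
  map_add : ∀ x y, f (x + y) = f x + f y
  map_smul : ∀ (c : 𝕜) x, f (c • x) = c • f x
  map_deg : ∀ {i x}, x ∈ V.deg i → f x ∈ W.deg i
  map_d : ∀ x, f (V.d x) = W.d (f x)

namespace IsCochainMap

variable {V : GradedComplex.{u} 𝕜} {W : GradedComplex.{v} 𝕜} {f : V → W}

/-- The linear map underlying a cochain map. -/
def toLinearMap (hf : IsCochainMap V W f) : V →ₗ[𝕜] W where
  toFun := f
  map_add' := hf.map_add
  map_smul' := hf.map_smul

/-- The map induced by a cochain map on cocycles. -/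
def cocyclesMap (hf : IsCochainMap V W f) (i : ℤ) : V.cocycles i →ₗ[𝕜] W.cocycles i :=
  hf.toLinearMap.restrict (p := V.cocycles i) (q := W.cocycles i) fun x hx =>
    ⟨hf.map_deg hx.1, by
      have h0 : V.d x = 0 := hx.2
      change W.d (f x) = 0
      rw [← hf.map_d, h0]
      exact hf.toLinearMap.map_zero⟩

/-- The map induced by a cochain map on the `i`-th cohomology. -/
def cohomologyMap (hf : IsCochainMap V W f) (i : ℤ) : V.cohomology i →ₗ[𝕜] W.cohomology i :=
  Submodule.mapQ _ _ (hf.cocyclesMap i) (by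
    rintro x ⟨y, hy, hyx⟩
    exact ⟨f y, hf.map_deg hy, by
      rw [← hf.map_d]
      exact congrArg f hyx⟩)

/-- `f` is a quasi-isomorphism: it induces isomorphisms in all cohomology degrees. -/
def IsQuasiIso (hf : IsCochainMap V W f) : Prop :=
  ∀ i : ℤ, Function.Bijective (hf.cohomologyMap i)

end IsCochainMap

end GradedComplex

/-- The isomorphism of a graded vector space with the direct sum of its components. -/
noncomputable def splitEquiv {𝕜 V : Type*} [Field 𝕜] [AddCommGroup V] [Module 𝕜 V]
    {deg : ℤ → Submodule 𝕜 V} (h : DirectSum.IsInternal deg) : (⨁ i, deg i) ≃ₗ[𝕜] V :=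
  LinearEquiv.ofBijective (DirectSum.coeLinearMap deg) (by exact h)

lemma splitEquiv_symm_of_mem {𝕜 V : Type*} [Field 𝕜] [AddCommGroup V] [Module 𝕜 V]
    {deg : ℤ → Submodule 𝕜 V} (h : DirectSum.IsInternal deg) {i : ℤ} {x : V} (hx : x ∈ deg i) :
    (splitEquiv h).symm x = DirectSum.lof 𝕜 ℤ (fun i => deg i) i ⟨x, hx⟩ := by
  rw [LinearEquiv.symm_apply_eq]
  exact (DirectSum.coeLinearMap_lof deg i ⟨x, hx⟩).symm

/-- The endomorphism of a graded vector space multiplying the degree `i` component by `c i`. -/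
noncomputable def weightMap {𝕜 V : Type*} [Field 𝕜] [AddCommGroup V] [Module 𝕜 V]
    {deg : ℤ → Submodule 𝕜 V} (h : DirectSum.IsInternal deg) (c : ℤ → 𝕜) : V →ₗ[𝕜] V :=
  (DirectSum.toModule 𝕜 ℤ V fun i => c i • (deg i).subtype) ∘ₗ (splitEquiv h).symm.toLinearMap

lemma weightMap_of_mem {𝕜 V : Type*} [Field 𝕜] [AddCommGroup V] [Module 𝕜 V]
    {deg : ℤ → Submodule 𝕜 V} (h : DirectSum.IsInternal deg) (c : ℤ → 𝕜) {i : ℤ} {x : V}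
    (hx : x ∈ deg i) : weightMap h c x = c i • x := by
  simp [weightMap, splitEquiv_symm_of_mem h hx]

lemma induction_of_internal {𝕜 V : Type*} [Field 𝕜] [AddCommGroup V] [Module 𝕜 V]
    {deg : ℤ → Submodule 𝕜 V} (h : DirectSum.IsInternal deg) {p : V → Prop}
    (hom : ∀ i x, x ∈ deg i → p x) (add : ∀ x y, p x → p y → p (x + y)) (x : V) : p x := by
  obtain ⟨y, rfl⟩ := h.2 x
  induction y using DirectSum.induction_on with
  | zero => simpa using hom 0 0 (zero_mem _)
  | of i x => simpa using hom i x x.2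
  | add x y hx hy => simpa using add _ _ hx hy

/-! ## Poisson complexes -/

/-- The sign `(-1) ^ i`, as an element of the field `𝕜`. -/
def sgn (𝕜 : Type) [Field 𝕜] (i : ℤ) : 𝕜 := ((i.negOnePow : ℤ) : 𝕜)

lemma sgn_of_even (𝕜 : Type) [Field 𝕜] {i : ℤ} (h : Even i) : sgn 𝕜 i = 1 := by
  simp [sgn, Int.negOnePow_even i h]

lemma sgn_of_odd (𝕜 : Type) [Field 𝕜] {i : ℤ} (h : Odd i) : sgn 𝕜 i = -1 := by
  simp [sgn, Int.negOnePow_odd i h]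

lemma sgn_add (𝕜 : Type) [Field 𝕜] (i j : ℤ) : sgn 𝕜 (i + j) = sgn 𝕜 i * sgn 𝕜 j := by
  simp [sgn, Int.negOnePow_add]

lemma sgn_mul_self (𝕜 : Type) [Field 𝕜] (i : ℤ) : sgn 𝕜 i * sgn 𝕜 i = 1 := by
  rcases Int.even_or_odd i with h | h
  · simp [sgn_of_even 𝕜 h]
  · simp [sgn_of_odd 𝕜 h]

/-- `τ` is an (unshifted) linear Poisson structure on the complex `V`: a graded antisymmetric
cochain map `V ⊗ V → ℝ`, written as a bilinear map. -/
structure IsPoisson (V : GradedComplex.{u} ℝ) (τ : V → V → ℝ) : Prop where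
  add_left : ∀ x y z, τ (x + y) z = τ x z + τ y z
  smul_left : ∀ (c : ℝ) x z, τ (c • x) z = c * τ x z
  add_right : ∀ x y z, τ x (y + z) = τ x y + τ x z
  smul_right : ∀ (c : ℝ) x z, τ x (c • z) = c * τ x z
  deg_zero : ∀ {i j x y}, x ∈ V.deg i → y ∈ V.deg j → i + j ≠ 0 → τ x y = 0
  antisymm : ∀ {i j x y}, x ∈ V.deg i → y ∈ V.deg j → τ x y = -(sgn ℝ (i * j) * τ y x)
  cochain : ∀ {i j x y}, x ∈ V.deg i → y ∈ V.deg j → τ (V.d x) y + sgn ℝ i * τ x (V.d y) = 0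

/-- A Poisson cochain complex. -/
structure PoCh extends GradedComplex.{u} ℝ where
  pairing : carrier → carrier → ℝ
  isPoisson : IsPoisson toGradedComplex pairing

namespace PoCh

/-- Morphisms of Poisson complexes: cochain maps preserving the Poisson structures. -/
structure IsPoissonMap (V W : PoCh.{u}) (f : V.carrier → W.carrier) : Prop
    extends GradedComplex.IsCochainMap V.toGradedComplex W.toGradedComplex f where
  map_pairing : ∀ x y, W.pairing (f x) (f y) = V.pairing x y

/-- The type of morphisms of Poisson complexes. -/
@[ext]
structure Hom (V W : PoCh.{u}) where
  toFun : V.carrier → W.carrier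
  isPoissonMap : IsPoissonMap V W toFun

instance : Category PoCh.{u} where
  Hom := Hom
  id V := ⟨id, ⟨⟨fun _ _ => rfl, fun _ _ => rfl, fun h => h, fun _ => rfl⟩, fun _ _ => rfl⟩⟩
  comp f g := ⟨g.toFun ∘ f.toFun,
    ⟨⟨fun x y => by simp [f.isPoissonMap.map_add, g.isPoissonMap.map_add],
      fun c x => by simp [f.isPoissonMap.map_smul, g.isPoissonMap.map_smul],
      fun h => g.isPoissonMap.map_deg (f.isPoissonMap.map_deg h),
      fun x => by simp [f.isPoissonMap.map_d, g.isPoissonMap.map_d]⟩,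
      fun x y => by simp [f.isPoissonMap.map_pairing, g.isPoissonMap.map_pairing]⟩⟩

end PoCh

/-! ## Differential graded `*`-algebras -/

/-- A differential graded unital associative `*`-algebra over `ℂ`. -/
structure DGStarAlg where
  carrier : Type u
  [ring : Ring carrier]
  [algebra : Algebra ℂ carrier]
  deg : ℤ → Submodule ℂ carrier
  gradedMonoid : SetLike.GradedMonoid deg
  internal : DirectSum.IsInternal deg
  d : carrier →ₗ[ℂ] carrier
  d_mem : ∀ {i : ℤ} {x : carrier}, x ∈ deg i → d x ∈ deg (i + 1)
  d_d : ∀ x : carrier, d (d x) = 0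
  leibniz : ∀ {i : ℤ} {x : carrier}, x ∈ deg i → ∀ y, d (x * y) = d x * y + sgn ℂ i • (x * d y)
  star : carrier → carrier
  star_add : ∀ x y, star (x + y) = star x + star y
  star_smul : ∀ (c : ℂ) x, star (c • x) = conj c • star x
  star_star : ∀ x, star (star x) = x
  star_mem : ∀ {i : ℤ} {x : carrier}, x ∈ deg i → star x ∈ deg i
  star_mul : ∀ {i j : ℤ} {x y : carrier}, x ∈ deg i → y ∈ deg j →
    star (x * y) = sgn ℂ (i * j) • (star y * star x)
  star_d : ∀ x, star (d x) = d (star x)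

namespace DGStarAlg

instance : CoeSort DGStarAlg.{u} (Type u) := ⟨carrier⟩
instance (A : DGStarAlg.{u}) : Ring A := A.ring
instance (A : DGStarAlg.{u}) : Algebra ℂ A := A.algebra

/-- The cochain complex underlying a dg-algebra. -/
def toComplex (A : DGStarAlg.{u}) : GradedComplex.{u} ℂ where
  carrier := A.carrier
  deg := A.deg
  internal := A.internal
  d := A.d
  d_mem := A.d_mem
  d_d := A.d_d

/-- Morphisms of dg-`*`-algebras. -/
@[ext]
structure Hom (A B : DGStarAlg.{u}) where
  toAlgHom : A →ₐ[ℂ] B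
  map_deg : ∀ {i x}, x ∈ A.deg i → toAlgHom x ∈ B.deg i
  map_d : ∀ x, toAlgHom (A.d x) = B.d (toAlgHom x)
  map_star : ∀ x, toAlgHom (A.star x) = B.star (toAlgHom x)

instance : Category DGStarAlg.{u} where
  Hom := Hom
  id A := ⟨AlgHom.id ℂ A, fun h => h, fun _ => rfl, fun _ => rfl⟩
  comp f g := ⟨g.toAlgHom.comp f.toAlgHom, fun h => g.map_deg (f.map_deg h),
    fun x => by simp [f.map_d, g.map_d], fun x => by simp [f.map_star, g.map_star]⟩

/-- The cochain map underlying a morphism of dg-algebras. -/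
lemma isCochainMap {A B : DGStarAlg.{u}} (f : A ⟶ B) :
    GradedComplex.IsCochainMap A.toComplex B.toComplex (Hom.toAlgHom f) where
  map_add := map_add (Hom.toAlgHom f)
  map_smul := map_smul (Hom.toAlgHom f)
  map_deg := Hom.map_deg f
  map_d := Hom.map_d f

/-- The weak equivalences: morphisms whose underlying cochain map is a quasi-isomorphism. -/
def IsWeakEquivalence {A B : DGStarAlg.{u}} (f : A ⟶ B) : Prop := (isCochainMap f).IsQuasiIso

end DGStarAlg

/-! ## Canonical commutation relations -/

section CCR

variable (P : PoCh.{u})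

instance : AddCommGroup P.carrier := P.addCommGroup
instance : Module ℝ P.carrier := P.module

/-- The generator of the complexified tensor algebra attached to an element of a real complex. -/
noncomputable def tensorGen (φ : P.carrier) : TensorAlgebra ℂ (ℂ ⊗[ℝ] P.carrier) :=
  TensorAlgebra.ι ℂ ((1 : ℂ) ⊗ₜ[ℝ] φ)

/-- The canonical commutation relations `φ ψ - (-1)^(|φ||ψ|) ψ φ = i τ(φ, ψ) 1`. -/
inductive CCRRel : TensorAlgebra ℂ (ℂ ⊗[ℝ] P.carrier) → TensorAlgebra ℂ (ℂ ⊗[ℝ] P.carrier) → Prop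
  | comm {i j : ℤ} {φ ψ : P.carrier} (hφ : φ ∈ P.deg i) (hψ : ψ ∈ P.deg j) :
      CCRRel (tensorGen P φ * tensorGen P ψ)
        (sgn ℂ (i * j) • (tensorGen P ψ * tensorGen P φ)
          + algebraMap ℂ _ (Complex.I * (P.pairing φ ψ : ℂ)))

/-- The algebra underlying the CCR dg-algebra: the complexified tensor algebra modulo the two-sided
ideal generated by the canonical commutation relations (this ideal is automatically a
differential graded `*`-ideal). -/
abbrev CCRAlg : Type u := RingQuot (CCRRel P)

namespace CCRAlg

variable {P}

/-- The generators of the CCR algebra. -/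
noncomputable def gen : P.carrier →ₛₗ[Complex.ofRealHom] CCRAlg P where
  toFun φ := RingQuot.mkAlgHom ℂ (CCRRel P) (tensorGen P φ)
  map_add' x y := by simp [tensorGen, TensorProduct.tmul_add]
  map_smul' c x := by
    have : ((1 : ℂ) ⊗ₜ[ℝ] (c • x)) = (c : ℂ) • ((1 : ℂ) ⊗ₜ[ℝ] x) := by
      rw [TensorProduct.smul_tmul', ← TensorProduct.smul_tmul]
      simp
    simp only [tensorGen, this, map_smul]
    rfl

lemma gen_comm {i j : ℤ} {φ ψ : P.carrier} (hφ : φ ∈ P.deg i) (hψ : ψ ∈ P.deg j) :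
    gen φ * gen ψ = sgn ℂ (i * j) • (gen ψ * gen φ)
      + algebraMap ℂ (CCRAlg P) (Complex.I * (P.pairing φ ψ : ℂ)) := by
  have h := RingQuot.mkAlgHom_rel ℂ (CCRRel.comm hφ hψ)
  rw [map_mul, map_add, AlgHom.commutes, map_smul, map_mul] at h
  exact h

/-- Extension of scalars for a real-linear map into a complex vector space. -/
noncomputable def complexify {A : Type*} [AddCommMonoid A] [Module ℂ A]
    (f : P.carrier →ₛₗ[Complex.ofRealHom] A) : ℂ ⊗[ℝ] P.carrier →ₗ[ℂ] A :=
  letI : Module ℝ A := Module.compHom A Complex.ofRealHom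
  haveI : IsScalarTower ℝ ℂ A := ⟨fun r c a => by
    change (r • c) • a = (r : ℂ) • c • a
    rw [smul_smul, Complex.real_smul]⟩
  LinearMap.liftBaseChange ℂ
    ({ toFun := f, map_add' := map_add f, map_smul' := fun c x => f.map_smul' c x } :
      P.carrier →ₗ[ℝ] A)

lemma complexify_tmul {A : Type*} [AddCommMonoid A] [Module ℂ A]
    (f : P.carrier →ₛₗ[Complex.ofRealHom] A) (φ : P.carrier) :
    complexify f ((1 : ℂ) ⊗ₜ[ℝ] φ) = f φ := by
  let _ : Module ℝ A := Module.compHom A Complex.ofRealHom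
  have : IsScalarTower ℝ ℂ A := ⟨fun r c a => by
    change (r • c) • a = (r : ℂ) • c • a
    rw [smul_smul, Complex.real_smul]⟩
  exact (LinearMap.liftBaseChange_tmul ℂ _ _ _).trans (one_smul ℂ _)

/-- The universal property of the CCR algebra. -/
noncomputable def lift {A : Type*} [Semiring A] [Algebra ℂ A] (f : P.carrier →ₛₗ[Complex.ofRealHom] A)
    (hf : ∀ {i j φ ψ}, φ ∈ P.deg i → ψ ∈ P.deg j →
      f φ * f ψ = sgn ℂ (i * j) • (f ψ * f φ)
        + algebraMap ℂ A (Complex.I * (P.pairing φ ψ : ℂ))) : CCRAlg P →ₐ[ℂ] A :=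
  RingQuot.liftAlgHom ℂ ⟨TensorAlgebra.lift ℂ (complexify f), by
    rintro _ _ ⟨hφ, hψ⟩
    rw [map_add, map_smul, AlgHom.commutes, map_mul, map_mul]
    simp only [tensorGen, TensorAlgebra.lift_ι_apply, complexify_tmul]
    exact hf hφ hψ⟩

@[simp]
lemma lift_gen {A : Type*} [Semiring A] [Algebra ℂ A] (f : P.carrier →ₛₗ[Complex.ofRealHom] A) (hf)
    (φ : P.carrier) : lift f hf (gen φ) = f φ := by
  refine (RingQuot.liftAlgHom_mkAlgHom_apply ℂ _ _ _).trans ?_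
  simp [tensorGen, complexify_tmul]

lemma hom_ext {A : Type*} [Semiring A] [Algebra ℂ A] {f g : CCRAlg P →ₐ[ℂ] A}
    (h : ∀ φ, f (gen φ) = g (gen φ)) : f = g := by
  apply RingQuot.ringQuot_ext'
  apply TensorAlgebra.hom_ext
  apply LinearMap.ext
  intro z
  induction z using TensorProduct.induction_on with
  | zero => simp
  | add x y hx hy => rw [map_add, map_add, hx, hy]
  | tmul c φ =>
    have hc : c ⊗ₜ[ℝ] φ = c • ((1 : ℂ) ⊗ₜ[ℝ] φ) := by simp [TensorProduct.smul_tmul']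
    rw [hc, map_smul, map_smul]
    congr 1
    exact h φ

/-- The degree `i` component: the span of the products of homogeneous generators of
total degree `i`. -/
noncomputable def deg (i : ℤ) : Submodule ℂ (CCRAlg P) :=
  Submodule.span ℂ {x | ∃ l : List (ℤ × P.carrier), (∀ a ∈ l, a.2 ∈ P.deg a.1) ∧
    (l.map Prod.fst).sum = i ∧ (l.map fun a => gen a.2).prod = x}

lemma gen_mem {i : ℤ} {φ : P.carrier} (hφ : φ ∈ P.deg i) : gen φ ∈ deg (P := P) i :=
  Submodule.subset_span ⟨[(i, φ)], by simpa using hφ, by simp, by simp⟩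

instance gradedMonoid : SetLike.GradedMonoid (deg (P := P)) where
  one_mem := Submodule.subset_span ⟨[], by simp, by simp, by simp⟩
  mul_mem i j x y hx hy := by
    induction hx using Submodule.span_induction with
    | zero => simp
    | add a b _ _ ha hb => rw [add_mul]; exact add_mem ha hb
    | smul c a _ ha => rw [smul_mul_assoc]; exact Submodule.smul_mem _ _ ha
    | mem a ha =>
      obtain ⟨l, hl, rfl, rfl⟩ := ha
      induction hy using Submodule.span_induction with
      | zero => simp
      | add a b _ _ ha hb => rw [mul_add]; exact add_mem ha hb
      | smul c a _ ha => rw [mul_smul_comm]; exact Submodule.smul_mem _ _ ha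
      | mem b hb =>
        obtain ⟨m, hm, rfl, rfl⟩ := hb
        refine Submodule.subset_span ⟨l ++ m, ?_, by simp, by simp⟩
        intro a ha
        rcases List.mem_append.1 ha with h | h
        exacts [hl a h, hm a h]

/-- Induction over the elements of degree `i`. -/
lemma deg_induction {p : ℤ → CCRAlg P → Prop} (zero : ∀ i, p i 0) (one : p 0 1)
    (add : ∀ i x y, x ∈ deg i → y ∈ deg i → p i x → p i y → p i (x + y))
    (smul : ∀ i (c : ℂ) x, x ∈ deg i → p i x → p i (c • x))
    (mul : ∀ i j φ x, φ ∈ P.deg i → x ∈ deg j → p j x → p (i + j) (gen φ * x))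
    {i : ℤ} {x : CCRAlg P} (hx : x ∈ deg i) : p i x := by
  induction hx using Submodule.span_induction with
  | zero => exact zero i
  | add a b ha' hb' ha hb => exact add _ _ _ ha' hb' ha hb
  | smul c a ha' ha => exact smul _ _ _ ha' ha
  | mem a ha =>
    obtain ⟨l, hl, rfl, rfl⟩ := ha
    induction l with
    | nil => simpa using one
    | cons a l ih =>
      simp only [List.map_cons, List.sum_cons, List.prod_cons]
      refine mul _ _ _ _ (hl a (by simp)) (Submodule.subset_span ⟨l, ?_, rfl, rfl⟩) (ih ?_)
      all_goals exact fun b hb => hl b (by simp [hb])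

/-- The generators, as a map to the direct sum of the homogeneous components. -/
noncomputable def gradedGenAux : P.carrier →+ ⨁ i, deg (P := P) i :=
  (DirectSum.toAddMonoid fun i =>
    (DirectSum.of (fun i => deg (P := P) i) i).comp
      (AddMonoidHom.mk' (fun φ : P.deg i => (⟨gen φ.1, gen_mem φ.2⟩ : deg (P := P) i))
        (fun a b => Subtype.ext (map_add gen a.1 b.1)))).comp
    (splitEquiv P.internal).symm.toLinearMap.toAddMonoidHom

lemma gradedGenAux_of_mem {i : ℤ} {φ : P.carrier} (hφ : φ ∈ P.deg i) :
    gradedGenAux φ = DirectSum.of (fun i => deg (P := P) i) i ⟨gen φ, gen_mem hφ⟩ := by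
  have h := splitEquiv_symm_of_mem P.internal hφ
  rw [DirectSum.lof_eq_of] at h
  change DirectSum.toAddMonoid _ ((splitEquiv P.internal).symm φ) = _
  rw [h, DirectSum.toAddMonoid_of]
  rfl

/-- The generators, as a real-linear map to the direct sum of the homogeneous components. -/
noncomputable def gradedGen : P.carrier →ₛₗ[Complex.ofRealHom] ⨁ i, deg (P := P) i where
  toFun := gradedGenAux
  map_add' := map_add _
  map_smul' c φ := by
    induction φ using induction_of_internal P.internal with
    | hom i φ hφ =>
      rw [gradedGenAux_of_mem hφ, gradedGenAux_of_mem (Submodule.smul_mem _ c hφ)]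
      refine Eq.trans ?_ ((DirectSum.lof ℂ ℤ (fun i => deg (P := P) i) i).map_smul (c : ℂ) _)
      rw [DirectSum.lof_eq_of]
      congr 1
      exact Subtype.ext (gen.map_smul' c φ)
    | add x y hx hy => rw [smul_add, map_add, hx, hy, map_add, smul_add]

lemma gradedGen_of_mem {i : ℤ} {φ : P.carrier} (hφ : φ ∈ P.deg i) :
    gradedGen φ = DirectSum.of (fun i => deg (P := P) i) i ⟨gen φ, gen_mem hφ⟩ :=
  gradedGenAux_of_mem hφ

lemma gradedGen_comm {i j : ℤ} {φ ψ : P.carrier} (hφ : φ ∈ P.deg i) (hψ : ψ ∈ P.deg j) :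
    gradedGen φ * gradedGen ψ = sgn ℂ (i * j) • (gradedGen ψ * gradedGen φ)
      + algebraMap ℂ (⨁ i, deg (P := P) i) (Complex.I * (P.pairing φ ψ : ℂ)) := by
  rw [gradedGen_of_mem hφ, gradedGen_of_mem hψ, DirectSum.of_mul_of, DirectSum.of_mul_of,
    DirectSum.algebraMap_apply]
  by_cases hij : i + j = 0
  · have hji : j + i = 0 := by omega
    have e1 : ∀ (k : ℤ) (hk : k = 0) (x : deg (P := P) k),
        DirectSum.of (fun i => deg (P := P) i) k x =
          DirectSum.of (fun i => deg (P := P) i) 0 ⟨x.1, hk ▸ x.2⟩ := by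
      rintro _ rfl x; rfl
    rw [e1 _ hij, e1 _ hji, ← DirectSum.lof_eq_of ℂ, ← DirectSum.lof_eq_of ℂ, ← map_smul]
    refine Eq.trans ?_ (map_add (DirectSum.lof ℂ ℤ (fun i => deg (P := P) i) 0) _ _)
    congr 1
    apply Subtype.ext
    exact gen_comm hφ hψ
  · rw [P.isPoisson.deg_zero hφ hψ hij]
    have e1 : ∀ (k l : ℤ) (hk : k = l) (x : deg (P := P) k),
        DirectSum.of (fun i => deg (P := P) i) k x =
          DirectSum.of (fun i => deg (P := P) i) l ⟨x.1, hk ▸ x.2⟩ := by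
      rintro _ _ rfl x; rfl
    rw [e1 (j + i) (i + j) (add_comm _ _), ← DirectSum.lof_eq_of ℂ, ← DirectSum.lof_eq_of ℂ,
      ← map_smul]
    simp only [Complex.ofReal_zero, mul_zero, map_zero, add_zero]
    congr 1
    apply Subtype.ext
    have := gen_comm hφ hψ
    rw [P.isPoisson.deg_zero hφ hψ hij] at this
    simpa using this

/-- The decomposition of the CCR algebra into its homogeneous components. -/
noncomputable def decomp : CCRAlg P →ₐ[ℂ] ⨁ i, deg (P := P) i :=
  lift gradedGen gradedGen_comm

lemma internal : DirectSum.IsInternal (deg (P := P)) := by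
  have : GradedAlgebra (deg (P := P)) := GradedAlgebra.ofAlgHom _ decomp
    (by
      apply hom_ext
      intro φ
      induction φ using induction_of_internal P.internal with
      | hom i φ hφ =>
        simp [decomp, gradedGen_of_mem hφ]
      | add x y hx hy => rw [map_add, map_add, map_add, hx, hy])
    (by
      rintro i ⟨x, hx⟩
      refine deg_induction (P := P) (p := fun i x => ∀ hx : x ∈ deg i,
        decomp x = DirectSum.of (fun i => deg (P := P) i) i ⟨x, hx⟩) ?_ ?_ ?_ ?_ ?_ hx hx
      · intro i h
        rw [map_zero]; symm; exact map_zero (DirectSum.of (fun i => deg (P := P) i) i)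
      · intro h; rw [map_one]; rfl
      · intro i x y hx hy hx' hy' h
        rw [map_add, hx' hx, hy' hy, ← map_add]; rfl
      · intro i c x hx hx' h
        rw [map_smul, hx' hx]
        exact ((DirectSum.lof ℂ ℤ (fun i => deg (P := P) i) i).map_smul c ⟨x, hx⟩).symm
      · intro i j φ x hφ hx hx' h
        rw [map_mul, hx' hx]
        simp only [decomp, lift_gen]
        rw [gradedGen_of_mem hφ, DirectSum.of_mul_of]
        rfl)
  exact DirectSum.Decomposition.isInternal _

lemma induction {p : CCRAlg P → Prop} (one : p 1)
    (add : ∀ x y, p x → p y → p (x + y)) (smul : ∀ (c : ℂ) x, p x → p (c • x))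
    (mul : ∀ i j φ x, φ ∈ P.deg i → x ∈ deg j → p x → p (gen φ * x)) (x : CCRAlg P) : p x := by
  refine induction_of_internal (internal (P := P)) (fun i x hx => ?_) add x
  refine deg_induction (P := P) (p := fun _ x => p x) (fun i => ?_) one
    (fun _ _ _ _ _ => add _ _) (fun _ c x _ => smul c x) mul hx
  simpa using smul 0 1 one

/-! ### The differential of the CCR algebra -/

/-- The map `φ ↦ ((-1)^|φ| φ, dφ; 0, φ)` to upper triangular matrices encoding the graded
derivation that extends the differential of the complex. -/
noncomputable def derGen : P.carrier →ₛₗ[Complex.ofRealHom] Matrix (Fin 2) (Fin 2) (CCRAlg P) where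
  toFun φ := !![gen (weightMap P.internal (sgn ℝ) φ), gen (P.d φ); 0, gen φ]
  map_add' x y := by ext i j; fin_cases i <;> fin_cases j <;> simp
  map_smul' c x := by
    ext i j
    fin_cases i <;> fin_cases j <;> simp [LinearMap.map_smulₛₗ]

lemma derGen_of_mem {i : ℤ} {φ : P.carrier} (hφ : φ ∈ P.deg i) :
    derGen φ = !![sgn ℂ i • gen φ, gen (P.d φ); 0, gen φ] := by
  have : gen (weightMap P.internal (sgn ℝ) φ) = sgn ℂ i • gen φ := by
    rw [weightMap_of_mem P.internal _ hφ, LinearMap.map_smulₛₗ]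
    simp [sgn]
  simp [derGen, this]

lemma derGen_comm {i j : ℤ} {φ ψ : P.carrier} (hφ : φ ∈ P.deg i) (hψ : ψ ∈ P.deg j) :
    derGen φ * derGen ψ = sgn ℂ (i * j) • (derGen ψ * derGen φ)
      + algebraMap ℂ (Matrix (Fin 2) (Fin 2) (CCRAlg P)) (Complex.I * (P.pairing φ ψ : ℂ)) := by
  have h1 := gen_comm hφ hψ
  have h2 := gen_comm (P.d_mem hφ) hψ
  have h3 := gen_comm hφ (P.d_mem hψ)
  have h4 := P.isPoisson.cochain hφ hψ
  have h5 : sgn ℂ i * sgn ℂ j * (Complex.I * (P.pairing φ ψ : ℂ)) =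
      Complex.I * (P.pairing φ ψ : ℂ) := by
    by_cases hij : i + j = 0
    · rw [← sgn_add, hij, sgn_of_even ℂ (by simp), one_mul]
    · simp [P.isPoisson.deg_zero hφ hψ hij]
  have h6 : (P.pairing (P.d φ) ψ : ℂ) = -(sgn ℂ i * (P.pairing φ (P.d ψ) : ℂ)) := by
    have h7 : ((sgn ℝ i : ℝ) : ℂ) = sgn ℂ i := by simp [sgn]
    rw [← h7]
    exact_mod_cast eq_neg_of_add_eq_zero_left h4
  have e1 : (i + 1) * j = i * j + j := by ring
  have e2 : i * (j + 1) = i * j + i := by ring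
  rw [e1, sgn_add] at h2
  rw [e2, sgn_add] at h3
  rw [derGen_of_mem hφ, derGen_of_mem hψ]
  ext a b
  fin_cases a <;> fin_cases b
  · simp only [Matrix.add_apply, Matrix.smul_apply, Matrix.mul_apply, Fin.sum_univ_two,
      Matrix.algebraMap_matrix_apply]
    simp only [Matrix.of_apply, Matrix.cons_val', Matrix.cons_val_zero, Matrix.cons_val_one,
      Fin.zero_eta, Fin.isValue, mul_zero, add_zero, if_true, smul_mul_smul_comm,
      Matrix.cons_val_fin_one]
    rw [h1, smul_add, smul_smul, smul_smul, ← h5]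
    simp only [Algebra.algebraMap_eq_smul_one, smul_smul]
    congr 1
    · congr 1; ring
    · congr 1
      linear_combination (sgn ℂ i * sgn ℂ j) * h5
  · simp only [Matrix.add_apply, Matrix.smul_apply, Matrix.mul_apply, Fin.sum_univ_two,
      Matrix.algebraMap_matrix_apply]
    simp
    rw [h2, h3, h6]
    simp only [Algebra.algebraMap_eq_smul_one, smul_add, smul_smul, mul_neg]
    have e3 : sgn ℂ i * (sgn ℂ (i * j) * sgn ℂ i) = sgn ℂ (i * j) := by
      linear_combination sgn ℂ (i * j) * sgn_mul_self ℂ i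
    have e4 : sgn ℂ i * (Complex.I * (P.pairing φ (P.d ψ) : ℂ)) =
      Complex.I * (sgn ℂ i * (P.pairing φ (P.d ψ) : ℂ)) := by ring
    rw [e3, e4, add_add_add_comm, ← add_smul, add_neg_cancel, zero_smul, add_zero]
    abel
  · simp [Matrix.mul_apply, Fin.sum_univ_two, Matrix.algebraMap_matrix_apply]
  · simp [Matrix.mul_apply, Fin.sum_univ_two, Matrix.algebraMap_matrix_apply, h1]

/-- The algebra map to upper triangular matrices encoding the differential. -/
noncomputable def derHom : CCRAlg P →ₐ[ℂ] Matrix (Fin 2) (Fin 2) (CCRAlg P) :=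
  lift derGen derGen_comm

/-- The differential of the CCR algebra: the graded derivation extending `P.d`. -/
noncomputable def d : CCRAlg P →ₗ[ℂ] CCRAlg P where
  toFun x := derHom x 0 1
  map_add' x y := by simp
  map_smul' c x := by simp

lemma derHom_of_mem {i : ℤ} {x : CCRAlg P} (hx : x ∈ deg i) :
    derHom x = !![sgn ℂ i • x, d x; 0, x] := by
  refine deg_induction (P := P) (p := fun i x => derHom x = !![sgn ℂ i • x, d x; 0, x])
    ?_ ?_ ?_ ?_ ?_ hx
  · intro i; rw [map_zero, map_zero]; ext a b; fin_cases a <;> fin_cases b <;> simp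
  · have h1 : d (1 : CCRAlg P) = 0 := by
      change derHom (1 : CCRAlg P) 0 1 = 0
      rw [map_one]; simp
    rw [map_one, h1, sgn_of_even ℂ (by simp)]
    ext a b; fin_cases a <;> fin_cases b <;> simp
  · intro i x y _ _ hx hy
    rw [map_add, map_add, hx, hy]
    ext a b; fin_cases a <;> fin_cases b <;> simp
  · intro i c x _ hx
    rw [map_smul, map_smul, hx]
    ext a b; fin_cases a <;> fin_cases b <;> simp [smul_comm c]
  · intro i j φ x hφ _ hx
    have h2 : derHom (gen φ * x) =
        !![sgn ℂ i • gen φ, gen (P.d φ); 0, gen φ] * !![sgn ℂ j • x, d x; 0, x] := by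
      rw [map_mul, hx, derHom, lift_gen, derGen_of_mem hφ]
    have h3 : d (gen φ * x) = derHom (gen φ * x) 0 1 := rfl
    rw [h3, h2]
    ext a b
    fin_cases a <;> fin_cases b <;>
      simp [Matrix.mul_apply, Fin.sum_univ_two, sgn_add, smul_smul]
    rw [mul_comm]

lemma d_gen (φ : P.carrier) : d (gen φ) = gen (P.d φ) := by
  change derHom (gen φ) 0 1 = _
  simp [derHom, derGen]

lemma d_one : d (1 : CCRAlg P) = 0 := by
  change derHom (1 : CCRAlg P) 0 1 = 0
  rw [map_one]; simp

lemma leibniz {i : ℤ} {x : CCRAlg P} (hx : x ∈ deg i) (y : CCRAlg P) :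
    d (x * y) = d x * y + sgn ℂ i • (x * d y) := by
  refine induction_of_internal (internal (P := P)) (p := fun y =>
    d (x * y) = d x * y + sgn ℂ i • (x * d y)) (fun j y hy => ?_) (fun y z hy hz => ?_) y
  · change derHom (x * y) 0 1 = _
    rw [map_mul, derHom_of_mem hx, derHom_of_mem hy]
    simp [Matrix.mul_apply, Fin.sum_univ_two]
    rw [add_comm]
  · rw [mul_add, map_add, hy, hz, map_add, mul_add, mul_add, smul_add]; abel

lemma d_mem {i : ℤ} {x : CCRAlg P} (hx : x ∈ deg i) : d x ∈ deg (i + 1) := by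
  refine deg_induction (P := P) (p := fun i x => d x ∈ deg (i + 1)) ?_ ?_ ?_ ?_ ?_ hx
  · intro i; simp
  · simp [d_one]
  · intro i x y _ _ hx hy; rw [map_add]; exact add_mem hx hy
  · intro i c x _ hx; rw [map_smul]; exact Submodule.smul_mem _ _ hx
  · intro i j φ x hφ hx hx'
    rw [leibniz (gen_mem hφ), d_gen]
    refine add_mem ?_ (Submodule.smul_mem _ _ ?_)
    · have := SetLike.mul_mem_graded (gen_mem (P.d_mem hφ)) hx
      rwa [show i + 1 + j = i + j + 1 by ring] at this
    · have := SetLike.mul_mem_graded (gen_mem hφ) hx'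
      rwa [← add_assoc] at this

lemma d_d (x : CCRAlg P) : d (d x) = 0 := by
  induction x using induction with
  | one => simp [d_one]
  | add x y hx hy => rw [map_add, map_add, hx, hy, add_zero]
  | smul c x hx => rw [map_smul, map_smul, hx, smul_zero]
  | mul i j φ x hφ hx ih =>
    rw [leibniz (gen_mem hφ), map_add, map_smul, d_gen, leibniz (gen_mem hφ),
      leibniz (gen_mem (P.d_mem hφ)), d_gen, P.d_d, ih, sgn_add, sgn_of_odd ℂ odd_one]
    simp only [d_gen, map_zero, zero_mul, zero_add, mul_zero, smul_zero, add_zero, mul_neg, mul_one]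
    rw [← add_smul, neg_add_cancel, zero_smul]

/-! ### The `*`-structure of the CCR algebra -/

/-- The opposite of a complex algebra with the conjugate scalar multiplication. -/
def ConjOp (A : Type*) := Aᵐᵒᵖ

instance (A : Type*) [Ring A] : Ring (ConjOp A) := inferInstanceAs (Ring Aᵐᵒᵖ)

noncomputable instance (A : Type*) [Ring A] [Algebra ℂ A] : Algebra ℂ (ConjOp A) :=
  RingHom.toAlgebra' (S := ConjOp A) ((algebraMap ℂ Aᵐᵒᵖ).comp (starRingEnd ℂ))
    fun c x => Algebra.commutes (A := Aᵐᵒᵖ) (conj c) x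

/-- The identification of a complex algebra with its conjugate opposite, as an additive map. -/
def toConjOp {A : Type*} [Ring A] : A ≃+ ConjOp A := MulOpposite.opAddEquiv

lemma toConjOp_mul {A : Type*} [Ring A] (x y : A) :
    toConjOp (x * y) = toConjOp y * toConjOp x := rfl

lemma smul_toConjOp {A : Type*} [Ring A] [Algebra ℂ A] (c : ℂ) (x : A) :
    c • toConjOp x = toConjOp (conj c • x) := by
  rw [Algebra.smul_def]
  change (MulOpposite.op (algebraMap ℂ A (conj c))) * MulOpposite.op x = MulOpposite.op (conj c • x)
  rw [← MulOpposite.op_mul, Algebra.smul_def, Algebra.commutes]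

lemma algebraMap_conjOp {A : Type*} [Ring A] [Algebra ℂ A] (c : ℂ) :
    algebraMap ℂ (ConjOp A) c = toConjOp (algebraMap ℂ A (conj c)) := rfl

/-- A square root of `(-1) ^ i`, turning graded into ungraded anti-multiplicativity. -/
noncomputable def rt (i : ℤ) : ℂ := if Even i then 1 else Complex.I

lemma rt_mul_conj (i : ℤ) : rt i * conj (rt i) = 1 := by
  by_cases h : Even i <;> simp [rt, h]

lemma rt_mul (i j : ℤ) : rt i * rt j = sgn ℂ (i * j) * rt (i + j) := by
  rcases Int.even_or_odd i with hi | hi <;> rcases Int.even_or_odd j with hj | hj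
  · simp [rt, hi, hj, hi.add hj, sgn_of_even ℂ (hi.mul_right j)]
  · simp [rt, hi, Int.not_even_iff_odd.2 hj, Int.not_even_iff_odd.2 (hi.add_odd hj),
      sgn_of_even ℂ (hi.mul_right j)]
  · simp [rt, hj, Int.not_even_iff_odd.2 hi, Int.not_even_iff_odd.2 (hi.add_even hj),
      sgn_of_even ℂ (hj.mul_left i)]
  · simp [rt, Int.not_even_iff_odd.2 hi, Int.not_even_iff_odd.2 hj, hi.add_odd hj,
      sgn_of_odd ℂ (hi.mul hj)]

/-- The generators of the conjugate opposite algebra. -/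
noncomputable def starGen : P.carrier →ₛₗ[Complex.ofRealHom] ConjOp (CCRAlg P) where
  toFun φ := toConjOp (weightMap internal rt (gen φ))
  map_add' x y := by simp
  map_smul' c x := by
    rw [LinearMap.map_smulₛₗ, map_smul, smul_toConjOp]
    simp

lemma starGen_of_mem {i : ℤ} {φ : P.carrier} (hφ : φ ∈ P.deg i) :
    starGen φ = toConjOp (rt i • gen φ) := by
  rw [← weightMap_of_mem internal rt (gen_mem hφ)]
  rfl

lemma conj_sgn (i : ℤ) : conj (sgn ℂ i) = sgn ℂ i := by simp [sgn]

lemma starGen_comm {i j : ℤ} {φ ψ : P.carrier} (hφ : φ ∈ P.deg i) (hψ : ψ ∈ P.deg j) :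
    starGen φ * starGen ψ = sgn ℂ (i * j) • (starGen ψ * starGen φ)
      + algebraMap ℂ (ConjOp (CCRAlg P)) (Complex.I * (P.pairing φ ψ : ℂ)) := by
  rw [starGen_of_mem hφ, starGen_of_mem hψ, ← toConjOp_mul, ← toConjOp_mul, smul_toConjOp,
    algebraMap_conjOp, ← map_add]
  congr 1
  simp only [smul_mul_smul_comm, gen_comm hφ hψ, conj_sgn, map_mul, Complex.conj_I,
    Complex.conj_ofReal, smul_add, smul_smul, Algebra.algebraMap_eq_smul_one]
  by_cases hij : i + j = 0
  · obtain rfl : j = -i := by omega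
    have h1 := rt_mul i (-i)
    have h2 := sgn_mul_self ℂ (i * -i)
    have h3 : rt (i + -i) = 1 := by simp [rt]
    rw [h3, mul_one] at h1
    rw [add_assoc, ← add_smul]
    have h4 : rt (-i) * rt i = sgn ℂ (i * -i) := by rw [mul_comm, h1]
    rw [h1, h4]
    generalize sgn ℂ (i * -i) = s at *
    have h5 : s * (s * (Complex.I * (P.pairing φ ψ : ℂ))) + -Complex.I * (P.pairing φ ψ : ℂ) = 0 := by
      linear_combination (Complex.I * (P.pairing φ ψ : ℂ)) * h2
    rw [h2, mul_one]
    simp only [neg_mul] at h5 ⊢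
    rw [h5, zero_smul, add_zero]
  · rw [P.isPoisson.deg_zero hφ hψ hij, mul_comm (rt j)]
    have h2 := sgn_mul_self ℂ (i * j)
    simp only [Complex.ofReal_zero, mul_zero, zero_smul, add_zero]
    congr 1
    linear_combination (-(rt i * rt j)) * h2

/-- The algebra map to the conjugate opposite algebra. -/
noncomputable def starHom : CCRAlg P →ₐ[ℂ] ConjOp (CCRAlg P) := lift starGen starGen_comm

/-- The `*`-involution of the CCR algebra: the conjugate linear graded anti-automorphism that
fixes the generators. -/
noncomputable def star (x : CCRAlg P) : CCRAlg P :=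
  weightMap internal (fun i => conj (rt i)) (toConjOp.symm (starHom x))

lemma star_add (x y : CCRAlg P) : star (x + y) = star x + star y := by simp [star]

lemma toConjOp_symm_smul (c : ℂ) (x : ConjOp (CCRAlg P)) :
    toConjOp.symm (c • x) = conj c • toConjOp.symm x := by
  obtain ⟨y, rfl⟩ := toConjOp.surjective x
  rw [smul_toConjOp]
  simp

lemma star_smul (c : ℂ) (x : CCRAlg P) : star (c • x) = conj c • star x := by
  simp only [star, map_smul, toConjOp_symm_smul]

lemma starHom_mem {i : ℤ} {x : CCRAlg P} (hx : x ∈ deg i) : toConjOp.symm (starHom x) ∈ deg i := by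
  refine deg_induction (P := P) (p := fun i x => toConjOp.symm (starHom x) ∈ deg i) ?_ ?_ ?_ ?_ ?_ hx
  · intro i; simp
  · rw [map_one]; exact SetLike.GradedOne.one_mem
  · intro i x y _ _ hx hy; rw [map_add, map_add]; exact add_mem hx hy
  · intro i c x _ hx; rw [map_smul, toConjOp_symm_smul]; exact Submodule.smul_mem _ _ hx
  · intro i j φ x hφ _ hx
    rw [map_mul]
    have h1 : starHom (gen φ) = toConjOp (rt i • gen φ) := by
      rw [starHom, lift_gen, starGen_of_mem hφ]
    have h2 : toConjOp.symm (starHom (gen φ) * starHom x)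
        = toConjOp.symm (starHom x) * (rt i • gen φ) := by rw [h1]; rfl
    rw [h2, add_comm i j]
    exact SetLike.mul_mem_graded hx (Submodule.smul_mem _ _ (gen_mem hφ))

lemma star_of_mem {i : ℤ} {x : CCRAlg P} (hx : x ∈ deg i) :
    star x = conj (rt i) • toConjOp.symm (starHom x) :=
  weightMap_of_mem internal _ (starHom_mem hx)

lemma star_mem {i : ℤ} {x : CCRAlg P} (hx : x ∈ deg i) : star x ∈ deg i := by
  rw [star_of_mem hx]
  exact Submodule.smul_mem _ _ (starHom_mem hx)

lemma star_mul {i j : ℤ} {x y : CCRAlg P} (hx : x ∈ deg i) (hy : y ∈ deg j) :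
    star (x * y) = sgn ℂ (i * j) • (star y * star x) := by
  rw [star_of_mem (SetLike.mul_mem_graded hx hy), star_of_mem hx, star_of_mem hy, map_mul]
  have h2 : toConjOp.symm (starHom x * starHom y)
      = toConjOp.symm (starHom y) * toConjOp.symm (starHom x) := rfl
  rw [h2, smul_mul_smul_comm, smul_smul]
  congr 1
  have h := congrArg conj (rt_mul i j)
  rw [map_mul, map_mul, conj_sgn] at h
  rw [mul_comm (conj (rt j)), h, ← mul_assoc, sgn_mul_self, one_mul]

lemma star_gen (φ : P.carrier) : star (gen φ) = gen φ := by
  refine induction_of_internal P.internal (p := fun φ => star (gen φ) = gen φ)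
    (fun i φ hφ => ?_) (fun x y hx hy => ?_) φ
  · rw [star_of_mem (gen_mem hφ), starHom, lift_gen, starGen_of_mem hφ, AddEquiv.symm_apply_apply,
      smul_smul, mul_comm, rt_mul_conj, one_smul]
  · rw [map_add, star_add, hx, hy]

lemma star_one : star (1 : CCRAlg P) = 1 := by
  rw [star_of_mem (i := 0) SetLike.GradedOne.one_mem, map_one]
  have : rt 0 = 1 := by simp [rt]
  rw [this, map_one, one_smul]
  rfl

lemma star_star (x : CCRAlg P) : star (star x) = x := by
  induction x using induction with
  | one => simp [star_one]
  | add x y hx hy => rw [star_add, star_add, hx, hy]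
  | smul c x hx => rw [star_smul, star_smul, hx]; simp
  | mul i j φ x hφ hx ih =>
    rw [star_mul (gen_mem hφ) hx, star_smul, star_mul (star_mem hx) (star_mem (gen_mem hφ)), ih,
      star_gen, star_gen, conj_sgn, smul_smul, mul_comm j i, sgn_mul_self, one_smul]

lemma star_d (x : CCRAlg P) : star (d x) = d (star x) := by
  have h0 : star (0 : CCRAlg P) = 0 := by simpa using star_smul (0 : ℂ) (0 : CCRAlg P)
  induction x using induction with
  | one => rw [d_one, star_one, d_one, h0]
  | add x y hx hy => rw [map_add, star_add, hx, hy, star_add, map_add]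
  | smul c x hx => rw [map_smul, star_smul, hx, star_smul, map_smul]
  | mul i j φ x hφ hx ih =>
    rw [star_mul (gen_mem hφ) hx, star_gen, leibniz (gen_mem hφ), d_gen, star_add, star_smul,
      star_mul (gen_mem (P.d_mem hφ)) hx, star_mul (gen_mem hφ) (d_mem hx), star_gen, star_gen,
      map_smul, leibniz (star_mem hx), d_gen, ih, conj_sgn, smul_smul, smul_add, smul_smul]
    have e1 : (i + 1) * j = i * j + j := by ring
    have e2 : i * (j + 1) = i * j + i := by ring
    rw [e1, e2, sgn_add, sgn_add, add_comm]
    congr 2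
    linear_combination sgn ℂ (i * j) * sgn_mul_self ℂ i

end CCRAlg

/-- The dg-`*`-algebra of canonical commutation relations of a Poisson complex. -/
noncomputable def ccrObj : DGStarAlg.{u} where
  carrier := CCRAlg P
  deg := CCRAlg.deg
  gradedMonoid := CCRAlg.gradedMonoid
  internal := CCRAlg.internal
  d := CCRAlg.d
  d_mem := CCRAlg.d_mem
  d_d := CCRAlg.d_d
  leibniz := CCRAlg.leibniz
  star := CCRAlg.star
  star_add := CCRAlg.star_add
  star_smul := CCRAlg.star_smul
  star_star := CCRAlg.star_star
  star_mem := CCRAlg.star_mem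
  star_mul := CCRAlg.star_mul
  star_d := CCRAlg.star_d

namespace CCRAlg

variable {P} {Q : PoCh.{u}}

/-- A morphism of Poisson complexes, on generators. -/
noncomputable def mapGen (f : P ⟶ Q) : P.carrier →ₛₗ[Complex.ofRealHom] CCRAlg Q where
  toFun φ := gen (PoCh.Hom.toFun f φ)
  map_add' x y := by rw [(PoCh.Hom.isPoissonMap f).map_add, map_add]
  map_smul' c x := by rw [(PoCh.Hom.isPoissonMap f).map_smul, LinearMap.map_smulₛₗ]

/-- The algebra map induced by a morphism of Poisson complexes. -/
noncomputable def map (f : P ⟶ Q) : CCRAlg P →ₐ[ℂ] CCRAlg Q :=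
  lift (mapGen f) (by
    intro i j φ ψ hφ hψ
    have h := (PoCh.Hom.isPoissonMap f)
    rw [← h.map_pairing φ ψ]
    exact gen_comm (h.map_deg hφ) (h.map_deg hψ))

lemma map_gen (f : P ⟶ Q) (φ : P.carrier) : map f (gen φ) = gen (PoCh.Hom.toFun f φ) :=
  lift_gen _ _ _

lemma map_mem (f : P ⟶ Q) {i : ℤ} {x : CCRAlg P} (hx : x ∈ deg i) : map f x ∈ deg i := by
  refine deg_induction (P := P) (p := fun i x => map f x ∈ deg i) ?_ ?_ ?_ ?_ ?_ hx
  · intro i; simp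
  · rw [map_one]; exact SetLike.GradedOne.one_mem
  · intro i x y _ _ hx hy; rw [map_add]; exact add_mem hx hy
  · intro i c x _ hx; rw [map_smul]; exact Submodule.smul_mem _ _ hx
  · intro i j φ x hφ _ hx
    rw [map_mul, map_gen]
    exact SetLike.mul_mem_graded (gen_mem ((PoCh.Hom.isPoissonMap f).map_deg hφ)) hx

lemma map_d (f : P ⟶ Q) (x : CCRAlg P) : map f (d x) = d (map f x) := by
  induction x using induction with
  | one => simp [d_one]
  | add x y hx hy => simp only [map_add, hx, hy]
  | smul c x hx => simp only [map_smul, hx]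
  | mul i j φ x hφ hx ih =>
    have h := PoCh.Hom.isPoissonMap f
    rw [leibniz (gen_mem hφ), d_gen, map_add, map_smul, map_mul, map_mul, map_mul, map_gen,
      map_gen, leibniz (gen_mem (h.map_deg hφ)), d_gen, ih, ← h.map_d]

lemma map_star (f : P ⟶ Q) (x : CCRAlg P) : map f (star x) = star (map f x) := by
  induction x using induction with
  | one => simp [star_one]
  | add x y hx hy => simp only [map_add, star_add, hx, hy]
  | smul c x hx => simp only [map_smul, star_smul, hx]
  | mul i j φ x hφ hx ih =>
    have h := PoCh.Hom.isPoissonMap f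
    rw [star_mul (gen_mem hφ) hx, star_gen, map_smul, map_mul, map_mul, map_gen,
      star_mul (gen_mem (h.map_deg hφ)) (map_mem f hx), star_gen, ih]

end CCRAlg

end CCR

/-- The canonical commutation relations functor. -/
noncomputable def CCR : PoCh.{u} ⥤ DGStarAlg.{u} where
  obj P := ccrObj P
  map f := ⟨CCRAlg.map f, CCRAlg.map_mem f, CCRAlg.map_d f, CCRAlg.map_star f⟩
  map_id P := by
    apply DGStarAlg.Hom.ext
    apply CCRAlg.hom_ext
    intro φ
    exact CCRAlg.map_gen (𝟙 P) φ
  map_comp f g := by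
    apply DGStarAlg.Hom.ext
    apply CCRAlg.hom_ext
    intro φ
    refine (CCRAlg.map_gen (f ≫ g) φ).trans ?_
    refine ((congrArg (CCRAlg.map g) (CCRAlg.map_gen f φ)).trans (CCRAlg.map_gen g _)).symm

/-! ## Differential forms on manifolds with boundary -/

section Forms

variable {E : Type*} [NormedAddCommGroup E] [NormedSpace ℝ E] {H : Type*} [TopologicalSpace H]
  {I : ModelWithCorners ℝ E H} {M : Type*} [TopologicalSpace M] [ChartedSpace H M] {k : ℕ}

/-- A (not necessarily smooth) differential `k`-form on a manifold modelled on `E`: the tangent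
space of `M` at `x` is by definition `E`, identified via the preferred chart at `x`. -/
abbrev Form (E M : Type*) [NormedAddCommGroup E] [NormedSpace ℝ E] (k : ℕ) :=
  M → E [⋀^Fin k]→L[ℝ] ℝ

/-- The derivative at `y` of the inverse of the chart at `x₀`, as a map from `E` to the tangent
space at the corresponding point `x`. -/
noncomputable def chartFrame (I : ModelWithCorners ℝ E H) (x₀ : M) (y : E) : E →L[ℝ] E :=
  fderivWithin ℝ (extChartAt I ((extChartAt I x₀).symm y) ∘ (extChartAt I x₀).symm) (range I) y

/-- The coordinate representation of a form in the chart at `x₀`. -/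
noncomputable def chartRep (I : ModelWithCorners ℝ E H) (α : Form E M k) (x₀ : M) :
    E → E [⋀^Fin k]→L[ℝ] ℝ :=
  fun y => (α ((extChartAt I x₀).symm y)).compContinuousLinearMap (chartFrame I x₀ y)

/-- A form is smooth if its coordinate representations are. -/
def IsSmoothForm (I : ModelWithCorners ℝ E H) (α : Form E M k) : Prop :=
  ∀ x₀, ContDiffOn ℝ ∞ (chartRep I α x₀) (extChartAt I x₀).target

/-- The exterior derivative of a form, computed at each point in the preferred chart. -/
noncomputable def extD (I : ModelWithCorners ℝ E H) (α : Form E M k) : Form E M (k + 1) :=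
  fun x => extDerivWithin (chartRep I α x) (range I) (extChartAt I x x)

lemma chartRep_add (α β : Form E M k) (x₀ : M) :
    chartRep I (α + β) x₀ = chartRep I α x₀ + chartRep I β x₀ := by
  ext y v; simp [chartRep]

lemma chartRep_smul (c : ℝ) (α : Form E M k) (x₀ : M) :
    chartRep I (c • α) x₀ = c • chartRep I α x₀ := by
  ext y v; simp [chartRep]

lemma chartRep_zero (x₀ : M) : chartRep I (0 : Form E M k) x₀ = 0 := by
  ext y v; simp [chartRep]

lemma isSmoothForm_zero : IsSmoothForm I (0 : Form E M k) := fun x₀ => by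
  rw [chartRep_zero]; exact contDiffOn_const

lemma IsSmoothForm.add {α β : Form E M k} (hα : IsSmoothForm I α) (hβ : IsSmoothForm I β) :
    IsSmoothForm I (α + β) := fun x₀ => by
  rw [chartRep_add]; exact (hα x₀).add (hβ x₀)

lemma IsSmoothForm.smul {α : Form E M k} (c : ℝ) (hα : IsSmoothForm I α) :
    IsSmoothForm I (c • α) := fun x₀ => by
  rw [chartRep_smul]; exact contDiffOn_const.smul (hα x₀)

lemma IsSmoothForm.contDiffWithinAt {α : Form E M k} (hα : IsSmoothForm I α) {x₀ : M} {y : E}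
    (hy : y ∈ (extChartAt I x₀).target) : ContDiffWithinAt ℝ ∞ (chartRep I α x₀) (range I) y :=
  (hα x₀ y hy).mono_of_mem_nhdsWithin (extChartAt_target_mem_nhdsWithin_of_mem hy)

lemma IsSmoothForm.differentiableWithinAt {α : Form E M k} (hα : IsSmoothForm I α) {x₀ : M} {y : E}
    (hy : y ∈ (extChartAt I x₀).target) :
    DifferentiableWithinAt ℝ (chartRep I α x₀) (range I) y :=
  (hα.contDiffWithinAt hy).differentiableWithinAt (by simp)

lemma extD_zero : extD I (0 : Form E M k) = 0 := by
  funext x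
  have h : chartRep I (0 : Form E M k) x = (0 : ℝ) • chartRep I (0 : Form E M k) x := by
    rw [chartRep_zero, smul_zero]
  rw [extD, h, extDerivWithin_smul _ _ (I.uniqueDiffOn _ (by simp)), zero_smul]
  rfl

lemma extD_add {α β : Form E M k} (hα : IsSmoothForm I α) (hβ : IsSmoothForm I β) :
    extD I (α + β) = extD I α + extD I β := by
  funext x
  rw [extD, chartRep_add, extDerivWithin_add (I.uniqueDiffOn _ (by simp))
    (hα.differentiableWithinAt (by simp)) (hβ.differentiableWithinAt (by simp))]
  rfl

lemma extD_smul (c : ℝ) (α : Form E M k) : extD I (c • α) = c • extD I α := by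
  funext x
  rw [extD, chartRep_smul, extDerivWithin_smul _ _ (I.uniqueDiffOn _ (by simp))]
  rfl

lemma tsupport_extD (α : Form E M k) : tsupport (extD I α) ⊆ tsupport α := by
  refine closure_minimal (fun x hx => ?_) isClosed_closure
  by_contra h
  apply hx
  have h1 : α =ᶠ[𝓝 x] 0 := notMem_tsupport_iff_eventuallyEq.1 h
  have h2 : chartRep I α x =ᶠ[𝓝[range I] (extChartAt I x x)] 0 := by
    have h3 : Tendsto (extChartAt I x).symm (𝓝[range I] (extChartAt I x x)) (𝓝 x) := by
      have := (continuousAt_extChartAt_symm (I := I) x).tendsto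
      rw [extChartAt_to_inv] at this
      exact this.mono_left nhdsWithin_le_nhds
    filter_upwards [h3.eventually h1] with y hy
    ext v
    simp only [chartRep, hy]
    simp
  have h4 := h2.extDerivWithin_eq_of_mem (mem_range_self _)
  rw [extD, h4]
  have h5 : (0 : E → E [⋀^Fin k]→L[ℝ] ℝ) = (0 : ℝ) • 0 := by simp
  rw [h5, extDerivWithin_smul _ _ (I.uniqueDiffOn _ (by simp)), zero_smul]

variable [IsManifold I ∞ M]

lemma chartFrame_comp {x₀ x : M} {y : E} (hy : y ∈ (extChartAt I x₀).target)
    (hx : (extChartAt I x₀).symm y ∈ (extChartAt I x).source) :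
    (chartFrame I x (extChartAt I x ((extChartAt I x₀).symm y))).comp
      (fderivWithin ℝ (extChartAt I x ∘ (extChartAt I x₀).symm) (range I) y) =
        chartFrame I x₀ y := by
  have : IsManifold I 1 M := IsManifold.of_le (n := ∞) (by simp)
  set z := (extChartAt I x₀).symm y with hz
  have hzy : extChartAt I x₀ z = y := (extChartAt I x₀).right_inv hy
  have hzs : z ∈ (extChartAt I x₀).source := (extChartAt I x₀).map_target hy
  have e1 : chartFrame I x₀ y = tangentCoordChange I x₀ z z := by
    rw [tangentCoordChange_def, hzy]; rfl
  have e2 : chartFrame I x (extChartAt I x z) = tangentCoordChange I x z z := by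
    rw [tangentCoordChange_def, chartFrame, (extChartAt I x).left_inv hx]
  have e3 : fderivWithin ℝ (extChartAt I x ∘ (extChartAt I x₀).symm) (range I) y =
      tangentCoordChange I x₀ x z := by
    rw [tangentCoordChange_def, hzy]
  rw [e1, e2, e3]
  ext v
  exact tangentCoordChange_comp ⟨⟨hzs, hx⟩, mem_extChartAt_source z⟩

lemma chartRep_eventuallyEq (α : Form E M k) {x₀ x : M} {y : E}
    (hy : y ∈ (extChartAt I x₀).target)
    (hx : (extChartAt I x₀).symm y ∈ (extChartAt I x).source) :
    chartRep I α x₀ =ᶠ[𝓝[range I] y] fun y' =>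
      (chartRep I α x ((extChartAt I x ∘ (extChartAt I x₀).symm) y')).compContinuousLinearMap
        (fderivWithin ℝ (extChartAt I x ∘ (extChartAt I x₀).symm) (range I) y') := by
  have h1 : ∀ᶠ y' in 𝓝[range I] y, (extChartAt I x₀).symm y' ∈ (extChartAt I x).source := by
    have := (continuousAt_extChartAt_symm'' (I := I) hy).tendsto.mono_left
      (nhdsWithin_le_nhds (s := range I))
    exact this.eventually ((isOpen_extChartAt_source (I := I) x).mem_nhds hx)
  filter_upwards [h1, extChartAt_target_mem_nhdsWithin_of_mem hy] with y' hy1 hy2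
  ext v
  have h2 := chartFrame_comp hy2 hy1
  simp only [chartRep, Function.comp_apply, (extChartAt I x).left_inv hy1]
  rw [← h2]
  simp [Function.comp_def]

/-- The exterior derivative may be computed in any chart. -/
lemma chartRep_extD {α : Form E M k} (hα : IsSmoothForm I α) {x₀ : M} {y : E}
    (hy : y ∈ (extChartAt I x₀).target) :
    chartRep I (extD I α) x₀ y = extDerivWithin (chartRep I α x₀) (range I) y := by
  set x := (extChartAt I x₀).symm y with hx
  have hxs : (extChartAt I x₀).symm y ∈ (extChartAt I x).source := mem_extChartAt_source x
  have hyr := extChartAt_target_subset_range x₀ hy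
  rw [(chartRep_eventuallyEq α hy hxs).extDerivWithin_eq_of_mem hyr]
  rw [extDerivWithin_pullback (t := range I) (r := ∞)]
  · rfl
  · exact hα.differentiableWithinAt ((extChartAt I x).map_source hxs)
  · apply contDiffWithinAt_ext_coord_change
    rw [PartialEquiv.trans_source]
    exact ⟨hy, hxs⟩
  · simpa using ENat.LEInfty.out
  · exact I.uniqueDiffOn
  · exact I.range_subset_closure_interior hyr
  · exact hyr
  · intro z _
    simp [extChartAt]

lemma IsSmoothForm.extD {α : Form E M k} (hα : IsSmoothForm I α) :
    IsSmoothForm I (extD I α) := by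
  intro x₀
  have h1 : ContDiffOn ℝ ∞ (extDerivWithin (chartRep I α x₀) (range I))
      (extChartAt I x₀).target := by
    intro y hy
    have h2 := ((hα.contDiffWithinAt hy).fderivWithin_right (m := ∞) I.uniqueDiffOn (by simp)
      (extChartAt_target_subset_range x₀ hy)).mono (extChartAt_target_subset_range x₀)
    exact (ContinuousAlternatingMap.alternatizeUncurryFinCLM ℝ E ℝ).contDiff.comp_contDiffWithinAt h2
  exact h1.congr fun y hy => chartRep_extD hα hy

lemma extD_extD {α : Form E M k} (hα : IsSmoothForm I α) : extD I (extD I α) = 0 := by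
  funext x
  have h1 : chartRep I (extD I α) x =ᶠ[𝓝[range I] (extChartAt I x x)]
      extDerivWithin (chartRep I α x) (range I) := by
    filter_upwards [extChartAt_target_mem_nhdsWithin x] with y hy using chartRep_extD hα hy
  rw [extD, h1.extDerivWithin_eq_of_mem (mem_range_self _)]
  exact extDerivWithin_extDerivWithin_apply (hα.contDiffWithinAt (by simp))
    (by simpa using ENat.LEInfty.out) I.uniqueDiffOn (I.range_subset_closure_interior (mem_range_self _)) (mem_range_self _)

end Forms

section Wedge
variable {E : Type*} [NormedAddCommGroup E] [NormedSpace ℝ E] {p q : ℕ}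

/-- The wedge product of alternating maps (the sum over shuffles of the signed products). -/
noncomputable def wedge (a : E [⋀^Fin p]→L[ℝ] ℝ) (b : E [⋀^Fin q]→L[ℝ] ℝ) :
    E [⋀^Fin (p + q)]→L[ℝ] ℝ :=
  { ((LinearMap.mul' ℝ ℝ).compAlternatingMap
      (a.toAlternatingMap.domCoprod b.toAlternatingMap)).domDomCongr finSumFinEquiv with
    cont := by
      change Continuous fun v : Fin (p + q) → E => LinearMap.mul' ℝ ℝ
        ((a.toAlternatingMap.domCoprod b.toAlternatingMap) fun i => v (finSumFinEquiv i))
      simp only [AlternatingMap.domCoprod_apply, sum_apply, map_sum]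
      refine continuous_finsetSum _ fun σ _ => ?_
      induction σ using Quotient.inductionOn with
      | h σ =>
        change Continuous fun v : Fin (p + q) → E => LinearMap.mul' ℝ ℝ
          (Equiv.Perm.sign σ • (a (fun i => v (finSumFinEquiv (σ (Sum.inl i)))) ⊗ₜ[ℝ]
            b (fun i => v (finSumFinEquiv (σ (Sum.inr i))))))
        rcases Int.units_eq_one_or (Equiv.Perm.sign σ) with h | h <;> rw [h] <;>
          simp only [one_smul, Units.neg_smul, map_neg, LinearMap.mul'_apply] <;>
          fun_prop }

end Wedge

section Complexes

variable {E : Type} [NormedAddCommGroup E] [NormedSpace ℝ E] [FiniteDimensional ℝ E] {H : Type*}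
  [TopologicalSpace H] {M : Type u} [TopologicalSpace M] [ChartedSpace H M]

/-- A (graded, linear) condition on differential forms that is stable under the exterior
derivative, such as a boundary condition. -/
structure FormCondition (I : ModelWithCorners ℝ E H) (M : Type*) [TopologicalSpace M]
    [ChartedSpace H M] where
  cond : ∀ k, Submodule ℝ (Form E M k)
  extD_mem : ∀ {k} {α : Form E M k}, IsSmoothForm I α → α ∈ cond k → extD I α ∈ cond (k + 1)

/-- The inhomogeneous smooth forms that satisfy the condition `C` and have compact support
contained in `U`. (For `U` open these are the compactly supported forms on `U`, and extension by
zero along `U ⊆ V` is the inclusion.) -/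
def compactForms {I : ModelWithCorners ℝ E H} (C : FormCondition I M) (U : Set M) :
    Submodule ℝ (∀ k, Form E M k) where
  carrier := {φ | ∀ k, IsSmoothForm I (φ k) ∧ HasCompactSupport (φ k) ∧ tsupport (φ k) ⊆ U ∧
    φ k ∈ C.cond k}
  zero_mem' k := ⟨isSmoothForm_zero, HasCompactSupport.zero, by simp, zero_mem _⟩
  add_mem' {φ ψ} hφ hψ k := ⟨(hφ k).1.add (hψ k).1, (hφ k).2.1.add (hψ k).2.1,
    (tsupport_add _ _).trans (union_subset (hφ k).2.2.1 (hψ k).2.2.1),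
    add_mem (hφ k).2.2.2 (hψ k).2.2.2⟩
  smul_mem' c φ hφ k := by
    have h : tsupport (c • φ k) ⊆ tsupport (φ k) :=
      closure_mono (Function.support_const_smul_subset c (φ k))
    exact ⟨(hφ k).1.smul c, (hφ k).2.1.of_isClosed_subset (isClosed_tsupport _) h,
      h.trans (hφ k).2.2.1, Submodule.smul_mem _ _ (hφ k).2.2.2⟩

/-- The vector space of inhomogeneous compactly supported forms in `U` satisfying `C`. -/
def CForms {I : ModelWithCorners ℝ E H} (C : FormCondition I M) (U : Set M) : Type u :=
  compactForms C U

instance {I : ModelWithCorners ℝ E H} (C : FormCondition I M) (U : Set M) :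
    AddCommGroup (CForms C U) := inferInstanceAs (AddCommGroup (compactForms C U))

instance {I : ModelWithCorners ℝ E H} (C : FormCondition I M) (U : Set M) :
    Module ℝ (CForms C U) := inferInstanceAs (Module ℝ (compactForms C U))

lemma form_eq_zero {k : ℕ} (hk : Module.finrank ℝ E < k) (α : Form E M k) : α = 0 := by
  funext x
  ext v
  refine (α x).toAlternatingMap.map_linearDependent v fun hv => ?_
  have := hv.fintype_card_le_finrank
  rw [Fintype.card_fin] at this
  omega

variable {I : ModelWithCorners ℝ E H} (C : FormCondition I M) (U : Set M) (n : ℤ)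

/-- The elements of degree `i` of the complex `Ω•[n]`: the forms of degree `i + n`. -/
def formDeg (i : ℤ) : Submodule ℝ (CForms C U) where
  carrier := {φ | ∀ k : ℕ, (k : ℤ) ≠ i + n → φ.1 k = 0}
  zero_mem' _ _ := rfl
  add_mem' {φ ψ} hφ hψ k hk := by
    change φ.1 k + ψ.1 k = 0
    rw [hφ k hk, hψ k hk, add_zero]
  smul_mem' c φ hφ k hk := by
    change c • φ.1 k = 0
    rw [hφ k hk, smul_zero]

/-- The homogeneous component of an inhomogeneous form. -/
noncomputable def formPart (φ : CForms C U) (i : ℤ) : formDeg C U n i :=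
  ⟨⟨fun k => if (k : ℤ) = i + n then φ.1 k else 0, fun k => by
    dsimp only
    split_ifs
    · exact φ.2 k
    · exact (compactForms C U).zero_mem k⟩, fun k hk => if_neg hk⟩

lemma formDeg_internal : DirectSum.IsInternal (formDeg C U n) := by
  have key : ∀ (x : ⨁ i, formDeg C U n i) (k : ℕ),
      (DirectSum.coeLinearMap (formDeg C U n) x).1 k = (x ((k : ℤ) - n)).1.1 k := by
    intro x k
    induction x using DirectSum.induction_on with
    | zero => simp
    | add x y hx hy =>
      rw [map_add]
      change (DirectSum.coeLinearMap (formDeg C U n) x).1 k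
        + (DirectSum.coeLinearMap (formDeg C U n) y).1 k = _
      rw [hx, hy]
      rfl
    | of i x =>
      rw [DirectSum.coeLinearMap_of]
      by_cases h : i = (k : ℤ) - n
      · subst h
        rw [DirectSum.of_eq_same]
      · rw [DirectSum.of_eq_of_ne _ _ _ (Ne.symm h)]
        exact x.2 k (by omega)
  constructor
  · intro x y hxy
    have hxy : DirectSum.coeLinearMap (formDeg C U n) x = DirectSum.coeLinearMap (formDeg C U n) y := hxy
    refine DFinsupp.ext fun i => Subtype.ext (Subtype.ext (funext fun k => ?_))
    by_cases hk : (k : ℤ) = i + n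
    · have h1 := key x k
      have h2 := key y k
      rw [hxy] at h1
      have h3 : (k : ℤ) - n = i := by omega
      rw [h3] at h1 h2
      exact h1.symm.trans h2
    · rw [(x i).2 k hk, (y i).2 k hk]
  · intro φ
    refine ⟨∑ k ∈ Finset.range (Module.finrank ℝ E + 1),
      DirectSum.lof ℝ ℤ (fun i => formDeg C U n i) ((k : ℤ) - n) (formPart C U n φ ((k : ℤ) - n)), ?_⟩
    change DirectSum.coeLinearMap (formDeg C U n) _ = φ
    apply Subtype.ext
    funext k
    rw [key]
    by_cases hk : Module.finrank ℝ E < k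
    · exact (form_eq_zero hk _).trans (form_eq_zero hk _).symm
    · have h1 : ∀ (s : Finset ℕ) (f : ℕ → ⨁ i, formDeg C U n i) (i : ℤ),
          ((∑ j ∈ s, f j) i).1.1 k = ∑ j ∈ s, (f j i).1.1 k := by
        intro s f i
        induction s using Finset.cons_induction with
        | empty => rfl
        | cons a s ha ih => rw [Finset.sum_cons, Finset.sum_cons, ← ih]; rfl
      rw [h1, Finset.sum_eq_single k]
      · rw [DirectSum.lof_eq_of, DirectSum.of_eq_same]
        simp [formPart]
      · intro j _ hj
        rw [DirectSum.lof_eq_of, DirectSum.of_eq_of_ne _ _ _ (by omega)]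
        rfl
      · intro h
        simp at h; omega

variable [IsManifold I ∞ M] (ε : ℝ)

/-- The differential `ε d` on inhomogeneous forms. -/
noncomputable def formD : CForms C U →ₗ[ℝ] CForms C U where
  toFun φ := ⟨fun k => match k with
    | 0 => 0
    | k + 1 => ε • extD I (φ.1 k), fun k => by
      match k with
      | 0 => exact (compactForms C U).zero_mem 0
      | k + 1 =>
        have h := φ.2 k
        have h1 : tsupport (ε • extD I (φ.1 k)) ⊆ tsupport (φ.1 k) :=
          (closure_mono (Function.support_const_smul_subset ε _)).trans (tsupport_extD _)
        exact ⟨h.1.extD.smul ε, h.2.1.of_isClosed_subset (isClosed_tsupport _) h1,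
          h1.trans h.2.2.1, Submodule.smul_mem _ _ (C.extD_mem h.1 h.2.2.2)⟩⟩
  map_add' φ ψ := by
    apply Subtype.ext
    funext k
    match k with
    | 0 => exact (add_zero 0).symm
    | k + 1 =>
      change ε • extD I (φ.1 k + ψ.1 k) = ε • extD I (φ.1 k) + ε • extD I (ψ.1 k)
      rw [extD_add (φ.2 k).1 (ψ.2 k).1, smul_add]
  map_smul' c φ := by
    apply Subtype.ext
    funext k
    match k with
    | 0 => exact (smul_zero c).symm
    | k + 1 =>
      change ε • extD I (c • φ.1 k) = c • ε • extD I (φ.1 k)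
      rw [extD_smul, smul_comm]

lemma formD_zero (φ : CForms C U) : (formD C U ε φ).1 0 = 0 := rfl

lemma formD_succ (φ : CForms C U) (k : ℕ) :
    (formD C U ε φ).1 (k + 1) = ε • extD I (φ.1 k) := rfl

/-- The complex `Ω•[n]` of compactly supported forms in `U` satisfying the condition `C`: its
elements of degree `i` are the `(i + n)`-forms, and its differential is `(-1)ⁿ d`. -/
noncomputable def formComplex : GradedComplex.{u} ℝ where
  carrier := CForms C U
  deg := formDeg C U n
  internal := formDeg_internal C U n
  d := formD C U (sgn ℝ n)
  d_mem {i φ} hφ k hk := by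
    match k with
    | 0 => rfl
    | k + 1 =>
      rw [formD_succ, hφ k (by push_cast at hk; omega), extD_zero, smul_zero]
  d_d φ := by
    apply Subtype.ext
    funext k
    match k with
    | 0 => rfl
    | 1 =>
      rw [formD_succ, formD_zero, extD_zero, smul_zero]
      rfl
    | k + 2 =>
      rw [formD_succ, formD_succ, extD_smul, extD_extD (φ.2 k).1, smul_zero, smul_zero]
      rfl

end Complexes

section Geometry

variable {E : Type*} [NormedAddCommGroup E] [NormedSpace ℝ E] {H : Type*} [TopologicalSpace H]
  {M : Type*} [TopologicalSpace M] [ChartedSpace H M]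
  {F : Type*} [NormedAddCommGroup F] [NormedSpace ℝ F] {G : Type*} [TopologicalSpace G]
  {N : Type*} [TopologicalSpace N] [ChartedSpace G N]

/-- The derivative of a map between manifolds. -/
noncomputable def tangentAt (J : ModelWithCorners ℝ F G) (I : ModelWithCorners ℝ E H) (f : N → M)
    (p : N) : F →L[ℝ] E := mfderiv J I f p

/-- The pullback of a form. -/
noncomputable def pullback (J : ModelWithCorners ℝ F G) (I : ModelWithCorners ℝ E H) (f : N → M)
    {k : ℕ} (α : Form E M k) : Form F N k :=
  fun p => (α (f p)).compContinuousLinearMap (tangentAt J I f p)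

/-- If a function vanishes along `f`, then so does the pullback of its differential. -/
lemma pullback_extD_eq_zero {J : ModelWithCorners ℝ F G} {I : ModelWithCorners ℝ E H} {f : N → M}
    (hf : ContMDiff J I ∞ f) {α : Form E M 0} (hα : IsSmoothForm I α) (h0 : ∀ p, α (f p) = 0) :
    pullback J I f (extD I α) = 0 := by
  funext p
  ext v
  have hd : MDifferentiableAt J I f p := hf.mdifferentiable (by simp) p
  set c := writtenInExtChartAt J I p f with hc
  have hc' : HasFDerivWithinAt c (tangentAt J I f p) (range J) (extChartAt J p p) := by
    have h1 := hd.differentiableWithinAt_writtenInExtChartAt.hasFDerivWithinAt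
    have h2 : tangentAt J I f p =
        fderivWithin ℝ (writtenInExtChartAt J I p f) (range J) (extChartAt J p p) := hd.mfderiv
    rw [h2]
    exact h1
  have hcp : c (extChartAt J p p) = extChartAt I (f p) (f p) := by simp [hc, writtenInExtChartAt]
  have hα' : HasFDerivWithinAt (chartRep I α (f p))
      (fderivWithin ℝ (chartRep I α (f p)) (range I) (c (extChartAt J p p))) (range I)
      (c (extChartAt J p p)) := by
    rw [hcp]
    exact (hα.differentiableWithinAt (by simp)).hasFDerivWithinAt
  have hmaps : MapsTo c (range J) (range I) := by
    intro u _
    simp [hc, writtenInExtChartAt, extChartAt]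
  have hcomp := hα'.comp (extChartAt J p p) hc' hmaps
  have hzero : chartRep I α (f p) ∘ c =ᶠ[𝓝[range J] (extChartAt J p p)] fun _ => 0 := by
    have h1 : Tendsto (fun u => f ((extChartAt J p).symm u)) (𝓝[range J] (extChartAt J p p))
        (𝓝 (f p)) := by
      have h2 := (continuousAt_extChartAt_symm (I := J) p).tendsto
      rw [extChartAt_to_inv] at h2
      exact (hf.continuous.continuousAt.tendsto.comp h2).mono_left nhdsWithin_le_nhds
    filter_upwards [h1.eventually (extChartAt_source_mem_nhds (I := I) (f p))] with u hu
    have h3 : (extChartAt I (f p)).symm (c u) = f ((extChartAt J p).symm u) := by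
      simp only [hc, writtenInExtChartAt, Function.comp_apply]
      exact (extChartAt I (f p)).left_inv hu
    simp only [Function.comp_apply, chartRep, h3, h0]
    ext; simp
  have hz : HasFDerivWithinAt (chartRep I α (f p) ∘ c) (0 : F →L[ℝ] E [⋀^Fin 0]→L[ℝ] ℝ)
      (range J) (extChartAt J p p) :=
    (hasFDerivWithinAt_const 0 _ _).congr_of_eventuallyEq hzero
      (hzero.self_of_nhdsWithin (mem_range_self _))
  have huniq := (J.uniqueDiffOn _ (mem_range_self _)).eq hcomp hz
  have h4 := DFunLike.congr_fun huniq (v 0)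
  rw [hcp] at h4
  simp only [pullback, extD, ContinuousAlternatingMap.compContinuousLinearMap_apply]
  rw [extDerivWithin, ContinuousAlternatingMap.alternatizeUncurryFin_apply]
  have h5 : (fderivWithin ℝ (chartRep I α (f p)) (range I) (extChartAt I (f p) (f p)))
      (tangentAt J I f p (v 0)) = 0 := h4
  refine Finset.sum_eq_zero fun i _ => ?_
  have hi : i = 0 := by ext; omega
  rw [hi, Function.comp_apply, h5]
  simp

/-! ### Integration -/

/-- The integral over an oriented `n`-manifold of a differential form (compactly supported, or
at least integrable). It is defined by means of a partition of unity subordinate to the charts;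
the orientation is given by a nowhere vanishing `n`-form `μ`, of which only the sign matters.
The integral of a form that is not of top degree is zero. -/
noncomputable def integral {n m : ℕ} {M : Type*} [TopologicalSpace M] [ChartedSpace H M]
    (I : ModelWithCorners ℝ (EuclideanSpace ℝ (Fin n)) H)
    (μ : Form (EuclideanSpace ℝ (Fin n)) M n) (α : Form (EuclideanSpace ℝ (Fin n)) M m) : ℝ := by
  classical exact
    if h : m = n ∧ ∃ ρ : SmoothPartitionOfUnity M I M univ,
        ρ.IsSubordinate fun x => (chartAt H x).source then
      ∑ᶠ x₀ : M, ∫ y in (extChartAt I x₀).target,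
        h.2.choose x₀ ((extChartAt I x₀).symm y) *
          (Real.sign (chartRep I μ x₀ y fun i => EuclideanSpace.single i 1) *
            chartRep I α x₀ y fun i => EuclideanSpace.single (Fin.cast h.1 i) 1)
    else 0

/-! ### Flows -/

/-- A smooth `ℝ`-action on a manifold (equivalently, the flow of a complete vector field). -/
structure SmoothFlow (I : ModelWithCorners ℝ E H) (M : Type*) [TopologicalSpace M]
    [ChartedSpace H M] where
  toFun : ℝ → M → M
  smooth : ContMDiff (𝓘(ℝ, ℝ).prod I) I ∞ fun q : ℝ × M => toFun q.1 q.2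
  map_zero : ∀ x, toFun 0 x = x
  map_add : ∀ s t x, toFun (s + t) x = toFun s (toFun t x)

namespace SmoothFlow

variable {I : ModelWithCorners ℝ E H} (Θ : SmoothFlow I M)

/-- The velocity `∂ₛ Θ(s, x)`. -/
noncomputable def velocity (s : ℝ) (x : M) : E := tangentAt 𝓘(ℝ, ℝ) I (fun t => Θ.toFun t x) s 1

/-- The action is proper: the shear map `(s, x) ↦ (x, Θ(s, x))` is a proper map. -/
def IsProper : Prop := IsProperMap fun q : ℝ × M => (q.2, Θ.toFun q.1 q.2)

/-- The future `J↑(S)` of a set along the flow. -/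
def future (S : Set M) : Set M := {y | ∃ s : ℝ, 0 ≤ s ∧ ∃ x ∈ S, Θ.toFun s x = y}

/-- The past `J↓(S)` of a set along the flow. -/
def past (S : Set M) : Set M := {y | ∃ s : ℝ, s ≤ 0 ∧ ∃ x ∈ S, Θ.toFun s x = y}

/-- The contraction of `Θ*α` with `∂ₛ` at `(s, x)`, restricted to the tangent space of `M`. -/
noncomputable def slice {k : ℕ} (α : Form E M (k + 1)) (s : ℝ) (x : M) : E [⋀^Fin k]→L[ℝ] ℝ :=
  ((α (Θ.toFun s x)).curryLeft (Θ.velocity s x)).compContinuousLinearMap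
    (tangentAt I I (Θ.toFun s) x)

/-- The forward Green's homotopy `G↑ = ∫_{s ≤ 0} Θ*` (fiber integration along `pr : ℝ × M → M`). -/
noncomputable def greenUp {k : ℕ} (α : Form E M (k + 1)) : Form E M k :=
  fun x => ∫ s in Iic (0 : ℝ), Θ.slice α s x

/-- The backward Green's homotopy `G↓ = - ∫_{s ≥ 0} Θ*`. -/
noncomputable def greenDown {k : ℕ} (α : Form E M (k + 1)) : Form E M k :=
  fun x => -∫ s in Ici (0 : ℝ), Θ.slice α s x

/-- The difference `G↑[1] - G↓[1]` of the shifted Green's homotopies `G[1] = - G`, acting on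
inhomogeneous forms. -/
noncomputable def propagator (φ : ∀ k, Form E M k) : ∀ k, Form E M k :=
  fun k => -Θ.greenUp (φ (k + 1)) - -Θ.greenDown (φ (k + 1))

/-- The equivalence relation of lying on the same orbit. -/
def orbitRel : Setoid M where
  r x y := ∃ s : ℝ, Θ.toFun s x = y
  iseqv :=
    ⟨fun x => ⟨0, Θ.map_zero x⟩,
     fun {x y} ⟨s, hs⟩ => ⟨-s, by rw [← hs, ← Θ.map_add, neg_add_cancel, Θ.map_zero]⟩,
     fun {x y z} ⟨s, hs⟩ ⟨t, ht⟩ => ⟨t + s, by rw [Θ.map_add, hs, ht]⟩⟩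

/-- The orbit space, with the quotient topology. -/
abbrev Base : Type _ := Quotient Θ.orbitRel

/-- The quotient map. -/
def proj : M → Θ.Base := Quotient.mk Θ.orbitRel

lemma continuous_proj : Continuous Θ.proj := continuous_quotient_mk'

lemma proj_surjective : Function.Surjective Θ.proj := Quotient.mk_surjective

lemma proj_toFun (s : ℝ) (x : M) : Θ.proj (Θ.toFun s x) = Θ.proj x :=
  (Quotient.sound (s := Θ.orbitRel) ⟨s, rfl⟩).symm

/-- The quotient map is a smooth principal `ℝ`-bundle with respect to a manifold structure on the
orbit space: it is smooth, and locally over the base there are a smooth section `σ` and a smooth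
function `t` such that every point `x` of the total space is `Θ(t x, σ (π x))`. -/
structure IsPrincipalBundle (J : ModelWithCorners ℝ F G) [ChartedSpace G Θ.Base] : Prop where
  smooth_proj : ContMDiff I J ∞ Θ.proj
  locally_trivial : ∀ b : Θ.Base, ∃ (V : Set Θ.Base) (σ : Θ.Base → M) (t : M → ℝ),
    IsOpen V ∧ b ∈ V ∧ ContMDiffOn J I ∞ σ V ∧ ContMDiffOn I 𝓘(ℝ, ℝ) ∞ t (Θ.proj ⁻¹' V) ∧
    (∀ c ∈ V, Θ.proj (σ c) = c) ∧ ∀ x ∈ Θ.proj ⁻¹' V, Θ.toFun (t x) (σ (Θ.proj x)) = x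

/-- A right inverse of a linear map (zero if there is none). -/
noncomputable def rightInv (D : E →L[ℝ] F) : F →L[ℝ] E := by
  classical exact if h : ∃ R : F →L[ℝ] E, D ∘L R = ContinuousLinearMap.id ℝ F then h.choose else 0

/-- Fiber integration along the quotient map, integrating out the first slot: the value at `b` is
the integral over the orbit of the contraction of `α` with the velocity, evaluated on lifts of
tangent vectors at `b` (it does not matter which). -/
noncomputable def fiberInt (J : ModelWithCorners ℝ F G) [ChartedSpace G Θ.Base] {k : ℕ}
    (α : Form E M (k + 1)) : Form F Θ.Base k :=
  fun b => ∫ s : ℝ, ((α (Θ.toFun s b.out)).curryLeft (Θ.velocity s b.out)).compContinuousLinearMap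
    (rightInv (tangentAt I J Θ.proj (Θ.toFun s b.out)))

/-- Fiber integration of inhomogeneous forms. -/
noncomputable def fiberIntegration (J : ModelWithCorners ℝ F G) [ChartedSpace G Θ.Base]
    (φ : ∀ k, Form E M k) : ∀ k, Form F Θ.Base k := fun k => Θ.fiberInt J (φ (k + 1))

end SmoothFlow

end Geometry

section ChernSimons

/-- The plane with its Euclidean structure. -/
abbrev E2 := EuclideanSpace ℝ (Fin 2)

/-- Three-dimensional Euclidean space. -/
abbrev E3 := EuclideanSpace ℝ (Fin 3)

/-- A smooth field of bilinear forms on the tangent spaces of a surface. -/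
def IsSmoothBilin {N : Type v} [TopologicalSpace N] [ChartedSpace E2 N]
    (g : N → E2 →L[ℝ] E2 →L[ℝ] ℝ) : Prop :=
  ∀ p₀ : N, ContDiffOn ℝ ∞ (fun y => (g ((extChartAt (𝓡 2) p₀).symm y)).bilinearComp
    (chartFrame (𝓡 2) p₀ y) (chartFrame (𝓡 2) p₀ y)) (extChartAt (𝓡 2) p₀).target

/-- A smooth vector field on a surface. -/
def IsSmoothField {N : Type v} [TopologicalSpace N] [ChartedSpace E2 N] (v : N → E2) : Prop :=
  ∀ p₀ : N, ContDiffOn ℝ ∞ (fun y => (chartFrame (𝓡 2) p₀ y).inverse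
    (v ((extChartAt (𝓡 2) p₀).symm y))) (extChartAt (𝓡 2) p₀).target

/-- The geometric input: an oriented `3`-manifold `M` with boundary, whose boundary (presented as
a boundaryless surface `N` together with its inclusion `ι`) carries a time-oriented Lorentzian
metric, a chirality `ε = ±1`, a `±`-chiral flow on the boundary, and a proper `ℝ`-action on `M`
that extends this flow. -/
structure BulkBoundary (M : Type u) [TopologicalSpace M] [ChartedSpace (EuclideanHalfSpace 3) M]
    (N : Type v) [TopologicalSpace N] [ChartedSpace E2 N] where
  /-- A volume form, representing the orientation of `M`. -/
  vol : Form E3 M 3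
  vol_smooth : IsSmoothForm (𝓡∂ 3) vol
  vol_ne_zero : ∀ x, vol x ≠ 0
  /-- The inclusion of the boundary. -/
  ι : N → M
  ι_smooth : ContMDiff (𝓡 2) (𝓡∂ 3) ∞ ι
  ι_embedding : Topology.IsEmbedding ι
  ι_immersion : ∀ p, Function.Injective (tangentAt (𝓡 2) (𝓡∂ 3) ι p)
  range_ι : range ι = (𝓡∂ 3).boundary M
  /-- The Lorentzian metric on the boundary (of signature `(-, +)`). -/
  g : N → E2 →L[ℝ] E2 →L[ℝ] ℝ
  g_smooth : IsSmoothBilin g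
  g_symm : ∀ p v w, g p v w = g p w v
  g_lorentzian : ∀ p, ∃ e₀ e₁, g p e₀ e₀ = -1 ∧ g p e₁ e₁ = 1 ∧ g p e₀ e₁ = 0
  /-- A time-like vector field, representing the time-orientation. -/
  time : N → E2
  time_smooth : IsSmoothField time
  time_timelike : ∀ p, g p (time p) (time p) < 0
  /-- The chirality. -/
  ε : ℤˣ
  /-- The chiral flow on the boundary. -/
  flow : SmoothFlow (𝓡 2) N
  /-- The flow lines are null, -/
  flow_null : ∀ p, g p (flow.velocity 0 p) (flow.velocity 0 p) = 0
  /-- they are future directed, -/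
  flow_future : ∀ p, g p (time p) (flow.velocity 0 p) < 0
  /-- and they point to the side of the future light cone that is determined by the chirality:
  for `ε = 1` the time-orientation and the flow line form an oriented frame, for `ε = -1` this
  frame has the opposite orientation. Here the boundary has the induced orientation, for which an
  outward normal vector comes first. -/
  flow_chiral : ∀ p, 0 < (ε : ℝ) * vol (ι p) ![EuclideanSpace.single 0 (-1),
    tangentAt (𝓡 2) (𝓡∂ 3) ι p (time p), tangentAt (𝓡 2) (𝓡∂ 3) ι p (flow.velocity 0 p)]
  /-- The extension of the chiral flow to `M`. -/
  bulkFlow : SmoothFlow (𝓡∂ 3) M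
  bulkFlow_proper : bulkFlow.IsProper
  bulkFlow_ι : ∀ s p, bulkFlow.toFun s (ι p) = ι (flow.toFun s p)

namespace BulkBoundary

variable {M : Type u} [TopologicalSpace M] [ChartedSpace (EuclideanHalfSpace 3) M]
  {N : Type v} [TopologicalSpace N] [ChartedSpace E2 N] (X : BulkBoundary M N)

/-- The frame `(e₀, e₁)` of the tangent space of the boundary at `p` is positively oriented. -/
def IsOriented (p : N) (e₀ e₁ : E2) : Prop :=
  0 < X.vol (X.ι p) ![EuclideanSpace.single 0 (-1),
    tangentAt (𝓡 2) (𝓡∂ 3) X.ι p e₀, tangentAt (𝓡 2) (𝓡∂ 3) X.ι p e₁]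

/-- `b = ∗a` for the Hodge operator `∗` on `1`-forms on the boundary: in an oriented orthonormal
frame, `∗e⁰ = -e¹` and `∗e¹ = -e⁰`. -/
def IsHodgeDual (p : N) (a b : E2 [⋀^Fin 1]→L[ℝ] ℝ) : Prop :=
  ∀ e₀ e₁, X.g p e₀ e₀ = -1 → X.g p e₁ e₁ = 1 → X.g p e₀ e₁ = 0 → X.IsOriented p e₀ e₁ →
    b ![e₀] = -a ![e₁] ∧ b ![e₁] = -a ![e₀]

/-- The `1`-forms on the boundary that are self-dual (for `ε = 1`) or anti-self-dual
(for `ε = -1`): `∗α = ε α`. -/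
def selfDual : Submodule ℝ (Form E2 N 1) where
  carrier := {α | ∀ p, X.IsHodgeDual p (α p) ((X.ε : ℝ) • α p)}
  zero_mem' p e₀ e₁ _ _ _ _ := by simp
  add_mem' {α β} hα hβ p e₀ e₁ h1 h2 h3 h4 := by
    have ha := hα p e₀ e₁ h1 h2 h3 h4
    have hb := hβ p e₀ e₁ h1 h2 h3 h4
    simp only [ContinuousAlternatingMap.smul_apply, smul_eq_mul, Pi.add_apply,
      ContinuousAlternatingMap.add_apply] at ha hb ⊢
    exact ⟨by linarith [ha.1, hb.1], by linarith [ha.2, hb.2]⟩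
  smul_mem' c α hα p e₀ e₁ h1 h2 h3 h4 := by
    have ha := hα p e₀ e₁ h1 h2 h3 h4
    simp only [ContinuousAlternatingMap.smul_apply, smul_eq_mul, Pi.smul_apply] at ha ⊢
    exact ⟨by linear_combination c * ha.1, by linear_combination c * ha.2⟩

/-- The forms whose pullback to the boundary satisfies the (anti-)self-dual boundary condition:
the pullback of the `0`-form vanishes, that of the `1`-form is (anti-)self-dual, and there is no
condition in higher degrees. -/
noncomputable def boundarySubmodule : ∀ k, Submodule ℝ (Form E3 M k)
  | 0 =>
    { carrier := {α | ∀ p, α (X.ι p) = 0}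
      zero_mem' := fun _ => rfl
      add_mem' := fun {α β} hα hβ p => by
        rw [Pi.add_apply, hα p, hβ p, add_zero]
      smul_mem' := fun c α hα p => by
        rw [Pi.smul_apply, hα p, smul_zero] }
  | 1 =>
    { carrier := {α | pullback (𝓡 2) (𝓡∂ 3) X.ι α ∈ X.selfDual}
      zero_mem' := X.selfDual.zero_mem
      add_mem' := fun hα hβ => X.selfDual.add_mem hα hβ
      smul_mem' := fun c _ hα => X.selfDual.smul_mem c hα }
  | _ + 2 => ⊤

/-- The (anti-)self-dual boundary condition. -/
noncomputable def boundaryCondition : FormCondition (𝓡∂ 3) M where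
  cond := X.boundarySubmodule
  extD_mem {k α} hα h := by
    match k with
    | 0 =>
      change pullback (𝓡 2) (𝓡∂ 3) X.ι (extD (𝓡∂ 3) α) ∈ X.selfDual
      rw [pullback_extD_eq_zero X.ι_smooth hα h]
      exact zero_mem _
    | k + 1 => trivial

/-- The pairing `τ(φ ⊗ ψ) = (-1)^(|φ| + 1) ∫_M φ ∧ (G↑[1] - G↓[1]) ψ`, where `|φ| = p - 2` if `φ`
is a `p`-form. -/
noncomputable def bulkPairing (φ ψ : ∀ k, Form E3 M k) : ℝ :=
  ∑ p ∈ Finset.range 4, ∑ q ∈ Finset.range 4, (-1) ^ (p + 1) *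
    integral (𝓡∂ 3) X.vol fun x => wedge (φ p x) (X.bulkFlow.propagator ψ q x)

/-- The orbit space `B` of the proper action on `M`. -/
abbrev B : Type u := X.bulkFlow.Base

/-- The non-empty open subsets of `M` that are convex for the flow. -/
abbrev FlowOpen : Type u :=
  {U : TopologicalSpace.Opens M // (U : Set M).Nonempty ∧
    X.bulkFlow.future U ∩ X.bulkFlow.past U ⊆ U}

/-- The non-empty open subsets of the orbit space. -/
abbrev BaseOpen : Type u := {V : TopologicalSpace.Opens X.B // (V : Set X.B).Nonempty}

/-- Two regions of `M` are orthogonal if they are disjoint with respect to the flow. -/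
def FlowDisjoint (U₁ U₂ : X.FlowOpen) : Prop :=
  (X.bulkFlow.future U₁.1 ∪ X.bulkFlow.past U₁.1) ∩ (U₂.1 : Set M) = ∅

/-- Two regions of the orbit space are orthogonal if they are disjoint. -/
def BaseDisjoint (V₁ V₂ : X.BaseOpen) : Prop := (V₁.1 : Set X.B) ∩ V₂.1 = ∅

/-- The functor taking preimages under the quotient map. -/
noncomputable def preimage : X.BaseOpen ⥤ X.FlowOpen :=
  Monotone.functor (f := fun V => ⟨⟨X.bulkFlow.proj ⁻¹' V.1,
      V.1.isOpen.preimage X.bulkFlow.continuous_proj⟩, by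
    obtain ⟨V, b, hb⟩ := V
    obtain ⟨x, rfl⟩ := X.bulkFlow.proj_surjective b
    refine ⟨⟨x, hb⟩, ?_⟩
    rintro _ ⟨⟨s, _, x, hx, rfl⟩, _⟩
    change X.bulkFlow.proj (X.bulkFlow.toFun s x) ∈ V
    rw [X.bulkFlow.proj_toFun]
    exact hx⟩) fun V W h x hx => h hx

variable [IsManifold (𝓡∂ 3) ∞ M]

/-- The complex of linear observables on `U`, whose elements of degree `i` are the compactly
supported `(i + 2)`-forms on `U` satisfying the boundary condition, with differential `d`. -/
noncomputable def observables (U : Set M) : GradedComplex.{u} ℝ :=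
  formComplex X.boundaryCondition U 2

/-- The Poisson structure `τ` on the linear observables on `U`. -/
noncomputable def tau (U : Set M) (φ ψ : X.observables U) : ℝ :=
  X.bulkPairing (Subtype.val φ) (Subtype.val ψ)

/-- The inclusion (extension by zero) of linear observables. -/
noncomputable def observablesIncl {U V : Set M} (h : U ⊆ V) (φ : X.observables U) : X.observables V :=
  ⟨Subtype.val φ, fun k => ⟨(Subtype.property φ k).1, (Subtype.property φ k).2.1,
    (Subtype.property φ k).2.2.1.trans h, (Subtype.property φ k).2.2.2⟩⟩

/-- The functor of Poisson complexes of linear observables on `M`, given that `τ` is a Poisson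
structure. -/
noncomputable def bulkFunctor (hτ : ∀ U : X.FlowOpen, IsPoisson (X.observables U.1) (X.tau U.1)) :
    X.FlowOpen ⥤ PoCh.{u} where
  obj U := ⟨X.observables U.1, X.tau U.1, hτ U⟩
  map {U V} h := ⟨X.observablesIncl (leOfHom h),
    ⟨⟨fun _ _ => rfl, fun _ _ => rfl, fun hx => hx, fun _ => rfl⟩, fun _ _ => rfl⟩⟩

/-! ### The orbit space -/

/-- With respect to the given manifold structure on the orbit space the quotient map is a smooth
principal `ℝ`-bundle, and `ν` is a volume form on it representing the orientation induced by that of `M`: a frame of the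
base is oriented if it becomes an oriented frame of `M` upon lifting it and putting the velocity
of the flow in the first place. -/
structure IsReduction [ChartedSpace (EuclideanHalfSpace 2) X.B] (ν : Form E2 X.B 2) : Prop where
  isPrincipalBundle : X.bulkFlow.IsPrincipalBundle (𝓡∂ 2)
  smooth : IsSmoothForm (𝓡∂ 2) ν
  oriented : ∀ x w₁ w₂, 0 < X.vol x ![X.bulkFlow.velocity 0 x, w₁, w₂] →
    0 < ν (X.bulkFlow.proj x) ![tangentAt (𝓡∂ 3) (𝓡∂ 2) X.bulkFlow.proj x w₁,
      tangentAt (𝓡∂ 3) (𝓡∂ 2) X.bulkFlow.proj x w₂]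

end BulkBoundary

/-- The condition on forms on a surface with boundary that the `0`-form vanishes on the boundary. -/
noncomputable def dirichlet (B : Type u) [TopologicalSpace B]
    [ChartedSpace (EuclideanHalfSpace 2) B] : FormCondition (𝓡∂ 2) B where
  cond
    | 0 =>
      { carrier := {α | ∀ b ∈ (𝓡∂ 2).boundary B, α b = 0}
        zero_mem' := fun _ _ => rfl
        add_mem' := fun {α β} hα hβ b hb => by
          rw [Pi.add_apply, hα b hb, hβ b hb, add_zero]
        smul_mem' := fun c α hα b hb => by
          rw [Pi.smul_apply, hα b hb, smul_zero] }
    | _ + 1 => ⊤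
  extD_mem _ _ := trivial

namespace BulkBoundary

variable {M : Type u} [TopologicalSpace M] [ChartedSpace (EuclideanHalfSpace 3) M]
  {N : Type v} [TopologicalSpace N] [ChartedSpace E2 N] (X : BulkBoundary M N)
  [ChartedSpace (EuclideanHalfSpace 2) X.B] (ν : Form E2 X.B 2)

/-- The pairing `σ(α ⊗ β) = (-1)^|α| ∫_B α ∧ β`, where `|α| = p - 1` if `α` is a `p`-form. -/
noncomputable def basePairing (α β : ∀ k, Form E2 X.B k) : ℝ :=
  ∑ p ∈ Finset.range 3, ∑ q ∈ Finset.range 3, (-1) ^ (p + 1) *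
    integral (𝓡∂ 2) ν fun b => wedge (α p b) (β q b)

variable [IsManifold (𝓡∂ 2) ∞ X.B]

/-- The complex on `V ⊆ B` whose elements of degree `i` are the compactly supported `(i + 1)`-forms
on `V`, where `0`-forms have to vanish on the boundary, with differential `-d`. -/
noncomputable def baseForms (V : Set X.B) : GradedComplex.{u} ℝ :=
  formComplex (dirichlet X.B) V 1

/-- The Poisson structure `σ` on the forms on `V`. -/
noncomputable def sigma (V : Set X.B) (α β : X.baseForms V) : ℝ :=
  X.basePairing ν (Subtype.val α) (Subtype.val β)

/-- The inclusion (extension by zero) of compactly supported forms. -/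
noncomputable def baseFormsIncl {U V : Set X.B} (h : U ⊆ V) (α : X.baseForms U) : X.baseForms V :=
  ⟨Subtype.val α, fun k => ⟨(Subtype.property α k).1, (Subtype.property α k).2.1,
    (Subtype.property α k).2.2.1.trans h, (Subtype.property α k).2.2.2⟩⟩

/-- The functor of Poisson complexes of forms on the base, given that `σ` is a Poisson
structure. -/
noncomputable def baseFunctor (hσ : ∀ V : X.BaseOpen, IsPoisson (X.baseForms V.1) (X.sigma ν V.1)) :
    X.BaseOpen ⥤ PoCh.{u} where
  obj V := ⟨X.baseForms V.1, X.sigma ν V.1, hσ V⟩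
  map {U V} h := ⟨X.baseFormsIncl (leOfHom h),
    ⟨⟨fun _ _ => rfl, fun _ _ => rfl, fun hx => hx, fun _ => rfl⟩, fun _ _ => rfl⟩⟩

variable [IsManifold (𝓡∂ 3) ∞ M]

/-- Fiber integration maps linear observables on the preimage of `V` to compactly supported forms
on `V` that satisfy the boundary condition. -/
def FiberIntegrationRestricts : Prop :=
  ∀ (V : X.BaseOpen) (φ : X.observables (X.preimage.obj V).1),
    X.bulkFlow.fiberIntegration (𝓡∂ 2) (Subtype.val φ) ∈ compactForms (dirichlet X.B) V.1

variable {X}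

/-- The fiber integration from the observables on the preimage of `V` to the forms on `V`. -/
noncomputable def fiberMap (hπ : X.FiberIntegrationRestricts) (V : X.BaseOpen)
    (φ : X.observables (X.preimage.obj V).1) : X.baseForms V.1 :=
  ⟨X.bulkFlow.fiberIntegration (𝓡∂ 2) (Subtype.val φ), hπ V φ⟩

variable {ν}

/-- Fiber integration as a natural transformation, given that its components are morphisms of
Poisson complexes. -/
noncomputable def fiberTransformation
    (hτ : ∀ U : X.FlowOpen, IsPoisson (X.observables U.1) (X.tau U.1))
    (hσ : ∀ V : X.BaseOpen, IsPoisson (X.baseForms V.1) (X.sigma ν V.1))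
    (hπ : X.FiberIntegrationRestricts)
    (hmap : ∀ V : X.BaseOpen, PoCh.IsPoissonMap ((X.preimage ⋙ X.bulkFunctor hτ).obj V)
      ((X.baseFunctor ν hσ).obj V) (fiberMap hπ V)) :
    X.preimage ⋙ X.bulkFunctor hτ ⟶ X.baseFunctor ν hσ where
  app V := ⟨fiberMap hπ V, hmap V⟩
  naturality _ _ _ := rfl

/-- The functor `𝔄 = CCR(observables, τ)` on the flow-convex open subsets of `M`. -/
noncomputable def bulkAQFT (X : BulkBoundary M N)
    (hτ : ∀ U : X.FlowOpen, IsPoisson (X.observables U.1) (X.tau U.1)) :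
    X.FlowOpen ⥤ DGStarAlg.{u} := X.bulkFunctor hτ ⋙ CCR

/-- The functor `𝔅 = CCR(forms on the base, σ)` on the open subsets of the base. -/
noncomputable def baseAQFT (X : BulkBoundary M N) [ChartedSpace (EuclideanHalfSpace 2) X.B]
    [IsManifold (𝓡∂ 2) ∞ X.B] (ν : Form E2 X.B 2)
    (hσ : ∀ V : X.BaseOpen, IsPoisson (X.baseForms V.1) (X.sigma ν V.1)) :
    X.BaseOpen ⥤ DGStarAlg.{u} := X.baseFunctor ν hσ ⋙ CCR

/-- The natural transformation `CCR(π_*)` from the pullback of `𝔄` to `𝔅`. -/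
noncomputable def dimensionalReduction
    (hτ : ∀ U : X.FlowOpen, IsPoisson (X.observables U.1) (X.tau U.1))
    (hσ : ∀ V : X.BaseOpen, IsPoisson (X.baseForms V.1) (X.sigma ν V.1))
    (hπ : X.FiberIntegrationRestricts)
    (hmap : ∀ V : X.BaseOpen, PoCh.IsPoissonMap ((X.preimage ⋙ X.bulkFunctor hτ).obj V)
      ((X.baseFunctor ν hσ).obj V) (fiberMap hπ V)) :
    X.preimage ⋙ X.bulkAQFT hτ ⟶ X.baseAQFT ν hσ :=
  Functor.whiskerRight (fiberTransformation hτ hσ hπ hmap) CCR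

end BulkBoundary

/-! ### Algebraic quantum field theories -/

/-- The Einstein causality axiom for a functor `𝔄` from a category of regions to dg-algebras: the
images of the algebras of orthogonal regions commute in the graded sense. -/
def EinsteinCausal {C : Type u} [Category.{u} C] (orth : C → C → Prop) (𝔄 : C ⥤ DGStarAlg.{u}) :
    Prop :=
  ∀ {U₁ U₂ U : C} (f₁ : U₁ ⟶ U) (f₂ : U₂ ⟶ U), orth U₁ U₂ →
    ∀ {i j : ℤ} {a : 𝔄.obj U₁} {b : 𝔄.obj U₂}, a ∈ (𝔄.obj U₁).deg i → b ∈ (𝔄.obj U₂).deg j →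
      (𝔄.map f₁).toAlgHom a * (𝔄.map f₂).toAlgHom b =
        sgn ℂ (i * j) • ((𝔄.map f₂).toAlgHom b * (𝔄.map f₁).toAlgHom a)

/-- A natural weak equivalence: all components are weak equivalences. -/
def IsNaturalWeakEquivalence {C : Type u} [Category.{u} C] {𝔄 𝔅 : C ⥤ DGStarAlg.{u}}
    (η : 𝔄 ⟶ 𝔅) : Prop :=
  ∀ U, DGStarAlg.IsWeakEquivalence (η.app U)

end ChernSimons

end CSWZW

/-!
# Chiral field theories on the base of a proper flow

The orbit space of a proper `ℝ`-action is Hausdorff and second countable because the quotient map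
is open and the orbit relation is closed (`t2Space_base`). Near an orbit, let `f` be a bump function
and put `F(x) = ∫ f(Θ(s, x)) e⁻ˢ ds`. Then `F(Θ(r, x)) = eʳ F(x)`, so that `T = log F` is a smooth
equivariant function (`exists_equivariant_near`). Its zero set meets each nearby orbit exactly once.
Since the flow is tangent to the boundary and `dT` is one on its velocity, the zero set can be
parametrized by the two-dimensional half space with the help of the implicit function theorem
(`exists_implicit`, `exists_slice`). These slices are the charts of the orbit space
(`exists_isPrincipalBundle`). The local equivariant functions are glued to a global equivariant
function `t`, that is, to a global trivialization `M ≅ ℝ × B` (`exists_equivariantTime`), and the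
contraction of the volume form with the velocity, restricted to `{t = 0}`, orients `B`
(`exists_isReduction`).

For the comparison of the field theories, all computations with forms take place in tubes, the
parametrizations of `M` by `ℝ` times a chart of `B` that are defined by `t`. Cartan's formula
`d ∫_A Θ^* + ∫_A Θ^* d = ∫_A ∂ₛ Θ^*` for the integral along the flow has the following consequences.

* Fiber integration `π_*` anticommutes with `d`, and `G↑ - G↓` is `π^* π_*` up to a sign
  (`propagator_eq`). By the projection formula and the theorem of Fubini, `τ` is the pullback of
  `σ` along `π_*` (`basePairing_fiberIntegration`). As `σ` is a Poisson structure by the theorem of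
  Stokes (`isPoisson_sigma`), so is `τ`, and `π_*` is a morphism of Poisson complexes. Einstein
  causality holds because the pairings of the images vanish: the supports are disjoint on the base,
  and on the bulk one support misses the flow-out of the other.
* If `χ` is a function of `t` that is zero in the past and one in the future, then
  `β ↦ dχ ∧ π^*β` is a section `s` of `π_*`, and `G↑ - χ π^* π_*` is a homotopy from `s π_*` to the
  identity that preserves compact supports (`fiberInt_lift`, `homotopyMap`).

The boundary conditions enter as follows: a null vector on the side of the light cone that is
selected by the chirality spans the common kernel of the (anti-)self-dual `1`-forms, so that the
condition on a `1`-form is that it vanishes on the velocity of the flow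
(`mem_boundaryCondition_one_iff`). This is what makes `π_*` of a `1`-form vanish on the boundary of
`B`, and what makes the section and the homotopy preserve the boundary conditions.

A deformation retraction of Poisson complexes induces a weak equivalence of CCR algebras
(`isWeakEquivalence_of_retraction`). Indeed the homotopy `k` and the projector `p = d k + k d` have
values in the radical of the pairing, whence they extend to graded derivations `K` and
`N = d K + K d` of the CCR algebra. So `N` acts by zero on cohomology. On the other hand `N` counts
the generators in the image of `p`. Hence, if `Φ` is the endomorphism of the algebra that extends
`1 - p`, each `x` satisfies `q(N) x = q(0) Φ(x)` for some polynomial `q` with `q(0) ≠ 0`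
(`exists_aeval_radDer`), and `Φ` acts as the identity on cohomology.
-/

/-! ### Homotopy equivalences and canonical commutation relations -/

namespace CSWZW

/-- A cochain map with a right inverse `g` such that `g ∘ f` acts as the identity on cohomology is a
quasi-isomorphism. -/
lemma GradedComplex.IsCochainMap.isQuasiIso_of_rightInverse {𝕜 : Type} [Field 𝕜]
    {V : GradedComplex.{u} 𝕜} {W : GradedComplex.{v} 𝕜} {f : V → W} (hf : IsCochainMap V W f)
    {g : W → V} (hg : IsCochainMap W V g) (hfg : ∀ y, f (g y) = y)
    (h : ∀ (i : ℤ) (x : V), x ∈ V.deg i → V.d x = 0 → ∃ w ∈ V.deg (i - 1), x - g (f x) = V.d w) :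
    hf.IsQuasiIso := by
  intro i
  constructor
  · rw [injective_iff_map_eq_zero]
    intro z hz
    obtain ⟨⟨x, hx, hdx⟩, rfl⟩ := Submodule.Quotient.mk_surjective _ z
    have hz' := (Submodule.Quotient.mk_eq_zero _).1 hz
    obtain ⟨y, hy, hyx⟩ := hz'
    have hyx : W.d y = f x := hyx
    obtain ⟨w, hw, hxw⟩ := h i x hx hdx
    refine (Submodule.Quotient.mk_eq_zero _).2 ⟨w + g y, add_mem hw (hg.map_deg hy), ?_⟩
    change V.d (w + g y) = x
    have h1 : V.d (g y) = g (f x) := by rw [← hg.map_d, hyx]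
    rw [V.d.map_add, ← hxw, h1, sub_add_cancel]
  · intro z
    obtain ⟨⟨y, hy, hdy⟩, rfl⟩ := Submodule.Quotient.mk_surjective _ z
    have hdy : W.d y = 0 := hdy
    refine ⟨Submodule.Quotient.mk ⟨g y, hg.map_deg hy, ?_⟩, ?_⟩
    · change V.d (g y) = 0
      rw [← hg.map_d, hdy]
      exact hg.toLinearMap.map_zero
    · change Submodule.Quotient.mk _ = _
      congr 1
      exact Subtype.ext (hfg y)

namespace CCRAlg

variable {P Q R : PoCh.{u}}

/-- Morphisms of Poisson complexes whose images have vanishing pairing induce algebra maps with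
graded commuting images. -/
lemma map_mul_map_comm (f : P ⟶ R) (g : Q ⟶ R)
    (h : ∀ φ ψ, R.pairing (PoCh.Hom.toFun f φ) (PoCh.Hom.toFun g ψ) = 0) {i j : ℤ}
    {a : CCRAlg P} {b : CCRAlg Q} (ha : a ∈ deg i) (hb : b ∈ deg j) :
    map f a * map g b = sgn ℂ (i * j) • (map g b * map f a) := by
  have h1 : ∀ {i : ℤ} {φ : P.carrier}, φ ∈ P.deg i →
      map f (gen φ) * map g b = sgn ℂ (i * j) • (map g b * map f (gen φ)) := by
    intro i φ hφ
    refine deg_induction (P := Q) (p := fun j b =>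
      map f (gen φ) * map g b = sgn ℂ (i * j) • (map g b * map f (gen φ))) ?_ ?_ ?_ ?_ ?_ hb
    · intro j; simp
    · simp [sgn_of_even ℂ]
    · intro j x y _ _ hx hy
      rw [map_add, mul_add, add_mul, hx, hy, smul_add]
    · intro j c x _ hx
      rw [map_smul, mul_smul_comm, hx, smul_mul_assoc, smul_comm]
    · intro k l ψ x hψ _ hx
      rw [map_mul, ← mul_assoc, map_gen, map_gen, gen_comm
        ((PoCh.Hom.isPoissonMap f).map_deg hφ) ((PoCh.Hom.isPoissonMap g).map_deg hψ), h]
      rw [map_gen] at hx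
      simp only [Complex.ofReal_zero, mul_zero, map_zero, add_zero, smul_mul_assoc]
      rw [mul_assoc, hx, mul_smul_comm, smul_smul, ← sgn_add, ← mul_add, mul_assoc]
  refine deg_induction (P := P) (p := fun i a =>
    map f a * map g b = sgn ℂ (i * j) • (map g b * map f a)) ?_ ?_ ?_ ?_ ?_ ha
  · intro i; simp
  · simp [sgn_of_even ℂ]
  · intro i x y _ _ hx hy
    rw [map_add, mul_add, add_mul, hx, hy, smul_add]
  · intro i c x _ hx
    rw [map_smul, mul_smul_comm, smul_mul_assoc, hx, smul_comm]
  · intro k l φ x hφ _ hx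
    rw [map_mul, mul_assoc, hx, mul_smul_comm, ← mul_assoc, h1 hφ, smul_mul_assoc, smul_smul,
      ← sgn_add, mul_assoc]
    congr 2
    ring

section Derivation

/-- An endomorphism of degree `e` of the Poisson complex `P` with image in the radical of the
pairing. -/
structure IsRadicalMap (e : ℤ) (k : P.carrier →ₗ[ℝ] P.carrier) : Prop where
  map_deg : ∀ {i x}, x ∈ P.deg i → k x ∈ P.deg (i + e)
  pairing_left : ∀ x y, P.pairing (k x) y = 0
  pairing_right : ∀ x y, P.pairing x (k y) = 0

variable {e : ℤ} {k : P.carrier →ₗ[ℝ] P.carrier}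

/-- The generators of upper triangular matrices that encode a graded derivation of degree `e`. -/
noncomputable def radGen (e : ℤ) (k : P.carrier →ₗ[ℝ] P.carrier) :
    P.carrier →ₛₗ[Complex.ofRealHom] Matrix (Fin 2) (Fin 2) (CCRAlg P) where
  toFun φ := !![gen (weightMap P.internal (fun i => sgn ℝ (e * i)) φ), gen (k φ); 0, gen φ]
  map_add' x y := by ext i j; fin_cases i <;> fin_cases j <;> simp
  map_smul' c x := by
    ext i j
    fin_cases i <;> fin_cases j <;> simp [LinearMap.map_smulₛₗ]

lemma radGen_of_mem {i : ℤ} {φ : P.carrier} (hφ : φ ∈ P.deg i) :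
    radGen e k φ = !![sgn ℂ (e * i) • gen φ, gen (k φ); 0, gen φ] := by
  have : gen (weightMap P.internal (fun i => sgn ℝ (e * i)) φ) = sgn ℂ (e * i) • gen φ := by
    rw [weightMap_of_mem P.internal _ hφ, LinearMap.map_smulₛₗ]
    simp [sgn]
  simp [radGen, this]

lemma radGen_comm (hk : IsRadicalMap e k) {i j : ℤ} {φ ψ : P.carrier} (hφ : φ ∈ P.deg i)
    (hψ : ψ ∈ P.deg j) :
    radGen e k φ * radGen e k ψ = sgn ℂ (i * j) • (radGen e k ψ * radGen e k φ)
      + algebraMap ℂ (Matrix (Fin 2) (Fin 2) (CCRAlg P)) (Complex.I * (P.pairing φ ψ : ℂ)) := by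
  have h1 := gen_comm hφ hψ
  have h2 := gen_comm (hk.map_deg hφ) hψ
  have h3 := gen_comm hφ (hk.map_deg hψ)
  rw [hk.pairing_left] at h2
  rw [hk.pairing_right] at h3
  simp only [Complex.ofReal_zero, mul_zero, map_zero, add_zero] at h2 h3
  have h5 : sgn ℂ (e * i) * sgn ℂ (e * j) * (Complex.I * (P.pairing φ ψ : ℂ)) =
      Complex.I * (P.pairing φ ψ : ℂ) := by
    by_cases hij : i + j = 0
    · rw [← sgn_add, ← mul_add, hij, sgn_of_even ℂ (by simp), one_mul]
    · simp [P.isPoisson.deg_zero hφ hψ hij]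
  rw [radGen_of_mem hφ, radGen_of_mem hψ]
  ext a b
  fin_cases a <;> fin_cases b
  · simp only [Matrix.add_apply, Matrix.smul_apply, Matrix.mul_apply, Fin.sum_univ_two,
      Matrix.algebraMap_matrix_apply]
    simp only [Matrix.of_apply, Matrix.cons_val', Matrix.cons_val_zero, Matrix.cons_val_one,
      Fin.zero_eta, Fin.isValue, mul_zero, add_zero, if_true, smul_mul_smul_comm,
      Matrix.cons_val_fin_one]
    rw [h1, smul_add, smul_smul, smul_smul]
    simp only [Algebra.algebraMap_eq_smul_one, smul_smul]
    rw [h5]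
    congr 2
    ring
  · simp only [Matrix.add_apply, Matrix.smul_apply, Matrix.mul_apply, Fin.sum_univ_two,
      Matrix.algebraMap_matrix_apply]
    simp
    rw [h2, h3]
    simp only [smul_add, smul_smul]
    have e1 : sgn ℂ (e * i) * sgn ℂ (i * (j + e)) = sgn ℂ (i * j) := by
      rw [mul_add, sgn_add, mul_comm i e]
      linear_combination sgn ℂ (i * j) * sgn_mul_self ℂ (e * i)
    have e2 : sgn ℂ ((i + e) * j) = sgn ℂ (i * j) * sgn ℂ (e * j) := by
      rw [add_mul, sgn_add]
    rw [e1, e2]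
    abel
  · simp [Matrix.mul_apply, Fin.sum_univ_two, Matrix.algebraMap_matrix_apply]
  · simp [Matrix.mul_apply, Fin.sum_univ_two, Matrix.algebraMap_matrix_apply, h1]

/-- The algebra map to upper triangular matrices that encodes `radDer`. -/
noncomputable def radHom (hk : IsRadicalMap e k) :
    CCRAlg P →ₐ[ℂ] Matrix (Fin 2) (Fin 2) (CCRAlg P) :=
  lift (radGen e k) (radGen_comm hk)

/-- The graded derivation of degree `e` of the CCR algebra that extends a map with values in the
radical of the pairing. -/
noncomputable def radDer (hk : IsRadicalMap e k) : CCRAlg P →ₗ[ℂ] CCRAlg P where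
  toFun x := radHom hk x 0 1
  map_add' x y := by simp
  map_smul' c x := by simp

lemma radDer_one (hk : IsRadicalMap e k) : radDer hk (1 : CCRAlg P) = 0 := by
  change radHom hk (1 : CCRAlg P) 0 1 = 0
  rw [map_one]; simp

lemma radHom_one_one (hk : IsRadicalMap e k) (x : CCRAlg P) :
    radHom hk x 1 1 = x ∧ radHom hk x 1 0 = 0 := by
  induction x using induction with
  | one => rw [map_one]; simp
  | add x y hx hy => rw [map_add]; simp [hx, hy]
  | smul c x hx => rw [map_smul]; simp [hx]
  | mul i j φ x hφ _ hx =>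
    rw [map_mul]
    have h : radHom hk (gen φ) 1 0 = 0 ∧ radHom hk (gen φ) 1 1 = gen φ := by simp [radHom, radGen]
    simp [Matrix.mul_apply, Fin.sum_univ_two, hx, h]

lemma radDer_gen_mul (hk : IsRadicalMap e k) {i : ℤ} {φ : P.carrier} (hφ : φ ∈ P.deg i)
    (y : CCRAlg P) :
    radDer hk (gen φ * y) = gen (k φ) * y + sgn ℂ (e * i) • (gen φ * radDer hk y) := by
  change radHom hk (gen φ * y) 0 1 = _
  have h : radHom hk (gen φ) = !![sgn ℂ (e * i) • gen φ, gen (k φ); 0, gen φ] := by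
    rw [radHom, lift_gen, radGen_of_mem hφ]
  rw [map_mul, Matrix.mul_apply, Fin.sum_univ_two, (radHom_one_one hk y).1, h, add_comm]
  simp
  rfl

lemma radDer_mem (hk : IsRadicalMap e k) {i : ℤ} {x : CCRAlg P} (hx : x ∈ deg i) :
    radDer hk x ∈ deg (i + e) := by
  refine deg_induction (P := P) (p := fun i x => radDer hk x ∈ deg (i + e)) ?_ ?_ ?_ ?_ ?_ hx
  · intro i; simp
  · rw [radDer_one]; exact zero_mem _
  · intro i x y _ _ hx hy; rw [map_add]; exact add_mem hx hy
  · intro i c x _ hx; rw [map_smul]; exact Submodule.smul_mem _ _ hx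
  · intro i j φ x hφ hx hx'
    rw [radDer_gen_mul hk hφ]
    refine add_mem ?_ (Submodule.smul_mem _ _ ?_)
    · rw [show i + j + e = i + e + j by ring]
      exact SetLike.mul_mem_graded (gen_mem (hk.map_deg hφ)) hx
    · rw [show i + j + e = i + (j + e) by ring]
      exact SetLike.mul_mem_graded (gen_mem hφ) hx'

/-- The graded commutator of `d` with the derivation extending a homotopy `k` is the derivation
extending `d k + k d`. -/
lemma d_radDer_add (hk : IsRadicalMap (-1) k) {p : P.carrier →ₗ[ℝ] P.carrier}
    (hp : IsRadicalMap 0 p) (h : ∀ x, P.d (k x) + k (P.d x) = p x) (x : CCRAlg P) :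
    d (radDer hk x) + radDer hk (d x) = radDer hp x := by
  induction x using induction with
  | one => simp [d_one, radDer_one]
  | add x y hx hy => simp only [map_add, ← hx, ← hy]; abel
  | smul c x hx => simp only [map_smul, ← hx, smul_add]
  | mul i j φ x hφ hxj hx =>
    rw [leibniz (gen_mem hφ), radDer_gen_mul hk hφ, radDer_gen_mul hp hφ, map_add, map_add,
      map_smul, map_smul, d_gen, radDer_gen_mul hk (P.d_mem hφ), radDer_gen_mul hk hφ,
      leibniz (gen_mem hφ), leibniz (gen_mem (hk.map_deg hφ)), d_gen, d_gen, ← hx, ← h, map_add]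
    have h0 : sgn ℂ (-1) = -1 := by simp [sgn]
    have e1 : sgn ℂ (-1 * i) = sgn ℂ i := by simp [sgn]
    have e2 : sgn ℂ (-1 * (i + 1)) = -sgn ℂ i := by
      rw [show -1 * (i + 1) = -1 * i + -1 by ring, sgn_add, e1, h0]; ring
    have e3 : sgn ℂ (i + -1) = -sgn ℂ i := by
      rw [sgn_add, h0]; ring
    have e4 : sgn ℂ (0 * i) = 1 := by simp [sgn]
    rw [e1, e2, e3, e4]
    simp only [smul_add, smul_smul, sgn_mul_self, one_smul, add_mul, mul_add]
    module

lemma d_radDer_comm {p : P.carrier →ₗ[ℝ] P.carrier}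
    (hp : IsRadicalMap 0 p) (h : ∀ x, P.d (p x) = p (P.d x)) (x : CCRAlg P) :
    d (radDer hp x) = radDer hp (d x) := by
  induction x using induction with
  | one => simp [d_one, radDer_one]
  | add x y hx hy => simp only [map_add, hx, hy]
  | smul c x hx => simp only [map_smul, hx]
  | mul i j φ x hφ hxj hx =>
    have hp0 : p φ ∈ P.deg i := by simpa using hp.map_deg hφ
    have e4 : ∀ i, sgn ℂ (0 * i) = 1 := by simp [sgn]
    rw [leibniz (gen_mem hφ), radDer_gen_mul hp hφ, map_add, map_add, map_smul, map_smul, d_gen,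
      radDer_gen_mul hp (P.d_mem hφ), radDer_gen_mul hp hφ, leibniz (gen_mem hφ),
      leibniz (gen_mem hp0), d_gen, d_gen, ← hx, h, e4, e4]
    simp only [one_smul, smul_add]
    abel

end Derivation

/-- The number operator of a decomposition of the generators into the kernel and the image of a
projector `p` is locally annihilated, off the subalgebra generated by the kernel, by polynomials
without roots on the half-line `t ≤ 0`. Only `t = 0` matters in the end, but the induction over the
word length shifts the argument of the polynomial by one. -/
lemma exists_aeval_radDer {p : P.carrier →ₗ[ℝ] P.carrier} (hp : IsRadicalMap 0 p)
    (hpp : ∀ x, p (p x) = p x) (Φ : CCRAlg P →ₐ[ℂ] CCRAlg P)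
    (hΦ : ∀ φ, Φ (gen φ) = gen (φ - p φ)) (x : CCRAlg P) :
    ∃ q : Polynomial ℂ, (∀ t : ℝ, t ≤ 0 → q.eval (t : ℂ) ≠ 0) ∧
      Polynomial.aeval (radDer hp) q x = q.eval 0 • Φ x := by
  have e4 : ∀ i, sgn ℂ (0 * i) = 1 := by simp [sgn]
  set N := radDer hp with hN
  have hmul : ∀ (φ : P.carrier) (y : CCRAlg P), N (gen φ * y) = gen (p φ) * y + gen φ * N y := by
    intro φ y
    refine induction_of_internal P.internal (p := fun φ =>
      N (gen φ * y) = gen (p φ) * y + gen φ * N y) (fun i φ hφ => ?_) (fun a b ha hb => ?_) φ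
    · rw [hN, radDer_gen_mul hp hφ, e4, one_smul]
    · simp only [map_add, add_mul, ha, hb]; abel
  have hker : ∀ x, N (Φ x) = 0 := by
    intro x
    induction x using induction with
    | one => rw [map_one, hN, radDer_one]
    | add x y hx hy => simp only [map_add, hx, hy, add_zero]
    | smul c x hx => simp only [map_smul, hx, smul_zero]
    | mul i j φ x hφ _ hx =>
      rw [map_mul, hΦ, hmul, hx, map_sub, hpp]
      simp
  have hev : ∀ (q : Polynomial ℂ) (x : CCRAlg P), N x = 0 → Polynomial.aeval N q x = q.eval 0 • x := by
    intro q x hx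
    induction q using Polynomial.induction_on' with
    | add a b ha hb => simp [ha, hb, add_smul]
    | monomial n a =>
      cases n with
      | zero => simp
      | succ n => simp [Polynomial.aeval_monomial, pow_succ, hx]
  induction x using induction with
  | one => exact ⟨1, by simp, by simp⟩
  | add x y hx hy =>
    obtain ⟨q, hq, hqx⟩ := hx
    obtain ⟨r, hr, hry⟩ := hy
    refine ⟨q * r, fun t ht => by simp [hq t ht, hr t ht], ?_⟩
    have h1 : Polynomial.aeval N (q * r) x = (q.eval 0 * r.eval 0) • Φ x := by
      rw [mul_comm q r, map_mul, Module.End.mul_apply, hqx, map_smul, hev r _ (hker x), smul_smul]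
    have h2 : Polynomial.aeval N (q * r) y = (q.eval 0 * r.eval 0) • Φ y := by
      rw [map_mul, Module.End.mul_apply, hry, map_smul, hev q _ (hker y), smul_smul, mul_comm]
    rw [map_add, h1, h2, map_add, smul_add, Polynomial.eval_mul]
  | smul c x hx =>
    obtain ⟨q, hq, hqx⟩ := hx
    exact ⟨q, hq, by rw [map_smul, hqx, map_smul, smul_comm]⟩
  | mul i j φ x hφ _ hx =>
    obtain ⟨q, hq, hqx⟩ := hx
    -- on products with a generator from the kernel of `p` the operator is unchanged, on those with
    -- one from the image it is shifted by one
    have hcomm : ∀ (c : ℂ) (a : CCRAlg P), (∀ y, N (a * y) = a * (N y + c • y)) →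
        ∀ (r : Polynomial ℂ) (y : CCRAlg P), Polynomial.aeval N r (a * y) =
          a * Polynomial.aeval N (r.comp (Polynomial.X + Polynomial.C c)) y := by
      intro c a ha r
      have hpow : ∀ (n : ℕ) (y : CCRAlg P),
          (N ^ n) (a * y) = a * ((N + algebraMap ℂ _ c) ^ n) y := by
        intro n
        induction n with
        | zero => intro y; simp
        | succ n ih =>
          intro y
          rw [pow_succ, Module.End.mul_apply, ha, ih, pow_succ, Module.End.mul_apply]
          rfl
      induction r using Polynomial.induction_on' with
      | add r s hr hs => intro y; simp only [map_add, LinearMap.add_apply, hr, hs, Polynomial.add_comp, mul_add]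
      | monomial n b =>
        intro y
        simp only [Polynomial.aeval_monomial, Polynomial.monomial_comp, map_mul, map_pow, map_add,
          Polynomial.aeval_X, Polynomial.aeval_C, Module.End.mul_apply, hpow,
          Module.algebraMap_end_apply, mul_smul_comm]
    have h0 : ∀ y, N (gen (φ - p φ) * y) = gen (φ - p φ) * (N y + (0 : ℂ) • y) := by
      intro y; rw [hmul, map_sub, hpp]; simp
    have h1 : ∀ y, N (gen (p φ) * y) = gen (p φ) * (N y + (1 : ℂ) • y) := by
      intro y; rw [hmul, hpp, one_smul, mul_add, add_comm]
    set r : Polynomial ℂ := q.comp (Polynomial.X + Polynomial.C (-1)) * (1 - Polynomial.X) with hr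
    have hr0 : ∀ t : ℝ, t ≤ 0 → r.eval (t : ℂ) ≠ 0 := by
      intro t ht
      have h2 := hq (t + -1) (by linarith)
      have h3 : (1 : ℂ) - t ≠ 0 := by
        intro h
        have : (1 : ℝ) - t = 0 := by exact_mod_cast h
        linarith
      simp only [hr, Polynomial.eval_mul, Polynomial.eval_comp, Polynomial.eval_add,
        Polynomial.eval_X, Polynomial.eval_C, Polynomial.eval_sub, Polynomial.eval_one]
      push_cast at h2
      exact mul_ne_zero h2 h3
    refine ⟨q * r, fun t ht => by simp [hq t ht, hr0 t ht], ?_⟩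
    have hsplit : gen φ * x = gen (φ - p φ) * x + gen (p φ) * x := by
      rw [← add_mul, ← map_add, sub_add_cancel]
    have hA : Polynomial.aeval N (q * r) (gen (φ - p φ) * x) =
        (q * r).eval 0 • (gen (φ - p φ) * Φ x) := by
      rw [hcomm 0 _ h0, map_zero, add_zero, Polynomial.comp_X, mul_comm q r, map_mul,
        Module.End.mul_apply, hqx, map_smul, hev r _ (hker x), smul_smul, mul_smul_comm,
        ← Polynomial.eval_mul, mul_comm q r]
    have hB : Polynomial.aeval N (q * r) (gen (p φ) * x) = 0 := by
      have h2 : r.comp (Polynomial.X + Polynomial.C 1) = -Polynomial.X * q := by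
        rw [hr, Polynomial.mul_comp, Polynomial.comp_assoc]
        simp
        ring
      rw [hcomm 1 _ h1, Polynomial.mul_comp, h2, map_mul, Module.End.mul_apply, map_mul,
        Module.End.mul_apply, hqx, map_smul, map_neg, Polynomial.aeval_X, LinearMap.neg_apply,
        hker]
      simp
    rw [map_mul Φ, hΦ, hsplit, map_add, hA, hB, add_zero]

/-- A deformation retraction of Poisson complexes induces a weak equivalence of CCR algebras. -/
theorem isWeakEquivalence_of_retraction (f : P ⟶ Q) {s : Q.carrier → P.carrier}
    (hs : GradedComplex.IsCochainMap Q.toGradedComplex P.toGradedComplex s)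
    (hfs : ∀ y, PoCh.Hom.toFun f (s y) = y) (k : P.carrier →ₗ[ℝ] P.carrier)
    (hk : ∀ {i x}, x ∈ P.deg i → k x ∈ P.deg (i - 1))
    (hdk : ∀ x, P.d (k x) + k (P.d x) = x - s (PoCh.Hom.toFun f x)) :
    DGStarAlg.IsWeakEquivalence (CCR.map f) := by
  have hf := PoCh.Hom.isPoissonMap f
  set F := PoCh.Hom.toFun f with hF
  have hsP : PoCh.IsPoissonMap Q P s :=
    ⟨hs, fun x y => by rw [← hf.map_pairing, hfs, hfs]⟩
  let g : Q ⟶ P := ⟨s, hsP⟩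
  let p : P.carrier →ₗ[ℝ] P.carrier :=
    LinearMap.id - hs.toLinearMap ∘ₗ hf.toIsCochainMap.toLinearMap
  have hpx : ∀ x, p x = x - s (F x) := fun x => rfl
  have hfp : ∀ x, F (p x) = 0 := by
    intro x
    have : F (x - s (F x)) = F x - F (s (F x)) := hf.toIsCochainMap.toLinearMap.map_sub _ _
    rw [hpx, this, hfs, sub_self]
  have hs0 : s 0 = 0 := hs.toLinearMap.map_zero
  have hpp : ∀ x, p (p x) = p x := by
    intro x; rw [hpx (p x), hfp, hs0, sub_zero]
  have hdp : ∀ x, P.d (p x) = p (P.d x) := by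
    intro x; rw [hpx, hpx, map_sub, ← hs.map_d, ← hf.map_d]
  have hz1 : ∀ y, Q.pairing 0 y = 0 := fun y => by
    simpa using Q.isPoisson.smul_left 0 0 y
  have hz2 : ∀ y, Q.pairing y 0 = 0 := fun y => by
    simpa using Q.isPoisson.smul_right 0 y 0
  have hpdeg : ∀ {i x}, x ∈ P.deg i → p x ∈ P.deg i := fun hx =>
    sub_mem hx (hs.map_deg (hf.map_deg hx))
  have hp : IsRadicalMap 0 p :=
    ⟨fun hx => by simpa using hpdeg hx, fun x y => by rw [← hf.map_pairing]; exact (by rw [hfp, hz1]),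
      fun x y => by rw [← hf.map_pairing]; exact (by rw [hfp, hz2])⟩
  -- sandwiching the homotopy between projectors moves its image into the radical
  let k' := p ∘ₗ k ∘ₗ p
  have hk' : IsRadicalMap (-1) k' :=
    ⟨fun hx => hpdeg (hk (hpdeg hx)), fun x y => hp.pairing_left _ y, fun x y => hp.pairing_right _ _⟩
  have hdk' : ∀ x, P.d (k' x) + k' (P.d x) = p x := by
    intro x
    change P.d (p (k (p x))) + p (k (p (P.d x))) = p x
    rw [hdp, ← hdp x, ← map_add, hdk, ← hpx, hpp, hpp]
  have hfg : ∀ y, map f (map g y) = y := by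
    intro y
    have : (map f).comp (map g) = AlgHom.id ℂ (CCRAlg Q) := by
      apply hom_ext
      intro φ
      change map f (map g (gen φ)) = gen φ
      rw [map_gen, map_gen]
      exact congrArg gen (hfs φ)
    exact DFunLike.congr_fun this y
  refine (DGStarAlg.isCochainMap (CCR.map f)).isQuasiIso_of_rightInverse
    (DGStarAlg.isCochainMap (CCR.map g)) hfg ?_
  suffices H : ∀ (i : ℤ) (x : CCRAlg P), x ∈ CCRAlg.deg i → CCRAlg.d x = 0 →
      ∃ w ∈ CCRAlg.deg (P := P) (i - 1), x - map g (map f x) = CCRAlg.d w from H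
  intro i x hx hdx
  obtain ⟨q, hq, hqx⟩ := exists_aeval_radDer hp hpp ((map g).comp (map f)) (fun φ => by
    change map g (map f (gen φ)) = _
    rw [map_gen, map_gen, hpx, sub_sub_cancel]) x
  have hq0 : q.eval 0 ≠ 0 := by simpa using hq 0 le_rfl
  obtain ⟨r, hr⟩ : Polynomial.X ∣ q - Polynomial.C (q.eval 0) := by
    rw [Polynomial.X_dvd_iff]; simp [Polynomial.coeff_zero_eq_eval_zero]
  set N := radDer hp
  have hNr : ∀ r : Polynomial ℂ, Polynomial.aeval N r x ∈ CCRAlg.deg (P := P) i ∧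
      CCRAlg.d (Polynomial.aeval N r x) = 0 := by
    have hpow : ∀ n : ℕ, (N ^ n) x ∈ CCRAlg.deg (P := P) i ∧ CCRAlg.d ((N ^ n) x) = 0 := by
      intro n
      induction n with
      | zero => exact ⟨hx, hdx⟩
      | succ n ih =>
        rw [pow_succ', Module.End.mul_apply]
        refine ⟨by simpa using radDer_mem hp ih.1, ?_⟩
        rw [d_radDer_comm hp hdp, ih.2, map_zero]
    intro r
    induction r using Polynomial.induction_on' with
    | add r s hr hs =>
      rw [map_add, LinearMap.add_apply, map_add, hr.2, hs.2, add_zero]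
      exact ⟨add_mem hr.1 hs.1, rfl⟩
    | monomial n b =>
      rw [Polynomial.aeval_monomial, Module.End.mul_apply, Module.algebraMap_end_apply, map_smul,
        (hpow n).2, smul_zero]
      exact ⟨Submodule.smul_mem _ _ (hpow n).1, rfl⟩
  have hkey : x - map g (map f x) = -(q.eval 0)⁻¹ • N (Polynomial.aeval N r x) := by
    have h1 : Polynomial.aeval N q x = N (Polynomial.aeval N r x) + q.eval 0 • x := by
      conv_lhs => rw [eq_add_of_sub_eq hr, map_add, map_mul, Polynomial.aeval_X, Polynomial.aeval_C,
        LinearMap.add_apply, Module.End.mul_apply, Module.algebraMap_end_apply]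
    have h2 : N (Polynomial.aeval N r x) = q.eval 0 • (map g (map f x)) - q.eval 0 • x := by
      rw [eq_sub_iff_add_eq, ← h1, hqx]; rfl
    rw [h2, smul_sub, smul_smul, smul_smul, neg_mul, inv_mul_cancel₀ hq0]
    module
  refine ⟨-(q.eval 0)⁻¹ • radDer hk' (Polynomial.aeval N r x),
    Submodule.smul_mem _ _ (radDer_mem hk' (hNr r).1), ?_⟩
  rw [hkey, map_smul, ← d_radDer_add hk' hp hdk', (hNr r).2, map_zero, add_zero]

end CCRAlg

end CSWZW

/-! ### Wedge products in low degrees -/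

namespace CSWZW

section WedgeFormulas

variable {E : Type*} [NormedAddCommGroup E] [NormedSpace ℝ E] {p q : ℕ}

/-- The wedge product as a sum over all permutations instead of shuffles. -/
lemma factorial_mul_wedge_apply (a : E [⋀^Fin p]→L[ℝ] ℝ) (b : E [⋀^Fin q]→L[ℝ] ℝ)
    (v : Fin (p + q) → E) :
    (p.factorial * q.factorial : ℝ) * wedge a b v =
      ∑ σ : Equiv.Perm (Fin p ⊕ Fin q), ((Equiv.Perm.sign σ : ℤ) : ℝ) *
        (a (fun i => v (finSumFinEquiv (σ (Sum.inl i)))) *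
          b (fun i => v (finSumFinEquiv (σ (Sum.inr i))))) := by
  have h := MultilinearMap.domCoprod_alternization_eq a.toAlternatingMap b.toAlternatingMap
  have h2 := congrArg (fun f => LinearMap.mul' ℝ ℝ (f (fun i => v (finSumFinEquiv i)))) h
  simp only [Fintype.card_fin, MultilinearMap.alternatization_apply, AlternatingMap.smul_apply,
    map_nsmul, map_sum] at h2
  rw [nsmul_eq_mul] at h2
  push_cast at h2
  refine Eq.trans ?_ (h2.symm.trans ?_)
  · rfl
  · refine Finset.sum_congr rfl fun σ _ => ?_
    rcases Int.units_eq_one_or (Equiv.Perm.sign σ) with h | h <;> rw [h] <;> simp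

/-- A summand of the expansion of the wedge product, for a permutation known by its values. -/
lemma wedge_summand (a : E [⋀^Fin p]→L[ℝ] ℝ) (b : E [⋀^Fin q]→L[ℝ] ℝ)
    (v : Fin (p + q) → E) (σ : Equiv.Perm (Fin p ⊕ Fin q)) (s : ℤ) (f : Fin p → Fin (p + q))
    (g : Fin q → Fin (p + q)) (hs : (Equiv.Perm.sign σ : ℤ) = s)
    (hf : (fun i => finSumFinEquiv (σ (Sum.inl i))) = f)
    (hg : (fun i => finSumFinEquiv (σ (Sum.inr i))) = g) :
    ((Equiv.Perm.sign σ : ℤ) : ℝ) * (a (fun i => v (finSumFinEquiv (σ (Sum.inl i)))) *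
        b (fun i => v (finSumFinEquiv (σ (Sum.inr i))))) = s * (a (v ∘ f) * b (v ∘ g)) := by
  rw [hs, ← hf, ← hg]; rfl

lemma swap_two (b : E [⋀^Fin 2]→L[ℝ] ℝ) (x y : E) : b ![y, x] = -b ![x, y] := by
  have h := b.toAlternatingMap.map_swap ![x, y] (i := 0) (j := 1) (by decide)
  refine Eq.trans ?_ h
  change b _ = b _
  congr 1
  ext i; fin_cases i <;> rfl

lemma wedge_zero_two (a : E [⋀^Fin 0]→L[ℝ] ℝ) (b : E [⋀^Fin 2]→L[ℝ] ℝ) (x y : E) :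
    wedge a b ![x, y] = a ![] * b ![x, y] := by
  have h := factorial_mul_wedge_apply a b ![x, y]
  have hu : (Finset.univ : Finset (Equiv.Perm (Fin 0 ⊕ Fin 2))) =
    {1, Equiv.swap (Sum.inr 0) (Sum.inr 1)} := by decide
  rw [hu, Finset.sum_pair (by decide),
    wedge_summand a b _ _ 1 ![] ![0, 1] (by decide) (by decide) (by decide),
    wedge_summand a b _ _ (-1) ![] ![1, 0] (by decide) (by decide) (by decide)] at h
  have e1 : (![x, y] : Fin 2 → E) ∘ ![0, 1] = ![x, y] := by ext i; fin_cases i <;> rfl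
  have e2 : (![x, y] : Fin 2 → E) ∘ ![1, 0] = ![y, x] := by ext i; fin_cases i <;> rfl
  have e3 : (![x, y] : Fin 2 → E) ∘ (![] : Fin 0 → Fin 2) = ![] := Subsingleton.elim _ _
  simp only [Nat.reduceAdd] at h
  rw [e1, e2, e3, swap_two b x y] at h
  norm_num at h
  linarith

lemma wedge_two_zero (a : E [⋀^Fin 2]→L[ℝ] ℝ) (b : E [⋀^Fin 0]→L[ℝ] ℝ) (x y : E) :
    wedge a b ![x, y] = a ![x, y] * b ![] := by
  have h := factorial_mul_wedge_apply a b ![x, y]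
  have hu : (Finset.univ : Finset (Equiv.Perm (Fin 2 ⊕ Fin 0))) =
    {1, Equiv.swap (Sum.inl 0) (Sum.inl 1)} := by decide
  rw [hu, Finset.sum_pair (by decide),
    wedge_summand a b _ _ 1 ![0, 1] ![] (by decide) (by decide) (by decide),
    wedge_summand a b _ _ (-1) ![1, 0] ![] (by decide) (by decide) (by decide)] at h
  have e1 : (![x, y] : Fin 2 → E) ∘ ![0, 1] = ![x, y] := by ext i; fin_cases i <;> rfl
  have e2 : (![x, y] : Fin 2 → E) ∘ ![1, 0] = ![y, x] := by ext i; fin_cases i <;> rfl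
  have e3 : (![x, y] : Fin 2 → E) ∘ (![] : Fin 0 → Fin 2) = ![] := Subsingleton.elim _ _
  simp only [Nat.reduceAdd] at h
  rw [e1, e2, e3, swap_two a x y] at h
  norm_num at h
  linarith

lemma wedge_one_one (a b : E [⋀^Fin 1]→L[ℝ] ℝ) (x y : E) :
    wedge a b ![x, y] = a ![x] * b ![y] - a ![y] * b ![x] := by
  have h := factorial_mul_wedge_apply a b ![x, y]
  have hu : (Finset.univ : Finset (Equiv.Perm (Fin 1 ⊕ Fin 1))) =
    {1, Equiv.swap (Sum.inl 0) (Sum.inr 0)} := by decide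
  rw [hu, Finset.sum_pair (by decide),
    wedge_summand a b _ _ 1 ![0] ![1] (by decide) (by decide) (by decide),
    wedge_summand a b _ _ (-1) ![1] ![0] (by decide) (by decide) (by decide)] at h
  have e1 : (![x, y] : Fin 2 → E) ∘ ![0] = ![x] := by ext i; fin_cases i; rfl
  have e2 : (![x, y] : Fin 2 → E) ∘ ![1] = ![y] := by ext i; fin_cases i; rfl
  simp only [Nat.reduceAdd] at h
  rw [e1, e2] at h
  norm_num at h
  linarith

lemma wedge_one_two (a : E [⋀^Fin 1]→L[ℝ] ℝ) (b : E [⋀^Fin 2]→L[ℝ] ℝ) (x y z : E) :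
    wedge a b ![x, y, z] = a ![x] * b ![y, z] - a ![y] * b ![x, z] + a ![z] * b ![x, y] := by
  have h := factorial_mul_wedge_apply a b ![x, y, z]
  let s1 : Equiv.Perm (Fin 1 ⊕ Fin 2) := Equiv.swap (Sum.inl 0) (Sum.inr 0)
  let s2 : Equiv.Perm (Fin 1 ⊕ Fin 2) := Equiv.swap (Sum.inr 0) (Sum.inr 1)
  have hu : (Finset.univ : Finset (Equiv.Perm (Fin 1 ⊕ Fin 2))) =
    {1, s1, s2, s1 * s2, s2 * s1, s1 * s2 * s1} := by decide
  rw [hu, Finset.sum_insert (by decide), Finset.sum_insert (by decide),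
    Finset.sum_insert (by decide), Finset.sum_insert (by decide), Finset.sum_pair (by decide),
    wedge_summand a b _ 1 1 ![0] ![1, 2] (by decide) (by decide) (by decide),
    wedge_summand a b _ s1 (-1) ![1] ![0, 2] (by decide) (by decide) (by decide),
    wedge_summand a b _ s2 (-1) ![0] ![2, 1] (by decide) (by decide) (by decide),
    wedge_summand a b _ (s1 * s2) 1 ![1] ![2, 0] (by decide) (by decide) (by decide),
    wedge_summand a b _ (s2 * s1) 1 ![2] ![0, 1] (by decide) (by decide) (by decide),
    wedge_summand a b _ (s1 * s2 * s1) (-1) ![2] ![1, 0] (by decide) (by decide) (by decide)] at h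
  have e1 : ∀ i, (![x, y, z] : Fin 3 → E) ∘ ![i] = ![(![x, y, z] : Fin 3 → E) i] := by
    intro i; ext k; fin_cases k; rfl
  have e2 : ∀ i j, (![x, y, z] : Fin 3 → E) ∘ ![i, j] =
      ![(![x, y, z] : Fin 3 → E) i, (![x, y, z] : Fin 3 → E) j] := by
    intro i j; ext k; fin_cases k <;> rfl
  simp only [Nat.reduceAdd] at h
  simp only [e1, e2] at h
  have s1 := swap_two b x y
  have s2 := swap_two b y z
  have s3 := swap_two b x z
  simp [Nat.factorial] at h
  rw [s1, s2, s3] at h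
  linarith

lemma wedge_two_one (a : E [⋀^Fin 2]→L[ℝ] ℝ) (b : E [⋀^Fin 1]→L[ℝ] ℝ) (x y z : E) :
    wedge a b ![x, y, z] = a ![x, y] * b ![z] - a ![x, z] * b ![y] + a ![y, z] * b ![x] := by
  have h := factorial_mul_wedge_apply a b ![x, y, z]
  let s1 : Equiv.Perm (Fin 2 ⊕ Fin 1) := Equiv.swap (Sum.inl 0) (Sum.inl 1)
  let s2 : Equiv.Perm (Fin 2 ⊕ Fin 1) := Equiv.swap (Sum.inl 1) (Sum.inr 0)
  have hu : (Finset.univ : Finset (Equiv.Perm (Fin 2 ⊕ Fin 1))) =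
    {1, s1, s2, s1 * s2, s2 * s1, s1 * s2 * s1} := by decide
  rw [hu, Finset.sum_insert (by decide), Finset.sum_insert (by decide),
    Finset.sum_insert (by decide), Finset.sum_insert (by decide), Finset.sum_pair (by decide),
    wedge_summand a b _ 1 1 ![0, 1] ![2] (by decide) (by decide) (by decide),
    wedge_summand a b _ s1 (-1) ![1, 0] ![2] (by decide) (by decide) (by decide),
    wedge_summand a b _ s2 (-1) ![0, 2] ![1] (by decide) (by decide) (by decide),
    wedge_summand a b _ (s1 * s2) 1 ![1, 2] ![0] (by decide) (by decide) (by decide),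
    wedge_summand a b _ (s2 * s1) 1 ![2, 0] ![1] (by decide) (by decide) (by decide),
    wedge_summand a b _ (s1 * s2 * s1) (-1) ![2, 1] ![0] (by decide) (by decide) (by decide)] at h
  have e1 : ∀ i, (![x, y, z] : Fin 3 → E) ∘ ![i] = ![(![x, y, z] : Fin 3 → E) i] := by
    intro i; ext k; fin_cases k; rfl
  have e2 : ∀ i j, (![x, y, z] : Fin 3 → E) ∘ ![i, j] =
      ![(![x, y, z] : Fin 3 → E) i, (![x, y, z] : Fin 3 → E) j] := by
    intro i j; ext k; fin_cases k <;> rfl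
  simp only [Nat.reduceAdd] at h
  simp only [e1, e2] at h
  have s1 := swap_two a x y
  have s2 := swap_two a y z
  have s3 := swap_two a x z
  simp [Nat.factorial] at h
  rw [s1, s2, s3] at h
  linarith

lemma wedge_three_zero (a : E [⋀^Fin 3]→L[ℝ] ℝ) (b : E [⋀^Fin 0]→L[ℝ] ℝ) (v : Fin 3 → E) :
    wedge a b v = a v * b ![] := by
  have h := factorial_mul_wedge_apply a b v
  have h1 : ∀ σ : Equiv.Perm (Fin 3 ⊕ Fin 0), ((Equiv.Perm.sign σ : ℤ) : ℝ) *
        (a (fun i => v (finSumFinEquiv (σ (Sum.inl i)))) *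
          b (fun i => v (finSumFinEquiv (σ (Sum.inr i))))) = a v * b ![] := by
    intro σ
    have hb : (fun i : Fin 0 => v (finSumFinEquiv (σ (Sum.inr i)))) = ![] := Subsingleton.elim _ _
    let τ : Equiv.Perm (Fin 3) := (Equiv.sumEmpty (Fin 3) (Fin 0)).permCongr σ
    have hτ : Equiv.Perm.sign τ = Equiv.Perm.sign σ := Equiv.Perm.sign_permCongr _ _
    have ha : (fun i => v (finSumFinEquiv (σ (Sum.inl i)))) = fun i => v (τ i) := by
      funext i
      congr 1
      change finSumFinEquiv (σ (Sum.inl i)) = Equiv.sumEmpty (Fin 3) (Fin 0) (σ (Sum.inl i))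
      rcases σ (Sum.inl i) with j | j
      · rfl
      · exact j.elim0
    have h2 := a.toAlternatingMap.map_perm v τ
    have h3 : a (fun i => v (τ i)) = Equiv.Perm.sign τ • a v := h2
    rw [hb, ha, h3, hτ]
    rcases Int.units_eq_one_or (Equiv.Perm.sign σ) with h | h <;> rw [h] <;> simp
  rw [Finset.sum_congr rfl fun σ _ => h1 σ] at h
  have hc : Fintype.card (Equiv.Perm (Fin 3 ⊕ Fin 0)) = 6 := by
    rw [Fintype.card_perm]; rfl
  simp only [Finset.sum_const, Finset.card_univ, hc, Nat.factorial] at h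
  norm_num at h
  linarith

end WedgeFormulas

end CSWZW

/-! ### Differential forms in local parametrizations -/

namespace CSWZW

section AlternatingSmooth

variable {F : Type*} [NormedAddCommGroup F] [NormedSpace ℝ F] [FiniteDimensional ℝ F]
  {G : Type*} [NormedAddCommGroup G] [NormedSpace ℝ G]
  {E : Type*} [NormedAddCommGroup E] [NormedSpace ℝ E]
  {k : ℕ} {n : WithTop ℕ∞}

/-- The values of an alternating map on tuples of basis vectors. -/
noncomputable def basisValues (F : Type*) [NormedAddCommGroup F] [NormedSpace ℝ F]
    [FiniteDimensional ℝ F] (k : ℕ) :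
    F [⋀^Fin k]→L[ℝ] ℝ →L[ℝ] ((Fin k → Fin (Module.finrank ℝ F)) → ℝ) :=
  ContinuousLinearMap.pi fun s =>
    (ContinuousMultilinearMap.apply ℝ (fun _ : Fin k => F) ℝ (fun i => Module.finBasis ℝ F (s i))) ∘L
      (ContinuousAlternatingMap.toContinuousMultilinearMapCLM ℝ)

lemma basisValues_injective : Function.Injective (basisValues F k) := by
  intro a b h
  apply ContinuousAlternatingMap.toAlternatingMap_injective
  apply AlternatingMap.coe_multilinearMap_injective
  refine Module.Basis.ext_multilinear (fun _ => Module.finBasis ℝ F) fun s => ?_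
  exact congrFun h s

instance finiteDimensional_alternating : FiniteDimensional ℝ (F [⋀^Fin k]→L[ℝ] ℝ) :=
  FiniteDimensional.of_injective (basisValues F k).toLinearMap basisValues_injective

/-- A family of alternating maps is smooth if its values are. -/
lemma contDiffWithinAt_alternating {a : G → F [⋀^Fin k]→L[ℝ] ℝ} {s : Set G} {x : G}
    (h : ∀ v : Fin k → F, ContDiffWithinAt ℝ n (fun y => a y v) s x) :
    ContDiffWithinAt ℝ n a s x := by
  obtain ⟨r, hr⟩ := (basisValues F k).toLinearMap.exists_leftInverse_of_injective
    (LinearMap.ker_eq_bot.2 basisValues_injective)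
  have h1 : a = fun y => LinearMap.toContinuousLinearMap r (basisValues F k (a y)) := by
    funext y
    exact (LinearMap.congr_fun hr (a y)).symm
  rw [h1]
  refine (LinearMap.toContinuousLinearMap r).contDiff.comp_contDiffWithinAt ?_
  rw [contDiffWithinAt_pi]
  exact fun s => h _

lemma contDiffWithinAt_compContinuousLinearMap {a : G → E [⋀^Fin k]→L[ℝ] ℝ} {g : G → F →L[ℝ] E}
    {s : Set G} {x : G} (ha : ContDiffWithinAt ℝ n a s x) (hg : ContDiffWithinAt ℝ n g s x) :
    ContDiffWithinAt ℝ n (fun y => (a y).compContinuousLinearMap (g y)) s x := by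
  refine contDiffWithinAt_alternating fun v => ?_
  have h1 : ContDiffWithinAt ℝ n
      (fun y => ContinuousMultilinearMap.compContinuousLinearMapContinuousMultilinear ℝ
        (fun _ : Fin k => F) (fun _ : Fin k => E) ℝ (fun _ => g y)) s x :=
    (ContinuousMultilinearMap.contDiff _).comp_contDiffWithinAt (contDiffWithinAt_pi.2 fun _ => hg)
  let L : E [⋀^Fin k]→L[ℝ] ℝ →L[ℝ] ContinuousMultilinearMap ℝ (fun _ : Fin k => E) ℝ :=
    ContinuousAlternatingMap.toContinuousMultilinearMapCLM ℝ
  have h2 : ContDiffWithinAt ℝ n (fun y => L (a y)) s x := L.contDiff.comp_contDiffWithinAt ha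
  exact (ContinuousMultilinearMap.apply ℝ (fun _ : Fin k => F) ℝ v).contDiff.comp_contDiffWithinAt
    (h1.clm_apply h2)

/-- The exterior derivative within a set commutes with pullbacks along maps that locally respect
the sets. -/
lemma extDerivWithin_pullback_of_eventually {α : F → F [⋀^Fin k]→L[ℝ] ℝ} {f : G → F}
    {s : Set G} {t : Set F} {x : G}
    (hα : DifferentiableWithinAt ℝ α t (f x)) (hf : ContDiffWithinAt ℝ ∞ f s x)
    (hs : UniqueDiffOn ℝ s)
    (hxc : x ∈ closure (interior s)) (hxs : x ∈ s) (hst : ∀ᶠ y in 𝓝[s] x, f y ∈ t) :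
    extDerivWithin (fun x ↦ (α (f x)).compContinuousLinearMap (fderivWithin ℝ f s x)) s x =
      (extDerivWithin α t (f x)).compContinuousLinearMap (fderivWithin ℝ f s x) := by
  obtain ⟨u, hu, hxu, hsub⟩ := mem_nhdsWithin.1 hst
  have hnhds : ∀ y ∈ u, u ∈ 𝓝 y := fun y hy => hu.mem_nhds hy
  have hd : ∀ y ∈ u, fderivWithin ℝ f s y = fderivWithin ℝ f (s ∩ u) y := fun y hy =>
    (fderivWithin_inter (hnhds y hy)).symm
  have hux : s ∩ u ∈ 𝓝[s] x := inter_mem self_mem_nhdsWithin (mem_nhdsWithin_of_mem_nhds (hnhds x hxu))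
  have h1 := extDerivWithin_pullback (f := f) (s := s ∩ u) (t := t) (x := x) (r := ∞) hα
    (hf.mono inter_subset_left) (by simpa using ENat.LEInfty.out) (hs.inter hu) (by
      rw [interior_inter, hu.interior_eq, inter_comm]
      exact hu.inter_closure ⟨hxu, hxc⟩) ⟨hxs, hxu⟩ (fun y hy => hsub ⟨hy.2, hy.1⟩)
  rw [hd x hxu, ← h1]
  have h2 : ∀ β : G → G [⋀^Fin k]→L[ℝ] ℝ, extDerivWithin β s x = extDerivWithin β (s ∩ u) x := by
    intro β
    rw [extDerivWithin, extDerivWithin, fderivWithin_inter (hnhds x hxu)]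
  rw [h2]
  refine extDerivWithin_congr (fun y hy => ?_) ?_
  · simp only [hd y hy.2]
  · simp only [hd x hxu]

end AlternatingSmooth

section Rep

variable {E : Type*} [NormedAddCommGroup E] [NormedSpace ℝ E] {H : Type*} [TopologicalSpace H]
  {I : ModelWithCorners ℝ E H} {M : Type*} [TopologicalSpace M] [ChartedSpace H M] {k : ℕ}
  {F : Type*} [NormedAddCommGroup F] [NormedSpace ℝ F]
  {F' : Type*} [NormedAddCommGroup F'] [NormedSpace ℝ F']

/-- The derivative within `R` of a parametrization `P` of a manifold by a vector space, as a map to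
the tangent space. -/
noncomputable def frame (I : ModelWithCorners ℝ E H) (P : F → M) (R : Set F) (z : F) : F →L[ℝ] E :=
  fderivWithin ℝ (extChartAt I (P z) ∘ P) R z

/-- The coordinate representation of a form in a parametrization; `chartRep` is the case of the
inverse of a chart. -/
noncomputable def rep (I : ModelWithCorners ℝ E H) (P : F → M) (R : Set F) (α : Form E M k) :
    F → F [⋀^Fin k]→L[ℝ] ℝ :=
  fun z => (α (P z)).compContinuousLinearMap (frame I P R z)

/-- `P` is a smooth map on `S`, a relatively open subset of a domain `R` with corners. -/
structure IsParam (I : ModelWithCorners ℝ E H) (P : F → M) (R S : Set F) : Prop where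
  uniqueDiffOn : UniqueDiffOn ℝ R
  subset_closure : R ⊆ closure (interior R)
  subset : S ⊆ R
  mem_nhds : ∀ z ∈ S, S ∈ 𝓝[R] z
  smooth : ∀ z ∈ S, ContMDiffWithinAt 𝓘(ℝ, F) I ∞ P R z

lemma chartRep_eq_rep (α : Form E M k) (x₀ : M) :
    chartRep I α x₀ = rep I (extChartAt I x₀).symm (range I) α := rfl

lemma rep_add (P : F → M) (R : Set F) (α β : Form E M k) :
    rep I P R (α + β) = rep I P R α + rep I P R β := by
  ext y v; simp [rep]

lemma rep_smul (P : F → M) (R : Set F) (c : M → ℝ) (α : Form E M k) (z : F) :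
    rep I P R (fun x => c x • α x) z = c (P z) • rep I P R α z := by
  ext v; simp [rep]

variable [IsManifold I ∞ M]

variable (I) in
lemma isParam_chart (x₀ : M) :
    IsParam I (extChartAt I x₀).symm (range I) (extChartAt I x₀).target where
  uniqueDiffOn := I.uniqueDiffOn
  subset_closure := I.range_subset_closure_interior
  subset := extChartAt_target_subset_range x₀
  mem_nhds z hz := extChartAt_target_mem_nhdsWithin_of_mem hz
  smooth z hz := (contMDiffOn_extChartAt_symm x₀ z hz).mono_of_mem_nhdsWithin
    (extChartAt_target_mem_nhdsWithin_of_mem hz)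

variable {P : F → M} {R S : Set F}

/-- A parametrization, read in a chart. -/
lemma IsParam.contDiffWithinAt (hP : IsParam I P R S) {z : F} (hz : z ∈ S) {x : M}
    (hx : P z ∈ (extChartAt I x).source) :
    ContDiffWithinAt ℝ ∞ (extChartAt I x ∘ P) R z := by
  have h := (hP.smooth z hz)
  rw [extChartAt_source] at hx
  exact contMDiffWithinAt_iff_contDiffWithinAt.1
    ((contMDiffWithinAt_iff_target_of_mem_source hx).1 h).2

lemma IsParam.differentiableWithinAt (hP : IsParam I P R S) {z : F} (hz : z ∈ S) :
    DifferentiableWithinAt ℝ (extChartAt I (P z) ∘ P) R z :=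
  (hP.contDiffWithinAt hz (mem_extChartAt_source (P z))).differentiableWithinAt (by simp)

omit [IsManifold I ∞ M] in
/-- The chain rule for frames. -/
lemma frame_comp {τ : F' → F} {R' : Set F'} {P' : F' → M} {z : F'}
    (hP : DifferentiableWithinAt ℝ (extChartAt I (P (τ z)) ∘ P) R (τ z))
    (hτ : DifferentiableWithinAt ℝ τ R' z) (hR' : UniqueDiffWithinAt ℝ R' z)
    (hm : ∀ᶠ z' in 𝓝[R'] z, τ z' ∈ R) (h : P' =ᶠ[𝓝[R'] z] P ∘ τ) (hz : z ∈ R') :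
    frame I P' R' z = (frame I P R (τ z)).comp (fderivWithin ℝ τ R' z) := by
  have h0 : P' z = P (τ z) := h.self_of_nhdsWithin hz
  have h1 : extChartAt I (P' z) ∘ P' =ᶠ[𝓝[R'] z] (extChartAt I (P (τ z)) ∘ P) ∘ τ := by
    filter_upwards [h] with y hy
    simp only [Function.comp_apply, hy, h0]
  rw [frame, h1.fderivWithin_eq (h1.self_of_nhdsWithin hz)]
  have ht : Tendsto τ (𝓝[R'] z) (𝓝[R] (τ z)) :=
    tendsto_nhdsWithin_iff.2 ⟨hτ.continuousWithinAt, hm⟩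
  exact (HasFDerivWithinAt.comp_of_tendsto z hP.hasFDerivWithinAt hτ.hasFDerivWithinAt ht).fderivWithin hR'

variable {τ : F' → F} {R' : Set F'} {P' : F' → M} {z : F'}

/-- Change of parametrization. -/
lemma IsParam.rep_eventuallyEq (hP : IsParam I P R S) (hτ : ContDiffWithinAt ℝ ∞ τ R' z)
    (hR' : UniqueDiffOn ℝ R') (hm : ∀ᶠ z' in 𝓝[R'] z, τ z' ∈ S)
    (h : P' =ᶠ[𝓝[R'] z] P ∘ τ) (hz : z ∈ R') (α : Form E M k) :
    rep I P' R' α =ᶠ[𝓝[R'] z] fun z' =>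
      (rep I P R α (τ z')).compContinuousLinearMap (fderivWithin ℝ τ R' z') := by
  have h1 : ∀ᶠ z' in 𝓝[R'] z, DifferentiableWithinAt ℝ τ R' z' := by
    have := (hτ.of_le (m := 1) (by simp)).eventually (by simp)
    rw [insert_eq_of_mem hz] at this
    filter_upwards [this] with y hy using hy.differentiableWithinAt (by simp)
  filter_upwards [h1, hm, eventually_eventually_nhdsWithin.2 hm,
    eventually_eventually_nhdsWithin.2 h, self_mem_nhdsWithin] with y hy1 hy2 hy3 hy4 hy5
  have h2 := frame_comp (hP.differentiableWithinAt hy2) hy1 (hR' y hy5)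
    (hy3.mono fun _ hw => hP.subset hw) hy4 hy5
  ext v
  simp only [rep, hy4.self_of_nhdsWithin hy5, Function.comp_apply, h2,
    ContinuousAlternatingMap.compContinuousLinearMap_apply]
  rfl

lemma IsParam.rep_apply (hP : IsParam I P R S) (hτ : DifferentiableWithinAt ℝ τ R' z)
    (hR' : UniqueDiffWithinAt ℝ R' z) (hm : ∀ᶠ z' in 𝓝[R'] z, τ z' ∈ S)
    (h : P' =ᶠ[𝓝[R'] z] P ∘ τ) (hz : z ∈ R') (α : Form E M k) :
    rep I P' R' α z =
      (rep I P R α (τ z)).compContinuousLinearMap (fderivWithin ℝ τ R' z) := by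
  have h2 := frame_comp (hP.differentiableWithinAt (hm.self_of_nhdsWithin hz)) hτ hR'
    (hm.mono fun _ hw => hP.subset hw) h hz
  ext v
  simp only [rep, h.self_of_nhdsWithin hz, Function.comp_apply, h2,
    ContinuousAlternatingMap.compContinuousLinearMap_apply]
  rfl

lemma IsParam.contDiffWithinAt_rep_comp [FiniteDimensional ℝ F'] [FiniteDimensional ℝ F]
    (hP : IsParam I P R S)
    (hτ : ContDiffWithinAt ℝ ∞ τ R' z)
    (hR' : UniqueDiffOn ℝ R') (hm : ∀ᶠ z' in 𝓝[R'] z, τ z' ∈ S)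
    (h : P' =ᶠ[𝓝[R'] z] P ∘ τ) (hz : z ∈ R') {α : Form E M k}
    (hα : ContDiffWithinAt ℝ ∞ (rep I P R α) R (τ z)) :
    ContDiffWithinAt ℝ ∞ (rep I P' R' α) R' z := by
  have ht : Tendsto τ (𝓝[R'] z) (𝓝[R] (τ z)) :=
    tendsto_nhdsWithin_iff.2 ⟨hτ.continuousWithinAt, hm.mono fun _ hw => hP.subset hw⟩
  refine ContDiffWithinAt.congr_of_eventuallyEq ?_ (hP.rep_eventuallyEq hτ hR' hm h hz α)
    ((hP.rep_eventuallyEq hτ hR' hm h hz α).self_of_nhdsWithin hz)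
  refine contDiffWithinAt_compContinuousLinearMap ?_ (hτ.fderivWithin_right hR' (by simp) hz)
  exact hα.comp_of_preimage_mem_nhdsWithin z hτ (ht self_mem_nhdsWithin)

lemma IsParam.extDerivWithin_rep_comp [FiniteDimensional ℝ F'] [FiniteDimensional ℝ F]
    (hP : IsParam I P R S)
    (hτ : ContDiffWithinAt ℝ ∞ τ R' z)
    (hR' : UniqueDiffOn ℝ R') (hm : ∀ᶠ z' in 𝓝[R'] z, τ z' ∈ S)
    (h : P' =ᶠ[𝓝[R'] z] P ∘ τ) (hz : z ∈ R') (hzc : z ∈ closure (interior R')) {α : Form E M k}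
    (hα : ContDiffWithinAt ℝ ∞ (rep I P R α) R (τ z)) :
    extDerivWithin (rep I P' R' α) R' z =
      (extDerivWithin (rep I P R α) R (τ z)).compContinuousLinearMap (fderivWithin ℝ τ R' z) := by
  rw [(hP.rep_eventuallyEq hτ hR' hm h hz α).extDerivWithin_eq_of_mem hz]
  exact extDerivWithin_pullback_of_eventually (hα.differentiableWithinAt (by simp)) hτ hR' hzc hz
    (hm.mono fun _ hw => hP.subset hw)

/-- A parametrization read in the chart at `x`, as data for a change of parametrization. -/
lemma IsParam.chart_transition (hP : IsParam I P R S) {z : F} (hz : z ∈ S) {x : M}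
    (hx : P z ∈ (extChartAt I x).source) :
    (∀ᶠ z' in 𝓝[R] z, (extChartAt I x ∘ P) z' ∈ (extChartAt I x).target) ∧
      P =ᶠ[𝓝[R] z] (extChartAt I x).symm ∘ (extChartAt I x ∘ P) := by
  have h1 : ∀ᶠ z' in 𝓝[R] z, P z' ∈ (extChartAt I x).source :=
    (hP.smooth z hz).continuousWithinAt.eventually ((isOpen_extChartAt_source x).mem_nhds hx)
  exact ⟨h1.mono fun y hy => (extChartAt I x).map_source hy,
    h1.mono fun y hy => ((extChartAt I x).left_inv hy).symm⟩

lemma IsParam.contDiffWithinAt_rep [FiniteDimensional ℝ E] [FiniteDimensional ℝ F]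
    (hP : IsParam I P R S) {α : Form E M k} (hα : IsSmoothForm I α) {z : F} (hz : z ∈ S) :
    ContDiffWithinAt ℝ ∞ (rep I P R α) R z := by
  have hx := mem_extChartAt_source (I := I) (P z)
  obtain ⟨h1, h2⟩ := hP.chart_transition hz hx
  exact (isParam_chart I (P z)).contDiffWithinAt_rep_comp (hP.contDiffWithinAt hz hx)
    hP.uniqueDiffOn h1 h2 (hP.subset hz) (hα.contDiffWithinAt ((extChartAt I (P z)).map_source hx))

/-- The exterior derivative may be computed in any parametrization. -/
lemma IsParam.rep_extD [FiniteDimensional ℝ E] [FiniteDimensional ℝ F]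
    (hP : IsParam I P R S) {α : Form E M k} (hα : IsSmoothForm I α) {z : F} (hz : z ∈ S) :
    rep I P R (extD I α) z = extDerivWithin (rep I P R α) R z := by
  have hx := mem_extChartAt_source (I := I) (P z)
  obtain ⟨h1, h2⟩ := hP.chart_transition hz hx
  have hd := hP.contDiffWithinAt hz hx
  rw [(isParam_chart I (P z)).extDerivWithin_rep_comp hd
    hP.uniqueDiffOn h1 h2 (hP.subset hz) (hP.subset_closure (hP.subset hz))
    (hα.contDiffWithinAt ((extChartAt I (P z)).map_source hx)),
    (isParam_chart I (P z)).rep_apply (hd.differentiableWithinAt (by simp))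
      (hP.uniqueDiffOn z (hP.subset hz)) h1 h2 (hP.subset hz), ← chartRep_eq_rep,
    Function.comp_apply, chartRep_extD hα ((extChartAt I (P z)).map_source hx)]
  rfl

/-- A smooth local inverse `Q` of the parametrization `P` near `x`. -/
structure IsLocalInverse (I : ModelWithCorners ℝ E H) (P : F → M) (S : Set F) (Q : M → F)
    (x : M) : Prop where
  smooth : ContMDiffAt I 𝓘(ℝ, F) ∞ Q x
  mem : ∀ᶠ x' in 𝓝 x, Q x' ∈ S
  right_inv : ∀ᶠ x' in 𝓝 x, P (Q x') = x'

omit [IsManifold I ∞ M] in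
lemma isLocalInverse_transition {Q : M → F} {x₀ : M} {y : E}
    (hy : y ∈ (extChartAt I x₀).target) (hQ : IsLocalInverse I P S Q ((extChartAt I x₀).symm y)) :
    (∀ᶠ y' in 𝓝[range I] y, (Q ∘ (extChartAt I x₀).symm) y' ∈ S) ∧
      (extChartAt I x₀).symm =ᶠ[𝓝[range I] y] P ∘ (Q ∘ (extChartAt I x₀).symm) := by
  have hc : Tendsto (extChartAt I x₀).symm (𝓝[range I] y) (𝓝 ((extChartAt I x₀).symm y)) :=
    ((continuousAt_extChartAt_symm'' hy).tendsto).mono_left nhdsWithin_le_nhds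
  exact ⟨hc.eventually hQ.mem, (hc.eventually hQ.right_inv).mono fun y hy => hy.symm⟩

lemma contDiffWithinAt_localInverse {Q : M → F} {x₀ : M} {y : E}
    (hy : y ∈ (extChartAt I x₀).target) (hQ : IsLocalInverse I P S Q ((extChartAt I x₀).symm y)) :
    ContDiffWithinAt ℝ ∞ (Q ∘ (extChartAt I x₀).symm) (range I) y := by
  have h2 := (isParam_chart I x₀).smooth y hy
  exact contMDiffWithinAt_iff_contDiffWithinAt.1 (hQ.smooth.comp_contMDiffWithinAt y h2)

/-- A form is smooth if it has smooth coordinate representations in suitable parametrizations. -/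
lemma isSmoothForm_of_rep [FiniteDimensional ℝ E] [FiniteDimensional ℝ F] {α : Form E M k}
    (h : ∀ x : M, ∃ (P : F → M) (R S : Set F) (Q : M → F), IsParam I P R S ∧
      IsLocalInverse I P S Q x ∧ ContDiffWithinAt ℝ ∞ (rep I P R α) R (Q x)) :
    IsSmoothForm I α := by
  intro x₀ y hy
  obtain ⟨P, R, S, Q, hP, hQ, hα⟩ := h ((extChartAt I x₀).symm y)
  obtain ⟨h1, h2⟩ := isLocalInverse_transition hy hQ
  exact (hP.contDiffWithinAt_rep_comp (contDiffWithinAt_localInverse hy hQ) I.uniqueDiffOn h1 h2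
    (extChartAt_target_subset_range x₀ hy) hα).mono (extChartAt_target_subset_range x₀)

/-- Two forms agree at a point if their representations in a parametrization agree. -/
lemma IsParam.eq_of_rep_eq (hP : IsParam I P R S) {Q : M → F} {x : M}
    (hQ : IsLocalInverse I P S Q x) {α β : Form E M k} (h : rep I P R α (Q x) = rep I P R β (Q x)) :
    α x = β x := by
  have hy := mem_extChartAt_target (I := I) x
  have hQ' : IsLocalInverse I P S Q ((extChartAt I x).symm (extChartAt I x x)) := by
    rwa [extChartAt_to_inv]
  obtain ⟨h1, h2⟩ := isLocalInverse_transition hy hQ'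
  have hd := (contDiffWithinAt_localInverse hy hQ').differentiableWithinAt (by simp)
  have h3 : ∀ γ : Form E M k, chartRep I γ x (extChartAt I x x) = γ x := by
    intro γ
    have : chartFrame I x (extChartAt I x x) = ContinuousLinearMap.id ℝ E := by
      have he : extChartAt I ((extChartAt I x).symm (extChartAt I x x)) ∘ (extChartAt I x).symm
          =ᶠ[𝓝[range I] (extChartAt I x x)] id := by
        rw [extChartAt_to_inv]
        filter_upwards [extChartAt_target_mem_nhdsWithin x] with y hy
          using (extChartAt I x).right_inv hy
      rw [chartFrame, he.fderivWithin_eq (he.self_of_nhdsWithin (mem_range_self _)),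
        fderivWithin_id]
      exact I.uniqueDiffOn _ (by simp)
    rw [chartRep, this, extChartAt_to_inv]
    ext v; rfl
  rw [← h3 α, ← h3 β, chartRep_eq_rep, chartRep_eq_rep,
    hP.rep_apply hd (I.uniqueDiffOn _ (mem_range_self _)) h1 h2 (mem_range_self _),
    hP.rep_apply hd (I.uniqueDiffOn _ (mem_range_self _)) h1 h2 (mem_range_self _),
    Function.comp_apply, extChartAt_to_inv, h]

end Rep

end CSWZW

/-! ### Parametric integrals on domains with boundary -/

namespace CSWZW

section Parametric

variable {X : Type} [NormedAddCommGroup X] [NormedSpace ℝ X] {R U : Set X} {K : Set ℝ}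

/-- A function continuous on `ℝ × V` is equicontinuous along `K × {x}` for compact `K`. -/
lemma eventually_forall_norm_sub_le {G : Type*} [NormedAddCommGroup G] {V : Set X}
    {f : ℝ × X → G} (hf : ContinuousOn f (univ ×ˢ V)) (hK : IsCompact K) {x : X} (hx : x ∈ V)
    {ε : ℝ} (hε : 0 < ε) : ∀ᶠ y in 𝓝[V] x, ∀ s ∈ K, ‖f (s, y) - f (s, x)‖ ≤ ε := by
  have h : ∀ s ∈ K, ∀ᶠ p : X × ℝ in 𝓝[V] x ×ˢ 𝓝 s, ‖f (p.2, p.1) - f (p.2, x)‖ ≤ ε := by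
    intro s _
    have h1 : Tendsto (fun p : X × ℝ => f (p.2, p.1)) (𝓝[V] x ×ˢ 𝓝 s) (𝓝 (f (s, x))) := by
      refine (hf (s, x) ⟨mem_univ _, hx⟩).tendsto.comp ?_
      rw [nhdsWithin_prod_eq, nhdsWithin_univ]
      exact Tendsto.prodMk tendsto_snd tendsto_fst
    have h2 : Tendsto (fun p : X × ℝ => f (p.2, x)) (𝓝[V] x ×ˢ 𝓝 s) (𝓝 (f (s, x))) := by
      refine (hf (s, x) ⟨mem_univ _, hx⟩).tendsto.comp ?_
      rw [nhdsWithin_prod_eq, nhdsWithin_univ]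
      refine Tendsto.prodMk tendsto_snd ?_
      exact tendsto_nhdsWithin_iff.2 ⟨tendsto_const_nhds, Eventually.of_forall fun _ => hx⟩
    have h3 := (h1.sub h2).norm
    rw [sub_self, norm_zero] at h3
    exact h3.eventually (ge_mem_nhds hε)
  have := hK.eventually_forall_of_forall_eventually (x₀ := x) (P := fun y s =>
    y ∈ V → ‖f (s, y) - f (s, x)‖ ≤ ε) (fun s hs => by
      have h4 := h s hs
      have h5 : 𝓝[V] x ×ˢ 𝓝 s = 𝓝[V ×ˢ univ] (x, s) := by
        rw [nhdsWithin_prod_eq, nhdsWithin_univ]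
      rw [h5, eventually_nhdsWithin_iff] at h4
      filter_upwards [h4] with p hp hpV
      exact hp ⟨hpV, mem_univ _⟩)
  rw [eventually_nhdsWithin_iff]
  filter_upwards [this] with y hy hyV s hs using hy s hs hyV

variable {G : Type} [NormedAddCommGroup G] [NormedSpace ℝ G]

lemma integrableOn_of_continuousOn {V : Set X} {f : ℝ × X → G} (hf : ContinuousOn f (univ ×ˢ V))
    (hK : IsCompact K) {x : X} (hx : x ∈ V) : IntegrableOn (fun s => f (s, x)) K := by
  refine ContinuousOn.integrableOn_compact hK ?_
  exact hf.comp (by fun_prop) fun s _ => ⟨mem_univ _, hx⟩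

/-- The derivative of `f (s, x)` with respect to `x`, within `V`. -/
noncomputable def partialDeriv (V : Set X) (f : ℝ × X → G) (p : ℝ × X) : X →L[ℝ] G :=
  (fderivWithin ℝ f (univ ×ˢ V) p).comp (ContinuousLinearMap.inr ℝ ℝ X)

lemma contDiffOn_partialDeriv {V : Set X} (hV : UniqueDiffOn ℝ V) {f : ℝ × X → G}
    (hf : ContDiffOn ℝ ∞ f (univ ×ˢ V)) : ContDiffOn ℝ ∞ (partialDeriv V f) (univ ×ˢ V) :=
  (hf.fderivWithin (uniqueDiffOn_univ.prod hV) (by simp)).clm_comp contDiffOn_const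

lemma hasFDerivWithinAt_partialDeriv {V : Set X} {f : ℝ × X → G}
    (hf : ContDiffOn ℝ ∞ f (univ ×ˢ V)) {s : ℝ} {x : X} (hx : x ∈ V) :
    HasFDerivWithinAt (fun y => f (s, y)) (partialDeriv V f (s, x)) V x := by
  have h1 := ((hf (s, x) ⟨mem_univ _, hx⟩).differentiableWithinAt (by simp)).hasFDerivWithinAt
  have h2 : HasFDerivWithinAt (fun y : X => (s, y)) (ContinuousLinearMap.inr ℝ ℝ X) V x :=
    (hasFDerivAt_prodMk_right s x).hasFDerivWithinAt
  exact h1.comp x h2 fun y hy => ⟨mem_univ _, hy⟩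

variable [CompleteSpace G]

/-- Differentiation under the integral sign within a relatively open subset of a convex set. -/
lemma hasFDerivWithinAt_integral (hR : Convex ℝ R) (hU : IsOpen U)
    (hRU : UniqueDiffOn ℝ (R ∩ U)) (hK : IsCompact K) {f : ℝ × X → G}
    (hf : ContDiffOn ℝ ∞ f (univ ×ˢ (R ∩ U))) {x : X} (hx : x ∈ R ∩ U) :
    HasFDerivWithinAt (fun y => ∫ s in K, f (s, y))
      (∫ s in K, partialDeriv (R ∩ U) f (s, x)) (R ∩ U) x := by
  have hc := (contDiffOn_partialDeriv hRU hf).continuousOn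
  rw [hasFDerivWithinAt_iff_isLittleO, Asymptotics.isLittleO_iff]
  intro c hc0
  set m := (volume K).toReal with hm
  have hm0 : 0 ≤ m := ENNReal.toReal_nonneg
  have hε : 0 < c / (m + 1) := by positivity
  have h1 := eventually_forall_norm_sub_le hc hK hx hε
  obtain ⟨δ, hδ, hball⟩ := Metric.mem_nhdsWithin_iff.1 h1
  obtain ⟨δ', hδ', hball'⟩ := Metric.isOpen_iff.1 hU x hx.2
  have hsub : Metric.ball x (min δ δ') ∩ R ⊆ R ∩ U := fun y hy =>
    ⟨hy.2, hball' (Metric.ball_subset_ball (min_le_right _ _) hy.1)⟩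
  have hconv : Convex ℝ (Metric.ball x (min δ δ') ∩ R) := (convex_ball _ _).inter hR
  have hmem : Metric.ball x (min δ δ') ∩ (R ∩ U) ∈ 𝓝[R ∩ U] x :=
    inter_mem (mem_nhdsWithin_of_mem_nhds (Metric.ball_mem_nhds x (lt_min hδ hδ')))
      self_mem_nhdsWithin
  filter_upwards [hmem] with y hy
  have hxin : x ∈ Metric.ball x (min δ δ') ∩ R := ⟨Metric.mem_ball_self (lt_min hδ hδ'), hx.1⟩
  have hyin : y ∈ Metric.ball x (min δ δ') ∩ R := ⟨hy.1, hy.2.1⟩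
  have hpt : ∀ s ∈ K, ‖f (s, y) - f (s, x) - partialDeriv (R ∩ U) f (s, x) (y - x)‖ ≤
      c / (m + 1) * ‖y - x‖ := by
    intro s hs
    refine hconv.norm_image_sub_le_of_norm_hasFDerivWithin_le' (f := fun y => f (s, y))
      (f' := fun y => partialDeriv (R ∩ U) f (s, y)) (fun z hz =>
        (hasFDerivWithinAt_partialDeriv hf (hsub hz)).mono hsub) (fun z hz => ?_) hxin hyin
    exact hball ⟨Metric.ball_subset_ball (min_le_left _ _) hz.1, hsub hz⟩ s hs
  have hi1 := integrableOn_of_continuousOn hf.continuousOn hK hy.2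
  have hi2 := integrableOn_of_continuousOn hf.continuousOn hK hx
  have hi3 := integrableOn_of_continuousOn hc hK hx
  rw [ContinuousLinearMap.integral_apply hi3 (y - x), ← integral_sub hi1 hi2,
    ← integral_sub (f := fun s => f (s, y) - f (s, x)) (hi1.sub hi2)
      (hi3.apply_continuousLinearMap _)]
  refine (norm_setIntegral_le_of_norm_le_const hK.measure_lt_top (fun s hs => hpt s hs)).trans ?_
  have h4 : volume.real K = m := rfl
  rw [h4, mul_right_comm]
  refine mul_le_mul_of_nonneg_right ?_ (norm_nonneg _)
  rw [div_mul_eq_mul_div, div_le_iff₀ (by positivity)]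
  nlinarith

/-- Parametric integrals over compact sets are smooth up to the boundary. -/
lemma contDiffOn_integral (hR : Convex ℝ R) (hU : IsOpen U)
    (hRU : UniqueDiffOn ℝ (R ∩ U)) (hK : IsCompact K) {f : ℝ × X → G}
    (hf : ContDiffOn ℝ ∞ f (univ ×ˢ (R ∩ U))) :
    ContDiffOn ℝ ∞ (fun y => ∫ s in K, f (s, y)) (R ∩ U) := by
  rw [contDiffOn_infty]
  intro n
  induction n generalizing G with
  | zero =>
    exact contDiffOn_zero.2 fun x hx =>
      (hasFDerivWithinAt_integral hR hU hRU hK hf hx).continuousWithinAt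
  | succ n ih =>
    push_cast
    rw [contDiffOn_succ_iff_hasFDerivWithinAt_of_uniqueDiffOn hRU]
    exact ⟨by simp, _, ih (contDiffOn_partialDeriv hRU hf), fun x hx =>
      hasFDerivWithinAt_integral hR hU hRU hK hf hx⟩

end Parametric

end CSWZW

/-! ### Integration of forms along a translation -/

namespace CSWZW

section Shift

variable {F : Type} [NormedAddCommGroup F] [NormedSpace ℝ F] {k : ℕ}

/-- Cartan's formula at a point: `D` plays the role of the derivative of a form. -/
lemma alternatizeUncurryFin_curryLeft_add (D : F →L[ℝ] F [⋀^Fin (k + 1)]→L[ℝ] ℝ) (e : F) :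
    ContinuousAlternatingMap.alternatizeUncurryFin
        (((ContinuousAlternatingMap.curryLeftLI (𝕜 := ℝ) (E := F) (F := ℝ) (n := k)
          ).toContinuousLinearMap.flip e).comp D)
      + (ContinuousAlternatingMap.alternatizeUncurryFin D).curryLeft e = D e := by
  ext v
  rw [ContinuousAlternatingMap.add_apply, ContinuousAlternatingMap.curryLeft_apply_apply,
    ContinuousAlternatingMap.alternatizeUncurryFin_apply,
    ContinuousAlternatingMap.alternatizeUncurryFin_apply, Fin.sum_univ_succ (n := k + 1)]
  have h0 : Fin.removeNth 0 (Matrix.vecCons e v) = v := by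
    ext i; rfl
  have h1 : ∀ i : Fin (k + 1), Fin.removeNth i.succ (Matrix.vecCons e v) =
      Matrix.vecCons e (Fin.removeNth i v) := by
    intro i
    ext j
    refine Fin.cases ?_ (fun j => ?_) j
    · simp [Fin.removeNth]
    · simp [Fin.removeNth]
  simp only [Matrix.cons_val_zero, h0, Matrix.cons_val_succ, h1, Fin.val_zero, pow_zero, one_smul,
    Fin.val_succ, pow_succ, mul_neg, mul_one, neg_smul, Finset.sum_neg_distrib]
  rw [add_left_comm]
  exact add_eq_left.2 (add_neg_cancel _)

lemma curryLeft_alternatizeUncurryFin_zero (D : F →L[ℝ] F [⋀^Fin 0]→L[ℝ] ℝ) (e : F) :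
    (ContinuousAlternatingMap.alternatizeUncurryFin D).curryLeft e = D e := by
  ext v
  rw [ContinuousAlternatingMap.curryLeft_apply_apply,
    ContinuousAlternatingMap.alternatizeUncurryFin_apply, Fin.sum_univ_succ]
  simp

/-- The integral over `s ∈ A` of the contraction with `e` of the translates `a (z + s e)`. -/
noncomputable def shiftInt (A : Set ℝ) (e : F) (a : F → F [⋀^Fin (k + 1)]→L[ℝ] ℝ) :
    F → F [⋀^Fin k]→L[ℝ] ℝ :=
  fun z => ∫ s in A, (a (z + s • e)).curryLeft e

/-- Locally uniformly in `z ∈ S`, the function `s ↦ a (z + s e)` has compact support. -/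
def CompactAlong {G : Type*} [Zero G] (e : F) (S : Set F) (a : F → G) : Prop :=
  ∀ z ∈ S, ∃ K : Set ℝ, IsCompact K ∧ ∃ V : Set F, IsOpen V ∧ z ∈ V ∧
    ∀ z' ∈ S ∩ V, ∀ s ∉ K, a (z' + s • e) = 0

variable {R U : Set F} {e : F} {a : F → F [⋀^Fin (k + 1)]→L[ℝ] ℝ}

lemma CompactAlong.shiftInt_eq (h : CompactAlong e (R ∩ U) a) {A : Set ℝ} (hA : IsClosed A) {z : F}
    (hz : z ∈ R ∩ U) : ∃ K : Set ℝ, IsCompact K ∧ ∃ V : Set F, IsOpen V ∧ z ∈ V ∧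
      ∀ z' ∈ R ∩ (U ∩ V), (∀ s ∉ K, a (z' + s • e) = 0) ∧
        shiftInt A e a z' = ∫ s in A ∩ K, (a (z' + s • e)).curryLeft e := by
  obtain ⟨K, hK, V, hV, hzV, h0⟩ := h z hz
  refine ⟨K, hK, V, hV, hzV, fun z' hz' => ?_⟩
  have h1 := h0 z' ⟨⟨hz'.1, hz'.2.1⟩, hz'.2.2⟩
  refine ⟨h1, ?_⟩
  refine setIntegral_eq_of_subset_of_forall_sdiff_eq_zero hA.measurableSet inter_subset_left
    fun s hs => ?_
  rw [h1 s fun h => hs.2 ⟨hs.1, h⟩]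
  rfl

/-- A relatively open subset `R ∩ U` of a convex set that is invariant under translations by
multiples of `e`. -/
structure IsShiftDomain (e : F) (R U : Set F) : Prop where
  convex : Convex ℝ R
  uniqueDiffOn : UniqueDiffOn ℝ R
  isOpen : IsOpen U
  add_mem : ∀ z ∈ R ∩ U, ∀ s : ℝ, z + s • e ∈ R ∩ U

variable [FiniteDimensional ℝ F]

/-- The integrand of `shiftInt` as a function of both variables. -/
lemma IsShiftDomain.contDiffOn_integrand (hD : IsShiftDomain e R U)
    (ha : ContDiffOn ℝ ∞ a (R ∩ U)) :
    ContDiffOn ℝ ∞ (fun p : ℝ × F => (a (p.2 + p.1 • e)).curryLeft e) (univ ×ˢ (R ∩ U)) := by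
  have h1 : ContDiffOn ℝ ∞ (fun p : ℝ × F => a (p.2 + p.1 • e)) (univ ×ˢ (R ∩ U)) :=
    ha.comp (by fun_prop) fun p hp => hD.add_mem _ hp.2 _
  exact (((ContinuousAlternatingMap.curryLeftLI (𝕜 := ℝ) (E := F) (F := ℝ) (n := k)
    ).toContinuousLinearMap.flip e).contDiff).comp_contDiffOn h1

lemma IsShiftDomain.contDiffOn_shiftInt (hD : IsShiftDomain e R U)
    (ha : ContDiffOn ℝ ∞ a (R ∩ U)) (hc : CompactAlong e (R ∩ U) a) {A : Set ℝ} (hA : IsClosed A) :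
    ContDiffOn ℝ ∞ (shiftInt A e a) (R ∩ U) := by
  intro z hz
  obtain ⟨K, hK, V, hV, hzV, h⟩ := hc.shiftInt_eq hA hz
  have hUV := hD.isOpen.inter hV
  have h1 := contDiffOn_integral (K := A ∩ K) hD.convex hUV (hD.uniqueDiffOn.inter hUV)
    (hK.inter_left hA) ((hD.contDiffOn_integrand ha).mono fun p hp => ⟨hp.1, hp.2.1, hp.2.2.1⟩)
  have h2 : ContDiffOn ℝ ∞ (shiftInt A e a) (R ∩ (U ∩ V)) := h1.congr fun z' hz' => (h z' hz').2
  refine (h2 z ⟨hz.1, hz.2, hzV⟩).mono_of_mem_nhdsWithin ?_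
  rw [← inter_assoc]
  exact inter_mem_nhdsWithin _ (hV.mem_nhds hzV)

/-- The derivative of a form along the direction of translation. -/
lemma IsShiftDomain.hasDerivAt (hD : IsShiftDomain e R U) {G : Type*} [NormedAddCommGroup G]
    [NormedSpace ℝ G] {a : F → G}
    (ha : ContDiffOn ℝ ∞ a (R ∩ U)) {z : F} (hz : z ∈ R ∩ U) (s : ℝ) :
    HasDerivAt (fun s : ℝ => a (z + s • e)) (fderivWithin ℝ a (R ∩ U) (z + s • e) e) s := by
  have h1 := ((ha _ (hD.add_mem z hz s)).differentiableWithinAt (by simp)).hasFDerivWithinAt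
  have h2 : HasDerivWithinAt (fun s : ℝ => z + s • e) e univ s := by
    have := (((hasDerivAt_id s).smul_const e).const_add z).hasDerivWithinAt (s := univ)
    simpa using this
  exact hasDerivWithinAt_univ.1
    (h1.comp_hasDerivWithinAt s h2 fun s _ => hD.add_mem z hz s)

lemma IsShiftDomain.continuous_fderivWithin (hD : IsShiftDomain e R U) {G : Type*}
    [NormedAddCommGroup G] [NormedSpace ℝ G] {a : F → G}
    (ha : ContDiffOn ℝ ∞ a (R ∩ U)) {z : F} (hz : z ∈ R ∩ U) :
    Continuous fun s : ℝ => fderivWithin ℝ a (R ∩ U) (z + s • e) :=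
  (ha.continuousOn_fderivWithin (hD.uniqueDiffOn.inter hD.isOpen) (by simp)).comp_continuous
    (by fun_prop) fun s => hD.add_mem z hz s

lemma integrable_restrict_of_continuous {G : Type*} [NormedAddCommGroup G] {f : ℝ → G} {K : Set ℝ}
    (hf : Continuous f) (hK : IsCompact K) : Integrable f (volume.restrict K) :=
  hf.continuousOn.integrableOn_compact hK

lemma integrable_and_integral_clm {G G' : Type*} [NormedAddCommGroup G] [NormedSpace ℝ G]
    [CompleteSpace G] [NormedAddCommGroup G'] [NormedSpace ℝ G'] [CompleteSpace G'] (L : G →L[ℝ] G')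
    {f : ℝ → G} {μ : Measure ℝ} (hf : Integrable f μ) :
    Integrable (fun s => L (f s)) μ ∧ L (∫ s, f s ∂μ) = ∫ s, L (f s) ∂μ :=
  ⟨L.integrable_comp hf, (L.integral_comp_comm hf).symm⟩

/-- Cartan's formula for the integral over translates. -/
lemma IsShiftDomain.extDerivWithin_shiftInt (hD : IsShiftDomain e R U)
    (ha : ContDiffOn ℝ ∞ a (R ∩ U)) (hc : CompactAlong e (R ∩ U) a) {A : Set ℝ} (hA : IsClosed A)
    {z : F} (hz : z ∈ R ∩ U) :
    extDerivWithin (shiftInt A e a) (R ∩ U) z + shiftInt A e (extDerivWithin a (R ∩ U)) z =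
      ∫ s in A, fderivWithin ℝ a (R ∩ U) (z + s • e) e := by
  obtain ⟨K, hK, V, hV, hzV, h⟩ := hc.shiftInt_eq hA hz
  have hUV := hD.isOpen.inter hV
  have hzUV : z ∈ R ∩ (U ∩ V) := ⟨hz.1, hz.2, hzV⟩
  have hsub : R ∩ (U ∩ V) ⊆ R ∩ U := fun y hy => ⟨hy.1, hy.2.1⟩
  have hu := hD.uniqueDiffOn.inter hD.isOpen
  have hu' := hD.uniqueDiffOn.inter hUV
  have hf := (hD.contDiffOn_integrand ha).mono (t := univ ×ˢ (R ∩ (U ∩ V)))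
    fun p hp => ⟨hp.1, hsub hp.2⟩
  have h1 := hasFDerivWithinAt_integral (K := A ∩ K) hD.convex hUV hu' (hK.inter_left hA) hf hzUV
  set L := (ContinuousAlternatingMap.curryLeftLI (𝕜 := ℝ) (E := F) (F := ℝ) (n := k)
    ).toContinuousLinearMap.flip e with hL
  set D := fun s : ℝ => fderivWithin ℝ a (R ∩ U) (z + s • e) with hDdef
  have hDc : Continuous D := hD.continuous_fderivWithin ha hz
  have hp : ∀ s, partialDeriv (R ∩ (U ∩ V)) (fun p : ℝ × F => (a (p.2 + p.1 • e)).curryLeft e) (s, z)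
      = L.comp (D s) := by
    intro s
    have h2 := hasFDerivWithinAt_partialDeriv hf (s := s) hzUV
    have h3 := ((ha _ (hD.add_mem z hz s)).differentiableWithinAt (by simp)).hasFDerivWithinAt
    have h4 : HasFDerivWithinAt (fun y : F => y + s • e) (ContinuousLinearMap.id ℝ F)
        (R ∩ (U ∩ V)) z := ((hasFDerivAt_id z).add_const _).hasFDerivWithinAt
    have h5 := (L.hasFDerivAt.comp_hasFDerivWithinAt _ h3).comp z h4
      fun y hy => hD.add_mem y (hsub hy) s
    exact (hu' z hzUV).eq h2 h5
  have h6 : HasFDerivWithinAt (shiftInt A e a) (∫ s in A ∩ K, L.comp (D s)) (R ∩ (U ∩ V)) z := by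
    simp only [hp] at h1
    exact h1.congr (fun y hy => (h y hy).2) (h z hzUV).2
  have h7 : fderivWithin ℝ (shiftInt A e a) (R ∩ U) z = ∫ s in A ∩ K, L.comp (D s) := by
    rw [← h6.fderivWithin (hu' z hzUV), ← inter_assoc, fderivWithin_inter (hV.mem_nhds hzV)]
  have hint := integrable_restrict_of_continuous
    (G := F →L[ℝ] F [⋀^Fin (k + 1)]→L[ℝ] ℝ) hDc (hK.inter_left hA)
  have hz0 : ∀ s ∈ A \ (A ∩ K), D s = 0 := by
    intro s hs
    have hsK : s ∉ K := fun h' => hs.2 ⟨hs.1, h'⟩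
    have h8 : a =ᶠ[𝓝[R ∩ U] (z + s • e)] fun _ => 0 := by
      have h9 : ∀ᶠ y in 𝓝 (z + s • e), y - s • e ∈ V := by
        have : Tendsto (fun y => y - s • e) (𝓝 (z + s • e)) (𝓝 z) := by
          have h10 : Continuous fun y : F => y - s • e := by fun_prop
          simpa using h10.tendsto (z + s • e)
        exact this (hV.mem_nhds hzV)
      filter_upwards [mem_nhdsWithin_of_mem_nhds h9, self_mem_nhdsWithin] with y hy hyR
      have h11 : y - s • e ∈ R ∩ U := by
        have := hD.add_mem y hyR (-s)
        rwa [neg_smul, ← sub_eq_add_neg] at this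
      simpa using (h (y - s • e) ⟨h11.1, h11.2, hy⟩).1 s hsK
    rw [hDdef]
    simp only
    rw [h8.fderivWithin_eq (h8.self_of_nhdsWithin (hD.add_mem z hz s)), fderivWithin_fun_const]
    rfl
  have h12 : shiftInt A e (extDerivWithin a (R ∩ U)) z =
      ∫ s in A ∩ K, (ContinuousAlternatingMap.alternatizeUncurryFin (D s)).curryLeft e := by
    refine setIntegral_eq_of_subset_of_forall_sdiff_eq_zero hA.measurableSet inter_subset_left
      fun s hs => ?_
    change (ContinuousAlternatingMap.alternatizeUncurryFin (D s)).curryLeft e = 0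
    rw [hz0 s hs]
    ext v
    simp [ContinuousAlternatingMap.alternatizeUncurryFin_apply]
  have h13 : ∫ s in A, fderivWithin ℝ a (R ∩ U) (z + s • e) e = ∫ s in A ∩ K, D s e := by
    refine setIntegral_eq_of_subset_of_forall_sdiff_eq_zero hA.measurableSet inter_subset_left
      fun s hs => ?_
    change D s e = 0
    rw [hz0 s hs]
    rfl
  let T := (ContinuousAlternatingMap.alternatizeUncurryFinCLM (n := k) ℝ F ℝ)
  let T' := (ContinuousAlternatingMap.alternatizeUncurryFinCLM (n := k + 1) ℝ F ℝ)
  let L' := (ContinuousAlternatingMap.curryLeftLI (𝕜 := ℝ) (E := F) (F := ℝ) (n := k + 1)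
    ).toContinuousLinearMap.flip e
  let PL := ContinuousLinearMap.compL ℝ F (F [⋀^Fin (k + 1)]→L[ℝ] ℝ) (F [⋀^Fin k]→L[ℝ] ℝ) L
  have hi0 := (integrable_and_integral_clm (G := F →L[ℝ] F [⋀^Fin (k + 1)]→L[ℝ] ℝ)
    (G' := F →L[ℝ] F [⋀^Fin k]→L[ℝ] ℝ) PL hint).1
  have hi1 := integrable_and_integral_clm (G := F →L[ℝ] F [⋀^Fin k]→L[ℝ] ℝ)
    (G' := F [⋀^Fin (k + 1)]→L[ℝ] ℝ) T hi0
  have hi2 := (integrable_and_integral_clm (G := F [⋀^Fin (k + 1 + 1)]→L[ℝ] ℝ)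
    (G' := F [⋀^Fin (k + 1)]→L[ℝ] ℝ) L' (integrable_and_integral_clm
      (G := F →L[ℝ] F [⋀^Fin (k + 1)]→L[ℝ] ℝ) (G' := F [⋀^Fin (k + 1 + 1)]→L[ℝ] ℝ) T' hint).1).1
  have h14 : extDerivWithin (shiftInt A e a) (R ∩ U) z = ∫ s in A ∩ K, T (PL (D s)) := by
    refine Eq.trans ?_ hi1.2
    change T _ = _
    rw [h7]
    rfl
  rw [h14, h12, h13]
  refine (integral_add hi1.1 hi2).symm.trans ?_
  refine integral_congr_ae (Eventually.of_forall fun s => ?_)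
  exact alternatizeUncurryFin_curryLeft_add (D s) e

/-- The integral over all translates of the derivative vanishes. -/
lemma IsShiftDomain.integral_fderivWithin (hD : IsShiftDomain e R U) {a : F → F [⋀^Fin k]→L[ℝ] ℝ}
    (ha : ContDiffOn ℝ ∞ a (R ∩ U)) (hc : CompactAlong e (R ∩ U) a) {z : F} (hz : z ∈ R ∩ U) :
    (∫ s in (univ : Set ℝ), fderivWithin ℝ a (R ∩ U) (z + s • e) e) = 0 ∧
    (∫ s in Iic (0 : ℝ), fderivWithin ℝ a (R ∩ U) (z + s • e) e) = a z := by
  obtain ⟨K, hK, V, hV, hzV, h⟩ := hc z hz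
  have hd := hD.hasDerivAt ha hz
  have h0 : ∀ s ∉ K, a (z + s • e) = 0 := h z ⟨hz, hzV⟩
  have hsupp : HasCompactSupport fun s : ℝ => a (z + s • e) := HasCompactSupport.intro hK h0
  have hsupp' : HasCompactSupport fun s : ℝ => fderivWithin ℝ a (R ∩ U) (z + s • e) e := by
    have h1 := hsupp.deriv
    have h2 : deriv (fun s : ℝ => a (z + s • e)) =
        fun s => fderivWithin ℝ a (R ∩ U) (z + s • e) e := funext fun s => (hd s).deriv
    rwa [h2] at h1
  have hcont : Continuous fun s : ℝ => fderivWithin ℝ a (R ∩ U) (z + s • e) e :=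
    (hD.continuous_fderivWithin ha hz).clm_apply continuous_const
  have hint := hcont.integrable_of_hasCompactSupport (μ := volume) hsupp'
  have hcont' : Continuous fun s : ℝ => a (z + s • e) :=
    continuous_iff_continuousAt.2 fun s => (hd s).continuousAt
  have hbot : Tendsto (fun s : ℝ => a (z + s • e)) atBot (𝓝 0) :=
    hsupp.is_zero_at_infty.mono_left atBot_le_cocompact
  refine ⟨?_, ?_⟩
  · rw [setIntegral_univ]
    exact integral_eq_zero_of_hasDerivAt_of_integrable hd hint
      (hcont'.integrable_of_hasCompactSupport hsupp)
  · rw [integral_Iic_of_hasDerivAt_of_tendsto' (fun s _ => hd s) hint.integrableOn hbot]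
    simp

lemma shiftInt_extDerivWithin_zero {a : F → F [⋀^Fin 0]→L[ℝ] ℝ} (A : Set ℝ) (S : Set F) (z : F) :
    shiftInt A e (extDerivWithin a S) z = ∫ s in A, fderivWithin ℝ a S (z + s • e) e := by
  simp only [shiftInt, extDerivWithin, curryLeft_alternatizeUncurryFin_zero]

lemma shiftInt_univ_add (a : F → F [⋀^Fin (k + 1)]→L[ℝ] ℝ) (z : F) (r : ℝ) :
    shiftInt univ e a (z + r • e) = shiftInt univ e a z := by
  simp only [shiftInt, setIntegral_univ]
  have := integral_add_right_eq_self (μ := volume) (fun s : ℝ => (a (z + s • e)).curryLeft e) r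
  rw [← this]
  simp only [add_smul, add_assoc, add_comm (r • e)]

/-- The integrand of `shiftInt` is integrable. -/
lemma IsShiftDomain.integrable (hD : IsShiftDomain e R U)
    (ha : ContDiffOn ℝ ∞ a (R ∩ U)) (hc : CompactAlong e (R ∩ U) a) {z : F} (hz : z ∈ R ∩ U) :
    Integrable fun s : ℝ => (a (z + s • e)).curryLeft e := by
  obtain ⟨K, hK, V, hV, hzV, h⟩ := hc z hz
  have h0 : ∀ s ∉ K, a (z + s • e) = 0 := h z ⟨hz, hzV⟩
  have hcont' : Continuous fun s : ℝ => a (z + s • e) :=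
    continuous_iff_continuousAt.2 fun s => (hD.hasDerivAt ha hz s).continuousAt
  refine Continuous.integrable_of_hasCompactSupport ?_ (HasCompactSupport.intro hK fun s hs => ?_)
  · exact (((ContinuousAlternatingMap.curryLeftLI (𝕜 := ℝ) (E := F) (F := ℝ) (n := k)
      ).toContinuousLinearMap.flip e).continuous).comp hcont'
  · simp [h0 s hs]

end Shift

end CSWZW

/-! ### Derivatives of maps between manifolds -/

namespace CSWZW

section Frame

variable {E : Type*} [NormedAddCommGroup E] [NormedSpace ℝ E] {H : Type*} [TopologicalSpace H]
  {I : ModelWithCorners ℝ E H} {M : Type*} [TopologicalSpace M] [ChartedSpace H M]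
  {E' : Type*} [NormedAddCommGroup E'] [NormedSpace ℝ E'] {H' : Type*} [TopologicalSpace H']
  {I' : ModelWithCorners ℝ E' H'} {M' : Type*} [TopologicalSpace M'] [ChartedSpace H' M']
  {E'' : Type*} [NormedAddCommGroup E''] [NormedSpace ℝ E''] {H'' : Type*} [TopologicalSpace H'']
  {I'' : ModelWithCorners ℝ E'' H''} {M'' : Type*} [TopologicalSpace M''] [ChartedSpace H'' M'']
  {F : Type*} [NormedAddCommGroup F] [NormedSpace ℝ F]

/-- `D` is the derivative of `f` within `s` at `x`, the tangent spaces being identified with the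
model spaces. -/
def HasDer (I : ModelWithCorners ℝ E H) (I' : ModelWithCorners ℝ E' H') (f : M → M') (s : Set M)
    (x : M) (D : E →L[ℝ] E') : Prop :=
  HasMFDerivWithinAt I I' f s x D

lemma HasDer.comp {g : M' → M''} {f : M → M'} {s : Set M} {u : Set M'} {x : M}
    {D' : E' →L[ℝ] E''} {D : E →L[ℝ] E'} (hg : HasDer I' I'' g u (f x) D')
    (hf : HasDer I I' f s x D) (h : MapsTo f s u) : HasDer I I'' (g ∘ f) s x (D'.comp D) :=
  HasMFDerivWithinAt.comp x hg hf h

lemma HasDer.mono {f : M → M'} {s u : Set M} {x : M} {D : E →L[ℝ] E'}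
    (hf : HasDer I I' f u x D) (h : s ⊆ u) : HasDer I I' f s x D :=
  HasMFDerivWithinAt.mono hf h

lemma HasDer.congr {f g : M → M'} {s : Set M} {x : M} {D : E →L[ℝ] E'}
    (hf : HasDer I I' f s x D) (h : g =ᶠ[𝓝[s] x] f) (hx : x ∈ s) : HasDer I I' g s x D :=
  HasMFDerivWithinAt.congr_of_eventuallyEq hf h (h.self_of_nhdsWithin hx)

lemma HasDer.eq {f : M → M'} {s : Set M} {x : M} {D D' : E →L[ℝ] E'}
    (hf : HasDer I I' f s x D) (hf' : HasDer I I' f s x D') (hs : UniqueMDiffWithinAt I s x) :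
    D = D' :=
  UniqueMDiffWithinAt.eq hs hf hf'

lemma hasDer_id {s : Set M} {x : M} : HasDer I I id s x (ContinuousLinearMap.id ℝ E) :=
  (hasMFDerivAt_id x).hasMFDerivWithinAt

lemma hasDer_of_hasFDerivWithinAt {f : F → E} {s : Set F} {x : F} {D : F →L[ℝ] E}
    (hf : HasFDerivWithinAt f D s x) : HasDer 𝓘(ℝ, F) 𝓘(ℝ, E) f s x D :=
  hf.hasMFDerivWithinAt

lemma hasDer_tangentAt {f : M → M'} {x : M} (hf : MDifferentiableAt I I' f x) (s : Set M) :
    HasDer I I' f s x (tangentAt I I' f x) :=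
  hf.hasMFDerivAt.hasMFDerivWithinAt

lemma HasDer.tangentAt_eq {f : M → M'} {x : M} {D : E →L[ℝ] E'} (hf : HasDer I I' f univ x D) :
    tangentAt I I' f x = D :=
  (hasMFDerivWithinAt_univ.1 hf).mfderiv

lemma hasDer_frame {P : F → M} {R : Set F} {z : F}
    (hP : MDifferentiableWithinAt 𝓘(ℝ, F) I P R z) :
    HasDer 𝓘(ℝ, F) I P R z (frame I P R z) := by
  have h : mfderivWithin 𝓘(ℝ, F) I P R z = fderivWithin ℝ (extChartAt I (P z) ∘ P) R z := by
    rw [hP.mfderivWithin]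
    simp only [mfld_simps]
    rfl
  have h1 := hP.hasMFDerivWithinAt
  rw [h] at h1
  exact h1

lemma IsParam.hasDer {P : F → M} {R S : Set F} (hP : IsParam I P R S) {z : F}
    (hz : z ∈ S) : HasDer 𝓘(ℝ, F) I P R z (frame I P R z) :=
  hasDer_frame ((hP.smooth z hz).mdifferentiableWithinAt (by simp))

lemma IsParam.uniqueMDiffWithinAt {P : F → M} {R S : Set F} (hP : IsParam I P R S) {z : F}
    (hz : z ∈ S) : UniqueMDiffWithinAt 𝓘(ℝ, F) R z :=
  (hP.uniqueDiffOn z (hP.subset hz)).uniqueMDiffWithinAt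

/-- The frame of a parametrization with a smooth two-sided local inverse is invertible. -/
lemma IsParam.exists_frame_equiv {P : F → M} {R S : Set F} (hP : IsParam I P R S) {z : F}
    (hz : z ∈ S) {Q : M → F} (hQ : IsLocalInverse I P S Q (P z)) (hQP : ∀ z' ∈ S, Q (P z') = z') :
    ∃ L : F ≃L[ℝ] E, (L : F →L[ℝ] E) = frame I P R z ∧
      (L.symm : E →L[ℝ] F) = tangentAt I 𝓘(ℝ, F) Q (P z) := by
  have h1 := hasDer_tangentAt (hQ.smooth.mdifferentiableAt (by simp)) univ
  have h2 := hP.hasDer hz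
  have h3 := h1.comp h2 (mapsTo_univ _ _)
  have h4 : HasDer 𝓘(ℝ, F) 𝓘(ℝ, F) (Q ∘ P) R z (ContinuousLinearMap.id ℝ F) := by
    refine hasDer_id.congr ?_ (hP.subset hz)
    filter_upwards [hP.mem_nhds z hz] with y hy using hQP y hy
  have h5 := h3.eq h4 (hP.uniqueMDiffWithinAt hz)
  have h6 : HasDer 𝓘(ℝ, F) I P R (Q (P z)) (frame I P R z) := by
    rwa [hQP z hz]
  obtain ⟨V, hV, hVo, hzV⟩ := eventually_nhds_iff.1 (hQ.mem.and hQ.right_inv)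
  have h7 := h6.comp (h1.mono (subset_univ V)) fun x hx => hP.subset (hV x hx).1
  have h8 : HasDer I I (P ∘ Q) V (P z) (ContinuousLinearMap.id ℝ E) := by
    refine hasDer_id.congr ?_ hzV
    filter_upwards [self_mem_nhdsWithin] with y hy using (hV y hy).2
  have h9 := h7.eq h8 (hVo.uniqueMDiffOn (P z) hzV)
  exact ⟨ContinuousLinearEquiv.equivOfInverse (frame I P R z) (tangentAt I 𝓘(ℝ, F) Q (P z))
    (fun v => congrArg (fun L => L v) h5) (fun v => congrArg (fun L => L v) h9), rfl, rfl⟩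

variable [IsManifold I ∞ M]

lemma isLocalInverse_chart (x₀ : M) {x : M} (hx : x ∈ (extChartAt I x₀).source) :
    IsLocalInverse I (extChartAt I x₀).symm (extChartAt I x₀).target (extChartAt I x₀) x where
  smooth := contMDiffAt_extChartAt' (by rwa [extChartAt_source] at hx)
  mem := by
    filter_upwards [(isOpen_extChartAt_source x₀).mem_nhds hx] with y hy
      using (extChartAt I x₀).map_source hy
  right_inv := by
    filter_upwards [(isOpen_extChartAt_source x₀).mem_nhds hx] with y hy
      using (extChartAt I x₀).left_inv hy

lemma hasDer_chartFrame {x₀ : M} {y : E} (hy : y ∈ (extChartAt I x₀).target) :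
    HasDer 𝓘(ℝ, E) I (extChartAt I x₀).symm (range I) y (chartFrame I x₀ y) :=
  (isParam_chart I x₀).hasDer hy

lemma exists_chartFrame_equiv {x₀ : M} {y : E} (hy : y ∈ (extChartAt I x₀).target) :
    ∃ L : E ≃L[ℝ] E, (L : E →L[ℝ] E) = chartFrame I x₀ y ∧
      (L.symm : E →L[ℝ] E) = tangentAt I 𝓘(ℝ, E) (extChartAt I x₀) ((extChartAt I x₀).symm y) :=
  (isParam_chart I x₀).exists_frame_equiv hy
    (isLocalInverse_chart x₀ ((extChartAt I x₀).map_target hy))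
    fun _ hz => (extChartAt I x₀).right_inv hz

end Frame

end CSWZW

/-! ### Equivariant time functions and tubes -/

namespace CSWZW

variable {E : Type} [NormedAddCommGroup E] [NormedSpace ℝ E] {H : Type} [TopologicalSpace H]
  {I : ModelWithCorners ℝ E H} {M : Type u} [TopologicalSpace M] [ChartedSpace H M]
  {W : Type} [NormedAddCommGroup W] [NormedSpace ℝ W] {H' : Type} [TopologicalSpace H']
  {J : ModelWithCorners ℝ W H'}

/-- A global smooth trivialization of the principal `ℝ`-bundle `M → B`: an equivariant function
`t` and the section `σ` with image `{t = 0}`. -/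
structure EquivariantTime (Θ : SmoothFlow I M) (J : ModelWithCorners ℝ W H')
    [ChartedSpace H' Θ.Base] where
  t : M → ℝ
  σ : Θ.Base → M
  smooth_proj : ContMDiff I J ∞ Θ.proj
  smooth_t : ContMDiff I 𝓘(ℝ, ℝ) ∞ t
  smooth_σ : ContMDiff J I ∞ σ
  t_toFun : ∀ s x, t (Θ.toFun s x) = t x + s
  proj_σ : ∀ b, Θ.proj (σ b) = b
  t_σ : ∀ b, t (σ b) = 0

namespace EquivariantTime

variable {Θ : SmoothFlow I M} [ChartedSpace H' Θ.Base] (T : EquivariantTime Θ J)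

lemma toFun_σ (x : M) : Θ.toFun (T.t x) (T.σ (Θ.proj x)) = x := by
  obtain ⟨s, hs⟩ := Quotient.exact (T.proj_σ (Θ.proj x))
  have h := T.t_toFun s (T.σ (Θ.proj x))
  rw [hs, T.t_σ, zero_add] at h
  rw [h, hs]

/-- The tube over the chart at `b₀`. -/
noncomputable def tube (b₀ : Θ.Base) (z : ℝ × W) : M :=
  Θ.toFun z.1 (T.σ ((extChartAt J b₀).symm z.2))

/-- The inverse of the tube over the chart at `b₀`. -/
noncomputable def tubeInv (b₀ : Θ.Base) (x : M) : ℝ × W := (T.t x, extChartAt J b₀ (Θ.proj x))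

variable (J) in
/-- The model of a tube. -/
def tubeRange : Set (ℝ × W) := univ ×ˢ range J

variable (J) in
/-- The domain of the tube over the chart at `b₀`. -/
def tubeDomain (b₀ : Θ.Base) : Set (ℝ × W) := univ ×ˢ (extChartAt J b₀).target

variable (J) in
/-- An open set cutting out `tubeDomain` from `tubeRange`. -/
def tubeOpen (b₀ : Θ.Base) : Set (ℝ × W) := univ ×ˢ (J.symm ⁻¹' (chartAt H' b₀).target)

variable (J) in
lemma tubeRange_inter (b₀ : Θ.Base) : tubeRange J ∩ tubeOpen J b₀ = tubeDomain J b₀ := by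
  rw [tubeRange, tubeOpen, tubeDomain, prod_inter_prod, univ_inter, extChartAt_target, inter_comm]

variable (J) in
lemma isShiftDomain_tube (b₀ : Θ.Base) :
    IsShiftDomain ((1, 0) : ℝ × W) (tubeRange J) (tubeOpen J b₀) where
  convex := convex_univ.prod J.convex_range
  uniqueDiffOn := uniqueDiffOn_univ.prod J.uniqueDiffOn
  isOpen := isOpen_univ.prod ((chartAt H' b₀).open_target.preimage J.continuous_symm)
  add_mem z hz s := by
    rw [tubeRange_inter] at hz ⊢
    exact ⟨mem_univ _, by simpa using hz.2⟩

lemma proj_tube {b₀ : Θ.Base} (z : ℝ × W) :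
    Θ.proj (T.tube b₀ z) = (extChartAt J b₀).symm z.2 := by
  rw [tube, Θ.proj_toFun, T.proj_σ]

lemma t_tube {b₀ : Θ.Base} (z : ℝ × W) : T.t (T.tube b₀ z) = z.1 := by
  rw [tube, T.t_toFun, T.t_σ, zero_add]

lemma tube_add (b₀ : Θ.Base) (z : ℝ × W) (s : ℝ) :
    T.tube b₀ (z + s • ((1, 0) : ℝ × W)) = Θ.toFun s (T.tube b₀ z) := by
  simp [tube, add_comm z.1 s, Θ.map_add]

lemma tubeInv_tube {b₀ : Θ.Base} {z : ℝ × W} (hz : z ∈ tubeDomain J b₀) :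
    T.tubeInv b₀ (T.tube b₀ z) = z := by
  rw [tubeInv, T.proj_tube, T.t_tube, (extChartAt J b₀).right_inv hz.2]

lemma tube_tubeInv {b₀ : Θ.Base} {x : M} (hx : Θ.proj x ∈ (extChartAt J b₀).source) :
    T.tube b₀ (T.tubeInv b₀ x) = x := by
  rw [tubeInv, tube, (extChartAt J b₀).left_inv hx, T.toFun_σ]

lemma tubeInv_mem {b₀ : Θ.Base} {x : M} (hx : Θ.proj x ∈ (extChartAt J b₀).source) :
    T.tubeInv b₀ x ∈ tubeDomain J b₀ :=
  ⟨mem_univ _, (extChartAt J b₀).map_source hx⟩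

variable [IsManifold J ∞ Θ.Base] [IsManifold I ∞ M]

omit [IsManifold I ∞ M] in
lemma contMDiffWithinAt_tube {b₀ : Θ.Base} {z : ℝ × W} (hz : z ∈ tubeDomain J b₀) :
    ContMDiffWithinAt 𝓘(ℝ, ℝ × W) I ∞ (T.tube b₀) (tubeRange J) z := by
  have h1 := (isParam_chart J b₀).smooth z.2 hz.2
  have h2 : ContMDiffWithinAt 𝓘(ℝ, ℝ × W) 𝓘(ℝ, W) ∞ (Prod.snd : ℝ × W → W) (tubeRange J) z :=
    (contDiff_snd.contMDiff z).contMDiffWithinAt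
  have h3 : ContMDiffWithinAt 𝓘(ℝ, ℝ × W) 𝓘(ℝ, ℝ) ∞ (Prod.fst : ℝ × W → ℝ) (tubeRange J) z :=
    (contDiff_fst.contMDiff z).contMDiffWithinAt
  have h4 := (T.smooth_σ _).comp_contMDiffWithinAt z (h1.comp z h2 fun y hy => hy.2)
  exact (Θ.smooth _).comp_contMDiffWithinAt z (h3.prodMk h4)

omit [IsManifold I ∞ M] in
lemma isParam_tube (b₀ : Θ.Base) : IsParam I (T.tube b₀) (tubeRange J) (tubeDomain J b₀) where
  uniqueDiffOn := (isShiftDomain_tube J b₀).uniqueDiffOn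
  subset_closure := by
    rintro z hz
    rw [tubeRange, interior_prod_eq, closure_prod_eq, interior_univ, closure_univ]
    exact ⟨mem_univ _, J.range_subset_closure_interior hz.2⟩
  subset z hz := ⟨mem_univ _, extChartAt_target_subset_range b₀ hz.2⟩
  mem_nhds z hz := by
    rw [← tubeRange_inter] at hz ⊢
    exact inter_mem_nhdsWithin _ ((isShiftDomain_tube J b₀).isOpen.mem_nhds hz.2)
  smooth z hz := T.contMDiffWithinAt_tube hz

omit [IsManifold I ∞ M] in
lemma isLocalInverse_tube {b₀ : Θ.Base} {x : M} (hx : Θ.proj x ∈ (extChartAt J b₀).source) :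
    IsLocalInverse I (T.tube b₀) (tubeDomain J b₀) (T.tubeInv b₀) x where
  smooth := by
    have h1 : ContMDiffAt I 𝓘(ℝ, W) ∞ (extChartAt J b₀ ∘ Θ.proj) x :=
      (contMDiffAt_extChartAt' (by rwa [extChartAt_source] at hx)).comp x (T.smooth_proj x)
    exact (T.smooth_t x).prodMk_space h1
  mem := by
    filter_upwards [Θ.continuous_proj.continuousAt.preimage_mem_nhds
      ((isOpen_extChartAt_source (I := J) b₀).mem_nhds hx)] with y hy using T.tubeInv_mem hy
  right_inv := by
    filter_upwards [Θ.continuous_proj.continuousAt.preimage_mem_nhds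
      ((isOpen_extChartAt_source (I := J) b₀).mem_nhds hx)] with y hy using T.tube_tubeInv hy

/-- The frame of a tube. -/
noncomputable abbrev tubeFrame (b₀ : Θ.Base) (z : ℝ × W) : ℝ × W →L[ℝ] E :=
  frame I (T.tube b₀) (tubeRange J) z

omit [IsManifold I ∞ M] in
lemma tubeDomain_add {b₀ : Θ.Base} {z : ℝ × W} (hz : z ∈ tubeDomain J b₀) (s : ℝ) :
    z + s • ((1, 0) : ℝ × W) ∈ tubeDomain J b₀ := by
  rw [← tubeRange_inter] at hz ⊢
  exact (isShiftDomain_tube J b₀).add_mem z hz s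

omit [IsManifold I ∞ M] [IsManifold J ∞ Θ.Base] in
lemma proj_tube_mem {b₀ : Θ.Base} {z : ℝ × W} (hz : z ∈ tubeDomain J b₀) :
    Θ.proj (T.tube b₀ z) ∈ (extChartAt J b₀).source := by
  rw [T.proj_tube]
  exact (extChartAt J b₀).map_target hz.2

omit [IsManifold I ∞ M] in
lemma exists_tubeFrame_equiv {b₀ : Θ.Base} {z : ℝ × W} (hz : z ∈ tubeDomain J b₀) :
    ∃ L : (ℝ × W) ≃L[ℝ] E, (L : ℝ × W →L[ℝ] E) = T.tubeFrame b₀ z := by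
  obtain ⟨L, hL, -⟩ := (T.isParam_tube b₀).exists_frame_equiv hz
    (T.isLocalInverse_tube (T.proj_tube_mem hz)) fun z' hz' => T.tubeInv_tube hz'
  exact ⟨L, hL⟩

omit [IsManifold I ∞ M] [IsManifold J ∞ Θ.Base] [ChartedSpace H' Θ.Base] in
lemma _root_.CSWZW.SmoothFlow.contMDiff_toFun (Θ : SmoothFlow I M) (s : ℝ) :
    ContMDiff I I ∞ (Θ.toFun s) :=
  Θ.smooth.comp (contMDiff_const.prodMk contMDiff_id)

omit [IsManifold I ∞ M] [IsManifold J ∞ Θ.Base] [ChartedSpace H' Θ.Base] in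
lemma _root_.CSWZW.SmoothFlow.contMDiff_orbit (Θ : SmoothFlow I M) (x : M) :
    ContMDiff 𝓘(ℝ, ℝ) I ∞ fun s => Θ.toFun s x :=
  Θ.smooth.comp (contMDiff_id.prodMk contMDiff_const)

omit [IsManifold I ∞ M] in
/-- In a tube, the flow is a translation. -/
lemma tangentAt_comp_tubeFrame {b₀ : Θ.Base} {z : ℝ × W} (hz : z ∈ tubeDomain J b₀) (s : ℝ) :
    (tangentAt I I (Θ.toFun s) (T.tube b₀ z)).comp (T.tubeFrame b₀ z) =
      T.tubeFrame b₀ (z + s • ((1, 0) : ℝ × W)) := by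
  have h1 := (hasDer_tangentAt ((Θ.contMDiff_toFun s).mdifferentiable (by simp) (T.tube b₀ z))
    univ).comp ((T.isParam_tube b₀).hasDer hz) (mapsTo_univ _ _)
  have h2 : HasDer 𝓘(ℝ, ℝ × W) 𝓘(ℝ, ℝ × W) (fun z : ℝ × W => z + s • ((1, 0) : ℝ × W))
      (tubeRange J) z (ContinuousLinearMap.id ℝ _) :=
    hasDer_of_hasFDerivWithinAt ((hasFDerivAt_id z).add_const _).hasFDerivWithinAt
  have h3 := HasDer.comp (f := fun z : ℝ × W => z + s • ((1, 0) : ℝ × W))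
    ((T.isParam_tube b₀).hasDer (tubeDomain_add hz s)) h2 fun y hy =>
      ⟨mem_univ _, by simpa using hy.2⟩
  have h4 : T.tube b₀ ∘ (fun z : ℝ × W => z + s • ((1, 0) : ℝ × W)) =
      Θ.toFun s ∘ T.tube b₀ := funext fun y => T.tube_add b₀ y s
  rw [h4] at h3
  exact h1.eq h3 ((T.isParam_tube b₀).uniqueMDiffWithinAt hz)

omit [IsManifold I ∞ M] in
lemma velocity_tube {b₀ : Θ.Base} {z : ℝ × W} (hz : z ∈ tubeDomain J b₀) (s : ℝ) :
    Θ.velocity s (T.tube b₀ z) = T.tubeFrame b₀ (z + s • ((1, 0) : ℝ × W)) (1, 0) := by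
  have h2 : HasDer 𝓘(ℝ, ℝ) 𝓘(ℝ, ℝ × W) (fun s : ℝ => z + s • ((1, 0) : ℝ × W)) univ s
      ((ContinuousLinearMap.id ℝ ℝ).smulRight ((1, 0) : ℝ × W)) := by
    refine hasDer_of_hasFDerivWithinAt ?_
    have := (((hasFDerivAt_id (𝕜 := ℝ) s).smul_const ((1, 0) : ℝ × W)).const_add z).hasFDerivWithinAt
      (s := univ)
    exact this
  have h3 := HasDer.comp (f := fun s : ℝ => z + s • ((1, 0) : ℝ × W))
    ((T.isParam_tube b₀).hasDer (tubeDomain_add hz s)) h2 fun y _ =>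
      (T.isParam_tube b₀).subset (tubeDomain_add hz y)
  have h4 : T.tube b₀ ∘ (fun s : ℝ => z + s • ((1, 0) : ℝ × W)) =
      fun s => Θ.toFun s (T.tube b₀ z) := funext fun y => T.tube_add b₀ z y
  rw [h4] at h3
  rw [SmoothFlow.velocity, h3.tangentAt_eq]
  simp

omit [IsManifold I ∞ M] in
/-- In a tube, the quotient map is the projection to the second factor. -/
lemma tangentAt_proj_comp_tubeFrame {b₀ : Θ.Base} {z : ℝ × W} (hz : z ∈ tubeDomain J b₀) :
    (tangentAt I J Θ.proj (T.tube b₀ z)).comp (T.tubeFrame b₀ z) =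
      (chartFrame J b₀ z.2).comp (ContinuousLinearMap.snd ℝ ℝ W) := by
  have h1 := (hasDer_tangentAt (T.smooth_proj.mdifferentiable (by simp) (T.tube b₀ z))
    univ).comp ((T.isParam_tube b₀).hasDer hz) (mapsTo_univ _ _)
  have h2 : HasDer 𝓘(ℝ, ℝ × W) 𝓘(ℝ, W) (Prod.snd : ℝ × W → W) (tubeRange J) z
      (ContinuousLinearMap.snd ℝ ℝ W) :=
    hasDer_of_hasFDerivWithinAt hasFDerivAt_snd.hasFDerivWithinAt
  have h3 := (hasDer_chartFrame (I := J) hz.2).comp h2 fun y hy => hy.2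
  have h4 : (extChartAt J b₀).symm ∘ (Prod.snd : ℝ × W → W) = Θ.proj ∘ T.tube b₀ :=
    funext fun y => (T.proj_tube y).symm
  rw [h4] at h3
  exact h1.eq h3 ((T.isParam_tube b₀).uniqueMDiffWithinAt hz)

end EquivariantTime

end CSWZW

/-! ### Fiber integration and the Green's homotopies in tubes -/

namespace CSWZW

section CurryLeft

variable {E : Type*} [NormedAddCommGroup E] [NormedSpace ℝ E] {k : ℕ}

/-- The contraction of an alternating map with `v` only depends on its arguments modulo `v`. -/
lemma curryLeft_apply_congr (A : E [⋀^Fin (k + 1)]→L[ℝ] ℝ) (v : E) {w w' : Fin k → E}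
    (h : ∀ i, ∃ r : ℝ, w i = w' i + r • v) : A.curryLeft v w = A.curryLeft v w' := by
  choose r hr using h
  have key : ∀ S : Finset (Fin k),
      A.curryLeft v (fun i => if i ∈ S then w i else w' i) = A.curryLeft v w' := by
    intro S
    induction S using Finset.induction_on with
    | empty => simp
    | insert j S hj ih =>
      set u : Fin k → E := fun i => if i ∈ S then w i else w' i with hu
      have h1 : (fun i => if i ∈ insert j S then w i else w' i) =
          Function.update u j (u j + r j • v) := by
        ext i
        by_cases hij : i = j
        · subst hij
          simp [hu, hj, hr]
        · simp [hu, hij]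
      have h2 : A.curryLeft v (Function.update u j v) = 0 := by
        rw [ContinuousAlternatingMap.curryLeft_apply_apply]
        exact A.map_eq_zero_of_eq _ (i := 0) (j := j.succ) (by simp) (Fin.succ_ne_zero j).symm
      rw [h1, ContinuousAlternatingMap.map_update_add, ContinuousAlternatingMap.map_update_smul, h2,
        smul_zero, add_zero, Function.update_eq_self, ih]
  have := key Finset.univ
  simpa using this

lemma curryLeft_compContinuousLinearMap {F : Type*} [NormedAddCommGroup F] [NormedSpace ℝ F]
    (A : E [⋀^Fin (k + 1)]→L[ℝ] ℝ) (L : F →L[ℝ] E) (v : F) :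
    (A.compContinuousLinearMap L).curryLeft v =
      (A.curryLeft (L v)).compContinuousLinearMap L := by
  ext w
  simp only [ContinuousAlternatingMap.curryLeft_apply_apply,
    ContinuousAlternatingMap.compContinuousLinearMap_apply]
  congr 1
  ext i
  refine Fin.cases ?_ (fun j => ?_) i <;> simp

lemma compContinuousLinearMap_comp {F G : Type*} [NormedAddCommGroup F] [NormedSpace ℝ F]
    [NormedAddCommGroup G] [NormedSpace ℝ G]
    (A : E [⋀^Fin k]→L[ℝ] ℝ) (L : F →L[ℝ] E) (L' : G →L[ℝ] F) :
    (A.compContinuousLinearMap L).compContinuousLinearMap L' =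
      A.compContinuousLinearMap (L.comp L') := rfl

lemma compContinuousLinearMap_equiv_symm {F : Type*} [NormedAddCommGroup F] [NormedSpace ℝ F]
    (A : E [⋀^Fin k]→L[ℝ] ℝ) (L : F ≃L[ℝ] E) :
    (A.compContinuousLinearMap (L : F →L[ℝ] E)).compContinuousLinearMap
      (L.symm : E →L[ℝ] F) = A := by
  ext v
  simp [ContinuousAlternatingMap.compContinuousLinearMap_apply, Function.comp_def]

lemma compContinuousLinearMap_equiv {F : Type*} [NormedAddCommGroup F] [NormedSpace ℝ F]
    (A : F [⋀^Fin k]→L[ℝ] ℝ) (L : F ≃L[ℝ] E) :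
    (A.compContinuousLinearMap (L.symm : E →L[ℝ] F)).compContinuousLinearMap
      (L : F →L[ℝ] E) = A := by
  ext v
  simp [ContinuousAlternatingMap.compContinuousLinearMap_apply, Function.comp_def]

end CurryLeft

lemma integral_compContinuousLinearMap {E F : Type} [NormedAddCommGroup E] [NormedSpace ℝ E]
    [FiniteDimensional ℝ E] [NormedAddCommGroup F] [NormedSpace ℝ F] [FiniteDimensional ℝ F] {k : ℕ}
    {f : ℝ → E [⋀^Fin k]→L[ℝ] ℝ} {μ : Measure ℝ} (hf : Integrable f μ) (L : F →L[ℝ] E) :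
    (∫ s, f s ∂μ).compContinuousLinearMap L = ∫ s, (f s).compContinuousLinearMap L ∂μ :=
  (integrable_and_integral_clm (ContinuousAlternatingMap.compContinuousLinearMapCLM L) hf).2

lemma extDerivWithin_inter {F : Type*} [NormedAddCommGroup F] [NormedSpace ℝ F] {k : ℕ}
    {a : F → F [⋀^Fin k]→L[ℝ] ℝ} {R U : Set F} (hU : IsOpen U) {z : F} (hz : z ∈ U) :
    extDerivWithin a (R ∩ U) z = extDerivWithin a R z := by
  rw [extDerivWithin, extDerivWithin, fderivWithin_inter (hU.mem_nhds hz)]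

variable {E : Type} [NormedAddCommGroup E] [NormedSpace ℝ E] [FiniteDimensional ℝ E]
  {H : Type} [TopologicalSpace H]
  {I : ModelWithCorners ℝ E H} {M : Type u} [TopologicalSpace M] [ChartedSpace H M]
  {W : Type} [NormedAddCommGroup W] [NormedSpace ℝ W] [FiniteDimensional ℝ W]
  {H' : Type} [TopologicalSpace H'] {J : ModelWithCorners ℝ W H'}

/-- The integral of `Θ*α` over the fibers `A × {x}`. -/
noncomputable def SmoothFlow.orbitInt (Θ : SmoothFlow I M) (A : Set ℝ) {k : ℕ}
    (α : Form E M (k + 1)) : Form E M k :=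
  fun x => ∫ s in A, Θ.slice α s x

namespace EquivariantTime

variable {Θ : SmoothFlow I M} [ChartedSpace H' Θ.Base] (T : EquivariantTime Θ J)
  [IsManifold J ∞ Θ.Base] [IsManifold I ∞ M] {k : ℕ}

/-- The representation of a form in a tube. -/
noncomputable abbrev tubeRep (b₀ : Θ.Base) (α : Form E M k) :
    ℝ × W → (ℝ × W) [⋀^Fin k]→L[ℝ] ℝ :=
  rep I (T.tube b₀) (tubeRange J) α

omit [FiniteDimensional ℝ W] [FiniteDimensional ℝ E] [IsManifold I ∞ M] in
/-- The integrand of the fiber integration in a tube. -/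
lemma slice_comp_tubeFrame (α : Form E M (k + 1)) {b₀ : Θ.Base} {z : ℝ × W}
    (hz : z ∈ tubeDomain J b₀) (s : ℝ) :
    (Θ.slice α s (T.tube b₀ z)).compContinuousLinearMap (T.tubeFrame b₀ z) =
      (T.tubeRep b₀ α (z + s • ((1, 0) : ℝ × W))).curryLeft (1, 0) := by
  rw [SmoothFlow.slice, compContinuousLinearMap_comp, T.tangentAt_comp_tubeFrame hz,
    T.velocity_tube hz, ← T.tube_add]
  exact (curryLeft_compContinuousLinearMap _ _ _).symm

variable {α : Form E M k}

lemma contDiffOn_tubeRep (hα : IsSmoothForm I α) (b₀ : Θ.Base) :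
    ContDiffOn ℝ ∞ (T.tubeRep b₀ α) (tubeRange J ∩ tubeOpen J b₀) := by
  intro z hz
  exact ((T.isParam_tube b₀).contDiffWithinAt_rep hα (by rwa [tubeRange_inter] at hz)).mono
    inter_subset_left

omit [FiniteDimensional ℝ W] [FiniteDimensional ℝ E] [IsManifold I ∞ M] [IsManifold J ∞ Θ.Base] in
/-- On the support of a compactly supported form the time function is bounded. -/
lemma exists_time_bound (hα : HasCompactSupport α) : ∃ ρ, ∀ x, ρ < |T.t x| → α x = 0 := by
  obtain ⟨ρ, hρ⟩ := (hα.isCompact.image T.smooth_t.continuous).isBounded.subset_closedBall 0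
  refine ⟨ρ, fun x hx => image_eq_zero_of_notMem_tsupport fun h => ?_⟩
  have := hρ (mem_image_of_mem _ h)
  rw [mem_closedBall_zero_iff, Real.norm_eq_abs] at this
  linarith

omit [FiniteDimensional ℝ W] [FiniteDimensional ℝ E] [IsManifold I ∞ M] [IsManifold J ∞ Θ.Base] in
lemma compactAlong_tubeRep (hα : HasCompactSupport α) (b₀ : Θ.Base) (S : Set (ℝ × W)) :
    CompactAlong ((1, 0) : ℝ × W) S (T.tubeRep b₀ α) := by
  obtain ⟨ρ, hρ⟩ := T.exists_time_bound hα
  intro z _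
  refine ⟨Icc (-(ρ + |z.1| + 1)) (ρ + |z.1| + 1), isCompact_Icc, {z' | |z'.1 - z.1| < 1},
    isOpen_lt (by fun_prop) continuous_const, by simp, ?_⟩
  rintro z' ⟨-, hz'⟩ s hs
  have h0 : α (T.tube b₀ (z' + s • ((1, 0) : ℝ × W))) = 0 := by
    apply hρ
    rw [T.t_tube]
    by_contra h
    push Not at h
    apply hs
    rw [mem_Icc, ← abs_le]
    have h1 : s = (z' + s • ((1, 0) : ℝ × W)).1 - z'.1 := by simp
    have h2 := abs_sub (z' + s • ((1, 0) : ℝ × W)).1 z'.1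
    rw [← h1] at h2
    have h3 : |z'.1| ≤ |z'.1 - z.1| + |z.1| := by
      have := abs_add_le (z'.1 - z.1) z.1
      simpa using this
    have h4 : |z'.1 - z.1| < 1 := hz'
    linarith
  change (α (T.tube b₀ (z' + s • ((1, 0) : ℝ × W)))).compContinuousLinearMap _ = 0
  rw [h0]
  rfl

lemma rep_orbitInt {α : Form E M (k + 1)} (hα : IsSmoothForm I α) (hc : HasCompactSupport α)
    (A : Set ℝ) {b₀ : Θ.Base} {z : ℝ × W} (hz : z ∈ tubeDomain J b₀) :
    T.tubeRep b₀ (Θ.orbitInt A α) z = shiftInt A (1, 0) (T.tubeRep b₀ α) z := by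
  have hz' : z ∈ tubeRange J ∩ tubeOpen J b₀ := by rwa [tubeRange_inter]
  obtain ⟨L, hL⟩ := T.exists_tubeFrame_equiv hz
  have hi := ((isShiftDomain_tube J b₀).integrable (T.contDiffOn_tubeRep hα b₀)
    (T.compactAlong_tubeRep hc b₀ _) hz').restrict (s := A)
  have h1 : ∀ s, Θ.slice α s (T.tube b₀ z) =
      ((T.tubeRep b₀ α (z + s • ((1, 0) : ℝ × W))).curryLeft (1, 0)).compContinuousLinearMap
        (L.symm : E →L[ℝ] ℝ × W) := by
    intro s
    rw [← T.slice_comp_tubeFrame α hz s, ← hL, compContinuousLinearMap_equiv_symm]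
  change (∫ s in A, Θ.slice α s (T.tube b₀ z)).compContinuousLinearMap (T.tubeFrame b₀ z) = _
  simp only [h1]
  rw [← integral_compContinuousLinearMap hi, ← hL, compContinuousLinearMap_equiv]
  rfl

/-- Fiber integration in a tube. -/
lemma chartRep_fiberInt {α : Form E M (k + 1)} (hα : IsSmoothForm I α) (hc : HasCompactSupport α)
    {b₀ : Θ.Base} {y : W} (hy : y ∈ (extChartAt J b₀).target) :
    chartRep J (Θ.fiberInt J α) b₀ y = (shiftInt univ (1, 0) (T.tubeRep b₀ α)
      (0, y)).compContinuousLinearMap (ContinuousLinearMap.inr ℝ ℝ W) := by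
  obtain ⟨L, hL, -⟩ := exists_chartFrame_equiv hy
  set b := (extChartAt J b₀).symm y with hb
  have hbs : b ∈ (extChartAt J b₀).source := (extChartAt J b₀).map_target hy
  set x := b.out with hx
  have hpx : Θ.proj x = b := Quotient.out_eq b
  set z : ℝ × W := T.tubeInv b₀ x with hzdef
  have hz : z ∈ tubeDomain J b₀ := T.tubeInv_mem (by rwa [hpx])
  have hzx : T.tube b₀ z = x := T.tube_tubeInv (by rwa [hpx])
  have hz2 : z.2 = y := by
    change extChartAt J b₀ (Θ.proj x) = y
    rw [hpx, hb, (extChartAt J b₀).right_inv hy]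
  have hz' : z ∈ tubeRange J ∩ tubeOpen J b₀ := by rwa [tubeRange_inter]
  have hi := (isShiftDomain_tube J b₀).integrable (T.contDiffOn_tubeRep hα b₀)
    (T.compactAlong_tubeRep hc b₀ _) hz'
  have h1 : ∀ s, (((α (Θ.toFun s x)).curryLeft (Θ.velocity s x)).compContinuousLinearMap
      (SmoothFlow.rightInv (tangentAt I J Θ.proj (Θ.toFun s x)))).compContinuousLinearMap
        (chartFrame J b₀ y) =
      ((T.tubeRep b₀ α (z + s • ((1, 0) : ℝ × W))).curryLeft (1, 0)).compContinuousLinearMap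
        (ContinuousLinearMap.inr ℝ ℝ W) := by
    intro s
    set z' := z + s • ((1, 0) : ℝ × W) with hz'def
    have hzd : z' ∈ tubeDomain J b₀ := tubeDomain_add hz s
    have hz2' : z'.2 = y := by simp [hz'def, hz2]
    have hxs : Θ.toFun s x = T.tube b₀ z' := by rw [hz'def, T.tube_add, hzx]
    have hv : Θ.velocity s x = T.tubeFrame b₀ z' (1, 0) := by rw [← T.velocity_tube hz s, hzx]
    have hD := T.tangentAt_proj_comp_tubeFrame hzd
    obtain ⟨L', hL'⟩ := T.exists_tubeFrame_equiv hzd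
    rw [hz2'] at hD
    rw [hxs, hv]
    set D := tangentAt I J Θ.proj (T.tube b₀ z') with hDdef
    have hex : ∃ R : W →L[ℝ] E, D ∘L R = ContinuousLinearMap.id ℝ W := by
      refine ⟨((T.tubeFrame b₀ z').comp (ContinuousLinearMap.inr ℝ ℝ W)).comp
        (L.symm : W →L[ℝ] W), ?_⟩
      rw [← ContinuousLinearMap.comp_assoc, ← ContinuousLinearMap.comp_assoc, hD, ← hL]
      ext w; simp
    have hR : D ∘L SmoothFlow.rightInv D = ContinuousLinearMap.id ℝ W := by
      rw [SmoothFlow.rightInv, dif_pos hex]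
      exact hex.choose_spec
    have hrep : (T.tubeRep b₀ α z').curryLeft (1, 0) =
        ((α (T.tube b₀ z')).curryLeft (T.tubeFrame b₀ z' (1, 0))).compContinuousLinearMap
          (T.tubeFrame b₀ z') := curryLeft_compContinuousLinearMap _ _ _
    rw [hrep]
    ext w
    simp only [ContinuousAlternatingMap.compContinuousLinearMap_apply]
    refine curryLeft_apply_congr _ _ fun i => ?_
    set u : E := SmoothFlow.rightInv D (chartFrame J b₀ y (w i)) with hu
    have h2 : D u = chartFrame J b₀ y (w i) :=
      congrArg (fun Q => Q (chartFrame J b₀ y (w i))) hR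
    have h3 : D (T.tubeFrame b₀ z' (L'.symm u)) = chartFrame J b₀ y (L'.symm u).2 :=
      congrArg (fun Q => Q (L'.symm u)) hD
    have h4 : T.tubeFrame b₀ z' (L'.symm u) = u := by rw [← hL']; simp
    rw [h4, h2, ← hL] at h3
    have h5 : w i = (L'.symm u).2 := L.injective h3
    refine ⟨(L'.symm u).1, ?_⟩
    rw [Function.comp_apply, Function.comp_apply, Function.comp_apply, Function.comp_apply,
      ← hu, ← map_smul, ← map_add]
    conv_lhs => rw [← h4]
    congr 1
    rw [h5]
    simp
  have h6 : ∀ s, ((α (Θ.toFun s x)).curryLeft (Θ.velocity s x)).compContinuousLinearMap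
      (SmoothFlow.rightInv (tangentAt I J Θ.proj (Θ.toFun s x))) =
      (((T.tubeRep b₀ α (z + s • ((1, 0) : ℝ × W))).curryLeft (1, 0)).compContinuousLinearMap
        (ContinuousLinearMap.inr ℝ ℝ W)).compContinuousLinearMap (L.symm : W →L[ℝ] W) := by
    intro s
    rw [← h1 s, ← hL, compContinuousLinearMap_equiv_symm]
  change (∫ s : ℝ, ((α (Θ.toFun s x)).curryLeft (Θ.velocity s x)).compContinuousLinearMap
      (SmoothFlow.rightInv (tangentAt I J Θ.proj (Θ.toFun s x)))).compContinuousLinearMap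
        (chartFrame J b₀ y) = _
  simp only [h6, compContinuousLinearMap_comp]
  rw [← integral_compContinuousLinearMap hi, ← compContinuousLinearMap_comp, ← hL,
    compContinuousLinearMap_equiv]
  have h7 : z = (0, y) + z.1 • ((1, 0) : ℝ × W) := by
    ext
    · simp
    · simp [hz2]
  rw [← shiftInt_univ_add _ (0, y) z.1, ← h7, shiftInt, setIntegral_univ]

end EquivariantTime

end CSWZW

/-! ### Fiber integration as a homotopy equivalence -/

namespace CSWZW

lemma IsSmoothForm.fun_smul {E : Type*} [NormedAddCommGroup E] [NormedSpace ℝ E] {H : Type*}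
    [TopologicalSpace H] {I : ModelWithCorners ℝ E H} {M : Type*} [TopologicalSpace M]
    [ChartedSpace H M] [IsManifold I ∞ M] {k : ℕ} {c : M → ℝ} (hc : ContMDiff I 𝓘(ℝ, ℝ) ∞ c)
    {α : Form E M k} (hα : IsSmoothForm I α) : IsSmoothForm I fun x => c x • α x := by
  intro x₀ y hy
  have h1 : chartRep I (fun x => c x • α x) x₀ =
      fun y => c ((extChartAt I x₀).symm y) • chartRep I α x₀ y := by
    funext z
    exact rep_smul _ _ c α z
  rw [h1]
  have h2 : ContDiffWithinAt ℝ ∞ (c ∘ (extChartAt I x₀).symm) (extChartAt I x₀).target y :=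
    contMDiffWithinAt_iff_contDiffWithinAt.1
      ((hc _).comp_contMDiffWithinAt y (contMDiffOn_extChartAt_symm x₀ y hy))
  exact h2.smul (hα x₀ y hy)

variable {E : Type} [NormedAddCommGroup E] [NormedSpace ℝ E] [FiniteDimensional ℝ E]
  {H : Type} [TopologicalSpace H]
  {I : ModelWithCorners ℝ E H} {M : Type u} [TopologicalSpace M] [ChartedSpace H M]
  {W : Type} [NormedAddCommGroup W] [NormedSpace ℝ W] [FiniteDimensional ℝ W]
  {H' : Type} [TopologicalSpace H'] {J : ModelWithCorners ℝ W H'}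

namespace EquivariantTime

variable {Θ : SmoothFlow I M} [ChartedSpace H' Θ.Base] (T : EquivariantTime Θ J)
  [IsManifold J ∞ Θ.Base] [IsManifold I ∞ M] {k : ℕ}

omit [FiniteDimensional ℝ W] [FiniteDimensional ℝ E] [IsManifold I ∞ M] [IsManifold J ∞ Θ.Base] in
lemma tubeRep_add (b₀ : Θ.Base) (α β : Form E M k) (z : ℝ × W) :
    T.tubeRep b₀ (α + β) z = T.tubeRep b₀ α z + T.tubeRep b₀ β z :=
  congrFun (rep_add _ _ α β) z

include T in
lemma isSmoothForm_of_tubeRep {α : Form E M k}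
    (h : ∀ b₀, ContDiffOn ℝ ∞ (T.tubeRep b₀ α) (tubeRange J ∩ tubeOpen J b₀)) :
    IsSmoothForm I α := by
  refine isSmoothForm_of_rep (F := ℝ × W) fun x => ?_
  have hx := mem_extChartAt_source (I := J) (Θ.proj x)
  have hm := T.tubeInv_mem hx
  refine ⟨T.tube (Θ.proj x), _, _, T.tubeInv (Θ.proj x), T.isParam_tube _,
    T.isLocalInverse_tube hx, ?_⟩
  rw [← tubeRange_inter] at hm
  exact (h _ _ hm).mono_of_mem_nhdsWithin
    (inter_mem_nhdsWithin _ ((isShiftDomain_tube J _).isOpen.mem_nhds hm.2))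

include T in
/-- Forms on the total space agree if they agree in tubes. -/
lemma eq_of_tubeRep_eq {α β : Form E M k}
    (h : ∀ b₀, ∀ z ∈ tubeDomain J b₀, T.tubeRep b₀ α z = T.tubeRep b₀ β z) : α = β := by
  funext x
  have hx := mem_extChartAt_source (I := J) (Θ.proj x)
  exact (T.isParam_tube _).eq_of_rep_eq (T.isLocalInverse_tube hx) (h _ _ (T.tubeInv_mem hx))

omit [IsManifold I ∞ M] [FiniteDimensional ℝ E] in
/-- Forms on the base agree if they agree in charts. -/
lemma base_eq_of_chartRep_eq {α β : Form W Θ.Base k}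
    (h : ∀ b₀, ∀ y ∈ (extChartAt J b₀).target, chartRep J α b₀ y = chartRep J β b₀ y) : α = β := by
  funext b
  exact (isParam_chart J b).eq_of_rep_eq (isLocalInverse_chart b (mem_extChartAt_source b))
    (h _ _ (mem_extChartAt_target b))

section orbitInt

variable {α : Form E M (k + 1)} (hα : IsSmoothForm I α) (hc : HasCompactSupport α)

include T hα hc in
lemma isSmoothForm_orbitInt {A : Set ℝ} (hA : IsClosed A) : IsSmoothForm I (Θ.orbitInt A α) := by
  refine T.isSmoothForm_of_tubeRep fun b₀ => ?_
  refine ((isShiftDomain_tube J b₀).contDiffOn_shiftInt (T.contDiffOn_tubeRep hα b₀)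
    (T.compactAlong_tubeRep hc b₀ _) hA).congr fun z hz => ?_
  exact T.rep_orbitInt hα hc A (by rwa [tubeRange_inter] at hz)

lemma tubeRep_extD {α : Form E M k} (hα : IsSmoothForm I α) {b₀ : Θ.Base} {z : ℝ × W}
    (hz : z ∈ tubeDomain J b₀) : T.tubeRep b₀ (extD I α) z =
      extDerivWithin (T.tubeRep b₀ α) (tubeRange J ∩ tubeOpen J b₀) z := by
  rw [← tubeRange_inter] at hz
  rw [extDerivWithin_inter (isShiftDomain_tube J b₀).isOpen hz.2, tubeRep,
    (T.isParam_tube b₀).rep_extD hα (by rwa [tubeRange_inter] at hz)]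

lemma hasCompactSupport_extD {α : Form E M k} (hc : HasCompactSupport α) :
    HasCompactSupport (extD I α) :=
  hc.of_isClosed_subset (isClosed_tsupport _) (tsupport_extD _)

/-- Under the integral along the flow, the exterior derivative may be computed in the tube. -/
lemma shiftInt_tubeRep_extD {α : Form E M k} (hα : IsSmoothForm I α) (A : Set ℝ) {b₀ : Θ.Base}
    {z : ℝ × W} (hz : z ∈ tubeDomain J b₀) :
    shiftInt A (1, 0) (T.tubeRep b₀ (extD I α)) z =
      shiftInt A (1, 0) (extDerivWithin (T.tubeRep b₀ α) (tubeRange J ∩ tubeOpen J b₀)) z := by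
  rw [shiftInt, shiftInt]
  congr 1
  funext s
  rw [T.tubeRep_extD hα (tubeDomain_add hz s)]

include T hα hc in
/-- Cartan's formula for the integrals along the flow. -/
lemma tubeRep_extD_orbitInt {A : Set ℝ} (hA : IsClosed A) {b₀ : Θ.Base} {z : ℝ × W}
    (hz : z ∈ tubeDomain J b₀) :
    T.tubeRep b₀ (extD I (Θ.orbitInt A α) + Θ.orbitInt A (extD I α)) z =
      ∫ s in A, fderivWithin ℝ (T.tubeRep b₀ α) (tubeRange J ∩ tubeOpen J b₀)
        (z + s • ((1, 0) : ℝ × W)) (1, 0) := by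
  have hz' : z ∈ tubeRange J ∩ tubeOpen J b₀ := by rwa [tubeRange_inter]
  have h1 := (isShiftDomain_tube J b₀).extDerivWithin_shiftInt (T.contDiffOn_tubeRep hα b₀)
    (T.compactAlong_tubeRep hc b₀ _) hA hz'
  rw [← h1, T.tubeRep_add, T.tubeRep_extD (T.isSmoothForm_orbitInt hα hc hA) hz,
    T.rep_orbitInt hα.extD (hasCompactSupport_extD hc) A hz, T.shiftInt_tubeRep_extD hα A hz]
  congr 1
  exact extDerivWithin_congr' (fun y hy => T.rep_orbitInt hα hc A (by rwa [tubeRange_inter] at hy))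
    hz'

include T hα hc in
lemma extD_orbitInt_univ : extD I (Θ.orbitInt univ α) + Θ.orbitInt univ (extD I α) = 0 := by
  refine T.eq_of_tubeRep_eq fun b₀ z hz => ?_
  rw [T.tubeRep_extD_orbitInt hα hc isClosed_univ hz,
    ((isShiftDomain_tube J b₀).integral_fderivWithin (T.contDiffOn_tubeRep hα b₀)
      (T.compactAlong_tubeRep hc b₀ _) (by rwa [tubeRange_inter])).1]
  rfl

include T hα hc in
lemma extD_orbitInt_Iic :
    extD I (Θ.orbitInt (Iic 0) α) + Θ.orbitInt (Iic 0) (extD I α) = α := by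
  refine T.eq_of_tubeRep_eq fun b₀ z hz => ?_
  rw [T.tubeRep_extD_orbitInt hα hc isClosed_Iic hz,
    ((isShiftDomain_tube J b₀).integral_fderivWithin (T.contDiffOn_tubeRep hα b₀)
      (T.compactAlong_tubeRep hc b₀ _) (by rwa [tubeRange_inter])).2]

end orbitInt

section zero

variable {α : Form E M 0} (hα : IsSmoothForm I α) (hc : HasCompactSupport α)

include T hα hc in
lemma tubeRep_orbitInt_extD_zero {A : Set ℝ} {b₀ : Θ.Base} {z : ℝ × W}
    (hz : z ∈ tubeDomain J b₀) : T.tubeRep b₀ (Θ.orbitInt A (extD I α)) z =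
      ∫ s in A, fderivWithin ℝ (T.tubeRep b₀ α) (tubeRange J ∩ tubeOpen J b₀)
        (z + s • ((1, 0) : ℝ × W)) (1, 0) := by
  rw [T.rep_orbitInt hα.extD (hasCompactSupport_extD hc) A hz, T.shiftInt_tubeRep_extD hα A hz,
    shiftInt_extDerivWithin_zero]

include T hα hc in
lemma orbitInt_univ_extD_zero : Θ.orbitInt univ (extD I α) = 0 := by
  refine T.eq_of_tubeRep_eq fun b₀ z hz => ?_
  rw [T.tubeRep_orbitInt_extD_zero hα hc hz,
    ((isShiftDomain_tube J b₀).integral_fderivWithin (T.contDiffOn_tubeRep hα b₀)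
      (T.compactAlong_tubeRep hc b₀ _) (by rwa [tubeRange_inter])).1]
  rfl

include T hα hc in
lemma orbitInt_Iic_extD_zero : Θ.orbitInt (Iic 0) (extD I α) = α := by
  refine T.eq_of_tubeRep_eq fun b₀ z hz => ?_
  rw [T.tubeRep_orbitInt_extD_zero hα hc hz,
    ((isShiftDomain_tube J b₀).integral_fderivWithin (T.contDiffOn_tubeRep hα b₀)
      (T.compactAlong_tubeRep hc b₀ _) (by rwa [tubeRange_inter])).2]

end zero

section pullback

omit [IsManifold I ∞ M] [FiniteDimensional ℝ E] [FiniteDimensional ℝ W] in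
lemma tubeRep_pullback (β : Form W Θ.Base k) {b₀ : Θ.Base} {z : ℝ × W}
    (hz : z ∈ tubeDomain J b₀) : T.tubeRep b₀ (pullback I J Θ.proj β) z =
      (chartRep J β b₀ z.2).compContinuousLinearMap (ContinuousLinearMap.snd ℝ ℝ W) := by
  rw [chartRep, compContinuousLinearMap_comp, ← T.tangentAt_proj_comp_tubeFrame hz, ← T.proj_tube]
  rfl

variable {β : Form W Θ.Base k} (hβ : IsSmoothForm J β)

omit [FiniteDimensional ℝ W] in
lemma contDiffOn_comp_snd [FiniteDimensional ℝ W] (hβ : IsSmoothForm J β) (b₀ : Θ.Base) :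
    ContDiffOn ℝ ∞ (fun z : ℝ × W => (chartRep J β b₀ z.2).compContinuousLinearMap
      (ContinuousLinearMap.snd ℝ ℝ W)) (tubeRange J ∩ tubeOpen J b₀) := by
  intro z hz
  refine contDiffWithinAt_compContinuousLinearMap ?_ contDiffWithinAt_const
  rw [tubeRange_inter] at hz ⊢
  exact (hβ b₀ z.2 hz.2).comp z contDiffWithinAt_snd fun y hy => hy.2

include T hβ in
lemma isSmoothForm_pullback_proj : IsSmoothForm I (pullback I J Θ.proj β) := by
  refine T.isSmoothForm_of_tubeRep fun b₀ => (contDiffOn_comp_snd hβ b₀).congr fun z hz => ?_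
  exact T.tubeRep_pullback β (by rwa [tubeRange_inter] at hz)

include T hβ in
/-- The exterior derivative commutes with the pullback along the quotient map. -/
lemma extD_pullback_proj :
    extD I (pullback I J Θ.proj β) = pullback I J Θ.proj (extD J β) := by
  refine T.eq_of_tubeRep_eq fun b₀ z hz => ?_
  have hz' : z ∈ tubeRange J ∩ tubeOpen J b₀ := by rwa [tubeRange_inter]
  have hu := (isShiftDomain_tube J b₀).uniqueDiffOn
  rw [T.tubeRep_extD (T.isSmoothForm_pullback_proj hβ) hz,
    T.tubeRep_pullback _ hz, chartRep_extD hβ hz.2,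
    extDerivWithin_inter (isShiftDomain_tube J b₀).isOpen hz'.2]
  have h1 : ∀ y ∈ tubeRange J, fderivWithin ℝ (Prod.snd : ℝ × W → W) (tubeRange J) y =
      ContinuousLinearMap.snd ℝ ℝ W := fun y hy => fderivWithin_snd (hu y hy)
  have h2 : T.tubeRep b₀ (pullback I J Θ.proj β) =ᶠ[𝓝[tubeRange J] z] fun z =>
      (chartRep J β b₀ (Prod.snd z)).compContinuousLinearMap
        (fderivWithin ℝ (Prod.snd : ℝ × W → W) (tubeRange J) z) := by
    filter_upwards [(T.isParam_tube b₀).mem_nhds z hz, self_mem_nhdsWithin] with y hy hy'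
    rw [T.tubeRep_pullback β hy, h1 y hy']
  rw [h2.extDerivWithin_eq_of_mem hz'.1, extDerivWithin_pullback_of_eventually
    (t := range J) (hβ.differentiableWithinAt hz.2) contDiff_snd.contDiffWithinAt hu
    ((T.isParam_tube b₀).subset_closure hz'.1) hz'.1
    (by filter_upwards [self_mem_nhdsWithin] with y hy using hy.2), h1 z hz'.1]

end pullback

section fiberInt

variable {α : Form E M (k + 1)} (hα : IsSmoothForm I α) (hc : HasCompactSupport α)

include T hα hc in
lemma tubeRep_orbitInt_univ {b₀ : Θ.Base} {z : ℝ × W} (hz : z ∈ tubeDomain J b₀) :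
    T.tubeRep b₀ (Θ.orbitInt univ α) z = shiftInt univ (1, 0) (T.tubeRep b₀ α) (0, z.2) := by
  have h7 : z = (0, z.2) + z.1 • ((1, 0) : ℝ × W) := by
    ext <;> simp
  rw [T.rep_orbitInt hα hc univ hz, ← shiftInt_univ_add _ (0, z.2) z.1, ← h7]

lemma curryLeft_shiftInt {F : Type} [NormedAddCommGroup F] [NormedSpace ℝ F]
    [FiniteDimensional ℝ F] {A : Set ℝ} {e : F} {a : F → F [⋀^Fin (k + 2)]→L[ℝ] ℝ} (z : F) :
    (shiftInt A e a z).curryLeft e = 0 := by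
  have h1 : ∀ c : F [⋀^Fin (k + 2)]→L[ℝ] ℝ, (c.curryLeft e).curryLeft e = 0 := by
    intro c
    ext v
    rw [ContinuousAlternatingMap.curryLeft_apply_apply,
      ContinuousAlternatingMap.curryLeft_apply_apply]
    exact c.map_eq_zero_of_eq _ (i := 0) (j := 1) (by simp) (by simp)
  by_cases hi : Integrable (fun s => (a (z + s • e)).curryLeft e) (volume.restrict A)
  · have := (integrable_and_integral_clm ((ContinuousAlternatingMap.curryLeftLI (𝕜 := ℝ) (E := F)
      (F := ℝ) (n := k)).toContinuousLinearMap.flip e) hi).2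
    refine this.trans ?_
    refine (integral_congr_ae (Eventually.of_forall fun s => ?_)).trans (integral_zero _ _)
    exact h1 _
  · rw [shiftInt, integral_undef hi]
    rfl

omit [FiniteDimensional ℝ W] in
/-- A form on `ℝ × W` that is annihilated by the contraction with `(1, 0)` is determined by its
restriction to `W`. -/
lemma comp_inr_comp_snd (a : (ℝ × W) [⋀^Fin k]→L[ℝ] ℝ)
    (ha : ∀ v : Fin k → ℝ × W, ∀ i, a (Function.update v i (1, 0)) = 0) :
    (a.compContinuousLinearMap (ContinuousLinearMap.inr ℝ ℝ W)).compContinuousLinearMap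
      (ContinuousLinearMap.snd ℝ ℝ W) = a := by
  ext v
  change a (fun i => ((0 : ℝ), (v i).2)) = a v
  have key : ∀ S : Finset (Fin k), a (fun i => if i ∈ S then (0, (v i).2) else v i) = a v := by
    intro S
    induction S using Finset.induction_on with
    | empty => simp
    | insert j S hj ih =>
      set u : Fin k → ℝ × W := fun i => if i ∈ S then (0, (v i).2) else v i with hu
      have h1 : (fun i => if i ∈ insert j S then (0, (v i).2) else v i) =
          Function.update u j (u j + (-(v j).1) • ((1, 0) : ℝ × W)) := by
        funext i
        by_cases hij : i = j
        · subst hij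
          ext <;> simp [hu, hj]
        · simp [hu, hij]
      rw [h1, ContinuousAlternatingMap.map_update_add, ContinuousAlternatingMap.map_update_smul, ha,
        smul_zero, add_zero, Function.update_eq_self, ih]
  simpa using key Finset.univ

omit [FiniteDimensional ℝ W] in
lemma update_eq_zero_of_curryLeft {F : Type*} [NormedAddCommGroup F] [NormedSpace ℝ F] {e : F}
    (a : F [⋀^Fin (k + 1)]→L[ℝ] ℝ) (ha : a.curryLeft e = 0) (v : Fin (k + 1) → F) (i : Fin (k + 1)) :
    a (Function.update v i e) = 0 := by
  have h1 := a.toAlternatingMap.map_perm (Function.update v i e) (Equiv.swap 0 i)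
  have h2 : a (Function.update v i e ∘ Equiv.swap 0 i) = 0 := by
    have h3 : Function.update v i e ∘ Equiv.swap 0 i =
        Matrix.vecCons e (Matrix.vecTail (Function.update v i e ∘ Equiv.swap 0 i)) := by
      funext j
      refine Fin.cases ?_ (fun j => ?_) j
      · simp
      · simp [Matrix.vecTail]
    rw [h3, ← ContinuousAlternatingMap.curryLeft_apply_apply, ha]
    rfl
  have h4 : a.toAlternatingMap (Function.update v i e ∘ Equiv.swap 0 i) = 0 := h2
  rw [h4] at h1
  rcases Int.units_eq_one_or (Equiv.Perm.sign (Equiv.swap 0 i)) with h | h <;> rw [h] at h1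
  · simpa using h1.symm
  · simpa using h1.symm

include T hα hc in
/-- Pulling back the fiber integral gives the integral over the whole orbits. -/
lemma pullback_fiberInt : pullback I J Θ.proj (Θ.fiberInt J α) = Θ.orbitInt univ α := by
  refine T.eq_of_tubeRep_eq fun b₀ z hz => ?_
  rw [T.tubeRep_pullback _ hz, T.chartRep_fiberInt hα hc hz.2, T.tubeRep_orbitInt_univ hα hc hz]
  refine comp_inr_comp_snd _ ?_
  match k, α with
  | 0, _ => exact fun v i => i.elim0
  | k + 1, _ => exact update_eq_zero_of_curryLeft _ (curryLeft_shiftInt _)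

include T hα hc in
lemma isSmoothForm_fiberInt : IsSmoothForm J (Θ.fiberInt J α) := by
  intro b₀
  refine ContDiffOn.congr (f := fun y => (shiftInt univ (1, 0) (T.tubeRep b₀ α)
      (0, y)).compContinuousLinearMap (ContinuousLinearMap.inr ℝ ℝ W)) ?_
    fun y hy => T.chartRep_fiberInt hα hc hy
  intro y hy
  refine contDiffWithinAt_compContinuousLinearMap ?_ contDiffWithinAt_const
  have h1 := (isShiftDomain_tube J b₀).contDiffOn_shiftInt (T.contDiffOn_tubeRep hα b₀)
    (T.compactAlong_tubeRep hc b₀ _) isClosed_univ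
  rw [tubeRange_inter] at h1
  exact (h1 (0, y) ⟨mem_univ _, hy⟩).comp y (f := fun y => ((0 : ℝ), y))
    (contDiffWithinAt_const.prodMk contDiffWithinAt_id) fun y hy => ⟨mem_univ _, hy⟩

include T in
omit [FiniteDimensional ℝ W] [FiniteDimensional ℝ E] [IsManifold I ∞ M] in
/-- The pullback along the quotient map is injective. -/
lemma pullback_proj_injective [FiniteDimensional ℝ W] {β β' : Form W Θ.Base k}
    (h : pullback I J Θ.proj β = pullback I J Θ.proj β') : β = β' := by
  refine base_eq_of_chartRep_eq (J := J) fun b₀ y hy => ?_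
  have hz : ((0 : ℝ), y) ∈ tubeDomain J b₀ := ⟨mem_univ _, hy⟩
  have h1 := T.tubeRep_pullback β hz
  rw [h, T.tubeRep_pullback β' hz] at h1
  have h2 := congrArg (fun a => a.compContinuousLinearMap (ContinuousLinearMap.inr ℝ ℝ W)) h1
  exact h2.symm

omit [FiniteDimensional ℝ W] [FiniteDimensional ℝ E] [IsManifold I ∞ M] [IsManifold J ∞ Θ.Base] in
lemma pullback_neg (β : Form W Θ.Base k) :
    pullback I J Θ.proj (-β) = -pullback I J Θ.proj β := rfl

include T hα hc in
/-- Fiber integration anticommutes with the exterior derivative. -/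
lemma fiberInt_extD : Θ.fiberInt J (extD I α) = -extD J (Θ.fiberInt J α) := by
  refine T.pullback_proj_injective ?_
  rw [T.pullback_fiberInt hα.extD (hasCompactSupport_extD hc), pullback_neg,
    ← T.extD_pullback_proj (T.isSmoothForm_fiberInt hα hc), T.pullback_fiberInt hα hc]
  exact eq_neg_of_add_eq_zero_right (T.extD_orbitInt_univ hα hc)

include T in
lemma fiberInt_extD_zero {α : Form E M 0} (hα : IsSmoothForm I α) (hc : HasCompactSupport α) :
    Θ.fiberInt J (extD I α) = 0 := by
  refine T.pullback_proj_injective ?_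
  rw [T.pullback_fiberInt hα.extD (hasCompactSupport_extD hc), T.orbitInt_univ_extD_zero hα hc]
  rfl

end fiberInt

end EquivariantTime

end CSWZW

/-! ### The section of fiber integration and the contracting homotopy -/

namespace CSWZW

section Sub

variable {E : Type*} [NormedAddCommGroup E] [NormedSpace ℝ E] {H : Type*} [TopologicalSpace H]
  {I : ModelWithCorners ℝ E H} {M : Type*} [TopologicalSpace M] [ChartedSpace H M] {k : ℕ}

lemma IsSmoothForm.sub {α β : Form E M k} (hα : IsSmoothForm I α) (hβ : IsSmoothForm I β) :
    IsSmoothForm I (α - β) := by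
  have h := hα.add (hβ.smul (-1))
  rwa [neg_one_smul ℝ β, ← sub_eq_add_neg] at h

lemma extD_sub {α β : Form E M k} (hα : IsSmoothForm I α) (hβ : IsSmoothForm I β) :
    extD I (α - β) = extD I α - extD I β := by
  have h := extD_add hα (hβ.smul (-1))
  rwa [extD_smul, neg_one_smul ℝ β, neg_one_smul ℝ (extD I β), ← sub_eq_add_neg,
    ← sub_eq_add_neg] at h

end Sub

section Derivative

variable {F : Type*} [NormedAddCommGroup F] [NormedSpace ℝ F] {k : ℕ}

/-- The Leibniz rule for the product of a function and a form. -/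
lemma extDerivWithin_fun_smul' {c : F → ℝ} {b : F → F [⋀^Fin k]→L[ℝ] ℝ} {R : Set F} {z : F}
    {c' : F →L[ℝ] ℝ} (hc : HasFDerivWithinAt c c' R z) (hb : DifferentiableWithinAt ℝ b R z)
    (hR : UniqueDiffWithinAt ℝ R z) :
    extDerivWithin (fun z => c z • b z) R z =
      c z • extDerivWithin b R z + ContinuousAlternatingMap.alternatizeUncurryFin
        (c'.smulRight (b z)) := by
  have h1 := (hc.smul hb.hasFDerivWithinAt).fderivWithin hR
  rw [extDerivWithin, extDerivWithin]
  change ContinuousAlternatingMap.alternatizeUncurryFin (fderivWithin ℝ (c • b) R z) = _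
  rw [h1, ContinuousAlternatingMap.alternatizeUncurryFin_add,
    ContinuousAlternatingMap.alternatizeUncurryFin_smul]

lemma curryLeft_alternatizeUncurryFin_smulRight (c' : F →L[ℝ] ℝ) (b : F [⋀^Fin k]→L[ℝ] ℝ) {e : F}
    (hb : ∀ v i, b (Function.update v i e) = 0) :
    (ContinuousAlternatingMap.alternatizeUncurryFin (c'.smulRight b)).curryLeft e = c' e • b := by
  ext v
  rw [ContinuousAlternatingMap.curryLeft_apply_apply,
    ContinuousAlternatingMap.alternatizeUncurryFin_apply, Fin.sum_univ_succ]
  rw [Finset.sum_eq_zero]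
  · simp
  · intro i _
    have h1 : b (Fin.removeNth i.succ (Matrix.vecCons e v)) = 0 := by
      match k, b, hb, v, i with
      | k + 1, b, hb, v, i =>
        have h2 : Fin.removeNth i.succ (Matrix.vecCons e v) =
            Function.update (Fin.removeNth i.succ (Matrix.vecCons e v)) 0 e := by
          funext j
          refine Fin.cases ?_ (fun j => ?_) j
          · simp [Fin.removeNth]
          · simp
        rw [h2, hb]
    simp [h1]

end Derivative

variable {E : Type} [NormedAddCommGroup E] [NormedSpace ℝ E] [FiniteDimensional ℝ E]
  {H : Type} [TopologicalSpace H]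
  {I : ModelWithCorners ℝ E H} {M : Type u} [TopologicalSpace M] [ChartedSpace H M]
  {W : Type} [NormedAddCommGroup W] [NormedSpace ℝ W] [FiniteDimensional ℝ W]
  {H' : Type} [TopologicalSpace H'] {J : ModelWithCorners ℝ W H'}

namespace EquivariantTime

variable {Θ : SmoothFlow I M} [ChartedSpace H' Θ.Base] (T : EquivariantTime Θ J) {k : ℕ}

/-- A smooth function on the total space that is zero in the past and one in the future. -/
noncomputable def cutoff (x : M) : ℝ := Real.smoothTransition (T.t x)

/-- The section `β ↦ d(χ π^*β) - χ π^*dβ` of fiber integration, with `χ` the cutoff function; in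
other words `β ↦ dχ ∧ π^*β`. -/
noncomputable def lift (β : Form W Θ.Base k) : Form E M (k + 1) :=
  extD I (fun x => T.cutoff x • pullback I J Θ.proj β x) -
    fun x => T.cutoff x • pullback I J Θ.proj (extD J β) x

/-- The homotopy `G↑ - χ ∫_ℝ Θ^*`. -/
noncomputable def homotopy (α : Form E M (k + 1)) : Form E M k :=
  Θ.orbitInt (Iic 0) α - fun x => T.cutoff x • Θ.orbitInt univ α x

/-- The points over `C` with time in `[-ρ, ρ]`. -/
def slab (ρ : ℝ) (C : Set Θ.Base) : Set M := {x | |T.t x| ≤ ρ ∧ Θ.proj x ∈ C}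

lemma isCompact_slab (ρ : ℝ) {C : Set Θ.Base} (hC : IsCompact C) : IsCompact (T.slab ρ C) := by
  have h1 : T.slab ρ C = (fun p : ℝ × Θ.Base => Θ.toFun p.1 (T.σ p.2)) '' (Icc (-ρ) ρ ×ˢ C) := by
    ext x
    constructor
    · rintro ⟨h1, h2⟩
      exact ⟨(T.t x, Θ.proj x), ⟨abs_le.1 h1, h2⟩, T.toFun_σ x⟩
    · rintro ⟨p, ⟨h1, h2⟩, rfl⟩
      refine ⟨?_, ?_⟩
      · rw [T.t_toFun, T.t_σ, zero_add]
        exact abs_le.2 h1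
      · rwa [Θ.proj_toFun, T.proj_σ]
  rw [h1]
  exact (isCompact_Icc.prod hC).image (Θ.smooth.continuous.comp
    (continuous_fst.prodMk (T.smooth_σ.continuous.comp continuous_snd)))

lemma contMDiff_cutoff : ContMDiff I 𝓘(ℝ, ℝ) ∞ T.cutoff :=
  (Real.smoothTransition.contDiff (n := ⊤)).contMDiff.comp T.smooth_t

lemma cutoff_of_nonpos {x : M} (hx : T.t x ≤ 0) : T.cutoff x = 0 :=
  Real.smoothTransition.zero_of_nonpos hx

lemma cutoff_of_one_le {x : M} (hx : 1 ≤ T.t x) : T.cutoff x = 1 :=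
  Real.smoothTransition.one_of_one_le hx

lemma deriv_smoothTransition_eq_zero {r : ℝ} (hr : r < 0 ∨ 1 < r) :
    deriv Real.smoothTransition r = 0 := by
  rcases hr with hr | hr
  · have : Real.smoothTransition =ᶠ[𝓝 r] fun _ => 0 := by
      filter_upwards [Iio_mem_nhds hr] with s hs
        using Real.smoothTransition.zero_of_nonpos (le_of_lt hs)
    rw [this.deriv_eq, deriv_const]
  · have : Real.smoothTransition =ᶠ[𝓝 r] fun _ => 1 := by
      filter_upwards [Ioi_mem_nhds hr] with s hs
        using Real.smoothTransition.one_of_one_le (le_of_lt hs)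
    rw [this.deriv_eq, deriv_const]

lemma integrable_and_integral_deriv_smoothTransition :
    Integrable (deriv Real.smoothTransition) ∧ ∫ r, deriv Real.smoothTransition r = 1 := by
  have hd : ContDiff ℝ 1 Real.smoothTransition := Real.smoothTransition.contDiff (n := 1)
  have hi : Integrable (deriv Real.smoothTransition) := by
    refine (hd.continuous_deriv le_rfl).integrable_of_hasCompactSupport
      (HasCompactSupport.intro (isCompact_Icc (a := 0) (b := 1)) fun r hr => ?_)
    apply deriv_smoothTransition_eq_zero
    by_contra! h
    exact hr h
  refine ⟨hi, ?_⟩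
  rw [integral_of_hasDerivAt_of_tendsto
    (fun r => ((hd.differentiable (by simp)) r).hasDerivAt) hi (m := 0) (n := 1), sub_zero]
  · refine tendsto_const_nhds.congr' ?_
    filter_upwards [eventually_le_atBot 0] with r hr
      using (Real.smoothTransition.zero_of_nonpos hr).symm
  · refine tendsto_const_nhds.congr' ?_
    filter_upwards [eventually_ge_atTop 1] with r hr
      using (Real.smoothTransition.one_of_one_le hr).symm

lemma homotopy_apply_eq_zero {α : Form E M (k + 1)} (hc : HasCompactSupport α) :
    ∃ ρ, ∀ x ∉ T.slab ρ (Θ.proj '' tsupport α), T.homotopy α x = 0 := by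
  obtain ⟨ρ, hρ⟩ := T.exists_time_bound hc
  have hs : ∀ s x, α (Θ.toFun s x) = 0 → Θ.slice α s x = 0 := by
    intro s x h
    rw [SmoothFlow.slice, h]
    rfl
  refine ⟨max 1 ρ, fun x hx => ?_⟩
  have hval : T.homotopy α x = (∫ s in Iic 0, Θ.slice α s x) -
      T.cutoff x • ∫ s in univ, Θ.slice α s x := rfl
  rw [hval]
  by_cases hπ : Θ.proj x ∈ Θ.proj '' tsupport α
  · have ht : max 1 ρ < |T.t x| := by
      by_contra! h
      exact hx ⟨h, hπ⟩
    rcases lt_abs.1 ht with h | h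
    · rw [T.cutoff_of_one_le ((le_max_left _ _).trans h.le), one_smul, sub_eq_zero]
      symm
      refine setIntegral_eq_of_subset_of_forall_sdiff_eq_zero MeasurableSet.univ (subset_univ _)
        fun s hs' => hs s x (hρ _ ?_)
      rw [T.t_toFun]
      have : 0 < s := by
        by_contra! h
        exact hs'.2 h
      refine lt_of_lt_of_le ?_ (le_abs_self _)
      linarith [le_max_right 1 ρ]
    · rw [T.cutoff_of_nonpos (by linarith [le_max_left 1 ρ]), zero_smul, sub_zero]
      refine setIntegral_eq_zero_of_forall_eq_zero fun s hs' => hs s x (hρ _ ?_)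
      rw [T.t_toFun]
      refine lt_of_lt_of_le ?_ (neg_le_abs _)
      have : s ≤ 0 := hs'
      linarith [le_max_right 1 ρ]
  · have h0 : ∀ s, Θ.slice α s x = 0 := by
      intro s
      refine hs s x (image_eq_zero_of_notMem_tsupport fun h => hπ ?_)
      exact ⟨_, h, Θ.proj_toFun s x⟩
    simp only [h0]
    simp

/-- Fiber integration does not enlarge supports. -/
lemma support_fiberInt (α : Form E M (k + 1)) :
    Function.support (Θ.fiberInt J α) ⊆ Θ.proj '' tsupport α := by
  intro b hb
  by_contra h
  apply hb
  have h0 : ∀ s, α (Θ.toFun s b.out) = 0 := by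
    intro s
    refine image_eq_zero_of_notMem_tsupport fun h' => h ⟨_, h', ?_⟩
    rw [Θ.proj_toFun]
    exact Quotient.out_eq b
  simp only [SmoothFlow.fiberInt, h0]
  refine (integral_congr_ae (Eventually.of_forall fun s => ?_)).trans (integral_zero _ _)
  rfl

variable [IsManifold J ∞ Θ.Base] [IsManifold I ∞ M]

section lift

variable {β : Form W Θ.Base k} (hβ : IsSmoothForm J β)

include hβ in
lemma isSmoothForm_lift : IsSmoothForm I (T.lift β) := by
  have h1 := (IsSmoothForm.fun_smul T.contMDiff_cutoff (T.isSmoothForm_pullback_proj hβ)).extD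
  have h2 := IsSmoothForm.fun_smul T.contMDiff_cutoff (T.isSmoothForm_pullback_proj hβ.extD)
  exact h1.sub h2

include hβ in
/-- In a tube, the lift of `β` is `χ' dt ∧ β`. -/
lemma tubeRep_lift {b₀ : Θ.Base} {z : ℝ × W} (hz : z ∈ tubeDomain J b₀) :
    T.tubeRep b₀ (T.lift β) z = ContinuousAlternatingMap.alternatizeUncurryFin
      ((deriv Real.smoothTransition z.1 • ContinuousLinearMap.fst ℝ ℝ W).smulRight
        ((chartRep J β b₀ z.2).compContinuousLinearMap (ContinuousLinearMap.snd ℝ ℝ W))) := by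
  have hz' : z ∈ tubeRange J ∩ tubeOpen J b₀ := by rwa [tubeRange_inter]
  have hu := ((isShiftDomain_tube J b₀).uniqueDiffOn.inter (isShiftDomain_tube J b₀).isOpen) z hz'
  have h1 : T.tubeRep b₀ (T.lift β) z =
      T.tubeRep b₀ (extD I (fun x => T.cutoff x • pullback I J Θ.proj β x)) z -
      T.cutoff (T.tube b₀ z) • T.tubeRep b₀ (pullback I J Θ.proj (extD J β)) z := by
    rfl
  have hcut : HasFDerivWithinAt (fun z : ℝ × W => T.cutoff (T.tube b₀ z))
      (deriv Real.smoothTransition z.1 • ContinuousLinearMap.fst ℝ ℝ W)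
      (tubeRange J ∩ tubeOpen J b₀) z := by
    have h2 : HasDerivAt Real.smoothTransition (deriv Real.smoothTransition z.1) z.1 :=
      (((Real.smoothTransition.contDiff (n := 1)).differentiable (by simp)) z.1).hasDerivAt
    have h3 := (h2.comp_hasFDerivAt z (hasFDerivAt_fst (𝕜 := ℝ) (p := z))).hasFDerivWithinAt
      (s := tubeRange J ∩ tubeOpen J b₀)
    refine h3.congr (fun y _ => ?_) ?_ <;> simp [cutoff, T.t_tube]
  have hπ := T.isSmoothForm_pullback_proj hβ
  have h4 : EqOn (T.tubeRep b₀ fun x => T.cutoff x • pullback I J Θ.proj β x)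
      (fun z => T.cutoff (T.tube b₀ z) • T.tubeRep b₀ (pullback I J Θ.proj β) z)
      (tubeRange J ∩ tubeOpen J b₀) := fun y _ => rep_smul _ _ _ _ _
  rw [h1, T.tubeRep_extD (IsSmoothForm.fun_smul T.contMDiff_cutoff hπ) hz,
    extDerivWithin_congr' h4 hz', extDerivWithin_fun_smul' hcut
      ((T.contDiffOn_tubeRep hπ b₀ z hz').differentiableWithinAt (by simp)) hu,
    ← T.extD_pullback_proj hβ, T.tubeRep_extD hπ hz, add_sub_cancel_left, T.tubeRep_pullback β hz]

include hβ in
lemma curryLeft_tubeRep_lift {b₀ : Θ.Base} {z : ℝ × W} (hz : z ∈ tubeDomain J b₀) :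
    (T.tubeRep b₀ (T.lift β) z).curryLeft (1, 0) = deriv Real.smoothTransition z.1 •
      (chartRep J β b₀ z.2).compContinuousLinearMap (ContinuousLinearMap.snd ℝ ℝ W) := by
  rw [T.tubeRep_lift hβ hz, curryLeft_alternatizeUncurryFin_smulRight]
  · simp
  · intro v i
    exact (chartRep J β b₀ z.2).map_coord_zero i (by simp)

include hβ in
lemma lift_apply_eq_zero {x : M} (hx : β (Θ.proj x) = 0 ∨ T.t x < 0 ∨ 1 < T.t x) :
    T.lift β x = 0 := by
  have hs := mem_extChartAt_source (I := J) (Θ.proj x)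
  refine (T.isParam_tube _).eq_of_rep_eq (T.isLocalInverse_tube hs) (β := 0) ?_
  refine (T.tubeRep_lift hβ (T.tubeInv_mem hs)).trans ?_
  have h0 : ((deriv Real.smoothTransition (T.tubeInv (Θ.proj x) x).1 •
      ContinuousLinearMap.fst ℝ ℝ W).smulRight
        ((chartRep J β (Θ.proj x) (T.tubeInv (Θ.proj x) x).2).compContinuousLinearMap
          (ContinuousLinearMap.snd ℝ ℝ W))) = 0 := by
    rcases hx with hx | hx
    · have h1 : chartRep J β (Θ.proj x) (T.tubeInv (Θ.proj x) x).2 = 0 := by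
        have h2 : (extChartAt J (Θ.proj x)).symm (T.tubeInv (Θ.proj x) x).2 = Θ.proj x :=
          extChartAt_to_inv _
        rw [chartRep, h2, hx]
        rfl
      refine ContinuousLinearMap.ext fun w => ?_
      rw [h1, ContinuousLinearMap.smulRight_apply]
      exact smul_zero _
    · have h1 : deriv Real.smoothTransition (T.tubeInv (Θ.proj x) x).1 = 0 :=
        deriv_smoothTransition_eq_zero hx
      refine ContinuousLinearMap.ext fun w => ?_
      rw [h1, ContinuousLinearMap.smulRight_apply, zero_smul]
      exact zero_smul _ _
  rw [h0]
  ext v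
  simp [ContinuousAlternatingMap.alternatizeUncurryFin_apply, rep]

include hβ in
lemma support_lift : Function.support (T.lift β) ⊆ T.slab 1 (tsupport β) := by
  intro x hx
  constructor
  · by_contra! h
    refine hx (T.lift_apply_eq_zero hβ (Or.inr ?_))
    rcases lt_abs.1 h with h | h
    · exact Or.inr h
    · exact Or.inl (by linarith)
  · by_contra h
    exact hx (T.lift_apply_eq_zero hβ (Or.inl (image_eq_zero_of_notMem_tsupport h)))

variable [T2Space M] (hc : HasCompactSupport β)

include hβ hc in
lemma tsupport_lift : tsupport (T.lift β) ⊆ T.slab 1 (tsupport β) :=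
  closure_minimal (T.support_lift hβ) (T.isCompact_slab 1 hc).isClosed

include hβ hc in
lemma hasCompactSupport_lift : HasCompactSupport (T.lift β) :=
  (T.isCompact_slab 1 hc).of_isClosed_subset (isClosed_tsupport _) (T.tsupport_lift hβ hc)

include hβ hc in
/-- The lift is a section of fiber integration. -/
lemma fiberInt_lift : Θ.fiberInt J (T.lift β) = β := by
  refine base_eq_of_chartRep_eq (J := J) fun b₀ y hy => ?_
  rw [T.chartRep_fiberInt (T.isSmoothForm_lift hβ) (T.hasCompactSupport_lift hβ hc) hy]
  have hz : ((0 : ℝ), y) ∈ tubeDomain J b₀ := ⟨mem_univ _, hy⟩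
  have h1 : shiftInt univ (1, 0) (T.tubeRep b₀ (T.lift β)) (0, y) =
      (∫ s, deriv Real.smoothTransition s) •
        (chartRep J β b₀ y).compContinuousLinearMap (ContinuousLinearMap.snd ℝ ℝ W) := by
    rw [shiftInt, setIntegral_univ]
    refine Eq.trans ?_ (integral_smul_const (𝕜 := ℝ) (E := (ℝ × W) [⋀^Fin k]→L[ℝ] ℝ) (μ := volume)
      (deriv Real.smoothTransition) ((chartRep J β b₀ y).compContinuousLinearMap
        (ContinuousLinearMap.snd ℝ ℝ W)))
    congr 1
    funext s
    rw [T.curryLeft_tubeRep_lift hβ (tubeDomain_add hz s)]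
    simp
  rw [h1, integrable_and_integral_deriv_smoothTransition.2, one_smul]
  rfl

include T hβ in
lemma extD_lift : extD I (T.lift β) = -T.lift (extD J β) := by
  have h1 := IsSmoothForm.fun_smul T.contMDiff_cutoff (T.isSmoothForm_pullback_proj hβ)
  have h2 := IsSmoothForm.fun_smul T.contMDiff_cutoff (T.isSmoothForm_pullback_proj hβ.extD)
  rw [lift, extD_sub h1.extD h2, extD_extD h1, zero_sub, lift, extD_extD hβ]
  have h4 : (fun x => T.cutoff x • pullback I J Θ.proj (0 : Form W Θ.Base (k + 1 + 1)) x) = 0 := by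
    funext x
    exact smul_zero _
  rw [h4, sub_zero]

end lift

section homotopy

variable {α : Form E M (k + 1)} (hα : IsSmoothForm I α) (hc : HasCompactSupport α)

include hα hc in
lemma isSmoothForm_homotopy : IsSmoothForm I (T.homotopy α) := by
  have h1 := T.isSmoothForm_orbitInt hα hc isClosed_Iic (A := Iic 0)
  have h2 := IsSmoothForm.fun_smul T.contMDiff_cutoff (T.isSmoothForm_orbitInt hα hc isClosed_univ)
  exact h1.sub h2

include hα hc in
lemma extD_homotopy : extD I (T.homotopy α) + T.homotopy (extD I α) =
    α - T.lift (Θ.fiberInt J α) := by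
  have h1 := T.isSmoothForm_orbitInt hα hc isClosed_Iic (A := Iic 0)
  have h2 := IsSmoothForm.fun_smul T.contMDiff_cutoff (T.isSmoothForm_orbitInt hα hc isClosed_univ)
  have h4 := T.extD_orbitInt_Iic hα hc
  have h5 : Θ.orbitInt univ (extD I α) = -pullback I J Θ.proj (extD J (Θ.fiberInt J α)) := by
    rw [← T.extD_pullback_proj (T.isSmoothForm_fiberInt hα hc), T.pullback_fiberInt hα hc]
    exact eq_neg_of_add_eq_zero_right (T.extD_orbitInt_univ hα hc)
  rw [homotopy, extD_sub h1 h2, homotopy, lift, h5, T.pullback_fiberInt hα hc]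
  funext x
  have h6 := congrFun h4 x
  simp only [Pi.add_apply, Pi.sub_apply, Pi.neg_apply] at h6 ⊢
  rw [smul_neg, ← h6]
  abel

lemma homotopy_extD_zero {α : Form E M 0} (hα : IsSmoothForm I α) (hc : HasCompactSupport α) :
    T.homotopy (extD I α) = α := by
  rw [homotopy, T.orbitInt_Iic_extD_zero hα hc, T.orbitInt_univ_extD_zero hα hc]
  funext x
  simp

include T in
lemma orbitInt_add {α β : Form E M (k + 1)} (hα : IsSmoothForm I α) (hc : HasCompactSupport α)
    (hβ : IsSmoothForm I β) (hc' : HasCompactSupport β) (A : Set ℝ) :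
    Θ.orbitInt A (α + β) = Θ.orbitInt A α + Θ.orbitInt A β := by
  refine T.eq_of_tubeRep_eq fun b₀ z hz => ?_
  have hz' : z ∈ tubeRange J ∩ tubeOpen J b₀ := by rwa [tubeRange_inter]
  have hi := fun {γ : Form E M (k + 1)} (hγ : IsSmoothForm I γ) (hc : HasCompactSupport γ) =>
    ((isShiftDomain_tube J b₀).integrable (T.contDiffOn_tubeRep hγ b₀)
      (T.compactAlong_tubeRep hc b₀ _) hz').restrict (s := A)
  rw [T.tubeRep_add, T.rep_orbitInt (hα.add hβ) (hc.add hc') A hz, T.rep_orbitInt hα hc A hz,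
    T.rep_orbitInt hβ hc' A hz, shiftInt, shiftInt, shiftInt, ← integral_add (hi hα hc) (hi hβ hc')]
  congr 1

omit [FiniteDimensional ℝ E] [IsManifold I ∞ M] in
lemma orbitInt_smul (c : ℝ) (α : Form E M (k + 1)) (A : Set ℝ) :
    Θ.orbitInt A (c • α) = c • Θ.orbitInt A α := by
  funext x
  change ∫ s in A, Θ.slice (c • α) s x = c • ∫ s in A, Θ.slice α s x
  rw [← integral_smul]
  rfl

lemma homotopy_add {α β : Form E M (k + 1)} (hα : IsSmoothForm I α) (hc : HasCompactSupport α)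
    (hβ : IsSmoothForm I β) (hc' : HasCompactSupport β) :
    T.homotopy (α + β) = T.homotopy α + T.homotopy β := by
  rw [homotopy, T.orbitInt_add hα hc hβ hc', T.orbitInt_add hα hc hβ hc', homotopy, homotopy]
  funext x
  simp only [Pi.add_apply, Pi.sub_apply, smul_add]
  abel

omit [FiniteDimensional ℝ E] [IsManifold I ∞ M] in
lemma homotopy_smul (c : ℝ) (α : Form E M (k + 1)) : T.homotopy (c • α) = c • T.homotopy α := by
  rw [homotopy, orbitInt_smul, orbitInt_smul, homotopy]
  funext x
  simp only [Pi.smul_apply, Pi.sub_apply, smul_sub, smul_comm c]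

include T in
lemma fiberInt_add {α β : Form E M (k + 1)} (hα : IsSmoothForm I α) (hc : HasCompactSupport α)
    (hβ : IsSmoothForm I β) (hc' : HasCompactSupport β) :
    Θ.fiberInt J (α + β) = Θ.fiberInt J α + Θ.fiberInt J β := by
  refine T.pullback_proj_injective ?_
  rw [T.pullback_fiberInt (hα.add hβ) (hc.add hc'), T.orbitInt_add hα hc hβ hc',
    ← T.pullback_fiberInt hα hc, ← T.pullback_fiberInt hβ hc']
  rfl

include T in
lemma fiberInt_smul (c : ℝ) {α : Form E M (k + 1)} (hα : IsSmoothForm I α)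
    (hc : HasCompactSupport α) : Θ.fiberInt J (c • α) = c • Θ.fiberInt J α := by
  refine T.pullback_proj_injective ?_
  rw [T.pullback_fiberInt (hα.smul c) (hc.smul_left (f := fun _ => c)), orbitInt_smul,
    ← T.pullback_fiberInt hα hc]
  rfl

lemma lift_add {β γ : Form W Θ.Base k} (hβ : IsSmoothForm J β) (hγ : IsSmoothForm J γ) :
    T.lift (β + γ) = T.lift β + T.lift γ := by
  have h1 : (fun x => T.cutoff x • pullback I J Θ.proj (β + γ) x) =
      (fun x => T.cutoff x • pullback I J Θ.proj β x) +
        fun x => T.cutoff x • pullback I J Θ.proj γ x := by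
    funext x
    exact smul_add (T.cutoff x) (pullback I J Θ.proj β x) (pullback I J Θ.proj γ x)
  have h2 := fun {β : Form W Θ.Base k} (hβ : IsSmoothForm J β) =>
    IsSmoothForm.fun_smul T.contMDiff_cutoff (T.isSmoothForm_pullback_proj hβ)
  rw [lift, h1, extD_add (h2 hβ) (h2 hγ), extD_add hβ hγ, lift, lift]
  funext x
  simp only [Pi.add_apply, Pi.sub_apply]
  have h3 : pullback I J Θ.proj (extD J β + extD J γ) x =
    pullback I J Θ.proj (extD J β) x + pullback I J Θ.proj (extD J γ) x := rfl
  rw [h3, smul_add]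
  abel

lemma lift_smul (c : ℝ) (β : Form W Θ.Base k) : T.lift (c • β) = c • T.lift β := by
  have h1 : (fun x => T.cutoff x • pullback I J Θ.proj (c • β) x) =
      c • fun x => T.cutoff x • pullback I J Θ.proj β x := by
    funext x
    exact smul_comm (T.cutoff x) c (pullback I J Θ.proj β x)
  rw [lift, h1, extD_smul, extD_smul, lift]
  funext x
  simp only [Pi.smul_apply, Pi.sub_apply, smul_sub]
  congr 1
  exact smul_comm (T.cutoff x) c (pullback I J Θ.proj (extD J β) x)

end homotopy

end EquivariantTime

end CSWZW

/-! ### Existence of equivariant time functions -/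

namespace CSWZW

section Freeness

variable {E : Type*} [NormedAddCommGroup E] [NormedSpace ℝ E] {H : Type*} [TopologicalSpace H]
  {I : ModelWithCorners ℝ E H} {M : Type*} [TopologicalSpace M] [ChartedSpace H M]

/-- A proper `ℝ`-action is free, since the stabilizers are compact subgroups of `ℝ`. -/
lemma SmoothFlow.IsProper.eq_zero_of_toFun_eq {Θ : SmoothFlow I M} (hΘ : Θ.IsProper) {s : ℝ} {x : M}
    (h : Θ.toFun s x = x) : s = 0 := by
  by_contra hs
  have h1 : ∀ n : ℕ, Θ.toFun (n * s) x = x := by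
    intro n
    induction n with
    | zero => simp [Θ.map_zero]
    | succ n ih => rw [Nat.cast_succ, add_one_mul, Θ.map_add, h, ih]
  have h2 := hΘ.isCompact_preimage (isCompact_singleton (x := (x, x)))
  obtain ⟨C, hC⟩ := (h2.image continuous_fst).isBounded.exists_norm_le
  obtain ⟨n, hn⟩ := exists_nat_gt (C / |s|)
  have h3 := hC (n * s) ⟨(n * s, x), by simp [h1], rfl⟩
  rw [div_lt_iff₀ (abs_pos.2 hs)] at hn
  rw [Real.norm_eq_abs, abs_mul, Nat.abs_cast] at h3
  linarith

lemma SmoothFlow.IsProper.toFun_injective {Θ : SmoothFlow I M} (hΘ : Θ.IsProper) {s t : ℝ} {x : M}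
    (h : Θ.toFun s x = Θ.toFun t x) : s = t := by
  have h1 : Θ.toFun (-t + s) x = x := by
    rw [Θ.map_add, h, ← Θ.map_add, neg_add_cancel, Θ.map_zero]
  linarith [hΘ.eq_zero_of_toFun_eq h1]

end Freeness

/-- The pullback of a smooth partition of unity along a smooth map. -/
noncomputable def comapPartition {E : Type*} [NormedAddCommGroup E] [NormedSpace ℝ E] {H : Type*}
    [TopologicalSpace H] {I : ModelWithCorners ℝ E H} {M : Type*} [TopologicalSpace M]
    [ChartedSpace H M] {F : Type*} [NormedAddCommGroup F] [NormedSpace ℝ F] {G : Type*}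
    [TopologicalSpace G] {J : ModelWithCorners ℝ F G} {N : Type*} [TopologicalSpace N]
    [ChartedSpace G N] {κ : Type*} (ρ : SmoothPartitionOfUnity κ J N univ) {f : M → N}
    (hf : ContMDiff I J ∞ f) : SmoothPartitionOfUnity κ I M univ where
  toFun i := (ρ i).comp ⟨f, hf⟩
  locallyFinite' := ρ.locallyFinite.preimage_continuous hf.continuous
  nonneg' i x := ρ.nonneg i (f x)
  sum_eq_one' x _ := ρ.sum_eq_one (mem_univ (f x))
  sum_le_one' x := ρ.sum_le_one (f x)

variable {E : Type} [NormedAddCommGroup E] [NormedSpace ℝ E] {H : Type} [TopologicalSpace H]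
  {I : ModelWithCorners ℝ E H} {M : Type u} [TopologicalSpace M] [ChartedSpace H M]
  {W : Type} [NormedAddCommGroup W] [NormedSpace ℝ W] [FiniteDimensional ℝ W]
  {H' : Type} [TopologicalSpace H'] {J : ModelWithCorners ℝ W H'}

/-- A principal bundle with fiber `ℝ` has a global equivariant time function: local ones form
an affine space over the functions on the base, so they are glued with a partition of unity. -/
lemma SmoothFlow.IsPrincipalBundle.exists_equivariantTime {Θ : SmoothFlow I M}
    [ChartedSpace H' Θ.Base] [IsManifold J ∞ Θ.Base] [T2Space Θ.Base] [SigmaCompactSpace Θ.Base]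
    (hΘ : Θ.IsProper) (h : Θ.IsPrincipalBundle J) : Nonempty (EquivariantTime Θ J) := by
  choose V σ t hV hb hσ ht hπσ htσ using h.locally_trivial
  have htadd : ∀ b x s, Θ.proj x ∈ V b → t b (Θ.toFun s x) = t b x + s := by
    intro b x s hx
    have h1 := htσ b (Θ.toFun s x) (by rwa [mem_preimage, Θ.proj_toFun])
    rw [Θ.proj_toFun] at h1
    refine hΘ.toFun_injective (x := σ b (Θ.proj x)) ?_
    rw [h1, add_comm, Θ.map_add, htσ b x hx]
  obtain ⟨ρ, hρ⟩ := SmoothPartitionOfUnity.exists_isSubordinate J isClosed_univ V hV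
    fun b _ => mem_iUnion.2 ⟨b, hb b⟩
  let f := comapPartition ρ h.smooth_proj
  let τ : M → ℝ := fun x => ∑ᶠ b, f b x • t b x
  have hτ : ContMDiff I 𝓘(ℝ, ℝ) ∞ τ := by
    refine f.contMDiff_finsum_smul fun b x hx => ?_
    have h1 : Θ.proj x ∈ V b := hρ b (tsupport_comp_subset_preimage (ρ b) Θ.continuous_proj hx)
    exact (ht b).contMDiffAt (((hV b).preimage Θ.continuous_proj).mem_nhds h1)
  have hfin : ∀ x, (Function.support fun b => f b x).Finite := fun x => f.locallyFinite.point_finite x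
  have hτadd : ∀ s x, τ (Θ.toFun s x) = τ x + s := by
    intro s x
    have h1 : ∀ b, f b (Θ.toFun s x) • t b (Θ.toFun s x) = f b x • t b x + f b x * s := by
      intro b
      have h2 : f b (Θ.toFun s x) = f b x := congrArg (ρ b) (Θ.proj_toFun s x)
      rw [h2]
      by_cases hx : Θ.proj x ∈ V b
      · rw [htadd b x s hx, smul_eq_mul, smul_eq_mul, mul_add]
      · have h3 : f b x = 0 := by
          by_contra h3
          exact hx (hρ b (subset_tsupport _ h3))
        simp [h3]
    have h4 : ∑ᶠ b, f b x * s = s := by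
      rw [← finsum_mul, f.sum_eq_one (mem_univ x), one_mul]
    change ∑ᶠ b, f b (Θ.toFun s x) • t b (Θ.toFun s x) = _
    rw [finsum_congr h1, finsum_add_distrib, h4]
    · exact (hfin x).subset fun b hb => left_ne_zero_of_mul hb
    · exact (hfin x).subset fun b hb => left_ne_zero_of_mul hb
  have hinv : ∀ x y, Θ.proj x = Θ.proj y → Θ.toFun (-τ x) x = Θ.toFun (-τ y) y := by
    intro x y hxy
    obtain ⟨s, rfl⟩ := Quotient.exact hxy
    rw [hτadd, ← Θ.map_add]
    congr 1
    ring
  refine ⟨⟨τ, fun b => Θ.toFun (-τ b.out) b.out, h.smooth_proj, hτ, fun b => ?_, hτadd, fun b => ?_,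
    fun b => ?_⟩⟩
  · have h1 : (fun b' : Θ.Base => Θ.toFun (-τ b'.out) b'.out) =ᶠ[𝓝 b]
        fun b' => Θ.toFun (-τ (σ b b')) (σ b b') := by
      filter_upwards [(hV b).mem_nhds (hb b)] with b' hb'
      exact hinv _ _ ((Quotient.out_eq _).trans (hπσ b b' hb').symm)
    have h2 : ContMDiffAt J I ∞ (σ b) b := (hσ b).contMDiffAt ((hV b).mem_nhds (hb b))
    refine ContMDiffAt.congr_of_eventuallyEq ?_ h1
    exact (Θ.smooth _).comp b (((hτ _).comp b h2).neg.prodMk h2)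
  · exact (Θ.proj_toFun _ _).trans (Quotient.out_eq b)
  · rw [hτadd, add_neg_cancel]

end CSWZW

/-! ### Integration in parametrizations -/

namespace CSWZW

section Patch

variable {E : Type*} [NormedAddCommGroup E] [NormedSpace ℝ E] {H : Type*} [TopologicalSpace H]
  {I : ModelWithCorners ℝ E H} {M : Type*} [TopologicalSpace M] [ChartedSpace H M]
  {F : Type*} [NormedAddCommGroup F] [NormedSpace ℝ F] [MeasurableSpace F]
  {F' : Type*} [NormedAddCommGroup F'] [NormedSpace ℝ F'] [MeasurableSpace F'] {k : ℕ}

/-- `P` is a smooth parametrization by `S ⊆ R` of the open subset `O` of `M`, with inverse `Q`. -/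
structure IsPatch (I : ModelWithCorners ℝ E H) (P : F → M) (R S : Set F) (Q : M → F) (O : Set M) :
    Prop where
  param : IsParam I P R S
  measurableSet : MeasurableSet S
  isOpen : IsOpen O
  mapsTo : MapsTo P S O
  mapsTo_inv : MapsTo Q O S
  left_inv : ∀ z ∈ S, Q (P z) = z
  right_inv : ∀ x ∈ O, P (Q x) = x
  smooth_inv : ∀ x ∈ O, ContMDiffAt I 𝓘(ℝ, F) ∞ Q x

namespace IsPatch

variable {P : F → M} {R S : Set F} {Q : M → F} {O : Set M}
  {P' : F' → M} {R' S' : Set F'} {Q' : M → F'} {O' : Set M}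

lemma continuousOn (h : IsPatch I P R S Q O) : ContinuousOn P S := fun z hz =>
  ((h.param.smooth z hz).continuousWithinAt).mono h.param.subset

lemma measurableSet_inter_preimage [OpensMeasurableSpace F] (h : IsPatch I P R S Q O)
    (hO' : IsOpen O') : MeasurableSet (S ∩ P ⁻¹' O') := by
  obtain ⟨u, hu, hu'⟩ := (continuousOn_iff'.1 h.continuousOn) O' hO'
  rw [inter_comm, hu']
  exact hu.measurableSet.inter h.measurableSet

lemma isCompact_image (h : IsPatch I P R S Q O) {K : Set M} (hK : IsCompact K) (hKO : K ⊆ O) :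
    IsCompact (Q '' K) :=
  hK.image_of_continuousOn fun x hx => (h.smooth_inv x (hKO hx)).continuousAt.continuousWithinAt

variable (I) in
lemma chart [MeasurableSpace E] [OpensMeasurableSpace E] [IsManifold I ∞ M] (x₀ : M) :
    IsPatch I (extChartAt I x₀).symm (range I) (extChartAt I x₀).target (extChartAt I x₀)
      (extChartAt I x₀).source where
  param := isParam_chart I x₀
  measurableSet := by
    rw [extChartAt_target]
    exact (I.continuous_symm.isOpen_preimage _ (chartAt H x₀).open_target).measurableSet.inter
      I.isClosed_range.measurableSet
  isOpen := isOpen_extChartAt_source x₀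
  mapsTo _ hz := (extChartAt I x₀).map_target hz
  mapsTo_inv _ hz := (extChartAt I x₀).map_source hz
  left_inv _ hz := (extChartAt I x₀).right_inv hz
  right_inv _ hx := (extChartAt I x₀).left_inv hx
  smooth_inv _ hx := contMDiffAt_extChartAt' (by rwa [extChartAt_source] at hx)

/-- The transition function between two parametrizations is smooth. -/
lemma contDiffWithinAt_transition (h : IsPatch I P R S Q O) (h' : IsPatch I P' R' S' Q' O')
    {z : F} (hz : z ∈ S ∩ P ⁻¹' O') : ContDiffWithinAt ℝ ∞ (Q' ∘ P) R z :=
  contMDiffWithinAt_iff_contDiffWithinAt.1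
    ((h'.smooth_inv _ hz.2).comp_contMDiffWithinAt z (h.param.smooth z hz.1))

lemma eventually_transition (h : IsPatch I P R S Q O) (h' : IsPatch I P' R' S' Q' O')
    {z : F} (hz : z ∈ S ∩ P ⁻¹' O') :
    (∀ᶠ z' in 𝓝[R] z, (Q' ∘ P) z' ∈ S') ∧ P =ᶠ[𝓝[R] z] P' ∘ (Q' ∘ P) := by
  have h1 : ∀ᶠ z' in 𝓝[R] z, P z' ∈ O' :=
    (h.param.smooth z hz.1).continuousWithinAt.eventually (h'.isOpen.mem_nhds hz.2)
  exact ⟨h1.mono fun y hy => h'.mapsTo_inv hy, h1.mono fun y hy => (h'.right_inv _ hy).symm⟩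

/-- Precomposition of a parametrization with a linear isomorphism. -/
lemma comp_equiv [BorelSpace F] [BorelSpace F'] (h : IsPatch I P R S Q O) (L : F' ≃L[ℝ] F) :
    IsPatch I (P ∘ L) (L ⁻¹' R) (L ⁻¹' S) (L.symm ∘ Q) O where
  param :=
    { uniqueDiffOn := L.uniqueDiffOn_preimage_iff.2 h.param.uniqueDiffOn
      subset_closure := by
        have h1 := preimage_mono (f := L) h.param.subset_closure
        have h2 := L.toHomeomorph.preimage_closure (interior R)
        rw [L.toHomeomorph.preimage_interior] at h2
        exact h1.trans h2.le
      subset := preimage_mono h.param.subset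
      mem_nhds := fun z hz => by
        have h1 : Tendsto L (𝓝[L ⁻¹' R] z) (𝓝[R] (L z)) :=
          (L.continuous.continuousWithinAt).tendsto_nhdsWithin fun _ hz => hz
        exact h1 (h.param.mem_nhds _ hz)
      smooth := fun z hz =>
        (h.param.smooth _ hz).comp z (L.contDiff.contMDiff z).contMDiffWithinAt fun _ hz => hz }
  measurableSet := L.continuous.measurable h.measurableSet
  isOpen := h.isOpen
  mapsTo z hz := h.mapsTo hz
  mapsTo_inv x hx := by simpa using h.mapsTo_inv hx
  left_inv z hz := by simp [h.left_inv _ hz]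
  right_inv x hx := by simp [h.right_inv x hx]
  smooth_inv x hx := (L.symm.contDiff.contMDiff _).comp x (h.smooth_inv x hx)

lemma rep_comp_equiv [IsManifold I ∞ M] (h : IsPatch I P R S Q O) (L : F' ≃L[ℝ] F) (α : Form E M k) {z : F'}
    (hz : L z ∈ S) : rep I (P ∘ L) (L ⁻¹' R) α z =
      (rep I P R α (L z)).compContinuousLinearMap (L : F' →L[ℝ] F) := by
  have hu : UniqueDiffWithinAt ℝ (L ⁻¹' R) z :=
    L.uniqueDiffOn_preimage_iff.2 h.param.uniqueDiffOn z (h.param.subset hz)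
  have h1 : Tendsto L (𝓝[L ⁻¹' R] z) (𝓝[R] (L z)) :=
    (L.continuous.continuousWithinAt).tendsto_nhdsWithin fun _ hz => hz
  rw [h.param.rep_apply (τ := L) L.differentiableAt.differentiableWithinAt hu
    (h1 (h.param.mem_nhds _ hz)) (Eventually.of_forall fun _ => rfl) (h.param.subset hz),
    L.fderivWithin hu]

end IsPatch

end Patch

section Integral

variable {n : ℕ} {H : Type*} [TopologicalSpace H]
  {I : ModelWithCorners ℝ (EuclideanSpace ℝ (Fin n)) H} {M : Type*} [TopologicalSpace M]
  [ChartedSpace H M]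

/-- The value of a top degree form on the standard basis is multiplied by the determinant under
linear maps. -/
lemma apply_single_compContinuousLinearMap (a : EuclideanSpace ℝ (Fin n) [⋀^Fin n]→L[ℝ] ℝ)
    (D : EuclideanSpace ℝ (Fin n) →L[ℝ] EuclideanSpace ℝ (Fin n)) :
    (a.compContinuousLinearMap D) (fun i => EuclideanSpace.single i 1) =
      D.det * a fun i => EuclideanSpace.single i 1 := by
  have h1 := a.toAlternatingMap.eq_smul_basis_det (EuclideanSpace.basisFun (Fin n) ℝ).toBasis
  have h2 : ∀ v, a v = a (EuclideanSpace.basisFun (Fin n) ℝ).toBasis *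
      (EuclideanSpace.basisFun (Fin n) ℝ).toBasis.det v := fun v => DFunLike.congr_fun h1 v
  have h3 : (fun i => EuclideanSpace.single i (1 : ℝ)) =
      ⇑(EuclideanSpace.basisFun (Fin n) ℝ).toBasis := by
    funext i; simp
  rw [h3, ContinuousAlternatingMap.compContinuousLinearMap_apply, h2,
    show (D ∘ (EuclideanSpace.basisFun (Fin n) ℝ).toBasis) =
      (D : EuclideanSpace ℝ (Fin n) →ₗ[ℝ] EuclideanSpace ℝ (Fin n)) ∘
        (EuclideanSpace.basisFun (Fin n) ℝ).toBasis from rfl, Module.Basis.det_comp,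
    Module.Basis.det_self, mul_one, mul_comm]

lemma sign_mul_mul (d m a : ℝ) : Real.sign (d * m) * (d * a) = |d| * (Real.sign m * a) := by
  have h : Real.sign (d * m) * d = |d| * Real.sign m := by
    rcases lt_trichotomy d 0 with h | rfl | h <;> rcases lt_trichotomy m 0 with h' | rfl | h'
    · rw [Real.sign_of_pos (mul_pos_of_neg_of_neg h h'), Real.sign_of_neg h', abs_of_neg h]; ring
    · simp
    · rw [Real.sign_of_neg (mul_neg_of_neg_of_pos h h'), Real.sign_of_pos h', abs_of_neg h]; ring
    · simp
    · simp
    · simp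
    · rw [Real.sign_of_neg (mul_neg_of_pos_of_neg h h'), Real.sign_of_neg h', abs_of_pos h]; ring
    · simp
    · rw [Real.sign_of_pos (mul_pos h h'), Real.sign_of_pos h', abs_of_pos h]; ring
  rw [← mul_assoc, h, mul_assoc]

lemma measurable_realSign : Measurable Real.sign := by
  unfold Real.sign
  exact Measurable.ite measurableSet_Iio measurable_const
    (Measurable.ite measurableSet_Ioi measurable_const measurable_const)

/-- The density of the top degree form `α` with respect to the orientation given by `μ`, in a
parametrization. -/
noncomputable def density (I : ModelWithCorners ℝ (EuclideanSpace ℝ (Fin n)) H)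
    (P : EuclideanSpace ℝ (Fin n) → M) (R : Set (EuclideanSpace ℝ (Fin n)))
    (μ α : Form (EuclideanSpace ℝ (Fin n)) M n) (z : EuclideanSpace ℝ (Fin n)) : ℝ :=
  Real.sign (rep I P R μ z fun i => EuclideanSpace.single i 1) *
    rep I P R α z fun i => EuclideanSpace.single i 1

variable {P P' : EuclideanSpace ℝ (Fin n) → M} {R S R' S' : Set (EuclideanSpace ℝ (Fin n))}
  {Q Q' : M → EuclideanSpace ℝ (Fin n)} {O O' : Set M}
  {μ α β : Form (EuclideanSpace ℝ (Fin n)) M n}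

lemma density_eq_zero {z : EuclideanSpace ℝ (Fin n)} (h : α (P z) = 0) : density I P R μ α z = 0 := by
  rw [density, rep, rep, h]
  simp

lemma density_add (z : EuclideanSpace ℝ (Fin n)) :
    density I P R μ (α + β) z = density I P R μ α z + density I P R μ β z := by
  simp [density, rep_add, mul_add]

lemma density_smul (c : M → ℝ) (z : EuclideanSpace ℝ (Fin n)) :
    density I P R μ (fun x => c x • α x) z = c (P z) * density I P R μ α z := by
  simp [density, rep_smul]
  ring

variable [IsManifold I ∞ M]

/-- Change of variables. -/
lemma setIntegral_density_eq (h : IsPatch I P R S Q O) (h' : IsPatch I P' R' S' Q' O') :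
    ∫ z in S' ∩ P' ⁻¹' O, density I P' R' μ α z = ∫ z in S ∩ P ⁻¹' O', density I P R μ α z := by
  have himg : (Q' ∘ P) '' (S ∩ P ⁻¹' O') = S' ∩ P' ⁻¹' O := by
    ext z
    constructor
    · rintro ⟨y, hy, rfl⟩
      refine ⟨h'.mapsTo_inv hy.2, ?_⟩
      rw [mem_preimage, Function.comp_apply, h'.right_inv _ hy.2]
      exact h.mapsTo hy.1
    · rintro ⟨hz, hz'⟩
      refine ⟨Q (P' z), ⟨h.mapsTo_inv hz', ?_⟩, ?_⟩
      · rw [mem_preimage, h.right_inv _ hz']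
        exact h'.mapsTo hz
      · rw [Function.comp_apply, h.right_inv _ hz', h'.left_inv z hz]
  have hinj : InjOn (Q' ∘ P) (S ∩ P ⁻¹' O') := by
    intro y hy z hz hyz
    have h1 := congrArg P' hyz
    simp only [Function.comp_apply] at h1
    rw [h'.right_inv _ hy.2, h'.right_inv _ hz.2] at h1
    rw [← h.left_inv y hy.1, h1, h.left_inv z hz.1]
  have hm := h.measurableSet_inter_preimage h'.isOpen
  have hd : ∀ z ∈ S ∩ P ⁻¹' O', DifferentiableWithinAt ℝ (Q' ∘ P) R z := fun z hz =>
    (h.contDiffWithinAt_transition h' hz).differentiableWithinAt (by simp)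
  rw [← himg, integral_image_eq_integral_abs_det_fderiv_smul volume hm
    (fun z hz => ((hd z hz).hasFDerivWithinAt).mono (inter_subset_left.trans h.param.subset)) hinj]
  refine setIntegral_congr_fun hm fun z hz => ?_
  obtain ⟨h1, h2⟩ := h.eventually_transition h' hz
  have h3 : ∀ γ : Form (EuclideanSpace ℝ (Fin n)) M n, rep I P R γ z
      (fun i => EuclideanSpace.single i 1) = (fderivWithin ℝ (Q' ∘ P) R z).det *
        rep I P' R' γ ((Q' ∘ P) z) (fun i => EuclideanSpace.single i 1) := by
    intro γ
    rw [h'.param.rep_apply (hd z hz) (h.param.uniqueDiffOn z (h.param.subset hz.1)) h1 h2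
      (h.param.subset hz.1), apply_single_compContinuousLinearMap]
  simp only [density, h3, smul_eq_mul, sign_mul_mul]

lemma integrableOn_density (h : IsPatch I P R S Q O) (hμ : IsSmoothForm I μ) (hα : IsSmoothForm I α)
    (hc : HasCompactSupport α) (hO : tsupport α ⊆ O) : IntegrableOn (density I P R μ α) S := by
  have hcont : ∀ γ : Form (EuclideanSpace ℝ (Fin n)) M n, IsSmoothForm I γ →
      ContinuousOn (fun z => rep I P R γ z fun i => EuclideanSpace.single i 1) S := by
    intro γ hγ z hz
    have h1 := ((h.param.contDiffWithinAt_rep hγ hz).continuousWithinAt).mono h.param.subset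
    have h2 : Continuous fun a : EuclideanSpace ℝ (Fin n) [⋀^Fin n]→L[ℝ] ℝ =>
        a fun i => EuclideanSpace.single i 1 :=
      (ContinuousMultilinearMap.apply ℝ (fun _ => EuclideanSpace ℝ (Fin n)) ℝ
        (fun i => EuclideanSpace.single i (1 : ℝ))).continuous.comp
          (ContinuousAlternatingMap.toContinuousMultilinearMapCLM ℝ).continuous
    exact h2.continuousAt.comp_continuousWithinAt h1
  set K := Q '' tsupport α with hKdef
  have hK : IsCompact K := h.isCompact_image hc hO
  have hKS : K ⊆ S := image_subset_iff.2 fun x hx => h.mapsTo_inv (hO hx)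
  have h1 : IntegrableOn (density I P R μ α) K := by
    refine Integrable.bdd_mul (c := 1) (((hcont α hα).mono hKS).integrableOn_compact hK) ?_ ?_
    · exact measurable_realSign.comp_aemeasurable
        (((hcont μ hμ).mono hKS).aemeasurable hK.measurableSet) |>.aestronglyMeasurable
    · refine Eventually.of_forall fun z => ?_
      rcases Real.sign_apply_eq (rep I P R μ z fun i => EuclideanSpace.single i 1) with h | h | h <;>
        rw [h] <;> simp
  refine h1.of_forall_sdiff_eq_zero h.measurableSet fun z hz => density_eq_zero ?_
  by_contra h0
  exact hz.2 ⟨P z, subset_tsupport _ h0, h.left_inv z hz.1⟩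

variable [T2Space M] [SigmaCompactSpace M]

/-- The integral is defined with a partition of unity. -/
lemma exists_integral_eq (I : ModelWithCorners ℝ (EuclideanSpace ℝ (Fin n)) H) (M : Type*)
    [TopologicalSpace M] [ChartedSpace H M] [IsManifold I ∞ M] [T2Space M] [SigmaCompactSpace M] :
    ∃ ρ : SmoothPartitionOfUnity M I M univ,
      (ρ.IsSubordinate fun x => (chartAt H x).source) ∧
      ∀ μ α : Form (EuclideanSpace ℝ (Fin n)) M n, integral I μ α = ∑ᶠ x₀ : M,
        ∫ y in (extChartAt I x₀).target,
          density I (extChartAt I x₀).symm (range I) μ (fun x => ρ x₀ x • α x) y := by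
  have h : n = n ∧ ∃ ρ : SmoothPartitionOfUnity M I M univ,
    ρ.IsSubordinate fun x => (chartAt H x).source :=
      ⟨rfl, SmoothPartitionOfUnity.exists_isSubordinate_chartAt_source I M⟩
  refine ⟨h.2.choose, h.2.choose_spec, fun μ α => ?_⟩
  rw [integral, dif_pos h]
  refine finsum_congr fun x₀ => integral_congr_ae (Eventually.of_forall fun y => ?_)
  simp only [density_smul]
  rfl

omit [T2Space M] [SigmaCompactSpace M] [IsManifold I ∞ M] in
lemma finite_support_inter (ρ : SmoothPartitionOfUnity M I M univ) (hc : HasCompactSupport α) :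
    {x₀ | (Function.support (ρ x₀) ∩ tsupport α).Nonempty}.Finite :=
  ρ.locallyFinite.finite_nonempty_inter_compact hc

omit [T2Space M] [SigmaCompactSpace M] in
lemma IsSmoothForm.partition_smul {κ : Type*} {k : ℕ} {α : Form (EuclideanSpace ℝ (Fin n)) M k}
    (hα : IsSmoothForm I α)
    (ρ : SmoothPartitionOfUnity κ I M univ) (i : κ) : IsSmoothForm I fun x => ρ i x • α x :=
  hα.fun_smul (ρ i).contMDiff

lemma tsupport_smul_form_subset {E : Type*} [NormedAddCommGroup E] [NormedSpace ℝ E]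
    {M : Type*} [TopologicalSpace M] {k : ℕ} {α : Form E M k} (c : M → ℝ) :
    tsupport (fun x => c x • α x) ⊆ tsupport c ∩ tsupport α :=
  subset_inter (closure_mono fun x hx h => hx (by simp [h]))
    (closure_mono fun x hx h => hx (by simp [h]))

lemma hasCompactSupport_smul_form {E : Type*} [NormedAddCommGroup E] [NormedSpace ℝ E]
    {M : Type*} [TopologicalSpace M] {k : ℕ} {α : Form E M k} (hα : HasCompactSupport α)
    (c : M → ℝ) : HasCompactSupport fun x => c x • α x :=
  hα.of_isClosed_subset (isClosed_tsupport _) ((tsupport_smul_form_subset c).trans inter_subset_right)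

lemma integral_add (hμ : IsSmoothForm I μ) (hα : IsSmoothForm I α) (hβ : IsSmoothForm I β)
    (hcα : HasCompactSupport α) (hcβ : HasCompactSupport β) :
    integral I μ (α + β) = integral I μ α + integral I μ β := by
  obtain ⟨ρ, hρ, hint⟩ := exists_integral_eq I M
  have hi : ∀ {α : Form (EuclideanSpace ℝ (Fin n)) M n}, IsSmoothForm I α → HasCompactSupport α →
      ∀ x₀, IntegrableOn (density I (extChartAt I x₀).symm (range I) μ fun x => ρ x₀ x • α x)
        (extChartAt I x₀).target := fun hα hc x₀ =>
    integrableOn_density (IsPatch.chart I x₀) hμ (hα.partition_smul ρ x₀)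
      (hasCompactSupport_smul_form hc _) (by
        rw [extChartAt_source]
        exact (tsupport_smul_form_subset _).trans (inter_subset_left.trans (hρ x₀)))
  have hf : ∀ {α : Form (EuclideanSpace ℝ (Fin n)) M n}, HasCompactSupport α →
      (Function.support fun x₀ => ∫ y in (extChartAt I x₀).target,
        density I (extChartAt I x₀).symm (range I) μ (fun x => ρ x₀ x • α x) y).Finite := by
    intro α hc
    refine (finite_support_inter ρ hc).subset fun x₀ hx₀ => ?_
    by_contra h
    refine hx₀ (integral_eq_zero_of_ae (Eventually.of_forall fun y => density_eq_zero ?_))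
    by_contra h'
    exact h ⟨(extChartAt I x₀).symm y, left_ne_zero_of_smul h',
      subset_tsupport _ (right_ne_zero_of_smul h')⟩
  rw [hint, hint, hint, ← finsum_add_distrib (hf hcα) (hf hcβ)]
  refine finsum_congr fun x₀ => ?_
  rw [← MeasureTheory.integral_add (hi hα hcα x₀) (hi hβ hcβ x₀)]
  refine integral_congr_ae (Eventually.of_forall fun y => ?_)
  simp only [density_smul, density_add, mul_add]

lemma integral_zero : integral I μ (0 : Form (EuclideanSpace ℝ (Fin n)) M n) = 0 := by
  obtain ⟨ρ, hρ, hint⟩ := exists_integral_eq I M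
  rw [hint]
  refine finsum_eq_zero_of_forall_eq_zero fun x₀ => ?_
  refine integral_eq_zero_of_ae (Eventually.of_forall fun y => density_eq_zero ?_)
  simp

lemma integral_finset_sum {κ : Type*} (s : Finset κ) (f : κ → Form (EuclideanSpace ℝ (Fin n)) M n)
    (hμ : IsSmoothForm I μ) (hf : ∀ i, IsSmoothForm I (f i)) (hc : ∀ i, HasCompactSupport (f i)) :
    integral I μ (∑ i ∈ s, f i) = ∑ i ∈ s, integral I μ (f i) := by
  classical
  suffices h : IsSmoothForm I (∑ i ∈ s, f i) ∧ HasCompactSupport (∑ i ∈ s, f i) ∧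
    integral I μ (∑ i ∈ s, f i) = ∑ i ∈ s, integral I μ (f i) from h.2.2
  induction s using Finset.induction_on with
  | empty => exact ⟨isSmoothForm_zero, HasCompactSupport.zero, integral_zero⟩
  | insert i s hi ih =>
    rw [Finset.sum_insert hi, Finset.sum_insert hi]
    exact ⟨(hf i).add ih.1, (hc i).add ih.2.1, by
      rw [integral_add hμ (hf i) ih.1 (hc i) ih.2.1, ih.2.2]⟩

/-- The integral of a form with support in a parametrized open set. -/
lemma integral_eq_setIntegral_density (h : IsPatch I P R S Q O) (hμ : IsSmoothForm I μ)
    (hα : IsSmoothForm I α) (hc : HasCompactSupport α) (hO : tsupport α ⊆ O) :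
    integral I μ α = ∫ z in S, density I P R μ α z := by
  obtain ⟨ρ, hρ, hint⟩ := exists_integral_eq I M
  have h0 : ∀ {α : Form (EuclideanSpace ℝ (Fin n)) M n} {P : EuclideanSpace ℝ (Fin n) → M}
      {R S : Set (EuclideanSpace ℝ (Fin n))} {Q : M → EuclideanSpace ℝ (Fin n)} {O O' : Set M},
      IsPatch I P R S Q O → IsOpen O' → tsupport α ⊆ O' →
      ∫ z in S, density I P R μ α z = ∫ z in S ∩ P ⁻¹' O', density I P R μ α z := by
    intro α P R S Q O O' h hO' hs
    have h1 : ∀ z ∈ S \ (S ∩ P ⁻¹' O'), density I P R μ α z = 0 := fun z hz =>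
      density_eq_zero (by_contra fun h1 => hz.2 ⟨hz.1, hs (subset_tsupport α h1)⟩)
    exact setIntegral_eq_of_subset_of_forall_sdiff_eq_zero h.measurableSet inter_subset_left h1
  have h1 : ∀ x₀, ∫ y in (extChartAt I x₀).target,
      density I (extChartAt I x₀).symm (range I) μ (fun x => ρ x₀ x • α x) y =
      ∫ z in S, density I P R μ (fun x => ρ x₀ x • α x) z := by
    intro x₀
    have hs := tsupport_smul_form_subset (α := α) (ρ x₀)
    rw [h0 (IsPatch.chart I x₀) h.isOpen (hs.trans (inter_subset_right.trans hO)),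
      h0 h (isOpen_extChartAt_source (I := I) x₀) (hs.trans (inter_subset_left.trans (by
        rw [extChartAt_source]; exact hρ x₀))), setIntegral_density_eq h (IsPatch.chart I x₀)]
  rw [hint]
  simp only [h1]
  have hfin := finite_support_inter ρ hc
  have h2 : ∀ x₀ ∉ hfin.toFinset, ∀ x, ρ x₀ x • α x = 0 := by
    intro x₀ hx₀ x
    rw [Finite.mem_toFinset] at hx₀
    by_contra h'
    exact hx₀ ⟨x, left_ne_zero_of_smul h', subset_tsupport _ (right_ne_zero_of_smul h')⟩
  rw [finsum_eq_sum_of_support_subset (s := hfin.toFinset), ← MeasureTheory.integral_finsetSum]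
  · refine integral_congr_ae (Eventually.of_forall fun z => ?_)
    simp only [density_smul]
    rw [← Finset.sum_mul]
    by_cases hz : α (P z) = 0
    · rw [density_eq_zero hz, mul_zero]
    · have h3 : ∑ x₀ ∈ hfin.toFinset, ρ x₀ (P z) = 1 := by
        rw [← ρ.sum_eq_one (mem_univ (P z)), finsum_eq_sum_of_support_subset]
        intro x₀ hx₀
        by_contra hx₁
        exact (smul_ne_zero hx₀ hz) (h2 x₀ hx₁ (P z))
      rw [h3, one_mul]
  · exact fun x₀ _ => integrableOn_density h hμ (hα.partition_smul ρ x₀)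
      (hasCompactSupport_smul_form hc _)
        ((tsupport_smul_form_subset _).trans (inter_subset_right.trans hO))
  · intro x₀ hx₀
    by_contra hx₁
    refine hx₀ (integral_eq_zero_of_ae (Eventually.of_forall fun y => density_eq_zero ?_))
    exact h2 x₀ hx₁ _

omit [IsManifold I ∞ M] [T2Space M] [SigmaCompactSpace M] in
/-- A compactly supported form is the finite sum of its products with the functions of a partition
of unity. -/
lemma exists_finset_sum_smul_eq {κ : Type*} {k : ℕ} {α : Form (EuclideanSpace ℝ (Fin n)) M k}
    (ρ : SmoothPartitionOfUnity κ I M univ) (hc : HasCompactSupport α) :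
    ∃ s : Finset κ, α = ∑ i ∈ s, fun x => ρ i x • α x := by
  have hfin := ρ.locallyFinite.finite_nonempty_inter_compact hc
  refine ⟨hfin.toFinset, funext fun x => ?_⟩
  rw [Finset.sum_apply, ← Finset.sum_smul]
  by_cases hx : α x = 0
  · simp [hx]
  · rw [← finsum_eq_sum_of_support_subset, ρ.sum_eq_one (mem_univ x), one_smul]
    intro i hi
    rw [Finite.coe_toFinset]
    exact ⟨x, hi, subset_tsupport _ hx⟩

end Integral

end CSWZW

/-! ### The Fubini theorem for fiber integration -/

namespace CSWZW

/-- The splitting of Euclidean space into the `i`-th coordinate and the remaining ones. -/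
noncomputable def splitCoord {n : ℕ} (i : Fin (n + 1)) :
    EuclideanSpace ℝ (Fin (n + 1)) ≃L[ℝ] ℝ × EuclideanSpace ℝ (Fin n) :=
  LinearEquiv.toContinuousLinearEquiv
    { toFun := fun x => (x i, WithLp.toLp 2 fun j => x (i.succAbove j))
      invFun := fun p => WithLp.toLp 2 (i.insertNth p.1 p.2)
      map_add' := fun x y => rfl
      map_smul' := fun c x => rfl
      left_inv := fun x => by
        ext j
        refine i.succAboveCases ?_ (fun k => ?_) j <;> simp
      right_inv := fun p => by
        ext <;> simp }

section Split

variable {n : ℕ} (i : Fin (n + 1))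

lemma splitCoord_apply (x : EuclideanSpace ℝ (Fin (n + 1))) :
    splitCoord i x = (x i, WithLp.toLp 2 fun j => x (i.succAbove j)) := rfl

lemma splitCoord_symm_apply (p : ℝ × EuclideanSpace ℝ (Fin n)) :
    (splitCoord i).symm p = WithLp.toLp 2 (i.insertNth p.1 p.2) := rfl

lemma splitCoord_single_self : splitCoord i (EuclideanSpace.single i 1) = (1, 0) := by
  rw [splitCoord_apply]
  ext j <;> simp

lemma splitCoord_single_succAbove (j : Fin n) :
    splitCoord i (EuclideanSpace.single (i.succAbove j) 1) = (0, EuclideanSpace.single j 1) := by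
  rw [splitCoord_apply]
  ext k <;> simp [Fin.ne_succAbove]

lemma measurePreserving_splitCoord : MeasurePreserving (splitCoord i) := by
  have h1 := PiLp.volume_preserving_ofLp (Fin (n + 1))
  have h2 := volume_preserving_piFinSuccAbove (fun _ : Fin (n + 1) => ℝ) i
  have h3 := (MeasurePreserving.id (volume : Measure ℝ)).prod (PiLp.volume_preserving_toLp (Fin n))
  exact h3.comp (h2.comp h1)

lemma setIntegral_splitCoord (f : ℝ × EuclideanSpace ℝ (Fin n) → ℝ)
    (s : Set (ℝ × EuclideanSpace ℝ (Fin n))) :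
    ∫ z in splitCoord i ⁻¹' s, f (splitCoord i z) = ∫ z in s, f z :=
  (measurePreserving_splitCoord i).setIntegral_preimage_emb
    (splitCoord i).toHomeomorph.measurableEmbedding f s

lemma integrableOn_splitCoord {f : ℝ × EuclideanSpace ℝ (Fin n) → ℝ}
    {s : Set (ℝ × EuclideanSpace ℝ (Fin n))} :
    IntegrableOn (fun z => f (splitCoord i z)) (splitCoord i ⁻¹' s) ↔ IntegrableOn f s :=
  (measurePreserving_splitCoord i).integrableOn_comp_preimage
    (splitCoord i).toHomeomorph.measurableEmbedding

end Split

namespace EquivariantTime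

variable {n : ℕ} {H : Type} [TopologicalSpace H]
  {I : ModelWithCorners ℝ (EuclideanSpace ℝ (Fin (n + 1))) H} {M : Type u} [TopologicalSpace M]
  [ChartedSpace H M] {H' : Type} [TopologicalSpace H']
  {J : ModelWithCorners ℝ (EuclideanSpace ℝ (Fin n)) H'} {Θ : SmoothFlow I M}
  [ChartedSpace H' Θ.Base] (T : EquivariantTime Θ J)
  [IsManifold J ∞ Θ.Base] [IsManifold I ∞ M]

omit [IsManifold I ∞ M] in
lemma isPatch_tube (b₀ : Θ.Base) : IsPatch I (T.tube b₀) (tubeRange J) (tubeDomain J b₀)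
    (T.tubeInv b₀) (Θ.proj ⁻¹' (extChartAt J b₀).source) where
  param := T.isParam_tube b₀
  measurableSet := MeasurableSet.univ.prod (IsPatch.chart J b₀).measurableSet
  isOpen := (isOpen_extChartAt_source b₀).preimage Θ.continuous_proj
  mapsTo _ hz := T.proj_tube_mem hz
  mapsTo_inv _ hx := T.tubeInv_mem hx
  left_inv _ hz := T.tubeInv_tube hz
  right_inv _ hx := T.tube_tubeInv hx
  smooth_inv _ hx := (T.isLocalInverse_tube hx).smooth

/-- The frame of a tube that consists of the direction of the flow and the coordinate directions of
the base. -/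
noncomputable def splitFrame (n : ℕ) : Fin (n + 1) → ℝ × EuclideanSpace ℝ (Fin n) :=
  Fin.cons (1, 0) fun i => (0, EuclideanSpace.single i 1)

lemma splitCoord_comp_single : (fun i => splitCoord (n := n) 0 (EuclideanSpace.single i 1)) =
    splitFrame n := by
  funext i
  refine Fin.cases ?_ (fun j => ?_) i
  · exact splitCoord_single_self 0
  · exact splitCoord_single_succAbove 0 j

/-- The orientations of the total space and of the base are compatible: in tubes, the direction of
the flow comes first. -/
def OrientationCompatible (μ : Form (EuclideanSpace ℝ (Fin (n + 1))) M (n + 1))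
    (ν : Form (EuclideanSpace ℝ (Fin n)) Θ.Base n) : Prop :=
  ∀ b₀, ∀ z ∈ tubeDomain J b₀, Real.sign (T.tubeRep b₀ μ z (splitFrame n)) =
    Real.sign (chartRep J ν b₀ z.2 fun i => EuclideanSpace.single i 1)

variable {T} {μ : Form (EuclideanSpace ℝ (Fin (n + 1))) M (n + 1)}
  {ν : Form (EuclideanSpace ℝ (Fin n)) Θ.Base n}
  {α : Form (EuclideanSpace ℝ (Fin (n + 1))) M (n + 1)}

variable [T2Space M] [SigmaCompactSpace M] [T2Space Θ.Base] [SigmaCompactSpace Θ.Base]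

omit [IsManifold J ∞ Θ.Base] [IsManifold I ∞ M] [T2Space M] [SigmaCompactSpace M]
  [SigmaCompactSpace Θ.Base] in
lemma tsupport_fiberInt_subset {k : ℕ}
    {α : Form (EuclideanSpace ℝ (Fin (n + 1))) M (k + 1)} (hc : HasCompactSupport α) :
    tsupport (Θ.fiberInt J α) ⊆ Θ.proj '' tsupport α :=
  closure_minimal (support_fiberInt α) (hc.isCompact.image Θ.continuous_proj).isClosed

omit [IsManifold J ∞ Θ.Base] [IsManifold I ∞ M] [T2Space M] [SigmaCompactSpace M]
  [SigmaCompactSpace Θ.Base] in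
lemma hasCompactSupport_fiberInt {k : ℕ}
    {α : Form (EuclideanSpace ℝ (Fin (n + 1))) M (k + 1)} (hc : HasCompactSupport α) :
    HasCompactSupport (Θ.fiberInt J α) :=
  (hc.isCompact.image Θ.continuous_proj).of_isClosed_subset (isClosed_tsupport _)
    (tsupport_fiberInt_subset hc)

/-- The Fubini theorem for forms with support over a chart of the base. -/
lemma integral_fiberInt_of_subset (hT : T.OrientationCompatible μ ν)
    (hμ : IsSmoothForm I μ) (hν : IsSmoothForm J ν) (hα : IsSmoothForm I α)
    (hc : HasCompactSupport α) {b₀ : Θ.Base}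
    (hs : tsupport α ⊆ Θ.proj ⁻¹' (extChartAt J b₀).source) :
    integral I μ α = integral J ν (Θ.fiberInt J α) := by
  have hp := (T.isPatch_tube b₀).comp_equiv (splitCoord 0)
  rw [integral_eq_setIntegral_density hp hμ hα hc hs, integral_eq_setIntegral_density
    (IsPatch.chart J b₀) hν (T.isSmoothForm_fiberInt hα hc) (hasCompactSupport_fiberInt hc)
    ((tsupport_fiberInt_subset hc).trans (image_subset_iff.2 hs))]
  let f : ℝ × EuclideanSpace ℝ (Fin n) → ℝ := fun z =>
    Real.sign (chartRep J ν b₀ z.2 fun i => EuclideanSpace.single i 1) *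
      T.tubeRep b₀ α z (splitFrame n)
  have h1 : ∀ z ∈ splitCoord 0 ⁻¹' tubeDomain J b₀, density I (T.tube b₀ ∘ splitCoord 0)
      (splitCoord 0 ⁻¹' tubeRange J) μ α z = f (splitCoord 0 z) := by
    intro z hz
    have h2 : ∀ γ : Form (EuclideanSpace ℝ (Fin (n + 1))) M (n + 1),
        rep I (T.tube b₀ ∘ splitCoord 0) (splitCoord 0 ⁻¹' tubeRange J) γ z
          (fun i => EuclideanSpace.single i 1) = T.tubeRep b₀ γ (splitCoord 0 z) (splitFrame n) := by
      intro γ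
      rw [(T.isPatch_tube b₀).rep_comp_equiv _ _ hz, ← splitCoord_comp_single]
      rfl
    rw [density, h2, h2, hT b₀ _ hz]
  have hi : IntegrableOn f (tubeDomain J b₀) := by
    rw [← integrableOn_splitCoord 0]
    exact (integrableOn_density hp hμ hα hc hs).congr_fun h1 hp.measurableSet
  rw [setIntegral_congr_fun hp.measurableSet h1, setIntegral_splitCoord]
  rw [tubeDomain, Measure.volume_eq_prod, IntegrableOn, ← Measure.prod_restrict] at hi
  rw [tubeDomain, Measure.volume_eq_prod, ← Measure.prod_restrict, integral_prod_symm _ hi,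
    Measure.restrict_univ]
  refine setIntegral_congr_fun (IsPatch.chart J b₀).measurableSet fun y hy => ?_
  have hz : ((0, y) : ℝ × EuclideanSpace ℝ (Fin n)) ∈ tubeDomain J b₀ := ⟨mem_univ _, hy⟩
  have hi' := (isShiftDomain_tube J b₀).integrable (T.contDiffOn_tubeRep hα b₀)
    (T.compactAlong_tubeRep hc b₀ _) (by rwa [tubeRange_inter] : ((0, y) : ℝ × _) ∈ _)
  let ev : (ℝ × EuclideanSpace ℝ (Fin n)) [⋀^Fin n]→L[ℝ] ℝ →L[ℝ] ℝ :=
    (ContinuousMultilinearMap.apply ℝ (fun _ => ℝ × EuclideanSpace ℝ (Fin n)) ℝ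
      (fun i => (0, EuclideanSpace.single i 1))) ∘L
        (ContinuousAlternatingMap.toContinuousMultilinearMapCLM ℝ)
  have h3 : chartRep J (Θ.fiberInt J α) b₀ y (fun i => EuclideanSpace.single i 1) =
      ∫ s : ℝ, T.tubeRep b₀ α (s, y) (splitFrame n) := by
    rw [T.chartRep_fiberInt hα hc hy]
    have h4 := (integrable_and_integral_clm
      (G := (ℝ × EuclideanSpace ℝ (Fin n)) [⋀^Fin n]→L[ℝ] ℝ) (G' := ℝ) ev hi').2
    rw [shiftInt, Measure.restrict_univ]
    refine Eq.trans (h4.trans ?_ : ev _ = _) rfl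
    refine integral_congr_ae (Eventually.of_forall fun s => ?_)
    have h5 : ((0, y) : ℝ × EuclideanSpace ℝ (Fin n)) + s • ((1, 0) : ℝ × _) = (s, y) := by
      ext <;> simp
    simp only [h5]
    rfl
  change ∫ s : ℝ, f (s, y) = Real.sign (chartRep J ν b₀ y fun i => EuclideanSpace.single i 1) *
    chartRep J (Θ.fiberInt J α) b₀ y (fun i => EuclideanSpace.single i 1)
  rw [h3, ← integral_const_mul]

/-- The Fubini theorem. -/
lemma integral_fiberInt (hT : T.OrientationCompatible μ ν)
    (hμ : IsSmoothForm I μ) (hν : IsSmoothForm J ν) (hα : IsSmoothForm I α)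
    (hc : HasCompactSupport α) : integral I μ α = integral J ν (Θ.fiberInt J α) := by
  obtain ⟨ρ, hρ⟩ := SmoothPartitionOfUnity.exists_isSubordinate_chartAt_source J Θ.Base
  let f := comapPartition ρ T.smooth_proj
  obtain ⟨s, hs⟩ := exists_finset_sum_smul_eq f hc
  have h1 : ∀ i, IsSmoothForm I fun x => f i x • α x := fun i => hα.partition_smul f i
  have h2 : ∀ i, HasCompactSupport fun x => f i x • α x := fun i => hasCompactSupport_smul_form hc _
  have h3 : Θ.fiberInt J α = ∑ i ∈ s, Θ.fiberInt J fun x => f i x • α x := by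
    classical
    have h4 : ∀ t : Finset Θ.Base, IsSmoothForm I (∑ i ∈ t, fun x => f i x • α x) ∧
        HasCompactSupport (∑ i ∈ t, fun x => f i x • α x) ∧
        Θ.fiberInt J (∑ i ∈ t, fun x => f i x • α x) =
          ∑ i ∈ t, Θ.fiberInt J fun x => f i x • α x := by
      intro t
      induction t using Finset.induction_on with
      | empty =>
        refine ⟨isSmoothForm_zero, HasCompactSupport.zero, ?_⟩
        have := T.fiberInt_smul (0 : ℝ) hα hc
        rwa [zero_smul, zero_smul] at this
      | insert i t hi ih =>
        rw [Finset.sum_insert hi, Finset.sum_insert hi]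
        exact ⟨(h1 i).add ih.1, (h2 i).add ih.2.1, by
          rw [T.fiberInt_add (h1 i) (h2 i) ih.1 ih.2.1, ih.2.2]⟩
    conv_lhs => rw [hs]
    exact (h4 s).2.2
  rw [h3, integral_finset_sum _ _ hν (fun i => T.isSmoothForm_fiberInt (h1 i) (h2 i))
    (fun i => hasCompactSupport_fiberInt (h2 i))]
  conv_lhs => rw [hs]
  rw [integral_finset_sum _ _ hμ h1 h2]
  refine Finset.sum_congr rfl fun i _ => integral_fiberInt_of_subset hT hμ hν (h1 i) (h2 i)
    (b₀ := i) ?_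
  rw [extChartAt_source]
  exact (tsupport_smul_form_subset _).trans (inter_subset_left.trans
    ((tsupport_comp_subset_preimage (ρ i) Θ.continuous_proj).trans (preimage_mono (hρ i))))

end EquivariantTime

end CSWZW

/-! ### The projection formula -/

namespace CSWZW

section Wedge

variable {E : Type*} [NormedAddCommGroup E] [NormedSpace ℝ E] {F : Type*} [NormedAddCommGroup F]
  [NormedSpace ℝ F] {p q : ℕ}

lemma wedge_apply (a : E [⋀^Fin p]→L[ℝ] ℝ) (b : E [⋀^Fin q]→L[ℝ] ℝ) (v : Fin (p + q) → E) :
    wedge a b v = (p.factorial * q.factorial : ℝ)⁻¹ *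
      ∑ σ : Equiv.Perm (Fin p ⊕ Fin q), ((Equiv.Perm.sign σ : ℤ) : ℝ) *
        (a (fun i => v (finSumFinEquiv (σ (Sum.inl i)))) *
          b (fun i => v (finSumFinEquiv (σ (Sum.inr i))))) := by
  rw [← factorial_mul_wedge_apply, inv_mul_cancel_left₀]
  positivity

lemma wedge_compContinuousLinearMap (a : E [⋀^Fin p]→L[ℝ] ℝ) (b : E [⋀^Fin q]→L[ℝ] ℝ)
    (L : F →L[ℝ] E) : (wedge a b).compContinuousLinearMap L =
      wedge (a.compContinuousLinearMap L) (b.compContinuousLinearMap L) := by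
  ext v
  rw [wedge_apply, ContinuousAlternatingMap.compContinuousLinearMap_apply, wedge_apply]
  rfl

lemma wedge_zero_left (b : E [⋀^Fin q]→L[ℝ] ℝ) : wedge (0 : E [⋀^Fin p]→L[ℝ] ℝ) b = 0 := by
  ext v; simp [wedge_apply]

lemma wedge_zero_right (a : E [⋀^Fin p]→L[ℝ] ℝ) : wedge a (0 : E [⋀^Fin q]→L[ℝ] ℝ) = 0 := by
  ext v; simp [wedge_apply]

lemma wedge_add_left (a a' : E [⋀^Fin p]→L[ℝ] ℝ) (b : E [⋀^Fin q]→L[ℝ] ℝ) :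
    wedge (a + a') b = wedge a b + wedge a' b := by
  ext v; simp [wedge_apply, add_mul, mul_add, Finset.sum_add_distrib]

lemma wedge_add_right (a : E [⋀^Fin p]→L[ℝ] ℝ) (b b' : E [⋀^Fin q]→L[ℝ] ℝ) :
    wedge a (b + b') = wedge a b + wedge a b' := by
  ext v; simp [wedge_apply, mul_add, Finset.sum_add_distrib]

lemma wedge_smul_left (c : ℝ) (a : E [⋀^Fin p]→L[ℝ] ℝ) (b : E [⋀^Fin q]→L[ℝ] ℝ) :
    wedge (c • a) b = c • wedge a b := by
  ext v
  simp only [wedge_apply, ContinuousAlternatingMap.smul_apply, smul_eq_mul, Finset.mul_sum]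
  exact Finset.sum_congr rfl fun σ _ => by ring

lemma wedge_smul_right (c : ℝ) (a : E [⋀^Fin p]→L[ℝ] ℝ) (b : E [⋀^Fin q]→L[ℝ] ℝ) :
    wedge a (c • b) = c • wedge a b := by
  ext v
  simp only [wedge_apply, ContinuousAlternatingMap.smul_apply, smul_eq_mul, Finset.mul_sum]
  exact Finset.sum_congr rfl fun σ _ => by ring

variable {H : Type*} [TopologicalSpace H] {I : ModelWithCorners ℝ E H} {M : Type*}
  [TopologicalSpace M] [ChartedSpace H M]

lemma rep_wedge (P : F → M) (R : Set F) (α : Form E M p) (β : Form E M q) (z : F) :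
    rep I P R (fun x => wedge (α x) (β x)) z = wedge (rep I P R α z) (rep I P R β z) :=
  wedge_compContinuousLinearMap _ _ _

lemma IsSmoothForm.wedge [FiniteDimensional ℝ E] {α : Form E M p} {β : Form E M q}
    (hα : IsSmoothForm I α) (hβ : IsSmoothForm I β) :
    IsSmoothForm I fun x => wedge (α x) (β x) := by
  intro x₀ y hy
  refine contDiffWithinAt_alternating fun v => ?_
  have h1 : ∀ y, chartRep I (fun x => CSWZW.wedge (α x) (β x)) x₀ y v =
      (p.factorial * q.factorial : ℝ)⁻¹ *
      ∑ σ : Equiv.Perm (Fin p ⊕ Fin q), ((Equiv.Perm.sign σ : ℤ) : ℝ) *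
        (chartRep I α x₀ y (fun i => v (finSumFinEquiv (σ (Sum.inl i)))) *
          chartRep I β x₀ y (fun i => v (finSumFinEquiv (σ (Sum.inr i))))) := fun y => by
    rw [← wedge_apply, chartRep_eq_rep, rep_wedge]
    rfl
  have h2 : ∀ {k : ℕ} {γ : Form E M k}, IsSmoothForm I γ → ∀ w : Fin k → E,
      ContDiffWithinAt ℝ ∞ (fun y => chartRep I γ x₀ y w) (extChartAt I x₀).target y := by
    intro k γ hγ w
    exact ((ContinuousMultilinearMap.apply ℝ (fun _ => E) ℝ w) ∘L
      (ContinuousAlternatingMap.toContinuousMultilinearMapCLM ℝ)).contDiff.comp_contDiffWithinAt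
        (hγ x₀ y hy)
  simp only [h1]
  exact contDiffWithinAt_const.mul (ContDiffWithinAt.sum fun σ _ =>
    contDiffWithinAt_const.mul ((h2 hα _).mul (h2 hβ _)))

lemma tsupport_wedge_left (α : Form E M p) (β : Form E M q) :
    tsupport (fun x => wedge (α x) (β x)) ⊆ tsupport α :=
  closure_mono fun x hx h => hx (by simp only [h, wedge_zero_left])

lemma hasCompactSupport_wedge {α : Form E M p} (hα : HasCompactSupport α) (β : Form E M q) :
    HasCompactSupport fun x => wedge (α x) (β x) :=
  hα.of_isClosed_subset (isClosed_tsupport _) (tsupport_wedge_left α β)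

/-- The linear map `a ↦ (a ∧ b)(v)`. -/
noncomputable def wedgeEval [FiniteDimensional ℝ E] (b : E [⋀^Fin q]→L[ℝ] ℝ)
    (v : Fin (p + q) → E) : E [⋀^Fin p]→L[ℝ] ℝ →L[ℝ] ℝ :=
  haveI := finiteDimensional_alternating (F := E) (k := p)
  LinearMap.toContinuousLinearMap
    { toFun := fun a => wedge a b v
      map_add' := fun a a' => by rw [wedge_add_left]; rfl
      map_smul' := fun c a => by rw [wedge_smul_left]; rfl }

end Wedge

namespace EquivariantTime

variable {E : Type} [NormedAddCommGroup E] [NormedSpace ℝ E] [FiniteDimensional ℝ E]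
  {H : Type} [TopologicalSpace H]
  {I : ModelWithCorners ℝ E H} {M : Type u} [TopologicalSpace M] [ChartedSpace H M]
  {W : Type} [NormedAddCommGroup W] [NormedSpace ℝ W] [FiniteDimensional ℝ W]
  {H' : Type} [TopologicalSpace H'] {J : ModelWithCorners ℝ W H'}
  {Θ : SmoothFlow I M} [ChartedSpace H' Θ.Base] (T : EquivariantTime Θ J)
  [IsManifold J ∞ Θ.Base] [IsManifold I ∞ M] {p q : ℕ}

include T in
/-- The projection formula, reduced to an identity at every point of a tube. -/
lemma fiberInt_eq_wedge {α : Form E M (p + 1)} {β : Form W Θ.Base q} {γ : Form E M (p + q + 1)}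
    (hα : IsSmoothForm I α) (hc : HasCompactSupport α)
    (hγ : IsSmoothForm I γ) (hcγ : HasCompactSupport γ)
    (h : ∀ b₀, ∀ z ∈ tubeDomain J b₀, ((T.tubeRep b₀ γ z).curryLeft (1, 0)).compContinuousLinearMap
      (ContinuousLinearMap.inr ℝ ℝ W) = wedge (((T.tubeRep b₀ α z).curryLeft
        (1, 0)).compContinuousLinearMap (ContinuousLinearMap.inr ℝ ℝ W)) (chartRep J β b₀ z.2)) :
    Θ.fiberInt J γ = fun b => wedge (Θ.fiberInt J α b) (β b) := by
  refine base_eq_of_chartRep_eq (J := J) fun b₀ y hy => ?_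
  have hz : ((0, y) : ℝ × W) ∈ tubeDomain J b₀ := ⟨mem_univ _, hy⟩
  have hz' : ((0, y) : ℝ × W) ∈ tubeRange J ∩ tubeOpen J b₀ := by rwa [tubeRange_inter]
  have hiα := (isShiftDomain_tube J b₀).integrable (T.contDiffOn_tubeRep hα b₀)
    (T.compactAlong_tubeRep hc b₀ _) hz'
  have hiγ := (isShiftDomain_tube J b₀).integrable (T.contDiffOn_tubeRep hγ b₀)
    (T.compactAlong_tubeRep hcγ b₀ _) hz'
  rw [show chartRep J (fun b => wedge (Θ.fiberInt J α b) (β b)) b₀ y =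
    wedge (chartRep J (Θ.fiberInt J α) b₀ y) (chartRep J β b₀ y) from rep_wedge _ _ _ _ _, T.chartRep_fiberInt hγ hcγ hy, T.chartRep_fiberInt hα hc hy, shiftInt,
    shiftInt, Measure.restrict_univ, integral_compContinuousLinearMap hiγ,
    integral_compContinuousLinearMap hiα]
  ext v
  let ev : W [⋀^Fin (p + q)]→L[ℝ] ℝ →L[ℝ] ℝ :=
    (ContinuousMultilinearMap.apply ℝ (fun _ => W) ℝ v) ∘L
        (ContinuousAlternatingMap.toContinuousMultilinearMapCLM ℝ)
  have hcomp : ∀ {k : ℕ} {f : ℝ → (ℝ × W) [⋀^Fin k]→L[ℝ] ℝ}, Integrable f →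
      Integrable fun s => (f s).compContinuousLinearMap (ContinuousLinearMap.inr ℝ ℝ W) := by
    intro k f hf
    exact (integrable_and_integral_clm (G := (ℝ × W) [⋀^Fin k]→L[ℝ] ℝ) (G' := W [⋀^Fin k]→L[ℝ] ℝ)
      (ContinuousAlternatingMap.compContinuousLinearMapCLM (ContinuousLinearMap.inr ℝ ℝ W)) hf).1
  have h1 := (integrable_and_integral_clm (G := W [⋀^Fin (p + q)]→L[ℝ] ℝ) (G' := ℝ) ev
    (hcomp hiγ)).2
  have h2 := (integrable_and_integral_clm (G := W [⋀^Fin p]→L[ℝ] ℝ) (G' := ℝ)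
    (wedgeEval (chartRep J β b₀ y) v) (hcomp hiα)).2
  refine h1.trans (Eq.trans ?_ h2.symm)
  refine integral_congr_ae (Eventually.of_forall fun s => ?_)
  have h3 := h b₀ _ (tubeDomain_add hz s)
  have h4 : (((0, y) : ℝ × W) + s • ((1, 0) : ℝ × W)).2 = y := by simp
  rw [h4] at h3
  exact DFunLike.congr_fun h3 v

lemma tubeRep_wedge_pullback (α : Form E M p) (β : Form W Θ.Base q) {b₀ : Θ.Base} {z : ℝ × W}
    (hz : z ∈ tubeDomain J b₀) :
    T.tubeRep b₀ (fun x => wedge (α x) (pullback I J Θ.proj β x)) z = wedge (T.tubeRep b₀ α z)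
      ((chartRep J β b₀ z.2).compContinuousLinearMap (ContinuousLinearMap.snd ℝ ℝ W)) := by
  rw [← T.tubeRep_pullback β hz]
  exact rep_wedge _ _ _ _ _

omit [FiniteDimensional ℝ W] in
lemma curryLeft_comp_inr_apply (A : (ℝ × W) [⋀^Fin 3]→L[ℝ] ℝ) (x y : W) :
    ((A.curryLeft (1, 0)).compContinuousLinearMap (ContinuousLinearMap.inr ℝ ℝ W)) ![x, y] =
      A ![(1, 0), (0, x), (0, y)] :=
  congrArg A (by ext i : 1; fin_cases i <;> rfl)

include T

/-- The projection formula for a `1`-form and a `2`-form. -/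
lemma fiberInt_wedge_one_two {α : Form E M 1} {β : Form W Θ.Base 2} (hα : IsSmoothForm I α)
    (hc : HasCompactSupport α) (hβ : IsSmoothForm J β) :
    Θ.fiberInt J (k := 2) (fun x => wedge (α x) (pullback I J Θ.proj β x) : Form E M (1 + 2)) =
      fun b => wedge (Θ.fiberInt J α b) (β b) := by
  refine T.fiberInt_eq_wedge (p := 0) (q := 2) hα hc (hα.wedge (T.isSmoothForm_pullback_proj hβ))
    (hasCompactSupport_wedge hc _) fun b₀ z hz => ?_
  ext v
  have hv : v = ![v 0, v 1] := by ext i; fin_cases i <;> rfl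
  rw [hv, wedge_zero_two]
  have h1 := congrArg (fun a => a ![(1, 0), (0, v 0), (0, v 1)]) (T.tubeRep_wedge_pullback α β hz)
  simp only [wedge_one_two] at h1
  refine (curryLeft_comp_inr_apply _ _ _).trans (h1.trans ?_)
  · have h2 : ∀ x y : ℝ × W, ((chartRep J β b₀ z.2).compContinuousLinearMap
        (ContinuousLinearMap.snd ℝ ℝ W)) ![x, y] = chartRep J β b₀ z.2 ![x.2, y.2] := fun x y =>
      congrArg (chartRep J β b₀ z.2) (by ext i : 1; fin_cases i <;> rfl)
    have h3 : ∀ x : W, chartRep J β b₀ z.2 ![0, x] = 0 := fun x =>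
      (chartRep J β b₀ z.2).map_coord_zero 0 rfl
    have h4 : (((T.tubeRep b₀ α z).curryLeft (1, 0)).compContinuousLinearMap
        (ContinuousLinearMap.inr ℝ ℝ W)) ![] = T.tubeRep b₀ α z ![(1, 0)] :=
      congrArg (T.tubeRep b₀ α z) (by ext i : 1; fin_cases i; rfl)
    simp only [h2, h3, h4, mul_zero, sub_zero, add_zero]

/-- The projection formula for a `2`-form and a `1`-form. -/
lemma fiberInt_wedge_two_one {α : Form E M 2} {β : Form W Θ.Base 1} (hα : IsSmoothForm I α)
    (hc : HasCompactSupport α) (hβ : IsSmoothForm J β) :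
    Θ.fiberInt J (k := 2) (fun x => wedge (α x) (pullback I J Θ.proj β x) : Form E M (2 + 1)) =
      fun b => wedge (Θ.fiberInt J α b) (β b) := by
  refine T.fiberInt_eq_wedge (p := 1) (q := 1) hα hc (hα.wedge (T.isSmoothForm_pullback_proj hβ))
    (hasCompactSupport_wedge hc _) fun b₀ z hz => ?_
  ext v
  have hv : v = ![v 0, v 1] := by ext i; fin_cases i <;> rfl
  rw [hv, wedge_one_one]
  have h1 := congrArg (fun a => a ![(1, 0), (0, v 0), (0, v 1)]) (T.tubeRep_wedge_pullback α β hz)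
  simp only [wedge_two_one] at h1
  refine (curryLeft_comp_inr_apply _ _ _).trans (h1.trans ?_)
  · have h2 : ∀ x : ℝ × W, ((chartRep J β b₀ z.2).compContinuousLinearMap
        (ContinuousLinearMap.snd ℝ ℝ W)) ![x] = chartRep J β b₀ z.2 ![x.2] := fun x =>
      congrArg (chartRep J β b₀ z.2) (by ext i : 1; fin_cases i; rfl)
    have h3 : chartRep J β b₀ z.2 ![0] = 0 := (chartRep J β b₀ z.2).map_coord_zero 0 rfl
    have h4 : ∀ w : W, (((T.tubeRep b₀ α z).curryLeft (1, 0)).compContinuousLinearMap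
        (ContinuousLinearMap.inr ℝ ℝ W)) ![w] = T.tubeRep b₀ α z ![(1, 0), (0, w)] := fun w =>
      congrArg (T.tubeRep b₀ α z) (by ext i : 1; fin_cases i <;> rfl)
    simp only [h2, h3, h4, mul_zero, add_zero]

/-- The projection formula for a `3`-form and a function. -/
lemma fiberInt_wedge_three_zero {α : Form E M 3} {β : Form W Θ.Base 0} (hα : IsSmoothForm I α)
    (hc : HasCompactSupport α) (hβ : IsSmoothForm J β) :
    Θ.fiberInt J (k := 2) (fun x => wedge (α x) (pullback I J Θ.proj β x) : Form E M (3 + 0)) =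
      fun b => wedge (Θ.fiberInt J α b) (β b) := by
  refine T.fiberInt_eq_wedge (p := 2) (q := 0) hα hc (hα.wedge (T.isSmoothForm_pullback_proj hβ))
    (hasCompactSupport_wedge hc _) fun b₀ z hz => ?_
  ext v
  have hv : v = ![v 0, v 1] := by ext i; fin_cases i <;> rfl
  rw [hv, wedge_two_zero]
  have h1 := congrArg (fun a => a ![(1, 0), (0, v 0), (0, v 1)]) (T.tubeRep_wedge_pullback α β hz)
  simp only [wedge_three_zero] at h1
  refine (curryLeft_comp_inr_apply _ _ _).trans (h1.trans ?_)
  · congr 1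
    · refine congrArg (T.tubeRep b₀ α z) ?_
      ext i : 1
      fin_cases i <;> rfl
    · exact congrArg (chartRep J β b₀ z.2) (Subsingleton.elim _ _)

end EquivariantTime

end CSWZW

/-! ### Stokes' theorem -/

namespace CSWZW

section HalfSpace

variable {n : ℕ}

lemma mem_range_halfSpace {y : EuclideanSpace ℝ (Fin (n + 1))} :
    y ∈ range (𝓡∂ (n + 1)) ↔ 0 ≤ y 0 := by
  rw [range_modelWithCornersEuclideanHalfSpace]; rfl

lemma mem_interior_range_halfSpace {y : EuclideanSpace ℝ (Fin (n + 1))} :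
    y ∈ interior (range (𝓡∂ (n + 1))) ↔ 0 < y 0 := by
  rw [interior_range_modelWithCornersEuclideanHalfSpace]; rfl

/-- Points with vanishing normal coordinate in some chart belong to the boundary. -/
lemma mem_boundary_of_chart {M : Type*} [TopologicalSpace M]
    [ChartedSpace (EuclideanHalfSpace (n + 1)) M] [IsManifold (𝓡∂ (n + 1)) ∞ M] {x₀ : M}
    {y : EuclideanSpace ℝ (Fin (n + 1))} (hy : y ∈ (extChartAt (𝓡∂ (n + 1)) x₀).target)
    (h0 : y 0 = 0) : (extChartAt (𝓡∂ (n + 1)) x₀).symm y ∈ (𝓡∂ (n + 1)).boundary M := by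
  by_contra h
  have h1 : (𝓡∂ (n + 1)).IsInteriorPoint ((extChartAt (𝓡∂ (n + 1)) x₀).symm y) :=
    ((𝓡∂ (n + 1)).isInteriorPoint_iff_not_isBoundaryPoint _).2 h
  have h2 := (extChartAt (𝓡∂ (n + 1)) x₀).map_target hy
  rw [extChartAt_source] at h2
  rw [(𝓡∂ (n + 1)).isInteriorPoint_iff_of_mem_atlas (n := ∞) (by simp)
    (chart_mem_atlas _ x₀) h2] at h1
  have h3 : (extChartAt (𝓡∂ (n + 1)) x₀) ((extChartAt (𝓡∂ (n + 1)) x₀).symm y) ∈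
    interior (range (𝓡∂ (n + 1))) := interior_mono (extChartAt_target_subset_range x₀) h1
  rw [(extChartAt (𝓡∂ (n + 1)) x₀).right_inv hy, mem_interior_range_halfSpace] at h3
  exact h3.ne' h0

/-- The integral over half space of a partial derivative of a compactly supported function
vanishes, provided that for the normal direction the function vanishes on the boundary. -/
lemma setIntegral_fderivWithin_halfSpace {G : EuclideanSpace ℝ (Fin (n + 1)) → ℝ}
    (hG : ContDiffOn ℝ ∞ G (range (𝓡∂ (n + 1)))) {K : Set (EuclideanSpace ℝ (Fin (n + 1)))}
    (hK : IsCompact K) (h0 : ∀ y ∉ K, G y = 0) (i : Fin (n + 1))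
    (hi : i = 0 → ∀ y, y 0 = 0 → G y = 0) :
    ∫ y in range (𝓡∂ (n + 1)), fderivWithin ℝ G (range (𝓡∂ (n + 1))) y
      (EuclideanSpace.single i 1) = 0 := by
  set R := range (𝓡∂ (n + 1)) with hR
  have hRm : MeasurableSet R := (𝓡∂ (n + 1)).isClosed_range.measurableSet
  set e := EuclideanSpace.single i (1 : ℝ) with he
  have hU : UniqueDiffOn ℝ R := (𝓡∂ (n + 1)).uniqueDiffOn
  have hd0 : ∀ y ∉ K, fderivWithin ℝ G R y = 0 := by
    intro y hy
    have h1 : G =ᶠ[𝓝[R] y] fun _ => 0 :=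
      mem_nhdsWithin_of_mem_nhds (Filter.mem_of_superset (hK.isClosed.isOpen_compl.mem_nhds hy) h0)
    rw [h1.fderivWithin_eq (h0 y hy)]
    simp
  have hint : IntegrableOn (fun y => fderivWithin ℝ G R y e) R := by
    have h1 : ContinuousOn (fun y => fderivWithin ℝ G R y e) R :=
      (hG.continuousOn_fderivWithin hU (by simp)).clm_apply continuousOn_const
    have h2 := (h1.mono inter_subset_left).integrableOn_compact (μ := volume)
      (hK.inter_left (𝓡∂ (n + 1)).isClosed_range)
    refine h2.of_forall_sdiff_eq_zero hRm fun y hy => ?_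
    rw [hd0 y fun h => hy.2 ⟨hy.1, h⟩]
    rfl
  rw [← integrable_indicator_iff hRm] at hint
  rw [← integral_indicator hRm]
  let f : ℝ × EuclideanSpace ℝ (Fin n) → ℝ := fun p =>
    R.indicator (fun y => fderivWithin ℝ G R y e) ((splitCoord i).symm p)
  have hf : R.indicator (fun y => fderivWithin ℝ G R y e) = fun y => f (splitCoord i y) := by
    funext y
    simp only [f, ContinuousLinearEquiv.symm_apply_apply]
  have h1 := setIntegral_splitCoord i f univ
  have h2 := integrableOn_splitCoord i (f := f) (s := univ)
  rw [preimage_univ, integrableOn_univ, integrableOn_univ] at h2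
  rw [preimage_univ, setIntegral_univ, setIntegral_univ] at h1
  rw [hf] at hint ⊢
  have hfi := h2.1 hint
  rw [h1, Measure.volume_eq_prod, integral_prod_symm _ (by rwa [← Measure.volume_eq_prod])]
  -- the inner integrals run over the intersection of a coordinate line with the half space
  have hae : ∀ᵐ u : EuclideanSpace ℝ (Fin n), Integrable fun s : ℝ => f (s, u) := by
    rw [Measure.volume_eq_prod] at hfi
    exact hfi.prod_left_ae
  refine integral_eq_zero_of_ae ?_
  filter_upwards [hae] with u hu
  set L := (splitCoord i).symm with hL
  have hLadd : ∀ s, L (s, u) = L (0, u) + s • e := by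
    intro s
    have : ((s, u) : ℝ × EuclideanSpace ℝ (Fin n)) = (0, u) + s • splitCoord i e := by
      rw [he, splitCoord_single_self]; ext <;> simp
    rw [this, map_add, map_smul, hL, ContinuousLinearEquiv.symm_apply_apply]
  obtain ⟨C, hC⟩ := ((hK.image (splitCoord i).continuous).image continuous_fst).isBounded.exists_norm_le
  have hzero : ∀ s, C < |s| → G (L (s, u)) = 0 := by
    intro s hs
    refine h0 _ fun h => ?_
    have h3 := hC s ⟨_, ⟨_, h, rfl⟩, by rw [hL, ContinuousLinearEquiv.apply_symm_apply]⟩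
    rw [Real.norm_eq_abs] at h3
    linarith
  have hder : ∀ s, ∀ A : Set ℝ, (∀ t ∈ A, L (t, u) ∈ R) → s ∈ A →
      HasDerivWithinAt (fun s => G (L (s, u))) (f (s, u)) A s := by
    intro s A hA hs
    have h3 := (hG.differentiableOn (by simp) _ (hA s hs)).hasFDerivWithinAt
    have h4 : HasDerivWithinAt (fun s => L (s, u)) e A s := by
      rw [show (fun s => L (s, u)) = fun s => L (0, u) + s • e from funext hLadd]
      have h6 := ((hasDerivAt_id s).smul_const e).const_add (L (0, u))
      rw [one_smul] at h6
      exact h6.hasDerivWithinAt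
    have h5 := h3.comp_hasDerivWithinAt s h4 hA
    simp only [f]
    rw [indicator_of_mem (hA s hs)]
    exact h5
  by_cases hi0 : i = 0
  · have hmem : ∀ s, L (s, u) ∈ R ↔ 0 ≤ s := by
      intro s
      rw [hR, mem_range_halfSpace, hL, splitCoord_symm_apply, hi0]
      simp
    have h3 : ∫ s, f (s, u) = ∫ s in Ioi (0 : ℝ), f (s, u) := by
      rw [← integral_Ici_eq_integral_Ioi]
      refine (setIntegral_eq_integral_of_forall_compl_eq_zero fun s hs => ?_).symm
      exact indicator_of_notMem (fun h => hs ((hmem s).1 h)) _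
    have h4 := fun s => hder s (Ici 0) fun t ht => (hmem t).2 ht
    have h5 : Tendsto (fun s => G (L (s, u))) atTop (𝓝 0) := by
      refine tendsto_const_nhds.congr' ?_
      filter_upwards [eventually_gt_atTop C] with s hs
      exact (hzero s (hs.trans_le (le_abs_self s))).symm
    change ∫ s, f (s, u) = 0
    rw [h3, integral_Ioi_of_hasDerivAt_of_tendsto (h4 0 self_mem_Ici).continuousWithinAt
      (fun s hs => (h4 s (Ioi_subset_Ici_self hs)).hasDerivAt (Ici_mem_nhds hs)) hu.integrableOn h5,
      hi hi0 _ (by rw [hL, splitCoord_symm_apply, hi0]; simp), sub_zero]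
  · have hcoord : ∀ s, (L (s, u)) 0 = (L (0, u)) 0 := by
      intro s
      rw [hLadd]
      simp [he, Ne.symm hi0]
    change ∫ s, f (s, u) = 0
    by_cases hu0 : 0 ≤ (L (0, u)) 0
    · have hmem : ∀ s, L (s, u) ∈ R := fun s => by
        rw [hR, mem_range_halfSpace, hcoord]; exact hu0
      have h4 := fun s => hder s univ (fun t _ => hmem t) (mem_univ s)
      simp only [hasDerivWithinAt_univ] at h4
      refine integral_eq_zero_of_hasDerivAt_of_integrable h4 hu ?_
      refine (continuous_iff_continuousAt.2 fun s => (h4 s).continuousAt).integrable_of_hasCompactSupport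
        (HasCompactSupport.intro (isCompact_Icc (a := -C) (b := C)) fun s hs => hzero s ?_)
      by_contra h
      exact hs (abs_le.1 (not_lt.1 h))
    · refine integral_eq_zero_of_ae (Eventually.of_forall fun s => ?_)
      refine indicator_of_notMem (fun h => hu0 ?_) _
      rwa [hR, mem_range_halfSpace, hcoord] at h

end HalfSpace

section Stokes

variable {B : Type u} [TopologicalSpace B] [ChartedSpace (EuclideanHalfSpace 2) B]
  [IsManifold (𝓡∂ 2) ∞ B]

lemma extDerivWithin_one_apply {F : Type*} [NormedAddCommGroup F] [NormedSpace ℝ F]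
    {a : F → F [⋀^Fin 1]→L[ℝ] ℝ} {R : Set F} {z : F} (x y : F) :
    extDerivWithin a R z ![x, y] = fderivWithin ℝ a R z x ![y] - fderivWithin ℝ a R z y ![x] := by
  rw [extDerivWithin, ContinuousAlternatingMap.alternatizeUncurryFin_apply, Fin.sum_univ_two]
  have h0 : Fin.removeNth 0 ![x, y] = ![y] := by ext i : 1; fin_cases i; rfl
  have h1 : Fin.removeNth 1 ![x, y] = ![x] := by ext i : 1; fin_cases i; rfl
  simp [h0, h1, sub_eq_add_neg]

/-- The sign of a nonvanishing continuous function is locally constant. -/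
lemma eventually_sign_eq {X : Type*} [TopologicalSpace X] {f : X → ℝ} {s : Set X} {x : X}
    (hf : ContinuousWithinAt f s x) (h0 : f x ≠ 0) :
    ∀ᶠ y in 𝓝[s] x, Real.sign (f y) = Real.sign (f x) := by
  rcases h0.lt_or_gt with h | h
  · filter_upwards [hf.eventually (Iio_mem_nhds h)] with y hy
    rw [Real.sign_of_neg hy, Real.sign_of_neg h]
  · filter_upwards [hf.eventually (Ioi_mem_nhds h)] with y hy
    rw [Real.sign_of_pos hy, Real.sign_of_pos h]

variable [T2Space B] [SigmaCompactSpace B] {ν : Form E2 B 2}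

/-- A nowhere vanishing top degree form does not vanish on the coordinate frames. -/
lemma chartRep_single_ne_zero {n : ℕ} {H : Type*} [TopologicalSpace H]
    {I : ModelWithCorners ℝ (EuclideanSpace ℝ (Fin n)) H} {M : Type*} [TopologicalSpace M]
    [ChartedSpace H M] [IsManifold I ∞ M] {μ : Form (EuclideanSpace ℝ (Fin n)) M n}
    (hμ : ∀ x, μ x ≠ 0) {x₀ : M} {y : EuclideanSpace ℝ (Fin n)}
    (hy : y ∈ (extChartAt I x₀).target) :
    chartRep I μ x₀ y (fun i => EuclideanSpace.single i 1) ≠ 0 := by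
  intro h
  obtain ⟨L, hL, -⟩ := exists_chartFrame_equiv (I := I) hy
  have h1 := apply_single_compContinuousLinearMap (μ ((extChartAt I x₀).symm y)) L
  rw [hL] at h1
  rw [chartRep, h1] at h
  have hdet : (L : EuclideanSpace ℝ (Fin n) →L[ℝ] EuclideanSpace ℝ (Fin n)).det ≠ 0 :=
    (LinearEquiv.isUnit_det' L.toLinearEquiv).ne_zero
  rw [← hL] at h
  have h2 := (mul_eq_zero.1 h).resolve_left hdet
  refine hμ ((extChartAt I x₀).symm y) ?_
  ext v
  have h3 := DFunLike.congr_fun ((μ ((extChartAt I x₀).symm y)).toAlternatingMap.eq_smul_basis_det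
    (EuclideanSpace.basisFun (Fin n) ℝ).toBasis) v
  have h4 : (fun i => EuclideanSpace.single i (1 : ℝ)) =
      ⇑(EuclideanSpace.basisFun (Fin n) ℝ).toBasis := by
    funext i; simp
  rw [h4] at h2
  refine h3.trans ?_
  change μ ((extChartAt I x₀).symm y) (EuclideanSpace.basisFun (Fin n) ℝ).toBasis * _ = 0
  rw [h2, zero_mul]

/-- Stokes' theorem for a form with support in a chart that vanishes on the boundary. -/
lemma integral_extD_eq_zero_of_subset (hν : IsSmoothForm (𝓡∂ 2) ν) (hν0 : ∀ b, ν b ≠ 0)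
    {γ : Form E2 B 1} (hγ : IsSmoothForm (𝓡∂ 2) γ) (hc : HasCompactSupport γ)
    (h0 : ∀ b ∈ (𝓡∂ 2).boundary B, γ b = 0) {b₀ : B}
    (hs : tsupport γ ⊆ (extChartAt (𝓡∂ 2) b₀).source) :
    integral (𝓡∂ 2) ν (extD (𝓡∂ 2) γ) = 0 := by
  have hp := IsPatch.chart (𝓡∂ 2) b₀
  have hcd : HasCompactSupport (extD (𝓡∂ 2) γ) :=
    hc.of_isClosed_subset (isClosed_tsupport _) (tsupport_extD γ)
  rw [integral_eq_setIntegral_density hp hν hγ.extD hcd ((tsupport_extD γ).trans hs)]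
  classical
  set S := (extChartAt (𝓡∂ 2) b₀).target with hS
  set R := range (𝓡∂ 2) with hR
  set a := chartRep (𝓡∂ 2) γ b₀ with ha
  set K := extChartAt (𝓡∂ 2) b₀ '' tsupport γ with hKdef
  have hK : IsCompact K := hp.isCompact_image hc hs
  have hKS : K ⊆ S := image_subset_iff.2 fun x hx => hp.mapsTo_inv (hs hx)
  let N : E2 → ℝ := fun y => chartRep (𝓡∂ 2) ν b₀ y fun i => EuclideanSpace.single i 1
  have hN : ∀ y ∈ S, ∀ᶠ y' in 𝓝[R] y, Real.sign (N y') = Real.sign (N y) := by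
    intro y hy
    refine eventually_sign_eq ?_ (chartRep_single_ne_zero hν0 hy)
    exact (((ContinuousMultilinearMap.apply ℝ (fun _ : Fin 2 => E2) ℝ
      (fun i => EuclideanSpace.single i (1 : ℝ))) ∘L
        (ContinuousAlternatingMap.toContinuousMultilinearMapCLM ℝ)).continuous.continuousAt
          ).comp_continuousWithinAt (hν.contDiffWithinAt hy).continuousWithinAt
  let e : Fin 2 → E2 := fun i => EuclideanSpace.single i 1
  let G : Fin 2 → E2 → ℝ := fun j y => if y ∈ S then Real.sign (N y) * a y ![e j] else 0
  have ha0 : ∀ y ∈ S, y ∉ K → a y = 0 := by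
    intro y hy hyK
    have h1 : γ ((extChartAt (𝓡∂ 2) b₀).symm y) = 0 := by
      by_contra h
      exact hyK ⟨_, subset_tsupport _ h, (extChartAt (𝓡∂ 2) b₀).right_inv hy⟩
    rw [ha, chartRep, h1]
    rfl
  have hG0 : ∀ j, ∀ y ∉ K, G j y = 0 := by
    intro j y hy
    simp only [G]
    split_ifs with h
    · rw [ha0 y h hy]; simp
    · rfl
  have hGS : ∀ j, ∀ y ∈ S, G j =ᶠ[𝓝[R] y] fun y' => Real.sign (N y) * a y' ![e j] := by
    intro j y hy
    filter_upwards [hN y hy, extChartAt_target_mem_nhdsWithin_of_mem hy] with y' h1 h2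
    simp only [G, if_pos (show y' ∈ S from h2), h1]
  have hev : ∀ j, ∀ y ∈ S, HasFDerivWithinAt (fun y' => Real.sign (N y) * a y' ![e j])
      (Real.sign (N y) • (((ContinuousMultilinearMap.apply ℝ (fun _ : Fin 1 => E2) ℝ ![e j]) ∘L
        (ContinuousAlternatingMap.toContinuousMultilinearMapCLM ℝ)) ∘L fderivWithin ℝ a R y))
        R y := by
    intro j y hy
    have h1 := ((ContinuousMultilinearMap.apply ℝ (fun _ : Fin 1 => E2) ℝ ![e j]) ∘L
        (ContinuousAlternatingMap.toContinuousMultilinearMapCLM ℝ)).hasFDerivAt.comp_hasFDerivWithinAt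
          y (hγ.differentiableWithinAt hy).hasFDerivWithinAt
    exact h1.const_mul _
  have hGsmooth : ∀ j, ContDiffOn ℝ ∞ (G j) R := by
    intro j y hy
    by_cases hyK : y ∈ K
    · have h1 := hGS j y (hKS hyK)
      refine ContDiffWithinAt.congr_of_eventuallyEq ?_ h1 (h1.self_of_nhdsWithin hy)
      exact contDiffWithinAt_const.mul (((ContinuousMultilinearMap.apply ℝ (fun _ : Fin 1 => E2) ℝ
        ![e j]) ∘L (ContinuousAlternatingMap.toContinuousMultilinearMapCLM ℝ)).contDiff
          |>.comp_contDiffWithinAt (hγ.contDiffWithinAt (hKS hyK)))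
    · have h1 : G j =ᶠ[𝓝[R] y] fun _ => 0 := mem_nhdsWithin_of_mem_nhds
        (Filter.mem_of_superset (hK.isClosed.isOpen_compl.mem_nhds hyK) (hG0 j))
      exact contDiffWithinAt_const.congr_of_eventuallyEq h1 (hG0 j y hyK)
  have hbd : ∀ y : E2, y 0 = 0 → G 1 y = 0 := by
    intro y hy
    simp only [G]
    split_ifs with h
    · have h1 : a y = 0 := by
        rw [ha, chartRep, h0 _ (mem_boundary_of_chart h hy)]
        rfl
      rw [h1]; simp
    · rfl
  have h1 := setIntegral_fderivWithin_halfSpace (hGsmooth 1) hK (hG0 1) 0 fun _ => hbd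
  have h2 := setIntegral_fderivWithin_halfSpace (hGsmooth 0) hK (hG0 0) 1 (by simp)
  have hdG : ∀ j i, ∀ y ∈ S, fderivWithin ℝ (G j) R y (e i) =
      Real.sign (N y) * fderivWithin ℝ a R y (e i) ![e j] := by
    intro j i y hy
    have hyR : y ∈ R := extChartAt_target_subset_range b₀ hy
    rw [(hGS j y hy).fderivWithin_eq ((hGS j y hy).self_of_nhdsWithin hyR),
      (hev j y hy).fderivWithin ((𝓡∂ 2).uniqueDiffOn y hyR)]
    rfl
  have hdG0 : ∀ j i, ∀ y ∉ K, fderivWithin ℝ (G j) R y (e i) = 0 := by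
    intro j i y hy
    have h1 : G j =ᶠ[𝓝[R] y] fun _ => 0 := mem_nhdsWithin_of_mem_nhds
        (Filter.mem_of_superset (hK.isClosed.isOpen_compl.mem_nhds hy) (hG0 j))
    rw [h1.fderivWithin_eq (hG0 j y hy)]
    simp
  have hi : ∀ j i, IntegrableOn (fun y => fderivWithin ℝ (G j) R y (e i)) S := by
    intro j i
    have h3 : ContinuousOn (fun y => fderivWithin ℝ (G j) R y (e i)) R :=
      ((hGsmooth j).continuousOn_fderivWithin (𝓡∂ 2).uniqueDiffOn (by simp)).clm_apply
        continuousOn_const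
    exact ((h3.mono (hKS.trans (extChartAt_target_subset_range b₀))).integrableOn_compact
      hK).of_forall_sdiff_eq_zero hp.measurableSet fun y hy => hdG0 j i y hy.2
  have hSR : ∀ j i, ∫ y in S, fderivWithin ℝ (G j) R y (e i) =
      ∫ y in R, fderivWithin ℝ (G j) R y (e i) := fun j i =>
    (setIntegral_eq_of_subset_of_forall_sdiff_eq_zero (𝓡∂ 2).isClosed_range.measurableSet
      (extChartAt_target_subset_range b₀) fun y hy => hdG0 j i y fun h => hy.2 (hKS h)).symm
  have h3 : ∀ y ∈ S, density (𝓡∂ 2) (extChartAt (𝓡∂ 2) b₀).symm R ν (extD (𝓡∂ 2) γ) y =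
      fderivWithin ℝ (G 1) R y (e 0) - fderivWithin ℝ (G 0) R y (e 1) := by
    intro y hy
    rw [hdG 1 0 y hy, hdG 0 1 y hy, ← mul_sub, ← extDerivWithin_one_apply, ← chartRep_extD hγ hy]
    have he : ![e 0, e 1] = fun i => EuclideanSpace.single i 1 := by
      ext i : 1; fin_cases i <;> rfl
    rw [he]
    rfl
  rw [setIntegral_congr_fun hp.measurableSet h3, integral_sub (hi 1 0) (hi 0 1), hSR, hSR]
  simp only [e]
  rw [h1, h2, sub_zero]

/-- Stokes' theorem for forms that vanish on the boundary. -/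
lemma integral_extD_eq_zero (hν : IsSmoothForm (𝓡∂ 2) ν) (hν0 : ∀ b, ν b ≠ 0)
    {γ : Form E2 B 1} (hγ : IsSmoothForm (𝓡∂ 2) γ) (hc : HasCompactSupport γ)
    (h0 : ∀ b ∈ (𝓡∂ 2).boundary B, γ b = 0) :
    integral (𝓡∂ 2) ν (extD (𝓡∂ 2) γ) = 0 := by
  classical
  obtain ⟨ρ, hρ⟩ := SmoothPartitionOfUnity.exists_isSubordinate_chartAt_source (𝓡∂ 2) B
  obtain ⟨s, hs⟩ := exists_finset_sum_smul_eq ρ hc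
  have h1 : ∀ i, IsSmoothForm (𝓡∂ 2) fun x => ρ i x • γ x := fun i => hγ.partition_smul ρ i
  have h2 : ∀ i, HasCompactSupport fun x => ρ i x • γ x := fun i => hasCompactSupport_smul_form hc _
  have h4 : ∀ t : Finset B, IsSmoothForm (𝓡∂ 2) (∑ i ∈ t, fun x => ρ i x • γ x) ∧
      extD (𝓡∂ 2) (∑ i ∈ t, fun x => ρ i x • γ x) =
        ∑ i ∈ t, extD (𝓡∂ 2) fun x => ρ i x • γ x := by
    intro t
    induction t using Finset.induction_on with
    | empty => exact ⟨isSmoothForm_zero, extD_zero⟩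
    | insert i t hi ih =>
      rw [Finset.sum_insert hi, Finset.sum_insert hi]
      exact ⟨(h1 i).add ih.1, by rw [extD_add (h1 i) ih.1, ih.2]⟩
  rw [hs, (h4 s).2, integral_finset_sum _ _ hν (fun i => (h1 i).extD)
    fun i => (h2 i).of_isClosed_subset (isClosed_tsupport _) (tsupport_extD _)]
  refine Finset.sum_eq_zero fun i _ => integral_extD_eq_zero_of_subset hν hν0 (h1 i) (h2 i)
    (fun b hb => by rw [h0 b hb, smul_zero]) (b₀ := i) ?_
  rw [extChartAt_source]
  exact (tsupport_smul_form_subset _).trans (inter_subset_left.trans (hρ i))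

end Stokes

end CSWZW

/-! ### The Poisson structure on the base -/

namespace CSWZW

section WedgeInt

variable {n : ℕ} {H : Type*} [TopologicalSpace H]
  {I : ModelWithCorners ℝ (EuclideanSpace ℝ (Fin n)) H} {M : Type*} [TopologicalSpace M]
  [ChartedSpace H M] {p q : ℕ} {μ : Form (EuclideanSpace ℝ (Fin n)) M n}

lemma integral_of_ne {m : ℕ} (h : m ≠ n) (α : Form (EuclideanSpace ℝ (Fin n)) M m) :
    integral I μ α = 0 := by
  rw [integral, dif_neg fun h' => h h'.1]

/-- The integral of the wedge product. -/
noncomputable def wedgeInt (I : ModelWithCorners ℝ (EuclideanSpace ℝ (Fin n)) H)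
    (μ : Form (EuclideanSpace ℝ (Fin n)) M n) (α : Form (EuclideanSpace ℝ (Fin n)) M p)
    (β : Form (EuclideanSpace ℝ (Fin n)) M q) : ℝ :=
  integral I μ fun x => wedge (α x) (β x)

variable {α α' : Form (EuclideanSpace ℝ (Fin n)) M p} {β β' : Form (EuclideanSpace ℝ (Fin n)) M q}

lemma wedgeInt_of_ne (h : p + q ≠ n) (α : Form (EuclideanSpace ℝ (Fin n)) M p)
    (β : Form (EuclideanSpace ℝ (Fin n)) M q) : wedgeInt I μ α β = 0 :=
  integral_of_ne h _

variable [IsManifold I ∞ M] [T2Space M] [SigmaCompactSpace M]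

lemma integral_smul (c : ℝ) (α : Form (EuclideanSpace ℝ (Fin n)) M n) :
    integral I μ (c • α) = c * integral I μ α := by
  obtain ⟨ρ, hρ, hint⟩ := exists_integral_eq I M
  rw [hint, hint, ← smul_eq_mul, smul_finsum]
  refine finsum_congr fun x₀ => ?_
  rw [smul_eq_mul, ← integral_const_mul]
  refine integral_congr_ae (Eventually.of_forall fun y => ?_)
  have h1 : c • α = fun x => c • α x := rfl
  rw [h1]
  simp only [density_smul]
  ring

lemma wedgeInt_smul_left (c : ℝ) : wedgeInt I μ (c • α) β = c * wedgeInt I μ α β := by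
  by_cases h : p + q = n
  · subst h
    rw [wedgeInt, wedgeInt, ← integral_smul]
    congr 1
    funext x
    exact wedge_smul_left c (α x) (β x)
  · rw [wedgeInt_of_ne h, wedgeInt_of_ne h, mul_zero]

lemma wedgeInt_smul_right (c : ℝ) : wedgeInt I μ α (c • β) = c * wedgeInt I μ α β := by
  by_cases h : p + q = n
  · subst h
    rw [wedgeInt, wedgeInt, ← integral_smul]
    congr 1
    funext x
    exact wedge_smul_right c (α x) (β x)
  · rw [wedgeInt_of_ne h, wedgeInt_of_ne h, mul_zero]

lemma wedgeInt_zero_left : wedgeInt I μ (0 : Form (EuclideanSpace ℝ (Fin n)) M p) β = 0 := by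
  have := wedgeInt_smul_left (I := I) (μ := μ) (α := (0 : Form (EuclideanSpace ℝ (Fin n)) M p))
    (β := β) 0
  rwa [zero_smul, zero_mul] at this

lemma wedgeInt_zero_right : wedgeInt I μ α (0 : Form (EuclideanSpace ℝ (Fin n)) M q) = 0 := by
  have := wedgeInt_smul_right (I := I) (μ := μ) (β := (0 : Form (EuclideanSpace ℝ (Fin n)) M q))
    (α := α) 0
  rwa [zero_smul, zero_mul] at this

lemma wedgeInt_add_left (hμ : IsSmoothForm I μ) (hα : IsSmoothForm I α) (hα' : IsSmoothForm I α')
    (hβ : IsSmoothForm I β) (hc : HasCompactSupport α) (hc' : HasCompactSupport α') :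
    wedgeInt I μ (α + α') β = wedgeInt I μ α β + wedgeInt I μ α' β := by
  by_cases h : p + q = n
  · subst h
    rw [wedgeInt, wedgeInt, wedgeInt, ← integral_add hμ (hα.wedge hβ) (hα'.wedge hβ)
      (hasCompactSupport_wedge hc _) (hasCompactSupport_wedge hc' _)]
    congr 1
    funext x
    exact wedge_add_left (α x) (α' x) (β x)
  · rw [wedgeInt_of_ne h, wedgeInt_of_ne h, wedgeInt_of_ne h, add_zero]

lemma wedgeInt_add_right (hμ : IsSmoothForm I μ) (hα : IsSmoothForm I α) (hβ : IsSmoothForm I β)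
    (hβ' : IsSmoothForm I β') (hc : HasCompactSupport α) :
    wedgeInt I μ α (β + β') = wedgeInt I μ α β + wedgeInt I μ α β' := by
  by_cases h : p + q = n
  · subst h
    rw [wedgeInt, wedgeInt, wedgeInt, ← integral_add hμ (hα.wedge hβ) (hα.wedge hβ')
      (hasCompactSupport_wedge hc _) (hasCompactSupport_wedge hc _)]
    congr 1
    funext x
    exact wedge_add_right (α x) (β x) (β' x)
  · rw [wedgeInt_of_ne h, wedgeInt_of_ne h, wedgeInt_of_ne h, add_zero]

end WedgeInt

/-- Forms agree if they agree in charts. -/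
lemma eq_of_chartRep_eq {E : Type*} [NormedAddCommGroup E] [NormedSpace ℝ E] {H : Type*}
    [TopologicalSpace H] {I : ModelWithCorners ℝ E H} {M : Type*} [TopologicalSpace M]
    [ChartedSpace H M] [IsManifold I ∞ M] {k : ℕ} {α β : Form E M k}
    (h : ∀ x₀, ∀ y ∈ (extChartAt I x₀).target, chartRep I α x₀ y = chartRep I β x₀ y) : α = β := by
  funext x
  exact (isParam_chart I x).eq_of_rep_eq (isLocalInverse_chart x (mem_extChartAt_source x))
    (h x _ (mem_extChartAt_target x))

section Surface

variable {B : Type u} [TopologicalSpace B] [ChartedSpace (EuclideanHalfSpace 2) B]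
  {ν : Form E2 B 2}

lemma eq_vecCons_two {V : Type*} (v : Fin 2 → V) : v = ![v 0, v 1] := by
  ext i : 1; fin_cases i <;> rfl

lemma wedgeInt_zero_two_comm (α : Form E2 B 0) (β : Form E2 B 2) :
    wedgeInt (𝓡∂ 2) ν α β = wedgeInt (𝓡∂ 2) ν β α := by
  have h : (fun b => wedge (α b) (β b) : Form E2 B (0 + 2)) =
      (fun b => wedge (β b) (α b) : Form E2 B (2 + 0)) := by
    funext b
    ext v
    have h1 := wedge_zero_two (α b) (β b) (v 0) (v 1)
    have h2 := wedge_two_zero (β b) (α b) (v 0) (v 1)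
    rw [← eq_vecCons_two v] at h1 h2
    exact h1.trans ((mul_comm _ _).trans h2.symm)
  exact congrArg (fun γ : Form E2 B 2 => integral (𝓡∂ 2) ν γ) h

variable [IsManifold (𝓡∂ 2) ∞ B] [T2Space B] [SigmaCompactSpace B]

lemma wedgeInt_one_one_comm (α β : Form E2 B 1) :
    wedgeInt (𝓡∂ 2) ν α β = -wedgeInt (𝓡∂ 2) ν β α := by
  have h : (fun b => wedge (α b) (β b) : Form E2 B (1 + 1)) =
      (-1 : ℝ) • (fun b => wedge (β b) (α b) : Form E2 B (1 + 1)) := by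
    funext b
    ext v
    change wedge (α b) (β b) v = (-1 : ℝ) • wedge (β b) (α b) v
    have h1 := wedge_one_one (α b) (β b) (v 0) (v 1)
    have h2 := wedge_one_one (β b) (α b) (v 0) (v 1)
    rw [← eq_vecCons_two v] at h1 h2
    refine h1.trans (Eq.trans ?_ (congrArg (fun r : ℝ => (-1 : ℝ) • r) h2.symm))
    rw [smul_eq_mul]
    ring
  have h3 := congrArg (fun γ : Form E2 B 2 => integral (𝓡∂ 2) ν γ) h
  refine h3.trans ((integral_smul (I := 𝓡∂ 2) (μ := ν) (-1) _).trans ?_)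
  rw [neg_one_mul]
  rfl

omit [T2Space B] [SigmaCompactSpace B] in
lemma isSmoothForm_zero_smul {f : Form E2 B 0} {β : Form E2 B 1} (hf : IsSmoothForm (𝓡∂ 2) f)
    (hβ : IsSmoothForm (𝓡∂ 2) β) : IsSmoothForm (𝓡∂ 2) fun b => f b ![] • β b := by
  have h1 : (fun b => f b ![] • β b) = (fun b => wedge (f b) (β b) : Form E2 B (0 + 1)) := by
    funext b
    ext v
    have := factorial_mul_wedge_apply (f b) (β b) v
    simp only [Nat.factorial_zero, Nat.factorial_one, Nat.cast_one, one_mul] at this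
    refine Eq.trans ?_ this.symm
    have hu : (Finset.univ : Finset (Equiv.Perm (Fin 0 ⊕ Fin 1))) = {1} := by decide
    rw [hu, Finset.sum_singleton]
    simp only [Equiv.Perm.sign_one, Equiv.Perm.coe_one, id]
    rw [Units.val_one, Int.cast_one, one_mul]
    refine congrArg₂ (fun r s : ℝ => r * s) ?_ ?_
    · exact congrArg (f b) (Subsingleton.elim _ _)
    · exact congrArg (β b) (by ext i : 1; fin_cases i; rfl)
  rw [h1]
  exact hf.wedge hβ

omit [T2Space B] [SigmaCompactSpace B] in
/-- The Leibniz rule for the product of a function and a `1`-form. -/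
lemma extD_wedge_zero_one {f : Form E2 B 0} {β : Form E2 B 1} (hf : IsSmoothForm (𝓡∂ 2) f)
    (hβ : IsSmoothForm (𝓡∂ 2) β) :
    extD (𝓡∂ 2) (k := 1) (fun b => f b ![] • β b) =
      (fun b => wedge (extD (𝓡∂ 2) f b) (β b) : Form E2 B (1 + 1)) +
        (fun b => wedge (f b) (extD (𝓡∂ 2) β b) : Form E2 B (0 + 2)) := by
  have hs := isSmoothForm_zero_smul hf hβ
  refine eq_of_chartRep_eq (I := 𝓡∂ 2) fun x₀ y hy => ?_
  have hu := (𝓡∂ 2).uniqueDiffOn y (extChartAt_target_subset_range x₀ hy)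
  let c : E2 → ℝ := fun y => chartRep (𝓡∂ 2) f x₀ y ![]
  have hc : HasFDerivWithinAt c (((ContinuousMultilinearMap.apply ℝ (fun _ : Fin 0 => E2) ℝ ![]) ∘L
      (ContinuousAlternatingMap.toContinuousMultilinearMapCLM ℝ)) ∘L
        fderivWithin ℝ (chartRep (𝓡∂ 2) f x₀) (range (𝓡∂ 2)) y) (range (𝓡∂ 2)) y :=
    ((ContinuousMultilinearMap.apply ℝ (fun _ : Fin 0 => E2) ℝ ![]) ∘L
      (ContinuousAlternatingMap.toContinuousMultilinearMapCLM ℝ)).hasFDerivAt.comp_hasFDerivWithinAt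
        y (hf.differentiableWithinAt hy).hasFDerivWithinAt
  have h1 : chartRep (𝓡∂ 2) (fun b => f b ![] • β b) x₀ =
      fun y => c y • chartRep (𝓡∂ 2) β x₀ y := by
    funext y
    refine (rep_smul _ _ (fun b => f b ![]) β y).trans ?_
    congr 1
    exact congrArg (f _) (Subsingleton.elim _ _)
  rw [chartRep_extD hs hy, h1, chartRep_add, Pi.add_apply]
  have h2 : chartRep (𝓡∂ 2) (fun b => wedge (extD (𝓡∂ 2) f b) (β b) : Form E2 B (1 + 1)) x₀ y =
      wedge (chartRep (𝓡∂ 2) (extD (𝓡∂ 2) f) x₀ y) (chartRep (𝓡∂ 2) β x₀ y) := rep_wedge _ _ _ _ _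
  have h3 : chartRep (𝓡∂ 2) (fun b => wedge (f b) (extD (𝓡∂ 2) β b) : Form E2 B (0 + 2)) x₀ y =
      wedge (chartRep (𝓡∂ 2) f x₀ y) (chartRep (𝓡∂ 2) (extD (𝓡∂ 2) β) x₀ y) := rep_wedge _ _ _ _ _
  ext v
  have h4 : ∀ w : E2, chartRep (𝓡∂ 2) (extD (𝓡∂ 2) f) x₀ y ![w] =
      fderivWithin ℝ (chartRep (𝓡∂ 2) f x₀) (range (𝓡∂ 2)) y w ![] := by
    intro w
    rw [chartRep_extD hf hy, extDerivWithin, ContinuousAlternatingMap.alternatizeUncurryFin_apply]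
    simp
  have h5 := wedge_one_one (chartRep (𝓡∂ 2) (extD (𝓡∂ 2) f) x₀ y) (chartRep (𝓡∂ 2) β x₀ y)
    (v 0) (v 1)
  have h6 := wedge_zero_two (chartRep (𝓡∂ 2) f x₀ y) (chartRep (𝓡∂ 2) (extD (𝓡∂ 2) β) x₀ y)
    (v 0) (v 1)
  rw [h4, h4, ← h2, ← eq_vecCons_two v] at h5
  rw [← h3, chartRep_extD hβ hy, ← eq_vecCons_two v] at h6
  refine Eq.trans ?_ (congrArg₂ (fun r s : ℝ => r + s) h5 h6).symm
  rw [extDerivWithin_fun_smul' hc (hβ.differentiableWithinAt hy) hu]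
  refine (add_comm (_ : ℝ) _).trans ?_
  refine congrArg₂ (fun r s : ℝ => r + s) ?_ rfl
  refine (ContinuousAlternatingMap.alternatizeUncurryFin_apply _ _).trans ?_
  rw [Fin.sum_univ_two]
  have h7 : Fin.removeNth 0 v = ![v 1] := by ext i : 1; fin_cases i; rfl
  have h8 : Fin.removeNth 1 v = ![v 0] := by ext i : 1; fin_cases i; rfl
  rw [h7, h8]
  simp
  ring

/-- Integration by parts. -/
lemma wedgeInt_extD_add (hν : IsSmoothForm (𝓡∂ 2) ν) (hν0 : ∀ b, ν b ≠ 0)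
    {f : Form E2 B 0} {β : Form E2 B 1} (hf : IsSmoothForm (𝓡∂ 2) f) (hβ : IsSmoothForm (𝓡∂ 2) β)
    (hcf : HasCompactSupport f) (hf0 : f ∈ (dirichlet B).cond 0) :
    wedgeInt (𝓡∂ 2) ν (extD (𝓡∂ 2) f) β + wedgeInt (𝓡∂ 2) ν f (extD (𝓡∂ 2) β) = 0 := by
  have hs := isSmoothForm_zero_smul hf hβ
  have hcs : HasCompactSupport fun b => f b ![] • β b :=
    hcf.of_isClosed_subset (isClosed_tsupport _) (closure_mono fun b hb h => hb (by simp [h]))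
  have h1 := integral_extD_eq_zero hν hν0 hs hcs fun b hb => by rw [hf0 b hb]; simp
  rw [extD_wedge_zero_one hf hβ] at h1
  have hcd : HasCompactSupport (extD (𝓡∂ 2) f) :=
    hcf.of_isClosed_subset (isClosed_tsupport _) (tsupport_extD f)
  rw [← h1]
  exact (integral_add hν (hf.extD.wedge hβ) (hf.wedge hβ.extD) (hasCompactSupport_wedge hcd _)
    (hasCompactSupport_wedge hcf _)).symm

end Surface

namespace BulkBoundary

variable {M : Type u} [TopologicalSpace M] [ChartedSpace (EuclideanHalfSpace 3) M]
  {N : Type v} [TopologicalSpace N] [ChartedSpace E2 N] {X : BulkBoundary M N}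
  [ChartedSpace (EuclideanHalfSpace 2) X.B] {ν : Form E2 X.B 2}

lemma basePairing_eq (α β : ∀ k, Form E2 X.B k) :
    X.basePairing ν α β = -wedgeInt (𝓡∂ 2) ν (α 0) (β 2) + wedgeInt (𝓡∂ 2) ν (α 1) (β 1)
      - wedgeInt (𝓡∂ 2) ν (α 2) (β 0) := by
  have h : X.basePairing ν α β = ∑ p ∈ Finset.range 3, ∑ q ∈ Finset.range 3, (-1) ^ (p + 1) *
    wedgeInt (𝓡∂ 2) ν (α p) (β q) := rfl
  rw [h]
  simp only [Finset.sum_range_succ, Finset.sum_range_zero]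
  rw [wedgeInt_of_ne (p := 0) (q := 0) (by norm_num), wedgeInt_of_ne (p := 0) (q := 1) (by norm_num),
    wedgeInt_of_ne (p := 1) (q := 0) (by norm_num), wedgeInt_of_ne (p := 1) (q := 2) (by norm_num),
    wedgeInt_of_ne (p := 2) (q := 1) (by norm_num), wedgeInt_of_ne (p := 2) (q := 2) (by norm_num)]
  ring

variable [IsManifold (𝓡∂ 2) ∞ X.B] [T2Space X.B] [SigmaCompactSpace X.B]

/-- The pairing `σ` is a Poisson structure: it is compatible with the differential by the theorem
of Stokes, whose boundary term vanishes as `0`-forms are zero on the boundary. -/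
theorem isPoisson_sigma (hν : IsSmoothForm (𝓡∂ 2) ν) (hν0 : ∀ b, ν b ≠ 0) (V : Set X.B) :
    IsPoisson (X.baseForms V) (X.sigma ν V) := by
  have key : ∀ x y : X.baseForms V, X.sigma ν V x y =
      -wedgeInt (𝓡∂ 2) ν (x.1 0) (y.1 2) + wedgeInt (𝓡∂ 2) ν (x.1 1) (y.1 1)
      - wedgeInt (𝓡∂ 2) ν (x.1 2) (y.1 0) := fun x y => basePairing_eq x.1 y.1
  have hz : ∀ {i j : ℤ} {x y : X.baseForms V}, x ∈ (X.baseForms V).deg i →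
      y ∈ (X.baseForms V).deg j → i + j ≠ 0 → X.sigma ν V x y = 0 := by
    intro i j x y hx hy hij
    have hw : ∀ p q : ℕ, p + q = 2 → wedgeInt (𝓡∂ 2) ν (x.1 p) (y.1 q) = 0 := by
      intro p q hpq
      by_cases hp : (p : ℤ) = i + 1
      · rw [hy q (by omega)]
        exact wedgeInt_zero_right
      · rw [hx p hp]
        exact wedgeInt_zero_left
    rw [key, hw 0 2 rfl, hw 1 1 rfl, hw 2 0 rfl]
    ring
  have hd0 : ∀ x : X.baseForms V, ((X.baseForms V).d x).1 0 = 0 := fun x => rfl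
  have hd : ∀ (x : X.baseForms V) (k : ℕ), ((X.baseForms V).d x).1 (k + 1) =
      (-1 : ℝ) • extD (𝓡∂ 2) (x.1 k) := by
    intro x k
    refine (formD_succ _ _ _ x k).trans ?_
    rw [sgn_of_odd ℝ odd_one]
  have hparts : ∀ x y : X.baseForms V, wedgeInt (𝓡∂ 2) ν (extD (𝓡∂ 2) (x.1 0)) (y.1 1) +
      wedgeInt (𝓡∂ 2) ν (x.1 0) (extD (𝓡∂ 2) (y.1 1)) = 0 := fun x y =>
    wedgeInt_extD_add hν hν0 (x.2 0).1 (y.2 1).1 (x.2 0).2.1 (x.2 0).2.2.2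
  have hdl : ∀ (x y : X.baseForms V), X.sigma ν V ((X.baseForms V).d x) y =
      -wedgeInt (𝓡∂ 2) ν (extD (𝓡∂ 2) (x.1 0)) (y.1 1) +
        wedgeInt (𝓡∂ 2) ν (extD (𝓡∂ 2) (x.1 1)) (y.1 0) := by
    intro x y
    rw [key, hd0, hd x 0, hd x 1, wedgeInt_zero_left, wedgeInt_smul_left, wedgeInt_smul_left]
    ring
  have hdr : ∀ (x y : X.baseForms V), X.sigma ν V x ((X.baseForms V).d y) =
      wedgeInt (𝓡∂ 2) ν (x.1 0) (extD (𝓡∂ 2) (y.1 1)) -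
        wedgeInt (𝓡∂ 2) ν (x.1 1) (extD (𝓡∂ 2) (y.1 0)) := by
    intro x y
    rw [key, hd0, hd y 0, hd y 1, wedgeInt_zero_right, wedgeInt_smul_right, wedgeInt_smul_right]
    ring
  refine ⟨fun x y z => ?_, fun c x z => ?_, fun x y z => ?_, fun c x z => ?_, hz,
    fun {i j x y} hx hy => ?_, fun {i j x y} hx hy => ?_⟩
  · have h1 : ∀ p q : ℕ, wedgeInt (𝓡∂ 2) ν ((x + y).1 p) (z.1 q) =
        wedgeInt (𝓡∂ 2) ν (x.1 p) (z.1 q) + wedgeInt (𝓡∂ 2) ν (y.1 p) (z.1 q) := fun p q =>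
      wedgeInt_add_left hν (x.2 p).1 (y.2 p).1 (z.2 q).1 (x.2 p).2.1 (y.2 p).2.1
    rw [key, key, key, h1, h1, h1]
    ring
  · have h1 : ∀ p q : ℕ, wedgeInt (𝓡∂ 2) ν ((c • x).1 p) (z.1 q) =
        c * wedgeInt (𝓡∂ 2) ν (x.1 p) (z.1 q) := fun p q => wedgeInt_smul_left c
    rw [key, key, h1, h1, h1]
    ring
  · have h1 : ∀ p q : ℕ, wedgeInt (𝓡∂ 2) ν (x.1 p) ((y + z).1 q) =
        wedgeInt (𝓡∂ 2) ν (x.1 p) (y.1 q) + wedgeInt (𝓡∂ 2) ν (x.1 p) (z.1 q) := fun p q =>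
      wedgeInt_add_right hν (x.2 p).1 (y.2 q).1 (z.2 q).1 (x.2 p).2.1
    rw [key, key, key, h1, h1, h1]
    ring
  · have h1 : ∀ p q : ℕ, wedgeInt (𝓡∂ 2) ν (x.1 p) ((c • z).1 q) =
        c * wedgeInt (𝓡∂ 2) ν (x.1 p) (z.1 q) := fun p q => wedgeInt_smul_right c
    rw [key, key, h1, h1, h1]
    ring
  · by_cases hij : i + j = 0
    · rw [key, key]
      have hj : j = -i := by omega
      subst hj
      rcases Int.even_or_odd i with hi | hi
      · rw [sgn_of_even ℝ (hi.mul_right _), hx 0 (by push_cast; grind),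
          hx 2 (by push_cast; grind), wedgeInt_zero_left, wedgeInt_zero_left, wedgeInt_zero_right,
          wedgeInt_zero_right, wedgeInt_one_one_comm]
        ring
      · rw [sgn_of_odd ℝ (hi.mul hi.neg), hx 1 (by push_cast; grind), wedgeInt_zero_left,
          wedgeInt_zero_right, wedgeInt_zero_two_comm, ← wedgeInt_zero_two_comm (y.1 0) (x.1 2)]
        ring
    · rw [hz hx hy hij, hz hy hx (by omega)]
      ring
  · rw [hdl, hdr]
    rcases Int.even_or_odd i with hi | hi
    · have h0 : x.1 0 = 0 := hx 0 (by push_cast; grind)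
      rw [sgn_of_even ℝ hi, h0, extD_zero, wedgeInt_zero_left, wedgeInt_zero_left,
        ← wedgeInt_zero_two_comm (y.1 0), wedgeInt_one_one_comm]
      linear_combination hparts y x
    · have h1 : x.1 1 = 0 := hx 1 (by push_cast; grind)
      rw [sgn_of_odd ℝ hi, h1, extD_zero, wedgeInt_zero_left, wedgeInt_zero_left]
      linear_combination -hparts x y

end BulkBoundary

end CSWZW

/-! ### The Poisson structure on the bulk -/

namespace CSWZW

namespace EquivariantTime

section Orbits

variable {E : Type} [NormedAddCommGroup E] [NormedSpace ℝ E] [FiniteDimensional ℝ E]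
  {H : Type} [TopologicalSpace H]
  {I : ModelWithCorners ℝ E H} {M : Type u} [TopologicalSpace M] [ChartedSpace H M]
  {W : Type} [NormedAddCommGroup W] [NormedSpace ℝ W] [FiniteDimensional ℝ W]
  {H' : Type} [TopologicalSpace H'] {J : ModelWithCorners ℝ W H'}
  {Θ : SmoothFlow I M} [ChartedSpace H' Θ.Base] (T : EquivariantTime Θ J)
  [IsManifold J ∞ Θ.Base] [IsManifold I ∞ M] {k : ℕ}

include T in
lemma orbitInt_Iic_add_Ici {α : Form E M (k + 1)} (hα : IsSmoothForm I α)
    (hc : HasCompactSupport α) :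
    Θ.orbitInt (Iic 0) α + Θ.orbitInt (Ici 0) α = Θ.orbitInt univ α := by
  refine T.eq_of_tubeRep_eq fun b₀ z hz => ?_
  have hz' : z ∈ tubeRange J ∩ tubeOpen J b₀ := by rwa [tubeRange_inter]
  have hi := (isShiftDomain_tube J b₀).integrable (T.contDiffOn_tubeRep hα b₀)
    (T.compactAlong_tubeRep hc b₀ _) hz'
  rw [T.tubeRep_add, T.rep_orbitInt hα hc _ hz, T.rep_orbitInt hα hc _ hz,
    T.rep_orbitInt hα hc _ hz, shiftInt, shiftInt, shiftInt, integral_Ici_eq_integral_Ioi,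
    setIntegral_univ, ← integral_add_compl (measurableSet_Iic (a := (0 : ℝ))) hi, compl_Iic]

include T in
/-- The propagator is pullback after fiber integration, up to a sign. -/
lemma propagator_eq {ψ : ∀ k, Form E M k} (hψ : ∀ k, IsSmoothForm I (ψ k))
    (hc : ∀ k, HasCompactSupport (ψ k)) (q : ℕ) :
    Θ.propagator ψ q = -pullback I J Θ.proj (Θ.fiberInt J (ψ (q + 1))) := by
  rw [T.pullback_fiberInt (hψ _) (hc _), ← T.orbitInt_Iic_add_Ici (hψ _) (hc _)]
  have h : Θ.propagator ψ q = -Θ.orbitInt (Iic 0) (ψ (q + 1)) - - -Θ.orbitInt (Ici 0) (ψ (q + 1)) :=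
    rfl
  rw [h]
  abel

end Orbits

section Dimension

variable {M : Type u} [TopologicalSpace M] [ChartedSpace (EuclideanHalfSpace 3) M]
  [IsManifold (𝓡∂ 3) ∞ M] [T2Space M] [SigmaCompactSpace M] {Θ : SmoothFlow (𝓡∂ 3) M}
  [ChartedSpace (EuclideanHalfSpace 2) Θ.Base] {T : EquivariantTime Θ (𝓡∂ 2)}
  [IsManifold (𝓡∂ 2) ∞ Θ.Base] [T2Space Θ.Base] [SigmaCompactSpace Θ.Base]
  {μ : Form E3 M 3} {ν : Form E2 Θ.Base 2}

lemma wedgeInt_pullback_one_two (hT : T.OrientationCompatible μ ν) (hμ : IsSmoothForm (𝓡∂ 3) μ)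
    (hν : IsSmoothForm (𝓡∂ 2) ν) {α : Form E3 M 1} {β : Form E2 Θ.Base 2}
    (hα : IsSmoothForm (𝓡∂ 3) α) (hc : HasCompactSupport α) (hβ : IsSmoothForm (𝓡∂ 2) β) :
    wedgeInt (𝓡∂ 3) μ α (pullback (𝓡∂ 3) (𝓡∂ 2) Θ.proj β) =
      wedgeInt (𝓡∂ 2) ν (Θ.fiberInt (𝓡∂ 2) α) β := by
  refine (integral_fiberInt hT hμ hν (hα.wedge (T.isSmoothForm_pullback_proj hβ))
    (hasCompactSupport_wedge hc _)).trans ?_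
  exact congrArg (fun γ : Form E2 Θ.Base 2 => integral (𝓡∂ 2) ν γ)
    (T.fiberInt_wedge_one_two hα hc hβ)

lemma wedgeInt_pullback_two_one (hT : T.OrientationCompatible μ ν) (hμ : IsSmoothForm (𝓡∂ 3) μ)
    (hν : IsSmoothForm (𝓡∂ 2) ν) {α : Form E3 M 2} {β : Form E2 Θ.Base 1}
    (hα : IsSmoothForm (𝓡∂ 3) α) (hc : HasCompactSupport α) (hβ : IsSmoothForm (𝓡∂ 2) β) :
    wedgeInt (𝓡∂ 3) μ α (pullback (𝓡∂ 3) (𝓡∂ 2) Θ.proj β) =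
      wedgeInt (𝓡∂ 2) ν (Θ.fiberInt (𝓡∂ 2) α) β := by
  refine (integral_fiberInt hT hμ hν (hα.wedge (T.isSmoothForm_pullback_proj hβ))
    (hasCompactSupport_wedge hc _)).trans ?_
  exact congrArg (fun γ : Form E2 Θ.Base 2 => integral (𝓡∂ 2) ν γ)
    (T.fiberInt_wedge_two_one hα hc hβ)

lemma wedgeInt_pullback_three_zero (hT : T.OrientationCompatible μ ν) (hμ : IsSmoothForm (𝓡∂ 3) μ)
    (hν : IsSmoothForm (𝓡∂ 2) ν) {α : Form E3 M 3} {β : Form E2 Θ.Base 0}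
    (hα : IsSmoothForm (𝓡∂ 3) α) (hc : HasCompactSupport α) (hβ : IsSmoothForm (𝓡∂ 2) β) :
    wedgeInt (𝓡∂ 3) μ α (pullback (𝓡∂ 3) (𝓡∂ 2) Θ.proj β) =
      wedgeInt (𝓡∂ 2) ν (Θ.fiberInt (𝓡∂ 2) α) β := by
  refine (integral_fiberInt hT hμ hν (hα.wedge (T.isSmoothForm_pullback_proj hβ))
    (hasCompactSupport_wedge hc _)).trans ?_
  exact congrArg (fun γ : Form E2 Θ.Base 2 => integral (𝓡∂ 2) ν γ)
    (T.fiberInt_wedge_three_zero hα hc hβ)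

end Dimension

end EquivariantTime

namespace BulkBoundary

variable {M : Type u} [TopologicalSpace M] [ChartedSpace (EuclideanHalfSpace 3) M]
  {N : Type v} [TopologicalSpace N] [ChartedSpace E2 N] {X : BulkBoundary M N}
  [ChartedSpace (EuclideanHalfSpace 2) X.B] {ν : Form E2 X.B 2}
  [IsManifold (𝓡∂ 3) ∞ M] [IsManifold (𝓡∂ 2) ∞ X.B]

lemma swap_three {E : Type*} [NormedAddCommGroup E] [NormedSpace ℝ E] (a : E [⋀^Fin 3]→L[ℝ] ℝ)
    (x y z : E) : a ![x, z, y] = -a ![x, y, z] := by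
  have h := a.toAlternatingMap.map_swap ![x, y, z] (i := 1) (j := 2) (by decide)
  refine Eq.trans ?_ h
  change a _ = a _
  congr 1
  ext i; fin_cases i <;> rfl

section Orientation

variable (T : EquivariantTime X.bulkFlow (𝓡∂ 2))

omit [IsManifold (𝓡∂ 3) ∞ M] in
lemma tubeRep_vol_ne_zero {b₀ : X.B} {z : ℝ × E2} (hz : z ∈ EquivariantTime.tubeDomain (𝓡∂ 2) b₀) :
    T.tubeRep b₀ X.vol z (EquivariantTime.splitFrame 2) ≠ 0 := by
  intro h
  obtain ⟨L, hL⟩ := T.exists_tubeFrame_equiv hz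
  let L' : E3 ≃L[ℝ] E3 := (splitCoord 0).trans L
  have h1 := apply_single_compContinuousLinearMap (X.vol (T.tube b₀ z)) L'
  have h2 : (X.vol (T.tube b₀ z)).compContinuousLinearMap (L' : E3 →L[ℝ] E3)
      (fun i => EuclideanSpace.single i 1) = 0 := by
    rw [← h]
    have h3 : T.tubeRep b₀ X.vol z =
      (X.vol (T.tube b₀ z)).compContinuousLinearMap (T.tubeFrame b₀ z) := rfl
    rw [h3, ← hL, ← EquivariantTime.splitCoord_comp_single]
    rfl
  rw [h1] at h2
  have hdet : (L' : E3 →L[ℝ] E3).det ≠ 0 := (LinearEquiv.isUnit_det' L'.toLinearEquiv).ne_zero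
  have h4 := (mul_eq_zero.1 h2).resolve_left hdet
  refine X.vol_ne_zero (T.tube b₀ z) ?_
  ext v
  have h5 := DFunLike.congr_fun ((X.vol (T.tube b₀ z)).toAlternatingMap.eq_smul_basis_det
    (EuclideanSpace.basisFun (Fin 3) ℝ).toBasis) v
  have h6 : (fun i => EuclideanSpace.single i (1 : ℝ)) =
      ⇑(EuclideanSpace.basisFun (Fin 3) ℝ).toBasis := by
    funext i; simp
  rw [h6] at h4
  refine h5.trans ?_
  change X.vol (T.tube b₀ z) (EuclideanSpace.basisFun (Fin 3) ℝ).toBasis * _ = 0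
  rw [h4, zero_mul]

omit [IsManifold (𝓡∂ 3) ∞ M] in
/-- An orientation of the base induced by that of `M` is compatible with it in tubes. -/
lemma IsReduction.sign_eq (hν : X.IsReduction ν) {b₀ : X.B} {z : ℝ × E2}
    (hz : z ∈ EquivariantTime.tubeDomain (𝓡∂ 2) b₀) :
    Real.sign (T.tubeRep b₀ X.vol z (EquivariantTime.splitFrame 2)) =
      Real.sign (chartRep (𝓡∂ 2) ν b₀ z.2 fun i => EuclideanSpace.single i 1) := by
  set x := T.tube b₀ z with hx
  set w : Fin 2 → E3 := fun i => T.tubeFrame b₀ z (0, EuclideanSpace.single i 1) with hw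
  have hv : X.bulkFlow.velocity 0 x = T.tubeFrame b₀ z (1, 0) := by
    rw [hx, T.velocity_tube hz, zero_smul, add_zero]
  have h1 : T.tubeRep b₀ X.vol z (EquivariantTime.splitFrame 2) =
      X.vol x ![X.bulkFlow.velocity 0 x, w 0, w 1] := by
    rw [hv]
    refine congrArg (X.vol x) ?_
    ext i : 1
    fin_cases i <;> rfl
  have h2 : ∀ i, tangentAt (𝓡∂ 3) (𝓡∂ 2) X.bulkFlow.proj x (w i) =
      chartFrame (𝓡∂ 2) b₀ z.2 (EuclideanSpace.single i 1) := fun i =>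
    congrArg (fun L => L (0, EuclideanSpace.single i 1)) (T.tangentAt_proj_comp_tubeFrame hz)
  have h3 : chartRep (𝓡∂ 2) ν b₀ z.2 (fun i => EuclideanSpace.single i 1) =
      ν (X.bulkFlow.proj x) ![tangentAt (𝓡∂ 3) (𝓡∂ 2) X.bulkFlow.proj x (w 0),
        tangentAt (𝓡∂ 3) (𝓡∂ 2) X.bulkFlow.proj x (w 1)] := by
    rw [h2, h2, hx, T.proj_tube]
    refine congrArg (ν _) ?_
    ext i : 1
    fin_cases i <;> rfl
  have h0 := tubeRep_vol_ne_zero T hz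
  rw [h1] at h0
  rw [h1, h3]
  rcases lt_or_gt_of_ne h0 with h | h
  · have h4 := hν.oriented x (w 1) (w 0) (by rw [swap_three]; linarith)
    rw [swap_two] at h4
    rw [Real.sign_of_neg h, Real.sign_of_neg (by linarith)]
  · rw [Real.sign_of_pos h, Real.sign_of_pos (hν.oriented x _ _ h)]

include T in
omit [IsManifold (𝓡∂ 3) ∞ M] in
lemma IsReduction.ne_zero (hν : X.IsReduction ν) (b : X.B) : ν b ≠ 0 := by
  intro h
  have hz : ((0 : ℝ), extChartAt (𝓡∂ 2) b b) ∈ EquivariantTime.tubeDomain (𝓡∂ 2) b :=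
    ⟨mem_univ _, mem_extChartAt_target b⟩
  have h1 := hν.sign_eq T hz
  have h2 : chartRep (𝓡∂ 2) ν b (extChartAt (𝓡∂ 2) b b) = 0 := by
    rw [chartRep, extChartAt_to_inv, h]
    rfl
  rw [h2] at h1
  replace h1 := h1.trans Real.sign_zero
  exact tubeRep_vol_ne_zero T hz (Real.sign_eq_zero_iff.1 h1)

end Orientation

variable [T2Space M] [SigmaCompactSpace M] [T2Space X.B] [SigmaCompactSpace X.B]

/-- Fiber integration intertwines the pairings of the bulk and of the base: the propagator is
pullback after fiber integration, so this is the projection formula together with the theorem of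
Fubini. -/
theorem basePairing_fiberIntegration (T : EquivariantTime X.bulkFlow (𝓡∂ 2))
    (hν : X.IsReduction ν) {φ ψ : ∀ k, Form E3 M k}
    (hφ : ∀ k, IsSmoothForm (𝓡∂ 3) (φ k)) (hφc : ∀ k, HasCompactSupport (φ k))
    (hψ : ∀ k, IsSmoothForm (𝓡∂ 3) (ψ k)) (hψc : ∀ k, HasCompactSupport (ψ k)) :
    X.basePairing ν (X.bulkFlow.fiberIntegration (𝓡∂ 2) φ)
      (X.bulkFlow.fiberIntegration (𝓡∂ 2) ψ) = X.bulkPairing φ ψ := by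
  have hT : T.OrientationCompatible X.vol ν := fun b₀ z hz => hν.sign_eq T hz
  have hs : ∀ k, IsSmoothForm (𝓡∂ 2) (X.bulkFlow.fiberInt (𝓡∂ 2) (ψ (k + 1))) := fun k =>
    T.isSmoothForm_fiberInt (hψ _) (hψc _)
  have h : X.bulkPairing φ ψ = ∑ p ∈ Finset.range 4, ∑ q ∈ Finset.range 4, (-1) ^ (p + 1) *
    wedgeInt (𝓡∂ 3) X.vol (φ p) (X.bulkFlow.propagator ψ q) := rfl
  have hneg : ∀ p q, wedgeInt (𝓡∂ 3) X.vol (φ p) (X.bulkFlow.propagator ψ q) =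
      -wedgeInt (𝓡∂ 3) X.vol (φ p) (pullback (𝓡∂ 3) (𝓡∂ 2) X.bulkFlow.proj
        (X.bulkFlow.fiberInt (𝓡∂ 2) (ψ (q + 1)))) := by
    intro p q
    rw [T.propagator_eq hψ hψc, ← neg_one_smul ℝ, wedgeInt_smul_right, neg_one_mul]
  have h3 : wedgeInt (𝓡∂ 3) X.vol (φ 0) (X.bulkFlow.propagator ψ 3) = 0 := by
    have h4 : X.bulkFlow.fiberInt (𝓡∂ 2) (ψ (3 + 1)) = 0 :=
      form_eq_zero (by simp) _
    rw [hneg, h4]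
    have h5 : pullback (𝓡∂ 3) (𝓡∂ 2) X.bulkFlow.proj (0 : Form E2 X.B 3) = 0 := rfl
    rw [h5, wedgeInt_zero_right, neg_zero]
  have hne : ∀ p q, p + q ≠ 3 → wedgeInt (𝓡∂ 3) X.vol (φ p) (X.bulkFlow.propagator ψ q) = 0 :=
    fun p q hpq => wedgeInt_of_ne hpq _ _
  rw [basePairing_eq, h]
  simp only [Finset.sum_range_succ, Finset.sum_range_zero]
  rw [hne 0 0 (by norm_num), hne 0 1 (by norm_num), hne 0 2 (by norm_num), hne 1 0 (by norm_num),
    hne 1 1 (by norm_num), hne 1 3 (by norm_num), hne 2 0 (by norm_num), hne 2 2 (by norm_num),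
    hne 2 3 (by norm_num), hne 3 1 (by norm_num), hne 3 2 (by norm_num), hne 3 3 (by norm_num),
    h3, hneg 1, hneg 2, hneg 3,
    EquivariantTime.wedgeInt_pullback_one_two hT X.vol_smooth hν.smooth (hφ 1) (hφc 1) (hs 2),
    EquivariantTime.wedgeInt_pullback_two_one hT X.vol_smooth hν.smooth (hφ 2) (hφc 2) (hs 1),
    EquivariantTime.wedgeInt_pullback_three_zero hT X.vol_smooth hν.smooth (hφ 3) (hφc 3) (hs 0)]
  change -wedgeInt (𝓡∂ 2) ν (X.bulkFlow.fiberInt (𝓡∂ 2) (φ 1)) (X.bulkFlow.fiberInt (𝓡∂ 2) (ψ 3)) +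
    wedgeInt (𝓡∂ 2) ν (X.bulkFlow.fiberInt (𝓡∂ 2) (φ 2)) (X.bulkFlow.fiberInt (𝓡∂ 2) (ψ 2)) -
    wedgeInt (𝓡∂ 2) ν (X.bulkFlow.fiberInt (𝓡∂ 2) (φ 3)) (X.bulkFlow.fiberInt (𝓡∂ 2) (ψ 1)) = _
  ring

end BulkBoundary

end CSWZW

/-! ### The boundary -/

namespace CSWZW

namespace EquivariantTime

variable {E : Type} [NormedAddCommGroup E] [NormedSpace ℝ E] {H : Type} [TopologicalSpace H]
  {I : ModelWithCorners ℝ E H} {M : Type u} [TopologicalSpace M] [ChartedSpace H M]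
  {W : Type} [NormedAddCommGroup W] [NormedSpace ℝ W] {H' : Type} [TopologicalSpace H']
  {J : ModelWithCorners ℝ W H'} {Θ : SmoothFlow I M} [ChartedSpace H' Θ.Base]
  (T : EquivariantTime Θ J) [IsManifold J ∞ Θ.Base]

include T

lemma velocity_toFun (s : ℝ) (x : M) : Θ.velocity s x = Θ.velocity 0 (Θ.toFun s x) := by
  have hs := mem_extChartAt_source (I := J) (Θ.proj x)
  have hz := T.tubeInv_mem hs
  have h1 := T.velocity_tube hz s
  have h2 := T.velocity_tube (tubeDomain_add hz s) 0
  rw [T.tube_add, zero_smul, add_zero, T.tube_tubeInv hs] at h2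
  rw [T.tube_tubeInv hs] at h1
  rw [h1, h2]

/-- The boundary of the total space consists of the fibers over the boundary of the base. -/
lemma proj_mem_boundary_iff (x : M) : Θ.proj x ∈ J.boundary Θ.Base ↔ x ∈ I.boundary M := by
  have hs := mem_extChartAt_source (I := J) (Θ.proj x)
  have hz := T.tubeInv_mem hs
  obtain ⟨L, hL⟩ := T.exists_tubeFrame_equiv hz
  have hx := T.tube_tubeInv hs
  rw [← not_iff_not]
  change ¬ J.IsBoundaryPoint (Θ.proj x) ↔ ¬ I.IsBoundaryPoint x
  rw [← ModelWithCorners.isInteriorPoint_iff_not_isBoundaryPoint,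
    ← ModelWithCorners.isInteriorPoint_iff_not_isBoundaryPoint]
  constructor
  · intro h
    have h1 : tubeRange J ∈ 𝓝 (T.tubeInv (Θ.proj x) x) := by
      refine prod_mem_nhds univ_mem ?_
      exact mem_interior_iff_mem_nhds.1 h
    have h2 : HasMFDerivAt 𝓘(ℝ, ℝ × W) I (T.tube (Θ.proj x)) (T.tubeInv (Θ.proj x) x)
        (T.tubeFrame (Θ.proj x) (T.tubeInv (Θ.proj x) x)) :=
      ((T.isParam_tube (Θ.proj x)).hasDer hz).hasMFDerivAt h1
    have h3 := h2.mdifferentiableAt.isInteriorPoint_of_surjective_mfderiv (by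
      rw [h2.mfderiv, ← hL]
      exact L.surjective) (BoundarylessManifold.isInteriorPoint' _)
    rwa [hx] at h3
  · intro h
    have h1 : MDifferentiableAt I J Θ.proj x := T.smooth_proj.mdifferentiable (by simp) x
    refine h1.isInteriorPoint_of_surjective_mfderiv ?_ h
    intro w
    obtain ⟨Lc, hLc, -⟩ := exists_chartFrame_equiv (I := J) hz.2
    have h2 := T.tangentAt_proj_comp_tubeFrame hz
    rw [hx] at h2
    refine ⟨T.tubeFrame (Θ.proj x) (T.tubeInv (Θ.proj x) x) (0, Lc.symm w), ?_⟩
    have h3 := congrArg (fun D => D (0, Lc.symm w)) h2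
    refine h3.trans ?_
    rw [← hLc]
    exact Lc.apply_symm_apply w

end EquivariantTime

namespace BulkBoundary

variable {M : Type u} [TopologicalSpace M] [ChartedSpace (EuclideanHalfSpace 3) M]
  {N : Type v} [TopologicalSpace N] [ChartedSpace E2 N] (X : BulkBoundary M N)

lemma bulkFlow_mem_boundary {x : M} (hx : x ∈ (𝓡∂ 3).boundary M) (s : ℝ) :
    X.bulkFlow.toFun s x ∈ (𝓡∂ 3).boundary M := by
  rw [← X.range_ι] at hx ⊢
  obtain ⟨p, rfl⟩ := hx
  exact ⟨_, (X.bulkFlow_ι s p).symm⟩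

lemma velocity_ι (p : N) : X.bulkFlow.velocity 0 (X.ι p) =
    tangentAt (𝓡 2) (𝓡∂ 3) X.ι p (X.flow.velocity 0 p) := by
  have h1 := hasDer_tangentAt ((X.flow.contMDiff_orbit p).mdifferentiable (by simp) 0) univ
  have h0 : X.flow.toFun 0 p = p := X.flow.map_zero p
  have h2 := hasDer_tangentAt (X.ι_smooth.mdifferentiable (by simp) (X.flow.toFun 0 p)) univ
  have h3 := HasDer.comp (f := fun s => X.flow.toFun s p) h2 h1 (mapsTo_univ _ _)
  have h4 : X.ι ∘ (fun s => X.flow.toFun s p) = fun s => X.bulkFlow.toFun s (X.ι p) :=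
    funext fun s => (X.bulkFlow_ι s p).symm
  rw [h4, h0] at h3
  have h5 := h3.tangentAt_eq
  exact congrArg (fun L => L 1) h5

/-- The orientation of the boundary, as a `2`-form. -/
noncomputable def area (p : N) : E2 [⋀^Fin 2]→L[ℝ] ℝ :=
  ((X.vol (X.ι p)).curryLeft (EuclideanSpace.single 0 (-1))).compContinuousLinearMap
    (tangentAt (𝓡 2) (𝓡∂ 3) X.ι p)

lemma area_apply (p : N) (x y : E2) : X.area p ![x, y] =
    X.vol (X.ι p) ![EuclideanSpace.single 0 (-1), tangentAt (𝓡 2) (𝓡∂ 3) X.ι p x,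
      tangentAt (𝓡 2) (𝓡∂ 3) X.ι p y] :=
  congrArg (X.vol (X.ι p)) (by ext i : 1; fin_cases i <;> rfl)

lemma apply_combination {E : Type*} [NormedAddCommGroup E] [NormedSpace ℝ E]
    (η : E [⋀^Fin 2]→L[ℝ] ℝ) (x y : E) (a b c d : ℝ) :
    η ![a • x + b • y, c • x + d • y] = (a * d - b * c) * η ![x, y] := by
  have hadd : ∀ u v w, η ![u + v, w] = η ![u, w] + η ![v, w] := fun u v w =>
    η.toContinuousMultilinearMap.cons_add ![w] u v
  have hsmul : ∀ (c : ℝ) u w, η ![c • u, w] = c * η ![u, w] := fun c u w =>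
    η.toContinuousMultilinearMap.cons_smul ![w] c u
  have h0 : ∀ u, η ![u, u] = 0 := fun u => η.map_eq_zero_of_eq _ (i := 0) (j := 1) rfl (by decide)
  have hadd' : ∀ u v w, η ![w, u + v] = η ![w, u] + η ![w, v] := by
    intro u v w
    rw [swap_two, hadd, swap_two η w u, swap_two η w v]
    ring
  have hsmul' : ∀ (c : ℝ) u w, η ![w, c • u] = c * η ![w, u] := by
    intro c u w
    rw [swap_two, hsmul, swap_two η w u]
    ring
  rw [hadd, hsmul, hsmul, hadd', hadd', hsmul', hsmul', hsmul', hsmul', h0, h0, swap_two η x y]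
  ring

variable {X}

lemma exists_eq_combination {p : N} {e₀ e₁ : E2} (h0 : X.g p e₀ e₀ = -1) (h1 : X.g p e₁ e₁ = 1)
    (h01 : X.g p e₀ e₁ = 0) (w : E2) : ∃ a b : ℝ, w = a • e₀ + b • e₁ := by
  have hli : LinearIndependent ℝ ![e₀, e₁] := by
    rw [LinearIndependent.pair_iff]
    intro s t hst
    have h2 := congrArg (X.g p e₀) hst
    have h3 := congrArg (X.g p e₁) hst
    rw [map_add, map_smul, map_smul, map_zero, h0, h01, smul_eq_mul, smul_eq_mul] at h2
    rw [map_add, map_smul, map_smul, map_zero, X.g_symm, h01, h1, smul_eq_mul, smul_eq_mul] at h3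
    constructor <;> linarith
  have hspan := hli.span_eq_top_of_card_eq_finrank (by simp)
  have hw : w ∈ Submodule.span ℝ (range ![e₀, e₁]) := by rw [hspan]; trivial
  rw [Matrix.range_cons_cons_empty, Submodule.mem_span_pair] at hw
  obtain ⟨a, b, h⟩ := hw
  exact ⟨a, b, h.symm⟩

/-- In a Lorentzian plane, a future directed null vector on the side of the light cone that is
determined by the sign `ε` is a multiple of `e₀ + ε e₁`, for every oriented orthonormal frame. -/
lemma exists_smul_eq_velocity {p : N} {e₀ e₁ : E2} (h0 : X.g p e₀ e₀ = -1) (h1 : X.g p e₁ e₁ = 1)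
    (h01 : X.g p e₀ e₁ = 0) (ho : X.IsOriented p e₀ e₁) :
    ∃ c : ℝ, c ≠ 0 ∧ X.flow.velocity 0 p = c • e₀ + (c * (X.ε : ℝ)) • e₁ := by
  obtain ⟨a, b, ht⟩ := exists_eq_combination h0 h1 h01 (X.time p)
  obtain ⟨x, y, hv⟩ := exists_eq_combination h0 h1 h01 (X.flow.velocity 0 p)
  have hg : ∀ a b c d : ℝ, X.g p (a • e₀ + b • e₁) (c • e₀ + d • e₁) = -(a * c) + b * d := by
    intro a b c d
    simp only [map_add, map_smul, ContinuousLinearMap.add_apply, ContinuousLinearMap.smul_apply,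
      smul_eq_mul, h0, h1, h01, X.g_symm p e₁ e₀]
    ring
  have hnull := X.flow_null p
  have hfut := X.flow_future p
  have hchi := X.flow_chiral p
  rw [← area_apply, ht, hv, apply_combination] at hchi
  rw [hv, hg] at hnull
  rw [ht, hv, hg] at hfut
  have hA : 0 < X.area p ![e₀, e₁] := by
    rw [area_apply]
    exact ho
  have hxy : (y - x) * (y + x) = 0 := by linarith
  have hx : x ≠ 0 := by
    rintro rfl
    have : y = 0 := by simpa using hxy
    subst this
    simp at hfut
  refine ⟨x, hx, ?_⟩
  rw [hv]
  rcases Int.units_eq_one_or X.ε with h | h <;> rw [h] at hchi ⊢ <;>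
    simp only [Units.val_one, Units.val_neg, Int.cast_one, Int.cast_neg, one_mul, neg_mul,
      mul_one, mul_neg] at hchi ⊢
  · have h2 : 0 < a * y - b * x := pos_of_mul_pos_left hchi hA.le
    rcases mul_eq_zero.1 hxy with h3 | h3
    · rw [show y = x by linarith]
    · exfalso
      have h4 : y = -x := by linarith
      rw [h4] at h2 hfut
      linarith
  · have h2 : 0 < -(a * y - b * x) := pos_of_mul_pos_left (by linarith) hA.le
    rcases mul_eq_zero.1 hxy with h3 | h3
    · exfalso
      have h4 : y = x := by linarith
      rw [h4] at h2 hfut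
      linarith
    · rw [show y = -x by linarith]

variable (X) in
lemma exists_oriented_frame (p : N) : ∃ e₀ e₁, X.g p e₀ e₀ = -1 ∧ X.g p e₁ e₁ = 1 ∧
    X.g p e₀ e₁ = 0 ∧ X.IsOriented p e₀ e₁ := by
  obtain ⟨e₀, e₁, h0, h1, h01⟩ := X.g_lorentzian p
  have hne : X.area p ![e₀, e₁] ≠ 0 := by
    intro h
    obtain ⟨a, b, ht⟩ := exists_eq_combination h0 h1 h01 (X.time p)
    obtain ⟨x, y, hv⟩ := exists_eq_combination h0 h1 h01 (X.flow.velocity 0 p)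
    have hchi := X.flow_chiral p
    rw [← area_apply, ht, hv, apply_combination, h] at hchi
    simp at hchi
  rcases lt_or_gt_of_ne hne with h | h
  · refine ⟨e₀, -e₁, h0, by simpa using h1, by simpa using h01, ?_⟩
    have h2 := apply_combination (X.area p) e₀ e₁ 1 0 0 (-1)
    rw [one_smul, zero_smul, zero_smul, add_zero, zero_add, neg_one_smul, area_apply] at h2
    rw [IsOriented, h2]
    linarith
  · refine ⟨e₀, e₁, h0, h1, h01, ?_⟩
    rw [area_apply] at h
    exact h

/-- A `1`-form satisfies the boundary condition if and only if it vanishes on the velocity of the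
flow along the boundary. -/
lemma mem_boundaryCondition_one_iff [IsManifold (𝓡∂ 3) ∞ M] {α : Form E3 M 1} :
    α ∈ X.boundaryCondition.cond 1 ↔
      ∀ x ∈ (𝓡∂ 3).boundary M, (α x).curryLeft (X.bulkFlow.velocity 0 x) = 0 := by
  have hlin : ∀ (a : E2 [⋀^Fin 1]→L[ℝ] ℝ) (c d : ℝ) (x y : E2),
      a ![c • x + d • y] = c * a ![x] + d * a ![y] := by
    intro a c d x y
    have h1 := a.toContinuousMultilinearMap.cons_add ![] (c • x) (d • y)
    have h2 := a.toContinuousMultilinearMap.cons_smul ![] c x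
    have h3 := a.toContinuousMultilinearMap.cons_smul ![] d y
    exact h1.trans (congrArg₂ (fun r s : ℝ => r + s) h2 h3)
  have hv : ∀ p, (α (X.ι p)).curryLeft (X.bulkFlow.velocity 0 (X.ι p)) = 0 ↔
      pullback (𝓡 2) (𝓡∂ 3) X.ι α p ![X.flow.velocity 0 p] = 0 := by
    intro p
    have h1 : pullback (𝓡 2) (𝓡∂ 3) X.ι α p ![X.flow.velocity 0 p] =
        (α (X.ι p)).curryLeft (X.bulkFlow.velocity 0 (X.ι p)) ![] := by
      rw [velocity_ι]
      exact congrArg (α (X.ι p)) (by ext i : 1; fin_cases i; rfl)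
    rw [h1]
    constructor
    · intro h
      rw [h]
      rfl
    · intro h
      ext v
      rw [Subsingleton.elim v ![], h]
      rfl
  have hmem : α ∈ X.boundaryCondition.cond 1 ↔ ∀ p, X.IsHodgeDual p
      (pullback (𝓡 2) (𝓡∂ 3) X.ι α p) ((X.ε : ℝ) • pullback (𝓡 2) (𝓡∂ 3) X.ι α p) := Iff.rfl
  have hε : (X.ε : ℝ) * X.ε = 1 := by
    rcases Int.units_eq_one_or X.ε with h | h <;> rw [h] <;> simp
  rw [hmem, ← X.range_ι, forall_mem_range]
  refine forall_congr' fun p => ?_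
  rw [hv]
  constructor
  · intro h
    obtain ⟨e₀, e₁, h0, h1, h01, ho⟩ := X.exists_oriented_frame p
    obtain ⟨c, -, hc⟩ := exists_smul_eq_velocity h0 h1 h01 ho
    have h2 := (h e₀ e₁ h0 h1 h01 ho).2
    rw [ContinuousAlternatingMap.smul_apply, smul_eq_mul] at h2
    rw [hc, hlin]
    linear_combination c * h2
  · intro h e₀ e₁ h0 h1 h01 ho
    obtain ⟨c, hc0, hc⟩ := exists_smul_eq_velocity h0 h1 h01 ho
    rw [hc, hlin, mul_assoc, ← mul_add] at h
    have h2 := (mul_eq_zero.1 h).resolve_left hc0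
    rw [ContinuousAlternatingMap.smul_apply, ContinuousAlternatingMap.smul_apply, smul_eq_mul,
      smul_eq_mul]
    constructor
    · linear_combination (X.ε : ℝ) * h2 - (pullback (𝓡 2) (𝓡∂ 3) X.ι α p ![e₁]) * hε
    · linear_combination h2

lemma mem_boundaryCondition_zero_iff [IsManifold (𝓡∂ 3) ∞ M] {α : Form E3 M 0} :
    α ∈ X.boundaryCondition.cond 0 ↔ ∀ x ∈ (𝓡∂ 3).boundary M, α x = 0 := by
  rw [← X.range_ι, forall_mem_range]
  rfl

section Conditions

variable [ChartedSpace (EuclideanHalfSpace 2) X.B] [IsManifold (𝓡∂ 3) ∞ M]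
  [IsManifold (𝓡∂ 2) ∞ X.B] (T : EquivariantTime X.bulkFlow (𝓡∂ 2))

include T in
omit [IsManifold (𝓡∂ 3) ∞ M] in
lemma slice_eq_zero [IsManifold (𝓡∂ 3) ∞ M] {α : Form E3 M 1}
    (hα : α ∈ X.boundaryCondition.cond 1) {x : M} (hx : x ∈ (𝓡∂ 3).boundary M) (s : ℝ) :
    X.bulkFlow.slice α s x = 0 := by
  rw [SmoothFlow.slice, T.velocity_toFun,
    mem_boundaryCondition_one_iff.1 hα _ (X.bulkFlow_mem_boundary hx s)]
  rfl

include T in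
lemma fiberInt_mem_dirichlet {k : ℕ} {α : Form E3 M (k + 1)}
    (hα : α ∈ X.boundaryCondition.cond (k + 1)) :
    X.bulkFlow.fiberInt (𝓡∂ 2) α ∈ (dirichlet X.B).cond k := by
  match k, α with
  | 0, α =>
    intro b hb
    have hx : b.out ∈ (𝓡∂ 3).boundary M := by
      rw [← T.proj_mem_boundary_iff]
      have : X.bulkFlow.proj b.out = b := Quotient.out_eq b
      rwa [this]
    refine (integral_congr_ae (Eventually.of_forall fun s => ?_)).trans (MeasureTheory.integral_zero _ _)
    rw [T.velocity_toFun,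
      mem_boundaryCondition_one_iff.1 hα _ (X.bulkFlow_mem_boundary hx s)]
    rfl
  | k + 1, α => trivial

lemma homotopy_mem_boundaryCondition {k : ℕ} {α : Form E3 M (k + 1)}
    (hα : α ∈ X.boundaryCondition.cond (k + 1)) (hs : IsSmoothForm (𝓡∂ 3) α)
    (hc : HasCompactSupport α) : T.homotopy α ∈ X.boundaryCondition.cond k := by
  match k, α with
  | 0, α =>
    rw [mem_boundaryCondition_zero_iff]
    intro x hx
    have h0 : ∀ A, X.bulkFlow.orbitInt A α x = 0 := by
      intro A
      refine (integral_congr_ae (Eventually.of_forall fun s => ?_)).trans (MeasureTheory.integral_zero _ _)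
      exact slice_eq_zero T hα hx s
    rw [EquivariantTime.homotopy, Pi.sub_apply, h0, h0, smul_zero, sub_zero]
  | 1, α =>
    rw [mem_boundaryCondition_one_iff]
    intro x _
    have h0 : ∀ A, (X.bulkFlow.orbitInt A α x).curryLeft (X.bulkFlow.velocity 0 x) = 0 := by
      intro A
      have hsx := mem_extChartAt_source (I := 𝓡∂ 2) (X.bulkFlow.proj x)
      have hz := T.tubeInv_mem hsx
      have h1 := T.rep_orbitInt hs hc A hz
      have h2 := congrArg (fun a => a.curryLeft ((1, 0) : ℝ × E2)) h1
      rw [EquivariantTime.curryLeft_shiftInt] at h2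
      have h3 := T.velocity_tube hz 0
      rw [zero_smul, add_zero, T.tube_tubeInv hsx] at h3
      obtain ⟨L, hL⟩ := T.exists_tubeFrame_equiv hz
      have h4 : ((X.bulkFlow.orbitInt A α x).curryLeft
          (X.bulkFlow.velocity 0 x)).compContinuousLinearMap (L : ℝ × E2 →L[ℝ] E3) = 0 := by
        rw [h3, hL, ← curryLeft_compContinuousLinearMap, ← h2]
        change _ = ((X.bulkFlow.orbitInt A α (T.tube (X.bulkFlow.proj x)
          (T.tubeInv (X.bulkFlow.proj x) x))).compContinuousLinearMap _).curryLeft (1, 0)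
        rw [T.tube_tubeInv hsx]
      rw [← compContinuousLinearMap_equiv_symm ((X.bulkFlow.orbitInt A α x).curryLeft
        (X.bulkFlow.velocity 0 x)) L, h4]
      rfl
    have h5 : (T.homotopy α x).curryLeft (X.bulkFlow.velocity 0 x) =
        (X.bulkFlow.orbitInt (Iic 0) α x).curryLeft (X.bulkFlow.velocity 0 x) -
        T.cutoff x • (X.bulkFlow.orbitInt univ α x).curryLeft (X.bulkFlow.velocity 0 x) := rfl
    rw [h5, h0, h0, smul_zero, sub_zero]
  | k + 2, α => trivial

lemma lift_mem_boundaryCondition {k : ℕ} {β : Form E2 X.B k}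
    (hβ : β ∈ (dirichlet X.B).cond k) (hs : IsSmoothForm (𝓡∂ 2) β) :
    T.lift β ∈ X.boundaryCondition.cond (k + 1) := by
  match k, β with
  | 0, β =>
    rw [mem_boundaryCondition_one_iff]
    intro x hx
    rw [T.lift_apply_eq_zero hs (Or.inl (hβ _ ((T.proj_mem_boundary_iff x).2 hx)))]
    rfl
  | k + 1, β => trivial

end Conditions

end BulkBoundary

end CSWZW

/-! ### The comparison of the two field theories -/

namespace CSWZW

lemma neg_one_smul_form {E : Type*} [NormedAddCommGroup E] [NormedSpace ℝ E] {M : Type*} {k : ℕ}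
    (α : Form E M k) : (-1 : ℝ) • α = -α :=
  neg_one_smul ℝ α

/-- Poisson structures can be pulled back along cochain maps. -/
lemma IsPoisson.comap {V W : GradedComplex.{u} ℝ} {τ : V → V → ℝ} {σ : W → W → ℝ}
    (hσ : IsPoisson W σ) {f : V → W} (hf : GradedComplex.IsCochainMap V W f)
    (h : ∀ x y, τ x y = σ (f x) (f y)) : IsPoisson V τ where
  add_left x y z := by rw [h, h, h, hf.map_add, hσ.add_left]
  smul_left c x z := by rw [h, h, hf.map_smul, hσ.smul_left]
  add_right x y z := by rw [h, h, h, hf.map_add, hσ.add_right]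
  smul_right c x z := by rw [h, h, hf.map_smul, hσ.smul_right]
  deg_zero hx hy hij := by rw [h, hσ.deg_zero (hf.map_deg hx) (hf.map_deg hy) hij]
  antisymm hx hy := by rw [h, h, hσ.antisymm (hf.map_deg hx) (hf.map_deg hy)]
  cochain hx hy := by
    rw [h, h, hf.map_d, hf.map_d, hσ.cochain (hf.map_deg hx) (hf.map_deg hy)]

namespace BulkBoundary

variable {M : Type u} [TopologicalSpace M] [ChartedSpace (EuclideanHalfSpace 3) M]
  {N : Type v} [TopologicalSpace N] [ChartedSpace E2 N] {X : BulkBoundary M N}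
  [IsManifold (𝓡∂ 3) ∞ M] [T2Space M] [SigmaCompactSpace M]

section Causality

lemma wedgeInt_eq_zero {n : ℕ} {H : Type*} [TopologicalSpace H]
    {I : ModelWithCorners ℝ (EuclideanSpace ℝ (Fin n)) H} {M : Type*} [TopologicalSpace M]
    [ChartedSpace H M] [IsManifold I ∞ M] [T2Space M] [SigmaCompactSpace M] {p q : ℕ}
    {μ : Form (EuclideanSpace ℝ (Fin n)) M n} {α : Form (EuclideanSpace ℝ (Fin n)) M p}
    {β : Form (EuclideanSpace ℝ (Fin n)) M q} (h : ∀ x, α x = 0 ∨ β x = 0) :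
    wedgeInt I μ α β = 0 := by
  have h1 : (fun x => wedge (α x) (β x)) =
      fun x => wedge ((0 : Form (EuclideanSpace ℝ (Fin n)) M p) x) (β x) := by
    funext x
    rcases h x with h | h
    · rw [h]
      rfl
    · rw [h, wedge_zero_right, wedge_zero_right]
  rw [wedgeInt, h1]
  exact wedgeInt_zero_left

/-- The Poisson structure vanishes on observables whose supports are not connected by the flow. -/
lemma bulkPairing_eq_zero {U₁ U₂ : X.FlowOpen} (h : X.FlowDisjoint U₁ U₂) (φ : X.observables U₁.1)
    (ψ : X.observables U₂.1) : X.bulkPairing (Subtype.val φ) (Subtype.val ψ) = 0 := by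
  refine Finset.sum_eq_zero fun p _ => Finset.sum_eq_zero fun q _ => ?_
  refine mul_eq_zero_of_right _ (wedgeInt_eq_zero fun x => ?_)
  by_cases hx : x ∈ (U₁.1 : Set M)
  · right
    have hs : ∀ s, X.bulkFlow.slice (ψ.1 (q + 1)) s x = 0 := by
      intro s
      have h0 : ψ.1 (q + 1) (X.bulkFlow.toFun s x) = 0 := by
        refine image_eq_zero_of_notMem_tsupport fun h' => ?_
        have h1 : X.bulkFlow.toFun s x ∈ (X.bulkFlow.future U₁.1 ∪ X.bulkFlow.past U₁.1) ∩
            (U₂.1 : Set M) := by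
          refine ⟨?_, (ψ.2 (q + 1)).2.2.1 h'⟩
          rcases le_total 0 s with h2 | h2
          · exact Or.inl ⟨s, h2, x, hx, rfl⟩
          · exact Or.inr ⟨s, h2, x, hx, rfl⟩
        rw [h] at h1
        exact h1
      rw [SmoothFlow.slice, h0]
      rfl
    have h1 : X.bulkFlow.propagator ψ.1 q x =
        -(∫ s in Iic (0 : ℝ), X.bulkFlow.slice (ψ.1 (q + 1)) s x) -
          - -∫ s in Ici (0 : ℝ), X.bulkFlow.slice (ψ.1 (q + 1)) s x := rfl
    have h2 : ∀ A : Set ℝ, ∫ s in A, X.bulkFlow.slice (ψ.1 (q + 1)) s x = 0 := fun A =>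
      (integral_congr_ae (Eventually.of_forall hs)).trans (MeasureTheory.integral_zero _ _)
    refine h1.trans ?_
    rw [h2, h2]
    simp
  · exact Or.inl (image_eq_zero_of_notMem_tsupport fun h' => hx ((φ.2 p).2.2.1 h'))

/-- The field theory on the bulk satisfies Einstein causality. -/
theorem einsteinCausal_bulkAQFT
    (hτ : ∀ U : X.FlowOpen, IsPoisson (X.observables U.1) (X.tau U.1)) :
    EinsteinCausal X.FlowDisjoint (X.bulkAQFT hτ) := by
  intro U₁ U₂ U f₁ f₂ h i j a b ha hb
  exact CCRAlg.map_mul_map_comm ((X.bulkFunctor hτ).map f₁) ((X.bulkFunctor hτ).map f₂)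
    (fun φ ψ => bulkPairing_eq_zero h φ ψ) ha hb

theorem einsteinCausal_preimage_bulkAQFT
    (hτ : ∀ U : X.FlowOpen, IsPoisson (X.observables U.1) (X.tau U.1)) :
    EinsteinCausal X.BaseDisjoint (X.preimage ⋙ X.bulkAQFT hτ) := by
  intro V₁ V₂ V f₁ f₂ h i j a b ha hb
  refine einsteinCausal_bulkAQFT hτ (X.preimage.map f₁) (X.preimage.map f₂) ?_ ha hb
  refine Set.eq_empty_iff_forall_notMem.2 ?_
  rintro y ⟨hy, hy2⟩
  have hy1 : X.bulkFlow.proj y ∈ (V₁.1 : Set X.B) := by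
    rcases hy with ⟨s, -, x, hx, rfl⟩ | ⟨s, -, x, hx, rfl⟩ <;>
    · rw [X.bulkFlow.proj_toFun]
      exact hx
  have h3 : X.bulkFlow.proj y ∈ (V₁.1 : Set X.B) ∩ V₂.1 := ⟨hy1, hy2⟩
  rw [h] at h3
  exact h3

variable [ChartedSpace (EuclideanHalfSpace 2) X.B] {ν : Form E2 X.B 2} [IsManifold (𝓡∂ 2) ∞ X.B]
  [T2Space X.B] [SigmaCompactSpace X.B]

omit [IsManifold (𝓡∂ 3) ∞ M] [T2Space M] [SigmaCompactSpace M] in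
/-- The field theory on the base satisfies Einstein causality. -/
theorem einsteinCausal_baseAQFT
    (hσ : ∀ V : X.BaseOpen, IsPoisson (X.baseForms V.1) (X.sigma ν V.1)) :
    EinsteinCausal X.BaseDisjoint (X.baseAQFT ν hσ) := by
  intro V₁ V₂ V f₁ f₂ h i j a b ha hb
  refine CCRAlg.map_mul_map_comm ((X.baseFunctor ν hσ).map f₁) ((X.baseFunctor ν hσ).map f₂)
    (fun (α : X.baseForms V₁.1) (β : X.baseForms V₂.1) => ?_) ha hb
  change X.basePairing ν α.1 β.1 = 0
  refine Finset.sum_eq_zero fun p _ => Finset.sum_eq_zero fun q _ => ?_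
  refine mul_eq_zero_of_right _ (wedgeInt_eq_zero (I := 𝓡∂ 2) (α := α.1 p) (β := β.1 q)
    fun b => ?_)
  by_cases hb1 : b ∈ (V₁.1 : Set X.B)
  · refine Or.inr (image_eq_zero_of_notMem_tsupport fun h' => ?_)
    have h3 : b ∈ (V₁.1 : Set X.B) ∩ V₂.1 := ⟨hb1, (β.2 q).2.2.1 h'⟩
    rw [h] at h3
    exact h3
  · exact Or.inl (image_eq_zero_of_notMem_tsupport fun h' => hb1 ((α.2 p).2.2.1 h'))

end Causality

variable [ChartedSpace (EuclideanHalfSpace 2) X.B] {ν : Form E2 X.B 2} [IsManifold (𝓡∂ 2) ∞ X.B]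
  [T2Space X.B] (T : EquivariantTime X.bulkFlow (𝓡∂ 2))

include T in
omit [T2Space M] [SigmaCompactSpace M] in
lemma fiberIntegration_mem {U : Set M} {V : Set X.B} (h : U ⊆ X.bulkFlow.proj ⁻¹' V)
    (φ : X.observables U) : X.bulkFlow.fiberIntegration (𝓡∂ 2) φ.1 ∈ compactForms (dirichlet X.B) V := by
  intro k
  obtain ⟨h1, h2, h3, h4⟩ := φ.2 (k + 1)
  refine ⟨T.isSmoothForm_fiberInt h1 h2, EquivariantTime.hasCompactSupport_fiberInt h2,
    (EquivariantTime.tsupport_fiberInt_subset h2).trans ?_, fiberInt_mem_dirichlet T h4⟩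
  rintro _ ⟨x, hx, rfl⟩
  exact h (h3 hx)

/-- Fiber integration of the observables on a region that lies over `V`. -/
noncomputable def pushforward {U : Set M} {V : Set X.B} (h : U ⊆ X.bulkFlow.proj ⁻¹' V)
    (φ : X.observables U) : X.baseForms V :=
  ⟨X.bulkFlow.fiberIntegration (𝓡∂ 2) φ.1, fiberIntegration_mem T h φ⟩

omit [T2Space M] [SigmaCompactSpace M] in
lemma isCochainMap_pushforward {U : Set M} {V : Set X.B} (h : U ⊆ X.bulkFlow.proj ⁻¹' V) :
    GradedComplex.IsCochainMap (X.observables U) (X.baseForms V) (pushforward T h) where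
  map_add φ ψ := Subtype.ext (funext fun k =>
    T.fiberInt_add (φ.2 (k + 1)).1 (φ.2 (k + 1)).2.1 (ψ.2 (k + 1)).1 (ψ.2 (k + 1)).2.1)
  map_smul c φ := Subtype.ext (funext fun k =>
    T.fiberInt_smul c (φ.2 (k + 1)).1 (φ.2 (k + 1)).2.1)
  map_deg {i φ} hφ k hk := by
    change X.bulkFlow.fiberInt (𝓡∂ 2) (φ.1 (k + 1)) = 0
    rw [hφ (k + 1) (by push_cast; omega)]
    have := T.fiberInt_smul (0 : ℝ) (φ.2 (k + 1)).1 (φ.2 (k + 1)).2.1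
    rwa [zero_smul, zero_smul] at this
  map_d φ := by
    refine Subtype.ext (funext fun k => ?_)
    have h1 : ((X.observables U).d φ).1 (k + 1) = extD (𝓡∂ 3) (φ.1 k) := by
      refine (formD_succ _ _ _ φ k).trans ?_
      rw [sgn_of_even ℝ even_two, one_smul]
    change X.bulkFlow.fiberInt (𝓡∂ 2) (((X.observables U).d φ).1 (k + 1)) = _
    rw [h1]
    match k with
    | 0 => exact T.fiberInt_extD_zero (φ.2 0).1 (φ.2 0).2.1
    | k + 1 =>
      refine (T.fiberInt_extD (φ.2 (k + 1)).1 (φ.2 (k + 1)).2.1).trans ?_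
      refine Eq.symm ((formD_succ _ _ _ (pushforward T h φ) k).trans ?_)
      rw [sgn_of_odd ℝ odd_one]
      exact neg_one_smul_form _

section Homotopy

variable (V : Set X.B)

/-- The section of fiber integration. -/
noncomputable def liftMap (β : X.baseForms V) : X.observables (X.bulkFlow.proj ⁻¹' V) :=
  ⟨fun k => match k with
    | 0 => 0
    | k + 1 => T.lift (β.1 k), fun k => by
      match k with
      | 0 => exact (compactForms X.boundaryCondition (X.bulkFlow.proj ⁻¹' V)).zero_mem 0
      | k + 1 =>
        obtain ⟨h1, h2, h3, h4⟩ := β.2 k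
        exact ⟨T.isSmoothForm_lift h1, T.hasCompactSupport_lift h1 h2,
          (T.tsupport_lift h1 h2).trans fun x hx => h3 hx.2, lift_mem_boundaryCondition T h4 h1⟩⟩

omit [SigmaCompactSpace M] in
lemma isCochainMap_liftMap :
    GradedComplex.IsCochainMap (X.baseForms V) (X.observables (X.bulkFlow.proj ⁻¹' V))
      (liftMap T V) where
  map_add β γ := by
    refine Subtype.ext (funext fun k => ?_)
    match k with
    | 0 => exact (add_zero _).symm
    | k + 1 => exact T.lift_add (β.2 k).1 (γ.2 k).1
  map_smul c β := by
    refine Subtype.ext (funext fun k => ?_)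
    match k with
    | 0 => exact (smul_zero c).symm
    | k + 1 => exact T.lift_smul c (β.1 k)
  map_deg {i β} hβ k hk := by
    match k with
    | 0 => rfl
    | k + 1 =>
      change T.lift (β.1 k) = 0
      rw [hβ k (by push_cast at hk; omega)]
      have := T.lift_smul (0 : ℝ) (β.1 k)
      rwa [zero_smul, zero_smul] at this
  map_d β := by
    have h1 : ∀ k, ((X.baseForms V).d β).1 (k + 1) = -extD (𝓡∂ 2) (β.1 k) := by
      intro k
      refine (formD_succ _ _ _ β k).trans ?_
      rw [sgn_of_odd ℝ odd_one]
      exact neg_one_smul_form _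
    refine Subtype.ext (funext fun k => ?_)
    match k with
    | 0 => rfl
    | 1 =>
      refine Eq.trans ?_ (formD_succ _ _ _ (liftMap T V β) 0).symm
      change T.lift (0 : Form E2 X.B 0) = sgn ℝ 2 • extD (𝓡∂ 3) (0 : Form E3 M 0)
      have := T.lift_smul (0 : ℝ) (0 : Form E2 X.B 0)
      rw [zero_smul, zero_smul] at this
      rw [this, extD_zero, smul_zero]
    | k + 2 =>
      refine Eq.trans ?_ (formD_succ _ _ _ (liftMap T V β) (k + 1)).symm
      rw [sgn_of_even ℝ even_two, one_smul]
      change T.lift (((X.baseForms V).d β).1 (k + 1)) = extD (𝓡∂ 3) (T.lift (β.1 k))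
      rw [h1, T.extD_lift (β.2 k).1, ← neg_one_smul ℝ, T.lift_smul]
      exact neg_one_smul_form _

/-- The homotopy between the identity and fiber integration followed by its section. -/
noncomputable def homotopyMap : X.observables (X.bulkFlow.proj ⁻¹' V) →ₗ[ℝ]
    X.observables (X.bulkFlow.proj ⁻¹' V) where
  toFun φ := ⟨fun k => T.homotopy (φ.1 (k + 1)), fun k => by
    obtain ⟨h1, h2, h3, h4⟩ := φ.2 (k + 1)
    obtain ⟨ρ, hρ⟩ := T.homotopy_apply_eq_zero h2
    have hK := T.isCompact_slab ρ (h2.isCompact.image X.bulkFlow.continuous_proj)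
    have ht : tsupport (T.homotopy (φ.1 (k + 1))) ⊆
        T.slab ρ (X.bulkFlow.proj '' tsupport (φ.1 (k + 1))) :=
      closure_minimal (fun x hx => by
        by_contra h
        exact hx (hρ x h)) hK.isClosed
    refine ⟨T.isSmoothForm_homotopy h1 h2, hK.of_isClosed_subset (isClosed_tsupport _) ht,
      ht.trans ?_, homotopy_mem_boundaryCondition T h4 h1 h2⟩
    rintro x ⟨-, y, hy, hyx⟩
    rw [mem_preimage, ← hyx]
    exact h3 hy⟩
  map_add' φ ψ := Subtype.ext (funext fun k =>
    T.homotopy_add (φ.2 (k + 1)).1 (φ.2 (k + 1)).2.1 (ψ.2 (k + 1)).1 (ψ.2 (k + 1)).2.1)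
  map_smul' c φ := Subtype.ext (funext fun k => T.homotopy_smul c (φ.1 (k + 1)))

omit [SigmaCompactSpace M] in
lemma homotopyMap_mem_deg {i : ℤ} {φ : X.observables (X.bulkFlow.proj ⁻¹' V)}
    (hφ : φ ∈ (X.observables (X.bulkFlow.proj ⁻¹' V)).deg i) :
    homotopyMap T V φ ∈ (X.observables (X.bulkFlow.proj ⁻¹' V)).deg (i - 1) := by
  intro k hk
  change T.homotopy (φ.1 (k + 1)) = 0
  rw [hφ (k + 1) (by push_cast; omega)]
  have := T.homotopy_smul (0 : ℝ) (0 : Form E3 M (k + 1))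
  rwa [zero_smul, zero_smul] at this

omit [SigmaCompactSpace M] in
lemma d_homotopyMap_add (φ : X.observables (X.bulkFlow.proj ⁻¹' V)) :
    (X.observables (X.bulkFlow.proj ⁻¹' V)).d (homotopyMap T V φ) +
      homotopyMap T V ((X.observables (X.bulkFlow.proj ⁻¹' V)).d φ) =
        φ - liftMap T V (pushforward T Subset.rfl φ) := by
  have h1 : ∀ (φ : X.observables (X.bulkFlow.proj ⁻¹' V)) (k : ℕ),
      ((X.observables (X.bulkFlow.proj ⁻¹' V)).d φ).1 (k + 1) = extD (𝓡∂ 3) (φ.1 k) := by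
    intro φ k
    refine (formD_succ _ _ _ φ k).trans ?_
    rw [sgn_of_even ℝ even_two, one_smul]
  refine Subtype.ext (funext fun k => ?_)
  match k with
  | 0 =>
    change (0 : Form E3 M 0) + T.homotopy (((X.observables (X.bulkFlow.proj ⁻¹' V)).d φ).1 1) =
      φ.1 0 - 0
    rw [h1, T.homotopy_extD_zero (φ.2 0).1 (φ.2 0).2.1, zero_add, sub_zero]
  | k + 1 =>
    change ((X.observables (X.bulkFlow.proj ⁻¹' V)).d (homotopyMap T V φ)).1 (k + 1) +
      T.homotopy (((X.observables (X.bulkFlow.proj ⁻¹' V)).d φ).1 (k + 1 + 1)) =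
      φ.1 (k + 1) - T.lift (X.bulkFlow.fiberInt (𝓡∂ 2) (φ.1 (k + 1)))
    rw [h1, h1]
    exact T.extD_homotopy (φ.2 (k + 1)).1 (φ.2 (k + 1)).2.1

end Homotopy

variable [SigmaCompactSpace X.B]

include T in
/-- The pairing on the bulk is a Poisson structure: it is the pullback of the one on the base along
fiber integration. -/
theorem isPoisson_tau (hν : X.IsReduction ν) (U : Set M) :
    IsPoisson (X.observables U) (X.tau U) :=
  (isPoisson_sigma hν.smooth (hν.ne_zero T) univ).comap
    (isCochainMap_pushforward T (subset_univ U)) fun φ ψ =>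
      (basePairing_fiberIntegration T hν (fun k => (φ.2 k).1) (fun k => (φ.2 k).2.1)
        (fun k => (ψ.2 k).1) fun k => (ψ.2 k).2.1).symm

/-- The comparison of the field theories on the bulk and on the base, for a given structure of a
principal bundle with a compatible orientation. -/
theorem isNaturalWeakEquivalence_dimensionalReduction (hν : X.IsReduction ν) :
    ∃ (hτ : ∀ U : X.FlowOpen, IsPoisson (X.observables U.1) (X.tau U.1))
      (hσ : ∀ V : X.BaseOpen, IsPoisson (X.baseForms V.1) (X.sigma ν V.1))
      (hπ : X.FiberIntegrationRestricts)
      (hmap : ∀ V : X.BaseOpen, PoCh.IsPoissonMap ((X.preimage ⋙ X.bulkFunctor hτ).obj V)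
        ((X.baseFunctor ν hσ).obj V) (fiberMap (X := X) hπ V)),
      EinsteinCausal X.FlowDisjoint (X.bulkAQFT hτ) ∧
      EinsteinCausal X.BaseDisjoint (X.preimage ⋙ X.bulkAQFT hτ) ∧
      EinsteinCausal X.BaseDisjoint (X.baseAQFT ν hσ) ∧
      IsNaturalWeakEquivalence (dimensionalReduction (X := X) hτ hσ hπ hmap) := by
  obtain ⟨T⟩ := SmoothFlow.IsPrincipalBundle.exists_equivariantTime X.bulkFlow_proper
    hν.isPrincipalBundle
  refine ⟨fun U => isPoisson_tau T hν U.1,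
    fun V => isPoisson_sigma hν.smooth (hν.ne_zero T) V.1,
    fun V φ => fiberIntegration_mem T Subset.rfl φ,
    fun V => ⟨isCochainMap_pushforward T (V := (V.1 : Set X.B)) Subset.rfl, fun φ ψ =>
      basePairing_fiberIntegration T hν (fun k => (φ.2 k).1) (fun k => (φ.2 k).2.1)
        (fun k => (ψ.2 k).1) fun k => (ψ.2 k).2.1⟩,
    einsteinCausal_bulkAQFT _, einsteinCausal_preimage_bulkAQFT _, einsteinCausal_baseAQFT _,
    fun V => ?_⟩
  exact CCRAlg.isWeakEquivalence_of_retraction _ (isCochainMap_liftMap T (V.1 : Set X.B))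
    (fun β => Subtype.ext (funext fun k => T.fiberInt_lift (β.2 k).1 (β.2 k).2.1))
    (homotopyMap T (V.1 : Set X.B)) (homotopyMap_mem_deg T (V.1 : Set X.B))
    (d_homotopyMap_add T (V.1 : Set X.B))

end BulkBoundary

end CSWZW

/-! ### Topology of the orbit space -/

namespace CSWZW

section InverseFunction

variable {E F : Type*} [NormedAddCommGroup E] [NormedSpace ℝ E] [CompleteSpace E]
  [NormedAddCommGroup F] [NormedSpace ℝ F]

/-- A continuous right inverse of a smooth map with invertible derivatives is smooth; the domains
may have boundary. -/
lemma contDiffOn_of_rightInverse {f : E → F} {g : F → E} {s : Set E} {t : Set F}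
    (hf : ContDiffOn ℝ ∞ f s) (hs : UniqueDiffOn ℝ s) (ht : UniqueDiffOn ℝ t)
    (hg : ContinuousOn g t) (hgt : MapsTo g t s) (hfg : ∀ y ∈ t, f (g y) = y)
    (hinv : ∀ y ∈ t, ∃ L : E ≃L[ℝ] F, (L : E →L[ℝ] F) = fderivWithin ℝ f s (g y)) :
    ContDiffOn ℝ ∞ g t := by
  have hder : ∀ y ∈ t, HasFDerivWithinAt g (fderivWithin ℝ f s (g y)).inverse t y := by
    intro y hy
    obtain ⟨L, hL⟩ := hinv y hy
    have h1 : HasFDerivWithinAt f (L : E →L[ℝ] F) s (g y) := by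
      rw [hL]
      exact ((hf _ (hgt hy)).differentiableWithinAt (by simp)).hasFDerivWithinAt
    rw [← hL, ContinuousLinearMap.inverse_equiv]
    exact h1.of_local_left_inverse
      ((hg y hy).tendsto_nhdsWithin hgt) hy (eventually_nhdsWithin_of_forall hfg)
  rw [contDiffOn_infty]
  intro n
  induction n with
  | zero => exact contDiffOn_zero.2 hg
  | succ n ih =>
    push_cast
    refine (contDiffOn_succ_iff_fderivWithin ht).2
      ⟨fun y hy => (hder y hy).differentiableWithinAt, fun h => absurd h WithTop.coe_ne_top, ?_⟩
    have h1 : ContDiffOn ℝ n (fun y => (fderivWithin ℝ f s (g y)).inverse) t := by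
      intro y hy
      obtain ⟨L, hL⟩ := hinv y hy
      have h2 : ContDiffWithinAt ℝ n (fun y => fderivWithin ℝ f s (g y)) t y :=
        ((hf.fderivWithin hs (m := n) (by exact_mod_cast le_top)).comp ih hgt) y hy
      have h3 : ContDiffAt ℝ n ContinuousLinearMap.inverse (fderivWithin ℝ f s (g y)) := by
        rw [← hL]
        exact contDiffAt_map_inverse L
      exact h3.comp_contDiffWithinAt y h2
    exact h1.congr fun y hy => (hder y hy).fderivWithin (ht y hy)

end InverseFunction

namespace SmoothFlow

variable {E : Type} [NormedAddCommGroup E] [NormedSpace ℝ E] {H : Type} [TopologicalSpace H]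
  {I : ModelWithCorners ℝ E H} {M : Type u} [TopologicalSpace M] [ChartedSpace H M]
  {Θ : SmoothFlow I M}

variable (Θ) in
lemma continuous_toFun : Continuous fun q : ℝ × M => Θ.toFun q.1 q.2 := Θ.smooth.continuous

variable (Θ) in
lemma continuous_toFun_left (s : ℝ) : Continuous (Θ.toFun s) :=
  Θ.continuous_toFun.comp (continuous_const.prodMk continuous_id)

lemma proj_eq_iff {x y : M} : Θ.proj x = Θ.proj y ↔ ∃ s, Θ.toFun s x = y :=
  Quotient.eq (r := Θ.orbitRel)

variable (Θ) in
lemma isOpenQuotientMap_proj : IsOpenQuotientMap Θ.proj where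
  surjective := Θ.proj_surjective
  continuous := Θ.continuous_proj
  isOpenMap U hU := by
    have h1 : Θ.proj ⁻¹' (Θ.proj '' U) = ⋃ s, Θ.toFun s ⁻¹' U := by
      ext x
      simp only [mem_preimage, mem_image, mem_iUnion]
      constructor
      · rintro ⟨y, hy, hyx⟩
        obtain ⟨s, rfl⟩ := proj_eq_iff.1 hyx.symm
        exact ⟨s, hy⟩
      · rintro ⟨s, hs⟩
        exact ⟨_, hs, Θ.proj_toFun s x⟩
    have h2 : IsOpen (Θ.proj ⁻¹' (Θ.proj '' U)) := by
      rw [h1]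
      exact isOpen_iUnion fun s => hU.preimage (Θ.continuous_toFun_left s)
    exact h2

/-- The orbit space of a proper action is Hausdorff. -/
lemma IsProper.t2Space_base (hΘ : Θ.IsProper) : T2Space Θ.Base := by
  rw [t2Space_iff_of_isOpenQuotientMap Θ.isOpenQuotientMap_proj]
  have h1 : {q : M × M | Θ.proj q.1 = Θ.proj q.2} =
      range fun q : ℝ × M => (q.2, Θ.toFun q.1 q.2) := by
    ext ⟨x, y⟩
    rw [mem_ofPred_eq, proj_eq_iff]
    constructor
    · rintro ⟨s, hs⟩
      exact ⟨(s, x), Prod.ext rfl hs⟩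
    · rintro ⟨⟨s, x⟩, h⟩
      obtain ⟨rfl, rfl⟩ := Prod.mk.inj h
      exact ⟨s, rfl⟩
  rw [h1]
  exact hΘ.isClosedMap.isClosed_range

variable (Θ) in
lemma secondCountableTopology_base [SecondCountableTopology M] : SecondCountableTopology Θ.Base :=
  Θ.isOpenQuotientMap_proj.isQuotientMap.secondCountableTopology
    Θ.isOpenQuotientMap_proj.isOpenMap

end SmoothFlow

end CSWZW


/-! ### Local equivariant functions -/

namespace CSWZW

variable {E : Type} [NormedAddCommGroup E] [NormedSpace ℝ E] {H : Type} [TopologicalSpace H]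
  {I : ModelWithCorners ℝ E H} {M : Type u} [TopologicalSpace M] [ChartedSpace H M]

/-- In a chart, an open subset of a manifold is a relatively open subset of the model. -/
lemma exists_isOpen_range_inter (I : ModelWithCorners ℝ E H) (x₀ : M) {Ω : Set M}
    (hΩ : IsOpen Ω) : ∃ U : Set E, IsOpen U ∧
      range I ∩ U = (extChartAt I x₀).target ∩ (extChartAt I x₀).symm ⁻¹' Ω := by
  refine ⟨I.symm ⁻¹' ((chartAt H x₀).target ∩ (chartAt H x₀).symm ⁻¹' Ω),
    ((chartAt H x₀).symm.isOpen_inter_preimage hΩ).preimage I.continuous_symm, ?_⟩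
  rw [extChartAt_target, preimage_inter, ← inter_assoc, inter_comm (range I)]
  rfl

/-- The integral `∫ f(Θ(s, x)) e⁻ˢ ds` of a compactly supported function is smooth. -/
lemma SmoothFlow.IsProper.contMDiff_integral_exp [IsManifold I ∞ M] [LocallyCompactSpace M]
    {Θ : SmoothFlow I M} (hΘ : Θ.IsProper) {f : M → ℝ} (hf : ContMDiff I 𝓘(ℝ, ℝ) ∞ f)
    (hc : HasCompactSupport f) :
    ContMDiff I 𝓘(ℝ, ℝ) ∞ fun x => ∫ s : ℝ, f (Θ.toFun s x) * Real.exp (-s) := by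
  intro x₁
  obtain ⟨K', hK', hx₁⟩ := exists_compact_mem_nhds x₁
  have hC := hΘ.isCompact_preimage (hK'.prod hc.isCompact)
  set K := Prod.fst '' ((fun q : ℝ × M => (q.2, Θ.toFun q.1 q.2)) ⁻¹' (K' ×ˢ tsupport f)) with hKdef
  have hK : IsCompact K := hC.image continuous_fst
  have h0 : ∀ x ∈ K', ∀ s ∉ K, f (Θ.toFun s x) = 0 := by
    intro x hx s hs
    by_contra h
    exact hs ⟨(s, x), ⟨hx, subset_tsupport f h⟩, rfl⟩
  obtain ⟨U, hU, hRU⟩ := exists_isOpen_range_inter I x₁ (isOpen_interior (s := K'))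
  have hmem : extChartAt I x₁ x₁ ∈ range I ∩ U := by
    rw [hRU]
    refine ⟨mem_extChartAt_target x₁, ?_⟩
    rw [mem_preimage, extChartAt_to_inv]
    exact mem_interior_iff_mem_nhds.2 hx₁
  have hsmooth : ContDiffOn ℝ ∞ (fun p : ℝ × E =>
      f (Θ.toFun p.1 ((extChartAt I x₁).symm p.2)) * Real.exp (-p.1)) (univ ×ˢ (range I ∩ U)) := by
    have h1 : ContMDiffOn 𝓘(ℝ, ℝ × E) I ∞ (fun p : ℝ × E => (extChartAt I x₁).symm p.2)
        (univ ×ˢ (range I ∩ U)) := by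
      refine (contMDiffOn_extChartAt_symm x₁).comp contDiff_snd.contMDiff.contMDiffOn fun p hp => ?_
      have := hp.2
      rw [hRU] at this
      exact this.1
    have h2 : ContMDiffOn 𝓘(ℝ, ℝ × E) 𝓘(ℝ, ℝ) ∞ (Prod.fst : ℝ × E → ℝ)
        (univ ×ˢ (range I ∩ U)) := contDiff_fst.contMDiff.contMDiffOn
    have h3 := (hf.comp Θ.smooth).comp_contMDiffOn (h2.prodMk h1)
    exact h3.contDiffOn.mul (Real.contDiff_exp.comp contDiff_fst.neg).contDiffOn
  have h1 := contDiffOn_integral I.convex_range hU (I.uniqueDiffOn.inter hU) hK hsmooth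
  rw [contMDiffAt_iff_source, contMDiffWithinAt_iff_contDiffWithinAt]
  have h2 : ContDiffOn ℝ ∞ ((fun x => ∫ s : ℝ, f (Θ.toFun s x) * Real.exp (-s)) ∘
      (extChartAt I x₁).symm) (range I ∩ U) := by
    refine h1.congr fun y hy => ?_
    rw [hRU] at hy
    refine (setIntegral_eq_integral_of_forall_compl_eq_zero fun s hs => ?_).symm
    rw [h0 _ (interior_subset hy.2) s hs, zero_mul]
  exact (contDiffWithinAt_inter (hU.mem_nhds hmem.2)).1 (h2 _ hmem)

/-- Near every orbit of a proper action there is an equivariant function: if `f` is a bump function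
and `F(x) = ∫ f(Θ(s, x)) e⁻ˢ ds`, then `F(Θ(r, x)) = eʳ F(x)`, so that `log F` is equivariant. -/
lemma SmoothFlow.IsProper.exists_equivariant_near [FiniteDimensional ℝ E] [IsManifold I ∞ M]
    [T2Space M] [LocallyCompactSpace M] {Θ : SmoothFlow I M} (hΘ : Θ.IsProper) (x₀ : M) :
    ∃ (Ω : Set M) (T : M → ℝ), IsOpen Ω ∧ x₀ ∈ Ω ∧ (∀ s, ∀ x ∈ Ω, Θ.toFun s x ∈ Ω) ∧
      ContMDiffOn I 𝓘(ℝ, ℝ) ∞ T Ω ∧ (∀ s, ∀ x ∈ Ω, T (Θ.toFun s x) = T x + s) ∧ T x₀ = 0 := by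
  obtain ⟨f⟩ : Nonempty (SmoothBumpFunction I x₀) := inferInstance
  set F : M → ℝ := fun x => ∫ s : ℝ, f (Θ.toFun s x) * Real.exp (-s) with hF
  have hFs : ContMDiff I 𝓘(ℝ, ℝ) ∞ F := hΘ.contMDiff_integral_exp f.contMDiff f.hasCompactSupport
  have hFr : ∀ r x, F (Θ.toFun r x) = Real.exp r * F x := by
    intro r x
    have h1 := integral_add_right_eq_self (μ := volume)
      (fun s : ℝ => f (Θ.toFun s x) * Real.exp (-s)) r
    simp only [hF]
    rw [← h1, ← integral_const_mul]
    refine integral_congr_ae (Eventually.of_forall fun s => ?_)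
    simp only
    rw [Θ.map_add, neg_add, Real.exp_add, Real.exp_neg r]
    field_simp
  have hpos : 0 < F x₀ := by
    have hcont : Continuous fun s => f (Θ.toFun s x₀) * Real.exp (-s) :=
      (f.continuous.comp (Θ.contMDiff_orbit x₀).continuous).mul (by fun_prop)
    have hsupp : HasCompactSupport fun s => f (Θ.toFun s x₀) * Real.exp (-s) := by
      have hC := (hΘ.isCompact_preimage ((isCompact_singleton (x := x₀)).prod
        f.hasCompactSupport.isCompact)).image continuous_fst
      refine HasCompactSupport.intro hC fun s hs => ?_
      by_contra h
      exact hs ⟨(s, x₀), ⟨rfl, subset_tsupport f (left_ne_zero_of_mul h)⟩, rfl⟩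
    refine hcont.integral_pos_of_hasCompactSupport_nonneg_nonzero hsupp
      (fun s => mul_nonneg f.nonneg (Real.exp_nonneg _)) (x := 0) ?_
    rw [Θ.map_zero, f.eq_one]
    simp
  refine ⟨{x | 0 < F x}, fun x => Real.log (F x) - Real.log (F x₀),
    isOpen_lt continuous_const hFs.continuous, hpos, ?_, ?_, ?_, sub_self _⟩
  · intro s x hx
    rw [mem_ofPred_eq, hFr]
    exact mul_pos (Real.exp_pos s) hx
  · intro x hx
    have h1 : ContDiffAt ℝ ∞ (fun y => Real.log y - Real.log (F x₀)) (F x) :=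
      (Real.contDiffAt_log.2 (ne_of_gt hx)).sub contDiffAt_const
    exact (h1.contMDiffAt.comp x (hFs x)).contMDiffWithinAt
  · intro s x hx
    simp only
    rw [hFr, Real.log_mul (Real.exp_ne_zero s) (ne_of_gt hx), Real.log_exp]
    ring

end CSWZW


/-! ### The implicit function theorem at the boundary -/

namespace CSWZW

section Implicit

variable {W : Type*} [NormedAddCommGroup W] [NormedSpace ℝ W] [CompleteSpace W]

/-- The implicit function theorem for `g (a, u) = 0`, solved for the real variable `a`, where `u`
ranges over a domain that may have boundary: existence and continuity follow from monotonicity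
in `a`. -/
lemma exists_implicit {R : Set W} (hR : UniqueDiffOn ℝ R) {g : ℝ × W → ℝ} {O : Set (ℝ × W)}
    (hO : IsOpen O) (hg : ContDiffOn ℝ ∞ g ((univ ×ˢ R) ∩ O)) {u₀ : W} (hu₀ : u₀ ∈ R)
    (h0 : ((0, u₀) : ℝ × W) ∈ O) (hg0 : g (0, u₀) = 0)
    (hpos : 0 < fderivWithin ℝ g ((univ ×ˢ R) ∩ O) (0, u₀) (1, 0)) :
    ∃ ε > 0, ∃ (U : Set W) (a : W → ℝ), IsOpen U ∧ u₀ ∈ U ∧ ContDiffOn ℝ ∞ a (R ∩ U) ∧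
      (∀ u ∈ R ∩ U, |a u| < ε ∧ (a u, u) ∈ O ∧ g (a u, u) = 0) ∧
      ∀ b, |b| < ε → ∀ u ∈ R ∩ U, g (b, u) = 0 → b = a u := by
  set D : Set (ℝ × W) := (univ ×ˢ R) ∩ O with hD
  have hDu : UniqueDiffOn ℝ D := (uniqueDiffOn_univ.prod hR).inter hO
  have hz₀ : ((0, u₀) : ℝ × W) ∈ D := ⟨⟨mem_univ _, hu₀⟩, h0⟩
  -- a box on which the derivative in the first direction is positive
  have hκ : ContinuousOn (fun z => fderivWithin ℝ g D z (1, 0)) D :=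
    (hg.continuousOn_fderivWithin hDu (by simp)).clm_apply continuousOn_const
  obtain ⟨O₁, hO₁, hO₁D⟩ := continuousOn_iff'.1 hκ (Ioi 0) isOpen_Ioi
  have hz₁ : ((0, u₀) : ℝ × W) ∈ O ∩ O₁ := by
    refine ⟨h0, ?_⟩
    have : ((0, u₀) : ℝ × W) ∈ (fun z => fderivWithin ℝ g D z (1, 0)) ⁻¹' Ioi 0 ∩ D := ⟨hpos, hz₀⟩
    rw [hO₁D] at this
    exact this.1
  obtain ⟨δ, hδ, hbox⟩ := Metric.isOpen_iff.1 (hO.inter hO₁) _ hz₁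
  rw [← ball_prod_same] at hbox
  have hposD : ∀ z ∈ D, z ∈ O₁ → 0 < fderivWithin ℝ g D z (1, 0) := by
    intro z hz hz1
    have : z ∈ O₁ ∩ D := ⟨hz1, hz⟩
    rw [← hO₁D] at this
    exact this.1
  have hball : ∀ b : ℝ, |b| < δ → b ∈ Metric.ball (0 : ℝ) δ := fun b hb => by
    rwa [mem_ball_zero_iff, Real.norm_eq_abs]
  have hsub : ∀ b : ℝ, |b| < δ → ∀ u ∈ R ∩ Metric.ball u₀ δ, (b, u) ∈ D ∧ (b, u) ∈ O₁ :=
    fun b hb u hu => ⟨⟨⟨mem_univ _, hu.1⟩, (hbox ⟨hball b hb, hu.2⟩).1⟩, (hbox ⟨hball b hb, hu.2⟩).2⟩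
  have hderiv : ∀ b : ℝ, |b| < δ → ∀ u ∈ R ∩ Metric.ball u₀ δ,
      HasDerivAt (fun b => g (b, u)) (fderivWithin ℝ g D (b, u) (1, 0)) b := by
    intro b hb u hu
    have h1 := ((hg _ (hsub b hb u hu).1).differentiableWithinAt (by simp)).hasFDerivWithinAt
    have h2 : HasDerivWithinAt (fun b : ℝ => (b, u)) ((1, 0) : ℝ × W) (Metric.ball 0 δ) b :=
      ((hasDerivAt_id b).prodMk (hasDerivAt_const b u)).hasDerivWithinAt
    have h3 := h1.comp_hasDerivWithinAt b h2 fun b' hb' =>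
      (hsub b' (by rwa [mem_ball_zero_iff, Real.norm_eq_abs] at hb') u hu).1
    exact h3.hasDerivAt (Metric.isOpen_ball.mem_nhds (hball b hb))
  have hmono : ∀ u ∈ R ∩ Metric.ball u₀ δ, StrictMonoOn (fun b => g (b, u)) (Ioo (-δ) δ) := by
    intro u hu
    refine strictMonoOn_of_deriv_pos (convex_Ioo _ _)
      (fun b hb => (hderiv b (abs_lt.2 hb) u hu).continuousAt.continuousWithinAt) fun b hb => ?_
    rw [interior_Ioo] at hb
    rw [(hderiv b (abs_lt.2 hb) u hu).deriv]
    exact hposD _ (hsub b (abs_lt.2 hb) u hu).1 (hsub b (abs_lt.2 hb) u hu).2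
  have hcont : ∀ b : ℝ, |b| < δ → ContinuousOn (fun u => g (b, u)) (R ∩ Metric.ball u₀ δ) :=
    fun b hb => hg.continuousOn.comp (by fun_prop) fun u hu => (hsub b hb u hu).1
  -- the function `g` takes all small values on the box
  set ε := δ / 2 with hε
  have hε0 : 0 < ε := by positivity
  have hεδ : |ε| < δ := by rw [abs_of_pos hε0]; linarith
  have hεδ' : |-ε| < δ := by rwa [abs_neg]
  have hu₀δ : u₀ ∈ R ∩ Metric.ball u₀ δ := ⟨hu₀, Metric.mem_ball_self hδ⟩
  have h0mem : (0 : ℝ) ∈ Ioo (-δ) δ := ⟨by linarith, hδ⟩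
  have hg1 : 0 < g (ε, u₀) := by
    rw [← hg0]
    exact hmono u₀ hu₀δ h0mem (abs_lt.1 hεδ) hε0
  have hg2 : g (-ε, u₀) < 0 := by
    rw [← hg0]
    exact hmono u₀ hu₀δ (abs_lt.1 hεδ') h0mem (by linarith)
  set η := min (g (ε, u₀)) (-g (-ε, u₀)) / 2 with hη
  have hη0 : 0 < η := by
    have : 0 < min (g (ε, u₀)) (-g (-ε, u₀)) := lt_min hg1 (by linarith)
    positivity
  have hη1 : η < g (ε, u₀) := by
    have := min_le_left (g (ε, u₀)) (-g (-ε, u₀))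
    linarith
  have hη2 : g (-ε, u₀) < -η := by
    have := min_le_right (g (ε, u₀)) (-g (-ε, u₀))
    linarith
  obtain ⟨U₁, hU₁, hU₁s⟩ := continuousOn_iff'.1 (hcont ε hεδ) (Ioi η) isOpen_Ioi
  obtain ⟨U₂, hU₂, hU₂s⟩ := continuousOn_iff'.1 (hcont (-ε) hεδ') (Iio (-η)) isOpen_Iio
  set U := Metric.ball u₀ δ ∩ (U₁ ∩ U₂) with hU
  have hUo : IsOpen U := Metric.isOpen_ball.inter (hU₁.inter hU₂)
  have hu₀U : u₀ ∈ U := by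
    have h1 : u₀ ∈ (fun u => g (ε, u)) ⁻¹' Ioi η ∩ (R ∩ Metric.ball u₀ δ) := ⟨hη1, hu₀δ⟩
    have h2 : u₀ ∈ (fun u => g (-ε, u)) ⁻¹' Iio (-η) ∩ (R ∩ Metric.ball u₀ δ) := ⟨hη2, hu₀δ⟩
    rw [hU₁s] at h1
    rw [hU₂s] at h2
    exact ⟨hu₀δ.2, h1.1, h2.1⟩
  have hUδ : ∀ u ∈ R ∩ U, u ∈ R ∩ Metric.ball u₀ δ := fun u hu => ⟨hu.1, hu.2.1⟩
  have hex : ∀ p ∈ Ioo (-η) η ×ˢ (R ∩ U), ∃ b, |b| < ε ∧ g (b, p.2) = p.1 := by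
    rintro ⟨y, u⟩ ⟨hy, hu⟩
    have h1 : u ∈ U₁ ∩ (R ∩ Metric.ball u₀ δ) := ⟨hu.2.2.1, hUδ u hu⟩
    have h2 : u ∈ U₂ ∩ (R ∩ Metric.ball u₀ δ) := ⟨hu.2.2.2, hUδ u hu⟩
    rw [← hU₁s] at h1
    rw [← hU₂s] at h2
    have h3 : ContinuousOn (fun b => g (b, u)) (Icc (-ε) ε) := fun b hb =>
      (hderiv b ((abs_le.2 hb).trans_lt (by linarith)) u (hUδ u hu)).continuousAt.continuousWithinAt
    obtain ⟨b, hb, hbg⟩ := intermediate_value_Ioo (by linarith : -ε ≤ ε) h3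
      (show y ∈ Ioo (g (-ε, u)) (g (ε, u)) from ⟨lt_trans h2.1 hy.1, lt_trans hy.2 h1.1⟩)
    exact ⟨b, abs_lt.2 hb, hbg⟩
  choose! A hAε hAg using hex
  have hAδ : ∀ p ∈ Ioo (-η) η ×ˢ (R ∩ U), A p ∈ Ioo (-δ) δ := fun p hp =>
    abs_lt.1 ((hAε p hp).trans (by linarith))
  -- the solution depends smoothly on the value and on the parameter
  have hAcont : ContinuousOn A (Ioo (-η) η ×ˢ (R ∩ U)) := by
    intro p hp
    have hcomp : ∀ b : ℝ, |b| < δ → ContinuousWithinAt (fun q : ℝ × W => g (b, q.2) - q.1)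
        (Ioo (-η) η ×ˢ (R ∩ U)) p := fun b hb =>
      ((((hcont b hb).comp (f := fun q : ℝ × W => q.2) continuousOn_snd
        fun q hq => hUδ q.2 hq.2).sub continuousOn_fst) p hp)
    rw [ContinuousWithinAt, tendsto_order]
    constructor
    · intro b hb
      rcases lt_or_ge (-δ) b with h | h
      · have hbδ : b ∈ Ioo (-δ) δ := ⟨h, hb.trans (hAδ p hp).2⟩
        have h1 : g (b, p.2) - p.1 < 0 := by
          have := hmono p.2 (hUδ _ hp.2) hbδ (hAδ p hp) hb
          simp only [hAg p hp] at this
          linarith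
        filter_upwards [(hcomp b (abs_lt.2 hbδ)).eventually_lt_const h1, self_mem_nhdsWithin]
          with q hq hqm
        refine ((hmono q.2 (hUδ _ hqm.2)).lt_iff_lt hbδ (hAδ q hqm)).1 ?_
        simp only [hAg q hqm]
        linarith
      · filter_upwards [self_mem_nhdsWithin] with q hq
        exact h.trans_lt (hAδ q hq).1
    · intro b hb
      rcases lt_or_ge b δ with h | h
      · have hbδ : b ∈ Ioo (-δ) δ := ⟨(hAδ p hp).1.trans hb, h⟩
        have h1 : 0 < g (b, p.2) - p.1 := by
          have := hmono p.2 (hUδ _ hp.2) (hAδ p hp) hbδ hb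
          simp only [hAg p hp] at this
          linarith
        filter_upwards [(hcomp b (abs_lt.2 hbδ)).eventually_const_lt h1, self_mem_nhdsWithin]
          with q hq hqm
        refine ((hmono q.2 (hUδ _ hqm.2)).lt_iff_lt (hAδ q hqm) hbδ).1 ?_
        simp only [hAg q hqm]
        linarith
      · filter_upwards [self_mem_nhdsWithin] with q hq
        exact (hAδ q hq).2.trans_le h
  have hAD : ∀ p ∈ Ioo (-η) η ×ˢ (R ∩ U), (A p, p.2) ∈ D ∧ (A p, p.2) ∈ O₁ := fun p hp =>
    hsub _ (abs_lt.2 (hAδ p hp)) _ (hUδ _ hp.2)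
  have hAsmooth : ContDiffOn ℝ ∞ (fun p : ℝ × W => (A p, p.2)) (Ioo (-η) η ×ˢ (R ∩ U)) := by
    refine contDiffOn_of_rightInverse (f := fun z : ℝ × W => (g z, z.2)) (s := D)
      (hg.prodMk contDiffOn_snd) hDu (isOpen_Ioo.uniqueDiffOn.prod (hR.inter hUo))
      (hAcont.prodMk continuousOn_snd) (fun p hp => (hAD p hp).1)
      (fun p hp => Prod.ext (hAg p hp) rfl) fun p hp => ?_
    -- the derivative is triangular
    set l := fderivWithin ℝ g D (A p, p.2) with hl
    have hκ0 : l (1, 0) ≠ 0 := (hposD _ (hAD p hp).1 (hAD p hp).2).ne'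
    have hder := ((hg _ (hAD p hp).1).differentiableWithinAt (by simp)).hasFDerivWithinAt.prodMk
      (hasFDerivWithinAt_snd (𝕜 := ℝ) (p := (A p, p.2)) (s := D))
    rw [hder.fderivWithin (hDu _ (hAD p hp).1)]
    have hsplit : ∀ z : ℝ × W, l z = z.1 * l (1, 0) + l (0, z.2) := by
      intro z
      have : z = z.1 • ((1, 0) : ℝ × W) + (0, z.2) := by ext <;> simp
      conv_lhs => rw [this, map_add, map_smul, smul_eq_mul]
    let r : ℝ × W →L[ℝ] ℝ × W := ((l (1, 0))⁻¹ •
      (ContinuousLinearMap.fst ℝ ℝ W - (l.comp (ContinuousLinearMap.inr ℝ ℝ W)).comp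
        (ContinuousLinearMap.snd ℝ ℝ W))).prod (ContinuousLinearMap.snd ℝ ℝ W)
    refine ⟨ContinuousLinearEquiv.equivOfInverse (l.prod (ContinuousLinearMap.snd ℝ ℝ W)) r
      (fun z => ?_) fun z => ?_, rfl⟩
    · refine Prod.ext ?_ rfl
      change (l (1, 0))⁻¹ * (l z - l (0, z.2)) = z.1
      rw [hsplit z]
      field_simp
      ring
    · refine Prod.ext ?_ rfl
      change l (((l (1, 0))⁻¹ * (z.1 - l (0, z.2))), z.2) = z.1
      rw [hsplit]
      simp only
      field_simp
      ring
  have h0η : (0 : ℝ) ∈ Ioo (-η) η := ⟨by linarith, hη0⟩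
  have hpair : ∀ u ∈ R ∩ U, ((0, u) : ℝ × W) ∈ Ioo (-η) η ×ˢ (R ∩ U) := fun u hu => ⟨h0η, hu⟩
  refine ⟨ε, hε0, U, fun u => A (0, u), hUo, hu₀U, ?_, ?_, ?_⟩
  · exact (contDiff_fst.comp_contDiffOn hAsmooth).comp
      (contDiff_const.prodMk contDiff_id).contDiffOn hpair
  · exact fun u hu => ⟨hAε _ (hpair u hu), (hAD _ (hpair u hu)).1.2, hAg _ (hpair u hu)⟩
  · intro b hb u hu hbg
    refine (hmono u (hUδ u hu)).injOn (abs_lt.1 (hb.trans (by linarith))) (hAδ _ (hpair u hu)) ?_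
    simp only [hbg]
    exact (hAg _ (hpair u hu)).symm

end Implicit

end CSWZW


/-! ### Slices -/

namespace CSWZW

section Coordinates

/-- Affine coordinates on half space in which a linear form `D` takes the value one on the first
basis vector, and in which the half space is a product with a lower-dimensional half space. Here
`v` is a vector tangent to the boundary with `D v = 1`. -/
lemma exists_adapted_coordinates (y₀ : E3) (D : E3 →L[ℝ] ℝ) {v : E3} (hD : D v = 1)
    (hy₀ : y₀ ∈ range (𝓡∂ 3)) (hv : y₀ 0 = 0 → v 0 = 0) :
    ∃ (L : E3 ≃L[ℝ] ℝ × E2) (k : ℝ × E2) (O : Set E3), IsOpen O ∧ y₀ ∈ O ∧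
      (∀ y ∈ O, y ∈ range (𝓡∂ 3) ↔ (L y + k).2 ∈ range (𝓡∂ 2)) ∧ (L y₀ + k).1 = 0 ∧
      D (L.symm (1, 0)) = 1 := by
  -- coordinates with a prescribed first basis vector
  have key : ∀ i, D (EuclideanSpace.single i 1) ≠ 0 → ∃ L : E3 ≃L[ℝ] ℝ × E2,
      (∀ y, (L y).2 = (splitCoord i y).2) ∧ D (L.symm (1, 0)) = 1 := by
    intro i hi
    refine ⟨(splitCoord i).trans ((ContinuousLinearEquiv.unitsEquivAut ℝ (Units.mk0 _ hi)).prodCongr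
      (ContinuousLinearEquiv.refl ℝ E2)), fun y => rfl, ?_⟩
    have h1 : (splitCoord i) ((D (EuclideanSpace.single i 1))⁻¹ • EuclideanSpace.single i (1 : ℝ)) =
        ((D (EuclideanSpace.single i 1))⁻¹, 0) := by
      rw [map_smul, splitCoord_single_self]
      simp
    rw [ContinuousLinearEquiv.symm_trans_apply]
    change D ((splitCoord i).symm ((1 * (D (EuclideanSpace.single i 1))⁻¹ : ℝ), 0)) = 1
    rw [one_mul, ← h1, ContinuousLinearEquiv.symm_apply_apply, map_smul, smul_eq_mul,
      inv_mul_cancel₀ hi]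
  by_cases hex : ∃ i, i ≠ 0 ∧ D (EuclideanSpace.single i 1) ≠ 0
  · -- a first basis vector tangent to the boundary
    obtain ⟨i, hi0, hi⟩ := hex
    obtain ⟨L, hL, hL1⟩ := key i hi
    refine ⟨L, (-(L y₀).1, 0), univ, isOpen_univ, mem_univ _, fun y _ => ?_, by simp, hL1⟩
    rw [mem_range_halfSpace, mem_range_halfSpace, Prod.snd_add, hL, splitCoord_apply]
    have h1 : i.succAbove 0 = 0 := Fin.succAbove_ne_zero_zero hi0
    simp [h1]
  · -- otherwise `y₀` is an interior point, where the boundary can be placed at will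
    push Not at hex
    have hD0 : D v = v 0 * D (EuclideanSpace.single 0 1) := by
      have hsum : v = ∑ i, v i • EuclideanSpace.single i (1 : ℝ) := by
        ext j
        simp [Finset.sum_apply, Pi.single_apply]
      conv_lhs => rw [hsum]
      rw [map_sum, Finset.sum_eq_single 0]
      · simp
      · intro i _ hi
        rw [map_smul, hex i hi, smul_zero]
      · simp
    have h0 : D (EuclideanSpace.single 0 1) ≠ 0 := fun h => by simp [hD0, h] at hD
    have hy0 : 0 < y₀ 0 := by
      refine lt_of_le_of_ne (mem_range_halfSpace.1 hy₀) fun h => ?_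
      rw [hD0, hv h.symm, zero_mul] at hD
      exact zero_ne_one hD
    obtain ⟨L, hL, hL1⟩ := key 0 h0
    refine ⟨L, (-(L y₀).1, EuclideanSpace.single 0 (1 - y₀ 1)), {y | 0 < y 0 ∧ y₀ 1 - 1 < y 1},
      ?_, ⟨hy0, by simp⟩, fun y hy => ?_, by simp, hL1⟩
    · exact (isOpen_lt continuous_const (EuclideanSpace.proj (𝕜 := ℝ) (0 : Fin 3)).continuous).inter
        (isOpen_lt continuous_const (EuclideanSpace.proj (𝕜 := ℝ) (1 : Fin 3)).continuous)
    · rw [mem_range_halfSpace, mem_range_halfSpace, Prod.snd_add, hL, splitCoord_apply]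
      refine iff_of_true hy.1.le ?_
      have := hy.2
      simp
      linarith

end Coordinates

variable {E : Type} [NormedAddCommGroup E] [NormedSpace ℝ E] {H : Type} [TopologicalSpace H]
  {I : ModelWithCorners ℝ E H} {M : Type u} [TopologicalSpace M] [ChartedSpace H M]
  {W : Type} [NormedAddCommGroup W] [NormedSpace ℝ W] {H' : Type} [TopologicalSpace H']

/-- A slice of a flow: a submanifold, given by a parametrization `d` with inverse `c`, that meets
every orbit over the open set `V` exactly once. The coordinates `c` are extended to be constant
along the orbits, and `T` is the time that it takes from the slice to a point. -/
structure Slice (Θ : SmoothFlow I M) (J : ModelWithCorners ℝ W H') where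
  V : Set Θ.Base
  U : Set W
  d : W → M
  c : M → W
  T : M → ℝ
  isOpen_V : IsOpen V
  isOpen_U : IsOpen U
  smooth_d : ContMDiffOn 𝓘(ℝ, W) I ∞ d (range J ∩ U)
  smooth_c : ContMDiffOn I 𝓘(ℝ, W) ∞ c (Θ.proj ⁻¹' V)
  smooth_T : ContMDiffOn I 𝓘(ℝ, ℝ) ∞ T (Θ.proj ⁻¹' V)
  proj_d : ∀ u ∈ range J ∩ U, Θ.proj (d u) ∈ V
  c_mem : ∀ x ∈ Θ.proj ⁻¹' V, c x ∈ range J ∩ U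
  c_d : ∀ u ∈ range J ∩ U, c (d u) = u
  c_toFun : ∀ s, ∀ x ∈ Θ.proj ⁻¹' V, c (Θ.toFun s x) = c x
  toFun_T : ∀ x ∈ Θ.proj ⁻¹' V, Θ.toFun (T x) (d (c x)) = x

/-- A proper action on a `3`-manifold with boundary has slices through all points: the zero set of
an equivariant function is parametrized by means of the implicit function theorem, where the
velocity of the flow, being tangent to the boundary, makes the zero set transversal to it. -/
lemma SmoothFlow.IsProper.exists_slice {M : Type u} [TopologicalSpace M] [T2Space M]
    [ChartedSpace (EuclideanHalfSpace 3) M] [IsManifold (𝓡∂ 3) ∞ M]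
    {Θ : SmoothFlow (𝓡∂ 3) M} (hΘ : Θ.IsProper) (x₀ : M) :
    ∃ S : Slice Θ (𝓡∂ 2), Θ.proj x₀ ∈ S.V := by
  have : LocallyCompactSpace M := Manifold.locallyCompact_of_finiteDimensional (𝓡∂ 3)
  obtain ⟨Ω, T, hΩ, hx₀, hΩs, hT, hTs, hT0⟩ := hΘ.exists_equivariant_near x₀
  set φ := extChartAt (𝓡∂ 3) x₀ with hφ
  set y₀ := φ x₀ with hy₀
  obtain ⟨U₀, hU₀, hRU₀⟩ := exists_isOpen_range_inter (𝓡∂ 3) x₀ hΩ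
  have hy₀U : y₀ ∈ range (𝓡∂ 3) ∩ U₀ := by
    rw [hRU₀]
    refine ⟨mem_extChartAt_target x₀, ?_⟩
    rw [mem_preimage, hy₀, hφ, extChartAt_to_inv]
    exact hx₀
  have hφs : ContMDiffOn 𝓘(ℝ, E3) (𝓡∂ 3) ∞ φ.symm (range (𝓡∂ 3) ∩ U₀) :=
    (contMDiffOn_extChartAt_symm x₀).mono fun y hy => by
      rw [hRU₀] at hy
      exact hy.1
  set g₀ : E3 → ℝ := T ∘ φ.symm with hg₀
  have hg₀s : ContDiffOn ℝ ∞ g₀ (range (𝓡∂ 3) ∩ U₀) :=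
    (hT.comp hφs fun y hy => by
      rw [hRU₀] at hy
      exact hy.2).contDiffOn
  have hRu : UniqueDiffOn ℝ (range (𝓡∂ 3) ∩ U₀) := (𝓡∂ 3).uniqueDiffOn.inter hU₀
  -- the velocity of the flow
  set γ : ℝ → E3 := fun s => φ (Θ.toFun s x₀) with hγ
  have hγ0 : γ 0 = y₀ := by simp only [hγ, Θ.map_zero, hy₀]
  have hγd : DifferentiableAt ℝ γ 0 := by
    have h1 : ContMDiffAt 𝓘(ℝ, ℝ) 𝓘(ℝ, E3) ∞ γ 0 := by
      refine ContMDiffAt.comp (g := φ) (f := fun s => Θ.toFun s x₀) (0 : ℝ)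
        (contMDiffAt_extChartAt' ?_) (Θ.contMDiff_orbit x₀ 0)
      rw [Θ.map_zero]
      exact mem_chart_source _ x₀
    exact h1.contDiffAt.differentiableAt (by simp)
  set v := deriv γ 0 with hv
  have hγv : HasDerivAt γ v 0 := hγd.hasDerivAt
  have hv0 : y₀ 0 = 0 → v 0 = 0 := by
    intro h
    have h1 : HasDerivAt (fun s => γ s 0) (v 0) 0 :=
      (EuclideanSpace.proj (𝕜 := ℝ) (0 : Fin 3)).hasFDerivAt.comp_hasDerivAt (0 : ℝ) hγv
    refine IsLocalMin.hasDerivAt_eq_zero (f := fun s => γ s 0) ?_ h1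
    refine Eventually.of_forall fun s => ?_
    simp only [hγ0, h]
    exact mem_range_halfSpace.1 ⟨_, rfl⟩
  have hev : ∀ᶠ s in 𝓝 (0 : ℝ), Θ.toFun s x₀ ∈ φ.source := by
    refine (Θ.contMDiff_orbit x₀).continuous.continuousAt.preimage_mem_nhds
      (extChartAt_source_mem_nhds' ?_)
    rw [Θ.map_zero]
    exact mem_extChartAt_source x₀
  have hDv : fderivWithin ℝ g₀ (range (𝓡∂ 3) ∩ U₀) y₀ v = 1 := by
    have h1 : HasFDerivWithinAt g₀ (fderivWithin ℝ g₀ (range (𝓡∂ 3) ∩ U₀) y₀)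
        (range (𝓡∂ 3)) (γ 0) := by
      rw [hγ0]
      exact (((hg₀s y₀ hy₀U).differentiableWithinAt (by simp)).hasFDerivWithinAt).mono_of_mem_nhdsWithin
        (inter_mem_nhdsWithin _ (hU₀.mem_nhds hy₀U.2))
    have h2 := h1.comp_hasDerivWithinAt (0 : ℝ) (hγv.hasDerivWithinAt (s := univ))
      fun s _ => ⟨_, rfl⟩
    rw [hasDerivWithinAt_univ] at h2
    have h3 : g₀ ∘ γ =ᶠ[𝓝 0] fun s => s := by
      filter_upwards [hev] with s hs
      simp only [hg₀, hγ, Function.comp_apply, φ.left_inv hs]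
      rw [hTs s x₀ hx₀, hT0, zero_add]
    exact (h2.congr_of_eventuallyEq h3.symm).unique (hasDerivAt_id 0)
  obtain ⟨L, k, O, hO, hy₀O, hLR, hL0, hL1⟩ := exists_adapted_coordinates y₀ _ hDv hy₀U.1 hv0
  -- straightened coordinates
  set A : ℝ × E2 → E3 := fun z => L.symm (z - k) with hA
  have hAL : ∀ y, A (L y + k) = y := fun y => by simp [hA]
  have hLA : ∀ z, L (A z) + k = z := fun z => by simp [hA]
  have hAs : ContDiff ℝ ∞ A := L.symm.contDiff.comp (contDiff_id.sub contDiff_const)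
  set O₀ : Set (ℝ × E2) := A ⁻¹' (O ∩ U₀) with hO₀
  have hO₀o : IsOpen O₀ := (hO.inter hU₀).preimage hAs.continuous
  have hAmem : ∀ z ∈ (univ ×ˢ range (𝓡∂ 2)) ∩ O₀, A z ∈ range (𝓡∂ 3) ∩ U₀ := by
    intro z hz
    refine ⟨(hLR _ hz.2.1).2 ?_, hz.2.2⟩
    rw [hLA]
    exact hz.1.2
  set P : ℝ × E2 → M := φ.symm ∘ A with hP
  have hPs : ContMDiffOn 𝓘(ℝ, ℝ × E2) (𝓡∂ 3) ∞ P ((univ ×ˢ range (𝓡∂ 2)) ∩ O₀) :=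
    hφs.comp hAs.contMDiff.contMDiffOn hAmem
  set u₀ := (L y₀ + k).2 with hu₀
  have hz₀ : ((0, u₀) : ℝ × E2) = L y₀ + k := Prod.ext hL0.symm rfl
  have hz₀D : ((0, u₀) : ℝ × E2) ∈ (univ ×ˢ range (𝓡∂ 2)) ∩ O₀ := by
    refine ⟨⟨mem_univ _, (hLR _ hy₀O).1 hy₀U.1⟩, ?_⟩
    rw [hO₀, mem_preimage, hz₀, hAL]
    exact ⟨hy₀O, hy₀U.2⟩
  have hgs : ContDiffOn ℝ ∞ (g₀ ∘ A) ((univ ×ˢ range (𝓡∂ 2)) ∩ O₀) :=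
    hg₀s.comp hAs.contDiffOn hAmem
  have hpos : 0 < fderivWithin ℝ (g₀ ∘ A) ((univ ×ˢ range (𝓡∂ 2)) ∩ O₀) (0, u₀) (1, 0) := by
    have h1 : HasFDerivWithinAt A (L.symm : ℝ × E2 →L[ℝ] E3)
        ((univ ×ˢ range (𝓡∂ 2)) ∩ O₀) (0, u₀) :=
      (L.symm.hasFDerivAt.comp ((0, u₀) : ℝ × E2)
        ((hasFDerivAt_id _).sub_const k)).hasFDerivWithinAt
    have h2 : HasFDerivWithinAt g₀ (fderivWithin ℝ g₀ (range (𝓡∂ 3) ∩ U₀) y₀)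
        (range (𝓡∂ 3) ∩ U₀) (A (0, u₀)) := by
      rw [hz₀, hAL]
      exact ((hg₀s y₀ hy₀U).differentiableWithinAt (by simp)).hasFDerivWithinAt
    have h3 := h2.comp ((0, u₀) : ℝ × E2) h1 hAmem
    rw [h3.fderivWithin (((uniqueDiffOn_univ.prod (𝓡∂ 2).uniqueDiffOn).inter hO₀o) _ hz₀D)]
    change 0 < fderivWithin ℝ g₀ (range (𝓡∂ 3) ∩ U₀) y₀ (L.symm (1, 0))
    rw [hL1]
    exact one_pos
  have hg0 : (g₀ ∘ A) (0, u₀) = 0 := by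
    rw [Function.comp_apply, hz₀, hAL, hg₀, Function.comp_apply, hy₀, φ.left_inv
      (mem_extChartAt_source x₀), hT0]
  obtain ⟨ε, hε, U, a, hU, hu₀U, has, ha, hauniq⟩ := exists_implicit (𝓡∂ 2).uniqueDiffOn hO₀o hgs
    hz₀D.1.2 hz₀D.2 hg0 hpos
  -- the retraction onto the zero set of `T`
  set r : M → M := fun x => Θ.toFun (-T x) x with hr
  have hrs : ContMDiffOn (𝓡∂ 3) (𝓡∂ 3) ∞ r Ω :=
    Θ.smooth.comp_contMDiffOn (hT.neg.prodMk contMDiffOn_id)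
  have hrΩ : ∀ x ∈ Ω, r x ∈ Ω := fun x hx => hΩs _ x hx
  have hTr : ∀ x ∈ Ω, T (r x) = 0 := fun x hx => by
    rw [hr, hTs _ x hx, add_neg_cancel]
  have hrt : ∀ s, ∀ x ∈ Ω, r (Θ.toFun s x) = r x := fun s x hx => by
    simp only [hr]
    rw [hTs s x hx, ← Θ.map_add]
    congr 1
    ring
  set ψ : M → ℝ × E2 := fun x => L (φ x) + k with hψ
  have hψs : ContMDiffOn (𝓡∂ 3) 𝓘(ℝ, ℝ × E2) ∞ ψ φ.source :=
    ((L.contDiff.add contDiff_const).contMDiff).comp_contMDiffOn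
      (by rw [hφ, extChartAt_source]; exact contMDiffOn_extChartAt)
  have hψc : ContinuousOn φ φ.source := continuousOn_extChartAt x₀
  set Q : Set M := φ.source ∩ φ ⁻¹' (O ∩ (fun y => L y + k) ⁻¹' (Metric.ball 0 ε ×ˢ U)) with hQ
  have hQo : IsOpen Q := by
    refine hψc.isOpen_inter_preimage (isOpen_extChartAt_source x₀) (hO.inter ?_)
    exact (Metric.isOpen_ball.prod hU).preimage (L.continuous.add continuous_const)
  have hψR : ∀ x ∈ Q, (ψ x).2 ∈ range (𝓡∂ 2) ∩ U := fun x hx =>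
    ⟨(hLR _ hx.2.1).1 ⟨_, rfl⟩, hx.2.2.2⟩
  have hxQ : x₀ ∈ Q := by
    refine ⟨mem_extChartAt_source x₀, hy₀O, ?_⟩
    change L y₀ + k ∈ Metric.ball (0 : ℝ) ε ×ˢ U
    rw [← hz₀]
    exact ⟨Metric.mem_ball_self hε, hu₀U⟩
  set d : E2 → M := fun u => P (a u, u) with hd
  have hPD : ∀ u ∈ range (𝓡∂ 2) ∩ U, (a u, u) ∈ (univ ×ˢ range (𝓡∂ 2)) ∩ O₀ := fun u hu =>
    ⟨⟨mem_univ _, hu.1⟩, (ha u hu).2.1⟩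
  have hAt : ∀ u ∈ range (𝓡∂ 2) ∩ U, A (a u, u) ∈ φ.target ∩ φ.symm ⁻¹' Ω := fun u hu => by
    rw [← hRU₀]
    exact hAmem _ (hPD u hu)
  have hφd : ∀ u ∈ range (𝓡∂ 2) ∩ U, φ (d u) = A (a u, u) := fun u hu =>
    φ.right_inv (hAt u hu).1
  have hdΩ : ∀ u ∈ range (𝓡∂ 2) ∩ U, d u ∈ Ω := fun u hu => (hAt u hu).2
  have hTd : ∀ u ∈ range (𝓡∂ 2) ∩ U, T (d u) = 0 := fun u hu => (ha u hu).2.2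
  have hrd : ∀ u ∈ range (𝓡∂ 2) ∩ U, r (d u) = d u := fun u hu => by
    simp only [hr]
    rw [hTd u hu, neg_zero, Θ.map_zero]
  have hdQ : ∀ u ∈ range (𝓡∂ 2) ∩ U, d u ∈ Q := fun u hu => by
    refine ⟨φ.map_target (hAt u hu).1, ?_⟩
    rw [mem_preimage, hφd u hu]
    refine ⟨(ha u hu).2.1.1, ?_⟩
    rw [mem_preimage, hLA]
    refine ⟨?_, hu.2⟩
    rw [mem_ball_zero_iff, Real.norm_eq_abs]
    exact (ha u hu).1
  have hdψ : ∀ x ∈ Q, x ∈ Ω → T x = 0 → d (ψ x).2 = x := by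
    intro x hx hxΩ hTx
    have h1 : A (ψ x) = φ x := hAL _
    have h2 : (ψ x).1 = a (ψ x).2 := by
      refine hauniq _ ?_ _ (hψR x hx) ?_
      · rw [← Real.norm_eq_abs, ← mem_ball_zero_iff]
        exact hx.2.2.1
      · rw [Prod.mk.eta, Function.comp_apply, h1, hg₀, Function.comp_apply, φ.left_inv hx.1, hTx]
    simp only [hd]
    rw [← h2, Prod.mk.eta, hP, Function.comp_apply, h1, φ.left_inv hx.1]
  set Ω' : Set M := Ω ∩ r ⁻¹' Q with hΩ'
  have hΩ'o : IsOpen Ω' := hrs.continuousOn.isOpen_inter_preimage hΩ hQo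
  have hpre : Θ.proj ⁻¹' (Θ.proj '' Ω') = Ω' := by
    refine Subset.antisymm ?_ (subset_preimage_image _ _)
    rintro x ⟨y, hy, hyx⟩
    obtain ⟨s, rfl⟩ := proj_eq_iff.1 hyx
    refine ⟨hΩs s y hy.1, ?_⟩
    rw [mem_preimage, hrt s y hy.1]
    exact hy.2
  have hdΩ' : ∀ u ∈ range (𝓡∂ 2) ∩ U, d u ∈ Ω' := fun u hu => by
    refine ⟨hdΩ u hu, ?_⟩
    rw [mem_preimage, hrd u hu]
    exact hdQ u hu
  refine ⟨{
    V := Θ.proj '' Ω'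
    U := U
    d := d
    c := fun x => (ψ (r x)).2
    T := T
    isOpen_V := Θ.isOpenQuotientMap_proj.isOpenMap _ hΩ'o
    isOpen_U := hU
    smooth_d := hPs.comp ((has.prodMk contDiffOn_id).contMDiffOn) hPD
    smooth_c := ?_
    smooth_T := ?_
    proj_d := fun u hu => ⟨_, hdΩ' u hu, rfl⟩
    c_mem := ?_
    c_d := fun u hu => ?_
    c_toFun := ?_
    toFun_T := ?_ }, ?_⟩
  · rw [hpre]
    exact contDiff_snd.contMDiff.comp_contMDiffOn
      (hψs.comp (hrs.mono inter_subset_left) fun x hx => hx.2.1)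
  · rw [hpre]
    exact hT.mono inter_subset_left
  · rw [hpre]
    exact fun x hx => hψR _ hx.2
  · simp only [hrd u hu, hψ, hφd u hu, hLA]
  · rw [hpre]
    exact fun s x hx => by simp only [hrt s x hx.1]
  · rw [hpre]
    intro x hx
    rw [hdψ _ hx.2 (hrΩ x hx.1) (hTr x hx.1), hr]
    simp only
    rw [← Θ.map_add, add_neg_cancel, Θ.map_zero]
  · refine ⟨x₀, ⟨hx₀, ?_⟩, rfl⟩
    rw [mem_preimage, hr]
    simp only [hT0, neg_zero, Θ.map_zero]
    exact hxQ

end CSWZW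


/-! ### The smooth structure of the orbit space -/

namespace CSWZW

variable {E : Type} [NormedAddCommGroup E] [NormedSpace ℝ E] {H : Type} [TopologicalSpace H]
  {I : ModelWithCorners ℝ E H} {M : Type u} [TopologicalSpace M] [ChartedSpace H M]
  {W : Type} [NormedAddCommGroup W] [NormedSpace ℝ W] {H' : Type} [TopologicalSpace H']
  {J : ModelWithCorners ℝ W H'} {Θ : SmoothFlow I M}

namespace Slice

variable (S : Slice Θ J)

lemma proj_d_c {x : M} (hx : Θ.proj x ∈ S.V) : Θ.proj (S.d (S.c x)) = Θ.proj x := by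
  conv_rhs => rw [← S.toFun_T x hx, Θ.proj_toFun]

lemma c_out {x : M} (hx : Θ.proj x ∈ S.V) : S.c (Θ.proj x).out = S.c x := by
  obtain ⟨s, hs⟩ := SmoothFlow.proj_eq_iff.1 (Quotient.out_eq (Θ.proj x)).symm
  rw [← hs, S.c_toFun s x hx]

/-- The chart of the orbit space that is defined by a slice. -/
noncomputable def chart : OpenPartialHomeomorph Θ.Base H' where
  toFun b := J.symm (S.c b.out)
  invFun h := Θ.proj (S.d (J h))
  source := S.V
  target := J ⁻¹' S.U
  map_source' b hb := by
    obtain ⟨x, rfl⟩ := Θ.proj_surjective b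
    have h := S.c_mem x hb
    rw [mem_preimage, S.c_out hb, J.right_inv h.1]
    exact h.2
  map_target' h hh := S.proj_d _ ⟨mem_range_self h, hh⟩
  left_inv' b hb := by
    obtain ⟨x, rfl⟩ := Θ.proj_surjective b
    rw [S.c_out hb, J.right_inv (S.c_mem x hb).1, S.proj_d_c hb]
  right_inv' h hh := by
    rw [S.c_out (S.proj_d _ ⟨mem_range_self h, hh⟩), S.c_d _ ⟨mem_range_self h, hh⟩, J.left_inv]
  open_source := S.isOpen_V
  open_target := S.isOpen_U.preimage J.continuous
  continuousOn_toFun := by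
    refine J.continuous_symm.comp_continuousOn ?_
    rw [Θ.isOpenQuotientMap_proj.isQuotientMap.continuousOn_isOpen_iff S.isOpen_V]
    exact S.smooth_c.continuousOn.congr fun x hx => S.c_out hx
  continuousOn_invFun := Θ.continuous_proj.comp_continuousOn
    (S.smooth_d.continuousOn.comp J.continuous.continuousOn fun h hh => ⟨mem_range_self h, hh⟩)

lemma chart_proj {x : M} (hx : Θ.proj x ∈ S.V) : J (S.chart (Θ.proj x)) = S.c x := by
  change J (J.symm (S.c (Θ.proj x).out)) = _
  rw [S.c_out hx, J.right_inv (S.c_mem x hx).1]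

end Slice

/-- The atlas that is defined by slices through all orbits. -/
@[reducible]
noncomputable def sliceChartedSpace (S : Θ.Base → Slice Θ J) (hS : ∀ b, b ∈ (S b).V) :
    ChartedSpace H' Θ.Base where
  atlas := range fun b => (S b).chart
  chartAt b := (S b).chart
  mem_chart_source := hS
  chart_mem_atlas b := mem_range_self b

lemma isManifold_sliceChartedSpace (S : Θ.Base → Slice Θ J) (hS : ∀ b, b ∈ (S b).V) :
    @IsManifold ℝ _ W _ _ H' _ J ∞ Θ.Base _ (sliceChartedSpace S hS) := by
  let _ := sliceChartedSpace S hS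
  refine isManifold_of_contDiffOn J ∞ Θ.Base ?_
  rintro _ _ ⟨b, rfl⟩ ⟨b', rfl⟩
  set s := J.symm ⁻¹' ((S b).chart.symm ≫ₕ (S b').chart).source ∩ range J with hs
  have hmem : ∀ y ∈ s, y ∈ range J ∩ (S b).U ∧ Θ.proj ((S b).d y) ∈ (S b').V := by
    rintro y ⟨⟨h1, h2⟩, hy⟩
    have h3 : J (J.symm y) = y := J.right_inv hy
    have h4 : J (J.symm y) ∈ (S b).U := h1
    have h5 : Θ.proj ((S b).d (J (J.symm y))) ∈ (S b').V := h2
    rw [h3] at h4 h5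
    exact ⟨⟨hy, h4⟩, h5⟩
  have h1 : ContDiffOn ℝ ∞ ((S b').c ∘ (S b).d) s :=
    ((S b').smooth_c.comp ((S b).smooth_d.mono fun y hy => (hmem y hy).1)
      fun y hy => (hmem y hy).2).contDiffOn
  refine h1.congr fun y hy => ?_
  change J ((S b').chart (Θ.proj ((S b).d (J (J.symm y))))) = _
  rw [J.right_inv hy.2, (S b').chart_proj (hmem y hy).2]
  rfl

/-- If there are slices through all orbits, the orbit space is a manifold over which the flow is a
principal bundle. -/
lemma exists_isPrincipalBundle [IsManifold I ∞ M]
    (h : ∀ x : M, ∃ S : Slice Θ J, Θ.proj x ∈ S.V) :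
    ∃ (_ : ChartedSpace H' Θ.Base) (_ : IsManifold J ∞ Θ.Base), Θ.IsPrincipalBundle J := by
  have h' : ∀ b : Θ.Base, ∃ S : Slice Θ J, b ∈ S.V := fun b => by
    obtain ⟨x, rfl⟩ := Θ.proj_surjective b
    exact h x
  choose S hS using h'
  let _ := sliceChartedSpace S hS
  have hM : IsManifold J ∞ Θ.Base := isManifold_sliceChartedSpace S hS
  refine ⟨sliceChartedSpace S hS, hM, ⟨fun x => ?_, fun b => ?_⟩⟩
  · refine contMDiffAt_iff_target.2 ⟨Θ.continuous_proj.continuousAt, ?_⟩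
    have hV : Θ.proj ⁻¹' (S (Θ.proj x)).V ∈ 𝓝 x :=
      ((S _).isOpen_V.preimage Θ.continuous_proj).mem_nhds (hS _)
    refine ((S (Θ.proj x)).smooth_c.contMDiffAt hV).congr_of_eventuallyEq ?_
    filter_upwards [hV] with y hy using (S _).chart_proj hy
  · have hsource : (extChartAt J b).source = (S b).V := extChartAt_source J b
    have hc : ∀ x, Θ.proj x ∈ (S b).V → extChartAt J b (Θ.proj x) = (S b).c x :=
      fun x hx => (S b).chart_proj hx
    refine ⟨(S b).V, (S b).d ∘ extChartAt J b, (S b).T, (S b).isOpen_V, hS b, ?_,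
      (S b).smooth_T, ?_, ?_⟩
    · refine (S b).smooth_d.comp (contMDiffOn_extChartAt (x := b)) fun b' hb' => ?_
      obtain ⟨x, rfl⟩ := Θ.proj_surjective b'
      rw [mem_preimage, hc x hb']
      exact (S b).c_mem x hb'
    · intro b' hb'
      obtain ⟨x, rfl⟩ := Θ.proj_surjective b'
      rw [Function.comp_apply, hc x hb', (S b).proj_d_c hb']
    · intro x hx
      rw [Function.comp_apply, hc x hx]
      exact (S b).toFun_T x hx

end CSWZW


/-! ### The induced orientation of the orbit space -/

namespace CSWZW

namespace EquivariantTime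

variable {E : Type} [NormedAddCommGroup E] [NormedSpace ℝ E] {H : Type} [TopologicalSpace H]
  {I : ModelWithCorners ℝ E H} {M : Type u} [TopologicalSpace M] [ChartedSpace H M]
  {W : Type} [NormedAddCommGroup W] [NormedSpace ℝ W] {H' : Type} [TopologicalSpace H']
  {J : ModelWithCorners ℝ W H'} {Θ : SmoothFlow I M} [ChartedSpace H' Θ.Base]
  (T : EquivariantTime Θ J)

/-- The contraction of a form with the velocity of the flow, restricted to the image of the
section. -/
noncomputable def contraction {k : ℕ} (α : Form E M (k + 1)) : Form W Θ.Base k :=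
  pullback J I T.σ fun x => (α x).curryLeft (Θ.velocity 0 x)

variable [IsManifold J ∞ Θ.Base]

/-- The derivative of the section in the coordinates of a tube. -/
lemma tangentAt_σ_comp_chartFrame {b₀ : Θ.Base} {y : W} (hy : y ∈ (extChartAt J b₀).target) :
    (tangentAt J I T.σ ((extChartAt J b₀).symm y)).comp (chartFrame J b₀ y) =
      (T.tubeFrame b₀ (0, y)).comp (ContinuousLinearMap.inr ℝ ℝ W) := by
  have h1 := (hasDer_tangentAt (T.smooth_σ.mdifferentiable (by simp) ((extChartAt J b₀).symm y))
    univ).comp (hasDer_chartFrame (I := J) hy) (mapsTo_univ _ _)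
  have h2 : HasDer 𝓘(ℝ, W) 𝓘(ℝ, ℝ × W) (fun y : W => ((0 : ℝ), y)) (range J) y
      (ContinuousLinearMap.inr ℝ ℝ W) :=
    hasDer_of_hasFDerivWithinAt (hasFDerivAt_prodMk_right (0 : ℝ) y).hasFDerivWithinAt
  have h3 := HasDer.comp (f := fun y : W => ((0 : ℝ), y))
    ((T.isParam_tube b₀).hasDer (z := (0, y)) ⟨mem_univ _, hy⟩) h2 fun y hy => ⟨mem_univ _, hy⟩
  have h4 : T.tube b₀ ∘ (fun y : W => ((0 : ℝ), y)) = T.σ ∘ (extChartAt J b₀).symm :=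
    funext fun y => Θ.map_zero _
  rw [h4] at h3
  exact h1.eq h3 ((isParam_chart J b₀).uniqueMDiffWithinAt hy)

lemma chartRep_contraction {k : ℕ} (α : Form E M (k + 1)) {b₀ : Θ.Base} {y : W}
    (hy : y ∈ (extChartAt J b₀).target) :
    chartRep J (T.contraction α) b₀ y = ((T.tubeRep b₀ α (0, y)).curryLeft
      (1, 0)).compContinuousLinearMap (ContinuousLinearMap.inr ℝ ℝ W) := by
  have h0 : T.tube b₀ (0, y) = T.σ ((extChartAt J b₀).symm y) := Θ.map_zero _
  have hv : Θ.velocity 0 (T.σ ((extChartAt J b₀).symm y)) = T.tubeFrame b₀ (0, y) (1, 0) := by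
    rw [← h0, T.velocity_tube ⟨mem_univ _, hy⟩, zero_smul, add_zero]
  change (((α (T.σ _)).curryLeft (Θ.velocity 0 (T.σ _))).compContinuousLinearMap
    (tangentAt J I T.σ _)).compContinuousLinearMap (chartFrame J b₀ y) = _
  rw [compContinuousLinearMap_comp, T.tangentAt_σ_comp_chartFrame hy, hv,
    ← compContinuousLinearMap_comp, ← curryLeft_compContinuousLinearMap, ← h0]
  rfl

lemma isSmoothForm_contraction [FiniteDimensional ℝ E] [FiniteDimensional ℝ W] [IsManifold I ∞ M]
    {k : ℕ} {α : Form E M (k + 1)} (hα : IsSmoothForm I α) :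
    IsSmoothForm J (T.contraction α) := by
  intro b₀
  refine ContDiffOn.congr (f := fun y => ((T.tubeRep b₀ α (0, y)).curryLeft
      (1, 0)).compContinuousLinearMap (ContinuousLinearMap.inr ℝ ℝ W)) ?_
    fun y hy => T.chartRep_contraction α hy
  intro y hy
  refine contDiffWithinAt_compContinuousLinearMap ?_ contDiffWithinAt_const
  have h1 := T.contDiffOn_tubeRep hα b₀
  rw [tubeRange_inter] at h1
  have h2 : ContDiffWithinAt ℝ ∞ (fun y => T.tubeRep b₀ α (0, y)) (extChartAt J b₀).target y :=
    (h1 (0, y) ⟨mem_univ _, hy⟩).comp y (f := fun y => ((0 : ℝ), y))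
      (contDiffWithinAt_const.prodMk contDiffWithinAt_id) fun y hy => ⟨mem_univ _, hy⟩
  exact ((ContinuousAlternatingMap.curryLeftLI (𝕜 := ℝ) (E := ℝ × W) (F := ℝ) (n := k)
    ).toContinuousLinearMap.contDiff.comp_contDiffWithinAt h2).clm_apply contDiffWithinAt_const

end EquivariantTime

namespace BulkBoundary

variable {M : Type u} [TopologicalSpace M] [ChartedSpace (EuclideanHalfSpace 3) M]
  {N : Type v} [TopologicalSpace N] [ChartedSpace E2 N] {X : BulkBoundary M N}

/-- The contraction of the volume form with the velocity, restricted to a section, induces the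
orientation of the base: along a tube the volume form has constant sign. -/
lemma isReduction_contraction [IsManifold (𝓡∂ 3) ∞ M]
    [ChartedSpace (EuclideanHalfSpace 2) X.B] [IsManifold (𝓡∂ 2) ∞ X.B]
    (h : X.bulkFlow.IsPrincipalBundle (𝓡∂ 2)) (T : EquivariantTime X.bulkFlow (𝓡∂ 2)) :
    X.IsReduction (T.contraction X.vol) where
  isPrincipalBundle := h
  smooth := T.isSmoothForm_contraction X.vol_smooth
  oriented x w₁ w₂ hpos := by
    set b := X.bulkFlow.proj x with hb
    set z := T.tubeInv b x with hz
    have hzd : z ∈ EquivariantTime.tubeDomain (𝓡∂ 2) b := T.tubeInv_mem (mem_extChartAt_source b)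
    have hzx : T.tube b z = x := T.tube_tubeInv (mem_extChartAt_source b)
    have hd : ∀ s : ℝ, (s, z.2) ∈ EquivariantTime.tubeDomain (𝓡∂ 2) b := fun s =>
      ⟨mem_univ _, hzd.2⟩
    obtain ⟨L, hL⟩ := T.exists_tubeFrame_equiv hzd
    have hLw : ∀ w, T.tubeFrame b z (L.symm w) = w := fun w => by rw [← hL]; simp
    -- the restrictions of the contracted volume form to the slices of the tube
    set η : ℝ → E2 [⋀^Fin 2]→L[ℝ] ℝ := fun s => ((T.tubeRep b X.vol (s, z.2)).curryLeft
      (1, 0)).compContinuousLinearMap (ContinuousLinearMap.inr ℝ ℝ E2) with hη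
    set e : Fin 2 → E2 := fun i => EuclideanSpace.single i 1 with he
    have hηs : ∀ s, η s ![e 0, e 1] =
        T.tubeRep b X.vol (s, z.2) (EquivariantTime.splitFrame 2) := by
      intro s
      refine congrArg (T.tubeRep b X.vol (s, z.2)) ?_
      ext i : 1
      fin_cases i <;> rfl
    have hcont : Continuous fun s => η s ![e 0, e 1] := by
      simp only [hηs]
      have h1 := (T.contDiffOn_tubeRep X.vol_smooth b).continuousOn
      rw [EquivariantTime.tubeRange_inter] at h1
      have h2 : Continuous fun s : ℝ => T.tubeRep b X.vol (s, z.2) :=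
        h1.comp_continuous (by fun_prop) hd
      exact (ContinuousEval.continuous_eval.comp (h2.prodMk continuous_const) :)
    have hne : ∀ s, η s ![e 0, e 1] ≠ 0 := fun s => by
      rw [hηs]
      exact tubeRep_vol_ne_zero T (hd s)
    have hsign : ∀ r : ℝ, 0 < r * η z.1 ![e 0, e 1] → 0 < r * η 0 ![e 0, e 1] := by
      intro r hr
      by_contra hle
      obtain ⟨s, hs⟩ := mem_range_of_exists_le_of_exists_ge (hcont.const_mul r)
        ⟨0, not_lt.1 hle⟩ ⟨z.1, hr.le⟩
      rcases mul_eq_zero.1 hs with h0 | h0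
      · rw [h0, zero_mul] at hr
        exact lt_irrefl _ hr
      · exact hne s h0
    have hcomb : ∀ q : E2, q = q 0 • e 0 + q 1 • e 1 := fun q => by
      ext i
      fin_cases i <;> simp [he]
    have hdet : ∀ s, ∀ q q' : E2, η s ![q, q'] =
        (q 0 * q' 1 - q 1 * q' 0) * η s ![e 0, e 1] := fun s q q' => by
      conv_lhs => rw [hcomb q, hcomb q', apply_combination]
    -- both sides of the assertion in the coordinates of the tube
    have h1 : X.vol x ![X.bulkFlow.velocity 0 x, w₁, w₂] =
        η z.1 ![(L.symm w₁).2, (L.symm w₂).2] := by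
      have hv : X.bulkFlow.velocity 0 x = T.tubeFrame b z (1, 0) := by
        rw [← hzx, T.velocity_tube hzd, zero_smul, add_zero]
      have h2 : X.vol x ![X.bulkFlow.velocity 0 x, w₁, w₂] =
          (T.tubeRep b X.vol z).curryLeft (1, 0) ![L.symm w₁, L.symm w₂] := by
        rw [hv]
        conv_lhs => rw [← hLw w₁, ← hLw w₂, ← hzx]
        refine congrArg (X.vol (T.tube b z)) ?_
        ext i : 1
        fin_cases i <;> rfl
      rw [h2]
      refine curryLeft_apply_congr _ _ fun i => ?_
      fin_cases i
      · exact ⟨(L.symm w₁).1, by ext <;> simp⟩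
      · exact ⟨(L.symm w₂).1, by ext <;> simp⟩
    have h2 : ∀ w, tangentAt (𝓡∂ 3) (𝓡∂ 2) X.bulkFlow.proj x w =
        chartFrame (𝓡∂ 2) b z.2 (L.symm w).2 := fun w => by
      have h3 := congrArg (fun Q => Q (L.symm w)) (T.tangentAt_proj_comp_tubeFrame hzd)
      rw [hzx] at h3
      refine Eq.trans ?_ h3
      exact congrArg _ (hLw w).symm
    have h3 : T.contraction X.vol b ![tangentAt (𝓡∂ 3) (𝓡∂ 2) X.bulkFlow.proj x w₁,
        tangentAt (𝓡∂ 3) (𝓡∂ 2) X.bulkFlow.proj x w₂] =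
        η 0 ![(L.symm w₁).2, (L.symm w₂).2] := by
      have hbz : (extChartAt (𝓡∂ 2) b).symm z.2 = b :=
        (extChartAt (𝓡∂ 2) b).left_inv (mem_extChartAt_source b)
      have h4 := T.chartRep_contraction X.vol hzd.2
      rw [h2, h2, hη]
      simp only
      rw [← h4, chartRep, hbz]
      refine congrArg (T.contraction X.vol b) ?_
      ext i : 1
      fin_cases i <;> rfl
    rw [h1, hdet] at hpos
    rw [h3, hdet]
    exact hsign _ hpos

/-- The orbit space of the bulk flow is an oriented surface with boundary over which the flow is a
principal bundle. -/
theorem exists_isReduction [T2Space M] [SecondCountableTopology M] [IsManifold (𝓡∂ 3) ∞ M]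
    (X : BulkBoundary M N) :
    T2Space X.B ∧ SecondCountableTopology X.B ∧
      ∃ (_ : ChartedSpace (EuclideanHalfSpace 2) X.B) (_ : IsManifold (𝓡∂ 2) ∞ X.B)
        (ν : Form E2 X.B 2), X.IsReduction ν := by
  have h1 : T2Space X.B := X.bulkFlow_proper.t2Space_base
  have h2 : SecondCountableTopology X.B := X.bulkFlow.secondCountableTopology_base
  obtain ⟨_, _, h⟩ := exists_isPrincipalBundle (J := 𝓡∂ 2) X.bulkFlow_proper.exists_slice
  have : LocallyCompactSpace X.B := Manifold.locallyCompact_of_finiteDimensional (𝓡∂ 2)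
  obtain ⟨T⟩ := h.exists_equivariantTime X.bulkFlow_proper
  exact ⟨h1, h2, _, ‹_›, _, isReduction_contraction h T⟩

end BulkBoundary

end CSWZW

theorem mainTheorem1 {M : Type u} [TopologicalSpace M] [T2Space M] [SecondCountableTopology M]
    [ChartedSpace (EuclideanHalfSpace 3) M] [IsManifold (𝓡∂ 3) ∞ M]
    {N : Type v} [TopologicalSpace N] [ChartedSpace (EuclideanSpace ℝ (Fin 2)) N]
    [IsManifold (𝓡 2) ∞ N] (X : CSWZW.BulkBoundary M N) :
    (T2Space X.B ∧ SecondCountableTopology X.B ∧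
      ∃ (_ : ChartedSpace (EuclideanHalfSpace 2) X.B) (_ : IsManifold (𝓡∂ 2) ∞ X.B)
        (ν : CSWZW.Form (EuclideanSpace ℝ (Fin 2)) X.B 2), X.IsReduction ν) ∧
    ∀ [ChartedSpace (EuclideanHalfSpace 2) X.B] [IsManifold (𝓡∂ 2) ∞ X.B]
      (ν : CSWZW.Form (EuclideanSpace ℝ (Fin 2)) X.B 2), X.IsReduction ν →
      ∃ (hτ : ∀ U : X.FlowOpen, CSWZW.IsPoisson (X.observables U.1) (X.tau U.1))
        (hσ : ∀ V : X.BaseOpen, CSWZW.IsPoisson (X.baseForms V.1) (X.sigma ν V.1))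
        (hπ : X.FiberIntegrationRestricts)
        (hmap : ∀ V : X.BaseOpen,
          CSWZW.PoCh.IsPoissonMap ((X.preimage ⋙ X.bulkFunctor hτ).obj V)
            ((X.baseFunctor ν hσ).obj V) (CSWZW.BulkBoundary.fiberMap (X := X) hπ V)),
        CSWZW.EinsteinCausal X.FlowDisjoint (X.bulkAQFT hτ) ∧
        CSWZW.EinsteinCausal X.BaseDisjoint (X.preimage ⋙ X.bulkAQFT hτ) ∧
        CSWZW.EinsteinCausal X.BaseDisjoint (X.baseAQFT ν hσ) ∧
        CSWZW.IsNaturalWeakEquivalence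
          (CSWZW.BulkBoundary.dimensionalReduction (X := X) hτ hσ hπ hmap) := by
  have h1 := CSWZW.BulkBoundary.exists_isReduction X
  refine ⟨h1, ?_⟩
  intro _ _ ν hν
  have : T2Space X.B := h1.1
  have : SecondCountableTopology X.B := h1.2.1
  have : LocallyCompactSpace M := Manifold.locallyCompact_of_finiteDimensional (𝓡∂ 3)
  have : LocallyCompactSpace X.B := Manifold.locallyCompact_of_finiteDimensional (𝓡∂ 2)
  exact CSWZW.BulkBoundary.isNaturalWeakEquivalence_dimensionalReduction hν
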